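/- Let $k$ be a fixed positive integer. An instance of unweighted MAX-$k$-CSP with $n$ variables $x_1,\dots,x_n\in\{-1,1\}$ and $m\ge 1$ constraints is given by, for each $j\in\{1,\dots,m\}$, a set of $k_j\in\{1,\dots,k\}$ variables and a non-constant predicate on them, with $s_j\in\{1,\dots,2^{k_j}-1\}$ satisfying assignments. Let $\mathcal C_j(x)=-1$ if $x$ satisfies the $j$-th constraint and $\mathcal C_j(x)=s_j/(2^{k_j}-s_j)$ otherwise. Put $H(x)=\sum_{j=1}^m\mathcal C_j(x)$ and $H_{\min}=\min_x H(x)$; an assignment $x$ is optimal if $H(x)=H_{\min}$. Let $d_i$ be the number of constraints that involve variable $i$, $\Sigma=\sum_i d_i$, $\Lambda_{\max}=\max_j 2^{k_j}/(2^{k_j}-s_j)$, and $$D=\frac{n\sum_i d_i^2}{k^2m^2},\qquad D_\Sigma=\frac{n\sum_i d_i^2}{\Sigma^2},\qquad \Delta=\frac{|H_{\min}|}{m}.$$ Let $h$ be the binary entropy function (in bits), and $$c_B^{\mathrm{cl}}=\min\Bigl\{\frac{1}{2\ln 2}\cdot\frac{1}{\Lambda_{\max}^2D_\Sigma}\Bigl(\frac{|H_{\min}|}{\Sigma}\Bigr)^2,\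 \frac12\,h\Bigl(\frac{|H_{\min}|}{2\Lambda_{\max}\Sigma}\Bigr)\Bigr\},\qquad c_B^{\mathrm q}=0.0578\cdot\frac{\Delta^3}{2^{3k}k^3D}.$$ (1) For every $\delta>0$ there is a quantum algorithm (one program, that receives the list of constraints and nothing else; in particular $H_{\min}$ is not given) such that, for instances with a polynomially bounded number of constraints, with probability at least $1-\delta$ it halts with an optimal assignment within time $O^*\bigl(2^{(1-c_B^{\mathrm{cl}})n/2}\bigr)$, where $O^*$ hides factors $2^{o(n)}$. Precisely: for every polynomial $p$ there is a function $g$ with $g(n)=o(n)$ such that on every instance with $n$ variables and $1\le m\le p(n)$ constraints, with probability at least $1-\delta$ the algorithm halts within time $2^{(1-c_B^{\mathrm{cl}})n/2+g(n)}$ and outputs an optimal assignment. Here a quantum algorithm is a program for a classical random-access machine with logarithmic (bit-size) cost that controls a register of qubits, initially all $|0\rangle$, to which it applies the gates NOT, Hadamard, $T$, CNOT, Toffoli and measurements in the computational basis, each at unit cost plus the cost of computing the addresses. (2) For all instances with $m\ge1$, $$c_B^{\mathrm{cl}}\ \ge\ 0.7213\cdot\frac{\Delta^2}{2^{2k}k^2D}.$$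 (3) The exponent improves on that of the short-path quantum algorithm of Dalzell et al., whose running time is $O^*(2^{(1-c_B^{\mathrm q})n/2})$: for all instances with $m\ge 1$ and $\Delta>0$, $c_B^{\mathrm{cl}}>c_B^{\mathrm q}$. -/

import Mathlib

noncomputable section

/-! ## A quantum machine: a classical random-access machine driving a quantum register

The classical part is a structured program over a read-only input, an unbounded memory of natural
numbers, and integer arithmetic with logarithmic (bit-size) costs. The quantum part is an unbounded
line of qubits, initially all `|0⟩`, on which the program applies gates of constant arity and
measurements in the computational basis, each addressed by a classically computed qubit number. -/

namespace QMachine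

/-- Classical arithmetic expressions. -/
inductive AExp : Type
  | lit (c : ℕ)
  /-- the input cell whose number is the value of `a` -/
  | input (a : AExp)
  /-- the memory cell whose address is the value of `a` -/
  | load (a : AExp)
  | add (a b : AExp)
  /-- truncated subtraction -/
  | sub (a b : AExp)
  | mul (a b : AExp)
  /-- integer division -/
  | div (a b : AExp)

/-- Value of an expression on input `inp` and memory `mem`. -/
def AExp.eval (inp mem : ℕ → ℕ) : AExp → ℕ
  | .lit c => c
  | .input a => inp (a.eval inp mem)
  | .load a => mem (a.eval inp mem)
  | .add a b => a.eval inp mem + b.eval inp mem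
  | .sub a b => a.eval inp mem - b.eval inp mem
  | .mul a b => a.eval inp mem * b.eval inp mem
  | .div a b => a.eval inp mem / b.eval inp mem

/-- Charge for one binary arithmetic operation: the product of the (positive) bit lengths. -/
def opCost (u v : ℕ) : ℕ := (u.size + 1) * (v.size + 1)

/-- Time to evaluate an expression: every access and operation is charged for the bit lengths of
the numbers involved. -/
def AExp.cost (inp mem : ℕ → ℕ) : AExp → ℕ
  | .lit c => 1 + c.size
  | .input a => a.cost inp mem + 1 + (a.eval inp mem).size + (inp (a.eval inp mem)).size
  | .load a => a.cost inp mem + 1 + (a.eval inp mem).size + (mem (a.eval inp mem)).size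
  | .add a b => a.cost inp mem + b.cost inp mem + opCost (a.eval inp mem) (b.eval inp mem)
  | .sub a b => a.cost inp mem + b.cost inp mem + opCost (a.eval inp mem) (b.eval inp mem)
  | .mul a b => a.cost inp mem + b.cost inp mem + opCost (a.eval inp mem) (b.eval inp mem)
  | .div a b => a.cost inp mem + b.cost inp mem + opCost (a.eval inp mem) (b.eval inp mem)

/-- The gate set: NOT, Hadamard, the `π/8`-gate `T = diag(1, e^{iπ/4})`, CNOT and Toffoli, on qubits
named by elements of `α`. The last argument of `cnot` and `toffoli` is the target. -/
inductive Gate (α : Type) : Type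
  | x (q : α)
  | h (q : α)
  | t (q : α)
  | cnot (c q : α)
  | toffoli (c d q : α)

def Gate.map {α β : Type} (f : α → β) : Gate α → Gate β
  | .x q => .x (f q)
  | .h q => .h (f q)
  | .t q => .t (f q)
  | .cnot c q => .cnot (f c) (f q)
  | .toffoli c d q => .toffoli (f c) (f d) (f q)

/-- The qubits a gate acts on. -/
def Gate.qubits {α : Type} : Gate α → List α
  | .x q => [q]
  | .h q => [q]
  | .t q => [q]
  | .cnot c q => [c, q]
  | .toffoli c d q => [c, d, q]

/-- (Unnormalized) pure states of qubits `0, 1, 2, …`, of which only finitely many are ever touched: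
the basis state `|s⟩` is labelled by the finite set `s` of the qubits that have value `1`. -/
abbrev QState : Type := Finset ℕ →₀ ℂ

/-- Flip the value of qubit `q` in a basis label. -/
def flipBit (q : ℕ) (s : Finset ℕ) : Finset ℕ := if q ∈ s then s.erase q else insert q s

/-- Action of a gate on a basis state. A `cnot` or `toffoli` whose target is one of its controls
does nothing. -/
def Gate.onBasis : Gate ℕ → Finset ℕ → QState
  | .x q, s => Finsupp.single (flipBit q s) 1
  | .h q, s =>
      Finsupp.single (s.erase q) (1 / (Real.sqrt 2 : ℂ)) +
        Finsupp.single (insert q s) ((if q ∈ s then -1 else 1) / (Real.sqrt 2 : ℂ))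
  | .t q, s => Finsupp.single s (if q ∈ s then Complex.exp (Complex.I * Real.pi / 4) else 1)
  | .cnot c q, s =>
      if c ≠ q ∧ c ∈ s then Finsupp.single (flipBit q s) 1 else Finsupp.single s 1
  | .toffoli c d q, s =>
      if c ≠ q ∧ d ≠ q ∧ c ∈ s ∧ d ∈ s then Finsupp.single (flipBit q s) 1
      else Finsupp.single s 1

/-- The linear operator of a gate. -/
def Gate.op (g : Gate ℕ) : QState →ₗ[ℂ] QState := Finsupp.linearCombination ℂ g.onBasis

/-- The squared norm of a state. -/
def weight (ψ : QState) : ℝ := ψ.sum fun _ a => ‖a‖ ^ 2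

/-- The projection of a state on the value `v` of qubit `q`. -/
def project (q : ℕ) (v : Bool) (ψ : QState) : QState := ψ.filter fun s => decide (q ∈ s) = v

/-- Programs. -/
inductive Prog : Type
  | skip
  /-- write the value of `e` to the memory cell with address `a` -/
  | store (a e : AExp)
  /-- apply a gate to qubits with the given numbers -/
  | gate (g : Gate AExp)
  /-- measure qubit `q` and write the outcome to the memory cell with address `a` -/
  | meas (q a : AExp)
  | seq (P Q : Prog)
  /-- run `P` if `e` is nonzero, else `Q` -/
  | ite (e : AExp) (P Q : Prog)
  /-- repeat `P` as long as `e` is nonzero -/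
  | loop (e : AExp) (P : Prog)

/-- A branch of a computation (one history of measurement outcomes): the time used so far, the
classical memory, and the quantum state projected on the outcomes, whose squared norm is the
probability of the branch. -/
structure Branch : Type where
  time : ℕ
  mem : ℕ → ℕ
  state : QState

/-- All branches in which `P`, started in the branch `b`, halts after a recursion of depth less than
`fuel`. (Raising `fuel` only adds branches; the running time is the field `time`.) -/
def run (inp : ℕ → ℕ) : ℕ → Prog → Branch → List Branch
  | 0, _, _ => []
  | _ + 1, .skip, b => [b]
  | _ + 1, .store a e, b =>
      [{ time := b.time + a.cost inp b.mem + e.cost inp b.mem + 1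
         mem := Function.update b.mem (a.eval inp b.mem) (e.eval inp b.mem)
         state := b.state }]
  | _ + 1, .gate g, b =>
      [{ time := b.time + (g.qubits.map fun a => a.cost inp b.mem).sum + 1
         mem := b.mem
         state := (g.map fun a => a.eval inp b.mem).op b.state }]
  | _ + 1, .meas q a, b =>
      [{ time := b.time + q.cost inp b.mem + a.cost inp b.mem + 1
         mem := Function.update b.mem (a.eval inp b.mem) 0
         state := project (q.eval inp b.mem) false b.state },
       { time := b.time + q.cost inp b.mem + a.cost inp b.mem + 1
         mem := Function.update b.mem (a.eval inp b.mem) 1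
         state := project (q.eval inp b.mem) true b.state }]
  | fuel + 1, .seq P Q, b => (run inp fuel P b).flatMap (run inp fuel Q)
  | fuel + 1, .ite e P Q, b =>
      run inp fuel (if e.eval inp b.mem ≠ 0 then P else Q)
        { b with time := b.time + e.cost inp b.mem + 1 }
  | fuel + 1, .loop e P, b =>
      if e.eval inp b.mem ≠ 0 then
        (run inp fuel P { b with time := b.time + e.cost inp b.mem + 1 }).flatMap
          (run inp fuel (.loop e P))
      else [{ b with time := b.time + e.cost inp b.mem + 1 }]

/-- The start: time zero, memory all zero, all qubits in state `|0⟩`. -/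
def init : Branch := ⟨0, fun _ => 0, Finsupp.single ∅ 1⟩

/-- Total probability of the branches in a list that use time at most `T` and end with a memory
satisfying `good`. -/
def probWithin (good : (ℕ → ℕ) → Prop) (T : ℝ) (l : List Branch) : ℝ :=
  open Classical in
  (l.map fun b => if (b.time : ℝ) ≤ T ∧ good b.mem then weight b.state else 0).sum

/-- On input `w`, with probability at least `p`, the program `P` halts within time `T` and with a
memory satisfying `good`. -/
def SucceedsWithin (P : Prog) (w : List ℕ) (good : (ℕ → ℕ) → Prop) (T p : ℝ) : Prop :=
  ∃ fuel : ℕ, p ≤ probWithin good T (run (fun i => w.getD i 0) fuel P init)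

end QMachine

/-! ## Unweighted MAX-`k`-CSP -/

/-- A nontrivial constraint on between `1` and `k` of `n` Boolean variables; `true` and `false` stand
for the two values `±1` of a variable. -/
structure CSPConstraint (k n : ℕ) : Type where
  arity : ℕ
  one_le_arity : 1 ≤ arity
  arity_le : arity ≤ k
  scope : Fin arity ↪ Fin n
  pred : (Fin arity → Bool) → Bool
  exists_sat : ∃ a, pred a = true
  exists_unsat : ∃ a, pred a = false

namespace CSPConstraint

variable {k n : ℕ}

/-- The number `s` of satisfying assignments of the constrained variables. -/
def numSat (C : CSPConstraint k n) : ℕ :=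
  (Finset.univ.filter fun a : Fin C.arity → Bool => C.pred a = true).card

/-- The centered value: `-1` if satisfied, `s / (2 ^ arity - s)` if violated. -/
def value (C : CSPConstraint k n) (x : Fin n → Bool) : ℝ :=
  if C.pred (fun l => x (C.scope l)) = true then -1
  else (C.numSat : ℝ) / (2 ^ C.arity - C.numSat)

/-- The gap `Λ = 2 ^ arity / (2 ^ arity - s)` between the two values of a constraint. -/
def gap (C : CSPConstraint k n) : ℝ := 2 ^ C.arity / (2 ^ C.arity - C.numSat)

/-- A constraint as a list of numbers: its arity, its variables, and its truth table, whose `i`-th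
entry is for the assignment given by the binary digits of `i`. -/
def encode (C : CSPConstraint k n) : List ℕ :=
  [C.arity] ++ List.ofFn (fun l => (C.scope l : ℕ)) ++
    List.ofFn (fun i : Fin (2 ^ C.arity) =>
      if C.pred (fun l => (i : ℕ).testBit l) = true then 1 else 0)

end CSPConstraint

/-- An unweighted MAX-`k`-CSP instance with `n` variables and `m` constraints. -/
abbrev MaxCSP (k n m : ℕ) : Type := Fin m → CSPConstraint k n

namespace MaxCSP

variable {k n m : ℕ}

/-- The objective `H`. -/
def H (I : MaxCSP k n m) (x : Fin n → Bool) : ℝ := ∑ j, (I j).value x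

/-- The optimum `H_min`. -/
def Hmin (I : MaxCSP k n m) : ℝ := ⨅ x, I.H x

def IsOptimal (I : MaxCSP k n m) (x : Fin n → Bool) : Prop := ∀ y, I.H x ≤ I.H y

/-- The number `d_i` of constraints that involve variable `i`. -/
def deg (I : MaxCSP k n m) (i : Fin n) : ℕ :=
  (Finset.univ.filter fun j => i ∈ Set.range (I j).scope).card

/-- The irregularity `D = n ∑ d_i² / (k m)²`. -/
def irregularity (I : MaxCSP k n m) : ℝ :=
  n * (∑ i, (I.deg i : ℝ) ^ 2) / ((k : ℝ) ^ 2 * (m : ℝ) ^ 2)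

/-- The normalized optimum scale `Δ = |H_min| / m`. -/
def optScale (I : MaxCSP k n m) : ℝ := |I.Hmin| / m

/-- The total incidence `Σ = ∑ d_i`. -/
def totalDeg (I : MaxCSP k n m) : ℝ := ∑ i, (I.deg i : ℝ)

/-- The irregularity relative to the average degree, `n ∑ d_i² / Σ²`. It equals `irregularity` if all
arities are `k`. -/
def irregularityAvg (I : MaxCSP k n m) : ℝ :=
  n * (∑ i, (I.deg i : ℝ) ^ 2) / I.totalDeg ^ 2

/-- The largest gap `Λ_max`. -/
def maxGap (I : MaxCSP k n m) : ℝ := ⨆ j, (I j).gap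

/-- The threshold exponent `γ_η`. -/
def gammaExp (I : MaxCSP k n m) (η : ℝ) : ℝ :=
  2 * (1 - η) ^ 2 / Real.log 2 * (1 / (I.maxGap ^ 2 * I.irregularityAvg)) *
    (|I.Hmin| / I.totalDeg) ^ 2

/-- The radius parameter `θ_η`. -/
def theta (I : MaxCSP k n m) (η : ℝ) : ℝ := η * |I.Hmin| / (I.maxGap * I.totalDeg)

/-- The exponent `c_B^cl = min {γ_η, h(θ_η) / 2}` at `η = 1/2`, where `h` is the binary entropy in
bits. -/
def cClassical (I : MaxCSP k n m) : ℝ :=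
  min (I.gammaExp (1 / 2)) (Real.binEntropy (I.theta (1 / 2)) / Real.log 2 / 2)

/-- The short-path exponent `c_B^q`. -/
def cShortPath (I : MaxCSP k n m) : ℝ :=
  0.0578 * (I.optScale ^ 3 / (2 ^ (3 * k) * (k : ℝ) ^ 3 * I.irregularity))

/-- The input of the machine: the numbers of variables and constraints, then the constraints. -/
def encode (I : MaxCSP k n m) : List ℕ :=
  [n, m] ++ (List.ofFn fun j => (I j).encode).flatten

/-- The assignment that a final memory holds in its cells `0, …, n - 1`. -/
def output (n : ℕ) (mem : ℕ → ℕ) : Fin n → Bool := fun i => decide (mem i ≠ 0)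

end MaxCSP

end

/-! Write E = |H_min|, Λ = Λ_max, S = Σ d_i². Every constraint has mean zero over the cube and takes
two values whose distance is its gap. So H has mean zero, and flipping variable i changes it by at
most Λ d_i. McDiarmid's inequality (`card_le_of_lipschitz`, `card_H_le`) leaves at most 2^(n-s)
points in the sublevel set L = {H ≤ -3E/4}, where s = ⌊E² / (Λ² S)⌋, because 2 (3/4)² = 9/8 exceeds
ln 2. On the other hand, averaging over the cyclic windows of s variables yields one whose total Λ
d_i is at most E/2 (`exists_window`). Two complementary sets of flips inside it raise H above an
optimum by at most E/2 together, so one of the two stays in L: at least half of the subcube through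
an optimum lies in L (`half_subcube`).

The search exploits this by nested amplitude amplification (`exists_search`). About sqrt(2^n / |L|)
rounds produce a superposition that favours L. The window qubits are then moved aside, and at most
about sqrt(2^s) rounds search for new values that make the assignment optimal. This preparation
succeeds with probability of order 2^s / |L|, so an outer amplification needs about sqrt(|L| / 2^s)
rounds. The total is of order sqrt(2^(n-s)) + sqrt(|L|), which is O(2^((n-s)/2)). Finally s ≥ γ n -
1, since γ n is E² / (Λ² S) times 1 / (2 ln 2) < 1. `MaxCSP.exists_attempt` collects these facts.

Neither H_min nor the window nor the numbers of rounds are known to the program. Scaling by Q =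
(2^k)! makes all gaps integers, so the target cost v runs over 0, …, Q m. The numbers of rounds are
(3^i - 1) / 2, which multiplies the angle by 3^i, and some power of three always brings the sine to
at least 1/2. All tuples (v, b, i₁, i₂, i₃) are tried with v varying slowest and upwards, each of
them M times, and tuples whose powers of three exceed the budget sqrt(256 · 2^(n-s)) are skipped. A
smaller v means a larger s, so no attempt before the right tuple is dearer than the optimum allows
(`width_anti`). Whatever is found up to then has at most the optimal cost, and M attempts with the
right tuple all fail with probability at most (3/4)^M (`eventually_loop`, `WF.mainProg`).

On the machine, oracles are Toffoli circuits in which a number is represented by the position of a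
single qubit with value one, the token; a sign is applied and the circuit is undone (`oracle_op`).
Programs are verified in a logic that counts steps (`ND`, its version `Impl` for unitary programs,
its version `QND` for expectations). The cost of a step is quadratic in the bit length of the
largest number, hence polynomial in n. The whole polynomial factor is absorbed into 2^g(n) with g
the logarithm of a polynomial.

For the other two claims, `MaxCSP.gammaExp_le_cClassical` shows that the entropy term is never the
smaller one, so c ≥ γ. Then Λ ≤ 2^k and 1 / (2 ln 2) > 0.7213 give the lower bound, and the
short-path exponent is smaller than this bound by the factor Δ / (2^k k) ≤ 1 and by the ratio of the
constants. -/

namespace QMachine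

/-! ## Stabilised runs -/

/-- The list of halting branches of `P` from `b` is `l`, for all sufficiently large fuel. -/
def Runs (inp : ℕ → ℕ) (P : Prog) (b : Branch) (l : List Branch) : Prop :=
  ∃ f₀, ∀ f, f₀ ≤ f → run inp f P b = l

variable {inp : ℕ → ℕ}

theorem Runs.of_succ {P : Prog} {b : Branch} {l : List Branch}
    (h : ∀ f, run inp (f + 1) P b = l) : Runs inp P b l :=
  ⟨1, fun f hf => by obtain ⟨g, rfl⟩ : ∃ g, f = g + 1 := ⟨f - 1, by omega⟩; exact h g⟩

/-- A list has finitely many branches, so the maximum of their fuel thresholds serves all of them.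
-/
theorem Runs.flatMap_congr {Q : Prog} {k : Branch → List Branch} :
    ∀ l : List Branch, (∀ b ∈ l, Runs inp Q b (k b)) →
      ∃ f₀, ∀ f, f₀ ≤ f → l.flatMap (run inp f Q) = l.flatMap k
  | [], _ => ⟨0, fun _ _ => rfl⟩
  | b :: l, h => by
    obtain ⟨f₁, h₁⟩ := h b (by simp)
    obtain ⟨f₂, h₂⟩ := Runs.flatMap_congr l fun b' hb' => h b' (by simp [hb'])
    refine ⟨max f₁ f₂, fun f hf => ?_⟩
    rw [List.flatMap_cons, List.flatMap_cons, h₁ f (by omega), h₂ f (by omega)]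

theorem Runs.seq {P Q : Prog} {b : Branch} {l : List Branch} {k : Branch → List Branch}
    (hP : Runs inp P b l) (hQ : ∀ b' ∈ l, Runs inp Q b' (k b')) :
    Runs inp (.seq P Q) b (l.flatMap k) := by
  obtain ⟨f₁, h₁⟩ := hP
  obtain ⟨f₂, h₂⟩ := Runs.flatMap_congr l hQ
  refine ⟨max f₁ f₂ + 1, fun f hf => ?_⟩
  obtain ⟨g, rfl⟩ : ∃ g, f = g + 1 := ⟨f - 1, by omega⟩
  rw [run, h₁ g (by omega), h₂ g (by omega)]

theorem Runs.ite {e : AExp} {P Q : Prog} {b : Branch} {l : List Branch}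
    (h : Runs inp (if e.eval inp b.mem ≠ 0 then P else Q)
      { b with time := b.time + e.cost inp b.mem + 1 } l) :
    Runs inp (.ite e P Q) b l := by
  obtain ⟨f₁, h₁⟩ := h
  refine ⟨f₁ + 1, fun f hf => ?_⟩
  obtain ⟨g, rfl⟩ : ∃ g, f = g + 1 := ⟨f - 1, by omega⟩
  rw [run, h₁ g (by omega)]

theorem Runs.loop_false {e : AExp} {P : Prog} {b : Branch} (h : e.eval inp b.mem = 0) :
    Runs inp (.loop e P) b [{ b with time := b.time + e.cost inp b.mem + 1 }] :=
  .of_succ fun f => by rw [run, if_neg (by simpa using h)]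

theorem Runs.loop_true {e : AExp} {P : Prog} {b : Branch} {l : List Branch}
    {k : Branch → List Branch} (h : e.eval inp b.mem ≠ 0)
    (hP : Runs inp P { b with time := b.time + e.cost inp b.mem + 1 } l)
    (hk : ∀ b' ∈ l, Runs inp (.loop e P) b' (k b')) :
    Runs inp (.loop e P) b (l.flatMap k) := by
  obtain ⟨f₁, h₁⟩ := hP
  obtain ⟨f₂, h₂⟩ := Runs.flatMap_congr l hk
  refine ⟨max f₁ f₂ + 1, fun f hf => ?_⟩
  obtain ⟨g, rfl⟩ : ∃ g, f = g + 1 := ⟨f - 1, by omega⟩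
  rw [run, if_pos h, h₁ g (by omega), h₂ g (by omega)]

/-! ## Costs -/

/-- Structural bound for the bit length of the value of an expression. -/
def AExp.width : AExp → ℕ
  | .lit c => c.size
  | .input _ => 1
  | .load _ => 1
  | .add a b => a.width + b.width + 1
  | .sub a b => a.width + b.width
  | .mul a b => a.width + b.width
  | .div a b => a.width + b.width

/-- Structural bound for the cost of an expression. -/
def AExp.unit : AExp → ℕ
  | .lit c => 1 + c.size
  | .input a => a.unit + a.width + 2
  | .load a => a.unit + a.width + 2
  | .add a b => a.unit + b.unit + (a.width + 1) * (b.width + 1)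
  | .sub a b => a.unit + b.unit + (a.width + 1) * (b.width + 1)
  | .mul a b => a.unit + b.unit + (a.width + 1) * (b.width + 1)
  | .div a b => a.unit + b.unit + (a.width + 1) * (b.width + 1)

theorem size_add_le (x y : ℕ) : (x + y).size ≤ x.size + y.size + 1 := by
  rw [Nat.size_le]
  have hx := Nat.lt_size_self x
  have hy := Nat.lt_size_self y
  have h1 : 2 ^ x.size ≤ 2 ^ (x.size + y.size) := Nat.pow_le_pow_right (by norm_num) (by omega)
  have h2 : 2 ^ y.size ≤ 2 ^ (x.size + y.size) := Nat.pow_le_pow_right (by norm_num) (by omega)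
  rw [pow_succ]; omega

theorem size_mul_le (x y : ℕ) : (x * y).size ≤ x.size + y.size := by
  rw [Nat.size_le, pow_add]
  exact Nat.mul_lt_mul'' (Nat.lt_size_self x) (Nat.lt_size_self y)

/-- Bit lengths are tracked as multiples of `B + 1`, so that the product charged for an operation
becomes a multiple of its square. -/
theorem opCost_le {u v a b B : ℕ} (hu : u.size ≤ a * (B + 1)) (hv : v.size ≤ b * (B + 1)) :
    opCost u v ≤ (a + 1) * (b + 1) * (B + 1) ^ 2 := by
  unfold opCost
  calc (u.size + 1) * (v.size + 1) ≤ ((a + 1) * (B + 1)) * ((b + 1) * (B + 1)) := by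
        gcongr <;> nlinarith
    _ = _ := by ring

section
variable {mem : ℕ → ℕ} {V : ℕ}

/-- Numbers read from input or memory have at most `V.size` bits, and an operation at most adds the
lengths of its operands plus one. The factor therefore depends on the expression only. -/
theorem AExp.size_eval_le (hi : ∀ i, inp i ≤ V) (hm : ∀ i, mem i ≤ V) (e : AExp) :
    (e.eval inp mem).size ≤ e.width * (V.size + 1) := by
  induction e with
  | lit c => simp only [AExp.eval, AExp.width]; nlinarith
  | input a _ => simp only [AExp.eval, AExp.width]; have := Nat.size_le_size (hi (a.eval inp mem)); omega
  | load a _ => simp only [AExp.eval, AExp.width]; have := Nat.size_le_size (hm (a.eval inp mem)); omega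
  | add a b iha ihb =>
    simp only [AExp.eval, AExp.width]
    refine (size_add_le _ _).trans ?_
    nlinarith
  | sub a b iha ihb =>
    simp only [AExp.eval, AExp.width]
    refine (Nat.size_le_size (Nat.sub_le _ _)).trans ?_
    nlinarith [Nat.zero_le (b.width * (V.size + 1))]
  | mul a b iha ihb =>
    simp only [AExp.eval, AExp.width]
    refine (size_mul_le _ _).trans ?_
    nlinarith
  | div a b iha ihb =>
    simp only [AExp.eval, AExp.width]
    refine (Nat.size_le_size (Nat.div_le_self _ _)).trans ?_
    nlinarith [Nat.zero_le (b.width * (V.size + 1))]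

theorem AExp.cost_le (hi : ∀ i, inp i ≤ V) (hm : ∀ i, mem i ≤ V) (e : AExp) :
    e.cost inp mem ≤ e.unit * (V.size + 1) ^ 2 := by
  have hB : 1 ≤ (V.size + 1) ^ 2 := Nat.one_le_pow _ _ (by omega)
  have hB' : V.size + 1 ≤ (V.size + 1) ^ 2 := by nlinarith
  have hs := fun e => AExp.size_eval_le hi hm e
  -- Input and memory accesses are charged alike; one estimate serves both.
  have hacc : ∀ (a : AExp) (x : ℕ), x ≤ V → a.cost inp mem ≤ a.unit * (V.size + 1) ^ 2 →
      a.cost inp mem + 1 + (a.eval inp mem).size + x.size ≤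
        (a.unit + a.width + 2) * (V.size + 1) ^ 2 := by
    intro a x hx ih
    have h1 := hs a
    have h2 := Nat.size_le_size hx
    have h3 : a.width * (V.size + 1) ≤ a.width * (V.size + 1) ^ 2 := Nat.mul_le_mul_left _ hB'
    nlinarith
  induction e with
  | lit c => simp only [AExp.cost, AExp.unit]; nlinarith
  | input a ih => exact hacc a _ (hi _) ih
  | load a ih => exact hacc a _ (hm _) ih
  | add a b iha ihb | sub a b iha ihb | mul a b iha ihb | div a b iha ihb =>
    simp only [AExp.cost, AExp.unit]
    have := opCost_le (hs a) (hs b)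
    nlinarith

end

/-- Structural bound for the cost of one step of a program. -/
def Prog.unit : Prog → ℕ
  | .skip => 0
  | .store a e => a.unit + e.unit + 1
  | .gate g => (g.qubits.map AExp.unit).sum + 1
  | .meas q a => q.unit + a.unit + 1
  | .seq P Q => max P.unit Q.unit
  | .ite e P Q => max (e.unit + 1) (max P.unit Q.unit)
  | .loop e P => max (e.unit + 1) P.unit

/-- Time allowed for one step of `P` if all numbers in memory and input are at most `V`. -/
def Prog.tick (V : ℕ) (P : Prog) : ℕ := P.unit * (V.size + 1) ^ 2

theorem Prog.tick_le {V : ℕ} {P Q : Prog} (h : P.unit ≤ Q.unit) : P.tick V ≤ Q.tick V :=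
  Nat.mul_le_mul_right _ h

theorem cost_add_one_le {V : ℕ} {mem : ℕ → ℕ} (hi : ∀ i, inp i ≤ V) (hm : ∀ i, mem i ≤ V)
    (e : AExp) {u : ℕ} (hu : e.unit + 1 ≤ u) :
    e.cost inp mem + 1 ≤ u * (V.size + 1) ^ 2 := by
  have hB : 1 ≤ (V.size + 1) ^ 2 := Nat.one_le_pow _ _ (by omega)
  have := AExp.cost_le hi hm e
  calc e.cost inp mem + 1 ≤ (e.unit + 1) * (V.size + 1) ^ 2 := by nlinarith
    _ ≤ _ := Nat.mul_le_mul_right _ hu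

theorem sum_cost_le {V : ℕ} {mem : ℕ → ℕ} (hi : ∀ i, inp i ≤ V) (hm : ∀ i, mem i ≤ V)
    (l : List AExp) :
    (l.map fun a => a.cost inp mem).sum ≤ (l.map AExp.unit).sum * (V.size + 1) ^ 2 := by
  induction l with
  | nil => simp
  | cons a l ih =>
    have := AExp.cost_le hi hm a
    simp only [List.map_cons, List.sum_cons]
    nlinarith

end QMachine

namespace QMachine

open Finsupp ComplexConjugate

/-! ## Linear algebra of states -/

/-- The basis state with label `s`. -/
noncomputable abbrev ket (s : Finset ℕ) : QState := single s 1

/-- The inner product, conjugate linear in the first argument. -/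
noncomputable def ip (a : QState) : QState →ₗ[ℂ] ℂ := linearCombination ℂ fun s => conj (a s)

theorem ip_apply (a b : QState) : ip a b = b.sum fun s c => c * conj (a s) := by
  simp [ip, linearCombination_apply]

@[simp] theorem ip_single_right (a : QState) (t : Finset ℕ) (c : ℂ) :
    ip a (single t c) = c * conj (a t) := by simp [ip]

theorem ip_add_left (a a' b : QState) : ip (a + a') b = ip a b + ip a' b := by
  induction b using Finsupp.induction_linear with
  | zero => simp
  | add f g hf hg => simp only [map_add, hf, hg]; ring
  | single t c => simp; ring

theorem ip_smul_left (c : ℂ) (a b : QState) : ip (c • a) b = conj c * ip a b := by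
  induction b using Finsupp.induction_linear with
  | zero => simp
  | add f g hf hg => simp only [map_add, hf, hg]; ring
  | single t c => simp; ring

theorem ip_ket_left (s : Finset ℕ) (b : QState) : ip (ket s) b = b s := by
  induction b using Finsupp.induction_linear with
  | zero => simp
  | add f g hf hg => simp [hf, hg]
  | single t c =>
    by_cases h : s = t
    · subst h; simp
    · simp [Finsupp.single_apply, h, Ne.symm h]

@[simp] theorem ip_zero_left (b : QState) : ip 0 b = 0 := by simp [ip_apply]

theorem weight_eq_sum {ψ : QState} {F : Finset (Finset ℕ)} (h : ψ.support ⊆ F) :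
    weight ψ = ∑ s ∈ F, ‖ψ s‖ ^ 2 :=
  Finsupp.sum_of_support_subset _ h _ (by simp)

theorem ofReal_weight (ψ : QState) : (weight ψ : ℂ) = ip ψ ψ := by
  rw [ip_apply, weight, Finsupp.sum, Finsupp.sum, Complex.ofReal_sum]
  refine Finset.sum_congr rfl fun s _ => ?_
  rw [Complex.mul_conj, Complex.normSq_eq_norm_sq]

theorem weight_nonneg (ψ : QState) : 0 ≤ weight ψ := Finset.sum_nonneg fun _ _ => by positivity

theorem weight_smul (c : ℂ) (ψ : QState) : weight (c • ψ) = ‖c‖ ^ 2 * weight ψ := by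
  rw [weight_eq_sum (F := ψ.support) (Finsupp.support_smul), weight, Finsupp.sum, Finset.mul_sum]
  exact Finset.sum_congr rfl fun s _ => by simp [mul_pow]

@[simp] theorem weight_single (s : Finset ℕ) (c : ℂ) : weight (single s c) = ‖c‖ ^ 2 := by
  simp [weight]

/-- A sum of squared amplitudes over distinct labels is at most the weight. -/
theorem sum_norm_sq_le_weight {ι : Type*} (ψ : QState) (F : Finset ι) (f : ι → Finset ℕ)
    (hf : Set.InjOn f F) : ∑ i ∈ F, ‖ψ (f i)‖ ^ 2 ≤ weight ψ := by
  classical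
  rw [← Finset.sum_image (f := fun s => ‖ψ s‖ ^ 2) hf,
    weight_eq_sum (F := ψ.support ∪ F.image f) Finset.subset_union_left]
  exact Finset.sum_le_sum_of_subset_of_nonneg Finset.subset_union_right fun _ _ _ => by positivity

/-- `A'` is the adjoint of `A`. -/
def Adj (A A' : QState →ₗ[ℂ] QState) : Prop := ∀ a b, ip (A a) b = ip a (A' b)

/-- Both sides are sesquilinear, so comparing matrix entries is enough. -/
theorem Adj.of_ket {A A' : QState →ₗ[ℂ] QState}
    (h : ∀ s t, conj (A (ket s) t) = A' (ket t) s) : Adj A A' := by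
  intro a b
  induction a using Finsupp.induction_linear with
  | zero => simp
  | add f g hf hg => rw [map_add, ip_add_left, ip_add_left, hf, hg]
  | single s c =>
    rw [← mul_one c, ← smul_eq_mul, ← Finsupp.smul_single, map_smul, ip_smul_left, ip_smul_left,
      ip_ket_left]
    congr 1
    induction b using Finsupp.induction_linear with
    | zero => simp
    | add f g hf hg => simp only [map_add, hf, hg, Finsupp.add_apply]
    | single t d =>
      rw [ip_single_right, h, ← mul_one d, ← smul_eq_mul d 1, ← Finsupp.smul_single, map_smul]
      simp

/-- `A'` is a two-sided inverse and adjoint of `A`. -/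
structure UPair (A A' : QState →ₗ[ℂ] QState) : Prop where
  adj : Adj A A'
  inv : A' ∘ₗ A = LinearMap.id
  inv' : A ∘ₗ A' = LinearMap.id

theorem ip_conj_symm (a b : QState) : conj (ip a b) = ip b a := by
  induction b using Finsupp.induction_linear with
  | zero => simp
  | add f g hf hg => rw [map_add, map_add, hf, hg, ip_add_left]
  | single t c =>
    have h : single t c = c • ket t := by simp
    rw [h, ip_smul_left, ip_ket_left, map_smul, ip_single_right]
    simp

theorem UPair.symm {A A' : QState →ₗ[ℂ] QState} (h : UPair A A') : UPair A' A :=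
  ⟨fun a b => by rw [← ip_conj_symm, ← h.adj, ip_conj_symm], h.inv', h.inv⟩

theorem UPair.comp {A A' B B' : QState →ₗ[ℂ] QState} (hA : UPair A A') (hB : UPair B B') :
    UPair (A ∘ₗ B) (B' ∘ₗ A') where
  adj a b := by rw [LinearMap.comp_apply, hA.adj, hB.adj]; rfl
  inv := LinearMap.ext fun ψ => by
    have h1 := LinearMap.congr_fun hA.inv (B ψ)
    have h2 := LinearMap.congr_fun hB.inv ψ
    simp only [LinearMap.comp_apply, LinearMap.id_apply] at *
    rw [h1, h2]
  inv' := LinearMap.ext fun ψ => by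
    have h1 := LinearMap.congr_fun hB.inv' (A' ψ)
    have h2 := LinearMap.congr_fun hA.inv' ψ
    simp only [LinearMap.comp_apply, LinearMap.id_apply] at *
    rw [h1, h2]

theorem UPair.id : UPair LinearMap.id LinearMap.id := ⟨fun _ _ => rfl, rfl, rfl⟩

theorem UPair.pow {A A' : QState →ₗ[ℂ] QState} (h : UPair A A') (t : ℕ) :
    UPair (A ^ t) (A' ^ t) := by
  induction t with
  | zero => exact .id
  | succ t ih => rw [pow_succ, pow_succ']; exact ih.comp h

theorem UPair.inv_apply {A A' : QState →ₗ[ℂ] QState} (h : UPair A A') (ψ : QState) :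
    A' (A ψ) = ψ := LinearMap.congr_fun h.inv ψ

/-- The inverse is the adjoint: ⟨Aψ, Aψ⟩ = ⟨ψ, A'Aψ⟩ = ⟨ψ, ψ⟩. -/
theorem UPair.weight {A A' : QState →ₗ[ℂ] QState} (h : UPair A A') (ψ : QState) :
    weight (A ψ) = weight ψ := by
  have : (QMachine.weight (A ψ) : ℂ) = QMachine.weight ψ := by
    rw [ofReal_weight, ofReal_weight, h.adj, h.inv_apply]
  exact_mod_cast this

/-! ## Diagonal and permutation operators -/

/-- The diagonal operator with entries `φ`. -/
noncomputable def diagOp (φ : Finset ℕ → ℂ) : QState →ₗ[ℂ] QState :=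
  linearCombination ℂ fun s => single s (φ s)

@[simp] theorem diagOp_single (φ : Finset ℕ → ℂ) (s : Finset ℕ) (c : ℂ) :
    diagOp φ (single s c) = single s (c * φ s) := by simp [diagOp]

theorem diagOp_apply (φ : Finset ℕ → ℂ) (ψ : QState) (s : Finset ℕ) :
    diagOp φ ψ s = φ s * ψ s := by
  induction ψ using Finsupp.induction_linear with
  | zero => simp
  | add f g hf hg => simp [hf, hg, mul_add]
  | single t c =>
    by_cases h : t = s
    · subst h; simp [mul_comm]
    · simp [Finsupp.single_apply, h]

theorem diagOp_comp (φ χ : Finset ℕ → ℂ) :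
    diagOp φ ∘ₗ diagOp χ = diagOp fun s => φ s * χ s := by
  ext s : 2; simp [mul_comm]

theorem diagOp_one : diagOp (fun _ => 1) = LinearMap.id := by
  ext s : 2; simp

theorem UPair.diag {φ : Finset ℕ → ℂ} (h : ∀ s, conj (φ s) * φ s = 1) :
    UPair (diagOp φ) (diagOp fun s => conj (φ s)) where
  adj := Adj.of_ket fun s t => by
    by_cases hst : s = t
    · subst hst; simp
    · simp [Finsupp.single_apply, hst, Ne.symm hst]
  inv := by rw [diagOp_comp]; simp only [h, diagOp_one]
  inv' := by rw [diagOp_comp]; simp only [mul_comm (φ _), h, diagOp_one]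

/-- The operator that relabels the basis by `π`. -/
noncomputable def permOp (π : Finset ℕ → Finset ℕ) : QState →ₗ[ℂ] QState := lmapDomain ℂ ℂ π

@[simp] theorem permOp_single (π : Finset ℕ → Finset ℕ) (s : Finset ℕ) (c : ℂ) :
    permOp π (single s c) = single (π s) c := by simp [permOp]

theorem permOp_comp (π σ : Finset ℕ → Finset ℕ) : permOp π ∘ₗ permOp σ = permOp (π ∘ σ) := by
  ext s : 2; simp

theorem permOp_id : permOp id = LinearMap.id := by
  ext s : 2; simp

theorem UPair.perm {π σ : Finset ℕ → Finset ℕ} (h : Function.LeftInverse σ π)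
    (h' : Function.LeftInverse π σ) : UPair (permOp π) (permOp σ) where
  adj := Adj.of_ket fun s t => by
    by_cases hst : π s = t
    · subst hst; simp [h s]
    · have : σ t ≠ s := fun e => hst (by rw [← e, h' t])
      simp [Finsupp.single_apply, hst, this]
  inv := by rw [permOp_comp, h.comp_eq_id, permOp_id]
  inv' := by rw [permOp_comp, h'.comp_eq_id, permOp_id]

/-- Conjugation by a relabelling only permutes the diagonal. This makes compute, sign, uncompute a
diagonal operator again. -/
theorem permOp_diagOp_permOp {π σ : Finset ℕ → Finset ℕ} (h : Function.LeftInverse σ π)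
    (φ : Finset ℕ → ℂ) : permOp σ ∘ₗ diagOp φ ∘ₗ permOp π = diagOp (φ ∘ π) := by
  ext s : 2; simp [h s]

/-! ## Gates -/

theorem flipBit_flipBit (q : ℕ) (s : Finset ℕ) : flipBit q (flipBit q s) = s := by
  unfold flipBit
  by_cases h : q ∈ s <;> simp [h]

theorem mem_flipBit {q r : ℕ} {s : Finset ℕ} :
    r ∈ flipBit q s ↔ (if r = q then q ∉ s else r ∈ s) := by
  unfold flipBit
  by_cases h : q ∈ s <;> by_cases hr : r = q <;> simp [h, hr]

/-- Action of a Toffoli gate on labels. -/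
def tof (g : ℕ × ℕ × ℕ) (s : Finset ℕ) : Finset ℕ :=
  if g.1 ≠ g.2.2 ∧ g.2.1 ≠ g.2.2 ∧ g.1 ∈ s ∧ g.2.1 ∈ s then flipBit g.2.2 s else s

/-- The gate acts only if its target differs from both controls, so the flip leaves the controls
unchanged. -/
theorem tof_tof (g : ℕ × ℕ × ℕ) (s : Finset ℕ) : tof g (tof g s) = s := by
  obtain ⟨c, d, q⟩ := g
  by_cases h : c ≠ q ∧ d ≠ q ∧ c ∈ s ∧ d ∈ s
  · have h' : c ≠ q ∧ d ≠ q ∧ c ∈ flipBit q s ∧ d ∈ flipBit q s := by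
      simpa [mem_flipBit, h.1, h.2.1] using h.2.2
    simp only [tof, if_pos h, if_pos h', flipBit_flipBit]
  · simp only [tof, if_neg h]

theorem Gate.op_single (g : Gate ℕ) (s : Finset ℕ) (c : ℂ) :
    g.op (single s c) = c • g.onBasis s := by simp [Gate.op]

theorem op_x (q : ℕ) : (Gate.x q).op = permOp (flipBit q) := by
  ext s : 2; simp [Gate.op_single, Gate.onBasis]

theorem op_toffoli (c d q : ℕ) : (Gate.toffoli c d q).op = permOp (tof (c, d, q)) := by
  ext s : 2
  simp only [LinearMap.comp_apply, lsingle_apply, Gate.op_single, Gate.onBasis, permOp_single, tof,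
    one_smul]
  split_ifs <;> rfl

/-- A CNOT is treated as a Toffoli gate with equal controls, so that one calculus of labels covers
both. -/
theorem op_cnot (c q : ℕ) : (Gate.cnot c q).op = permOp (tof (c, c, q)) := by
  ext s : 2
  simp only [LinearMap.comp_apply, lsingle_apply, Gate.op_single, Gate.onBasis, permOp_single, tof,
    one_smul]
  by_cases h1 : c ≠ q <;> by_cases h2 : c ∈ s <;> simp [h1, h2]

theorem op_t (q : ℕ) :
    (Gate.t q).op = diagOp fun s => if q ∈ s then Complex.exp (Complex.I * Real.pi / 4) else 1 := by
  ext s : 2; simp [Gate.op_single, Gate.onBasis]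

/-- The gate set contains no Z gate; four `T` gates provide the sign. -/
theorem op_t_pow_four (q : ℕ) :
    (Gate.t q).op ∘ₗ (Gate.t q).op ∘ₗ (Gate.t q).op ∘ₗ (Gate.t q).op =
      diagOp fun s => if q ∈ s then -1 else 1 := by
  have h : Complex.exp (Complex.I * Real.pi / 4) * (Complex.exp (Complex.I * Real.pi / 4) *
      (Complex.exp (Complex.I * Real.pi / 4) * Complex.exp (Complex.I * Real.pi / 4))) = -1 := by
    rw [← Complex.exp_add, ← Complex.exp_add, ← Complex.exp_add, ← Complex.exp_pi_mul_I]
    congr 1; ring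
  rw [op_t, diagOp_comp, diagOp_comp, diagOp_comp]
  congr 1; ext s
  split_ifs with hs
  · exact h
  · simp

theorem sqrt_two_sq : (Real.sqrt 2 : ℂ) ^ 2 = 2 := by
  rw [← Complex.ofReal_pow, Real.sq_sqrt (by norm_num)]; norm_num

theorem sqrt_two_ne : (Real.sqrt 2 : ℂ) ≠ 0 := fun h => by
  have := sqrt_two_sq; rw [h] at this; norm_num at this

theorem op_h_ket (q : ℕ) (s : Finset ℕ) :
    (Gate.h q).op (ket s) = single (s.erase q) (1 / (Real.sqrt 2 : ℂ)) +
      single (insert q s) ((if q ∈ s then -1 else 1) / (Real.sqrt 2 : ℂ)) := by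
  rw [Gate.op_single, one_smul]; rfl

/-- After two Hadamard gates each label is reached along two paths: they add up to one at `s` and
cancel at the other label. -/
theorem UPair.h (q : ℕ) : UPair (Gate.h q).op (Gate.h q).op := by
  have inv : (Gate.h q).op ∘ₗ (Gate.h q).op = LinearMap.id := by
    ext s : 2
    have h2 := sqrt_two_sq
    have h0 := sqrt_two_ne
    simp only [LinearMap.comp_apply, lsingle_apply, op_h_ket, map_add, LinearMap.id_apply]
    rw [Gate.op_single, Gate.op_single, Gate.onBasis, Gate.onBasis]
    have e1 : (s.erase q).erase q = s.erase q := by simp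
    have e2 : insert q (s.erase q) = insert q s := by ext r; simp; tauto
    have e3 : (insert q s).erase q = s.erase q := by ext r; simp
    have e4 : insert q (insert q s) = insert q s := by simp
    by_cases hs : q ∈ s
    · have e5 : insert q s = s := by simp [hs]
      simp only [e1, e2, e3, e4, hs, Finset.mem_erase, Finset.mem_insert, true_or, if_true, e5,
        ne_eq, not_true, false_and, if_false, smul_add, smul_single, smul_eq_mul]
      rw [add_add_add_comm, ← single_add, ← single_add,
        show 1 / (Real.sqrt 2 : ℂ) * (1 / Real.sqrt 2) + -1 / Real.sqrt 2 * (1 / Real.sqrt 2) = 0 by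
          ring, show 1 / (Real.sqrt 2 : ℂ) * (1 / Real.sqrt 2) +
          -1 / Real.sqrt 2 * (-1 / Real.sqrt 2) = 1 by field_simp; rw [h2]; norm_num]
      simp
    · have e5 : s.erase q = s := by simp [hs]
      simp only [e1, e2, e3, e4, hs, Finset.mem_erase, Finset.mem_insert, true_or, if_true, e5,
        ne_eq, not_true, false_and, if_false, smul_add, smul_single, smul_eq_mul]
      rw [add_add_add_comm, ← single_add, ← single_add,
        show 1 / (Real.sqrt 2 : ℂ) * (1 / Real.sqrt 2) + 1 / Real.sqrt 2 * (1 / Real.sqrt 2) = 1 by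
          field_simp; rw [h2]; norm_num, show 1 / (Real.sqrt 2 : ℂ) * (1 / Real.sqrt 2) +
          1 / Real.sqrt 2 * (-1 / Real.sqrt 2) = 0 by ring]
      simp
  -- The matrix of the gate is real and symmetric; the four cases are the values of qubit `q` in the
  -- two labels.
  refine ⟨Adj.of_ket fun s t => ?_, inv, inv⟩
  rw [op_h_ket, op_h_ket]
  simp only [Finsupp.add_apply, single_apply]
  by_cases hs : q ∈ s <;> by_cases ht : q ∈ t
  · have a1 : s.erase q ≠ t := by rintro rfl; simp at ht
    have a2 : t.erase q ≠ s := by rintro rfl; simp at hs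
    simp [hs, ht, a1, a2, eq_comm, apply_ite conj]
  · have a1 : insert q s ≠ t := by rintro rfl; simp at ht
    have a2 : (s.erase q = t) ↔ (insert q t = s) := by
      constructor
      · rintro rfl; simp [hs]
      · rintro rfl; simp [ht]
    have a3 : t ≠ s := by rintro rfl; exact ht hs
    simp [hs, ht, a1, a2, a3, Ne.symm a3, apply_ite conj]
  · have a1 : insert q t ≠ s := by rintro rfl; simp at hs
    have a2 : (insert q s = t) ↔ (t.erase q = s) := by
      constructor
      · rintro rfl; simp [hs]
      · rintro rfl; simp [ht]
    have a3 : t ≠ s := by rintro rfl; exact hs ht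
    simp [hs, ht, a1, a2, a3, Ne.symm a3, apply_ite conj]
  · have a1 : insert q s ≠ t := by rintro rfl; simp at ht
    have a2 : insert q t ≠ s := by rintro rfl; simp at hs
    simp [hs, ht, a1, a2, eq_comm, apply_ite conj]

theorem UPair.flip (q : ℕ) : UPair (permOp (flipBit q)) (permOp (flipBit q)) :=
  .perm (flipBit_flipBit q) (flipBit_flipBit q)

theorem UPair.tof (g : ℕ × ℕ × ℕ) : UPair (permOp (tof g)) (permOp (tof g)) :=
  .perm (tof_tof g) (tof_tof g)

theorem weight_op (g : Gate ℕ) (ψ : QState) : weight (g.op ψ) = weight ψ := by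
  cases g with
  | x q => rw [op_x]; exact (UPair.flip q).weight ψ
  | h q => exact (UPair.h q).weight ψ
  | t q =>
    rw [op_t]
    refine (UPair.diag fun s => ?_).weight ψ
    split_ifs
    · rw [← Complex.exp_conj, ← Complex.exp_add]
      simp only [map_div₀, map_mul, Complex.conj_I, Complex.conj_ofReal, map_ofNat]
      rw [show -Complex.I * (Real.pi : ℂ) / 4 + Complex.I * Real.pi / 4 = 0 by ring, Complex.exp_zero]
    · simp
  | cnot c q => rw [op_cnot]; exact (UPair.tof _).weight ψ
  | toffoli c d q => rw [op_toffoli]; exact (UPair.tof _).weight ψ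

theorem project_apply (q : ℕ) (v : Bool) (ψ : QState) (s : Finset ℕ) :
    project q v ψ s = if decide (q ∈ s) = v then ψ s else 0 := by
  rw [project, Finsupp.filter_apply]

theorem weight_project_add (q : ℕ) (ψ : QState) :
    weight (project q false ψ) + weight (project q true ψ) = weight ψ := by
  have h : ∀ v, (project q v ψ).support ⊆ ψ.support := fun v => by
    intro s; simp only [mem_support_iff, project_apply]; split_ifs <;> simp
  rw [weight_eq_sum (h false), weight_eq_sum (h true), weight, Finsupp.sum,
    ← Finset.sum_add_distrib]
  refine Finset.sum_congr rfl fun s _ => ?_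
  by_cases hs : q ∈ s <;> simp [project_apply, hs]

end QMachine

namespace QMachine

open Function

variable {inp : ℕ → ℕ} {V : ℕ}

/-! ## A program logic -/

/-- From memory `mem` and state `ψ`, all branches of `P` halt within `N` steps with `Q`, and their
weights add up to that of `ψ`; numbers up to `V` in memory and input are allowed throughout. -/
def ND (inp : ℕ → ℕ) (V : ℕ) (P : Prog) (N : ℕ) (mem : ℕ → ℕ) (ψ : QState)
    (Q : (ℕ → ℕ) → QState → Prop) : Prop :=
  (∀ i, inp i ≤ V) → (∀ i, mem i ≤ V) → ∀ t, ∃ l, Runs inp P ⟨t, mem, ψ⟩ l ∧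
    (∀ b ∈ l, b.time ≤ t + N * P.tick V ∧ (∀ i, b.mem i ≤ V) ∧ Q b.mem b.state) ∧
    (l.map fun b => weight b.state).sum = weight ψ

variable {P P' : Prog} {N N' M : ℕ} {mem : ℕ → ℕ} {ψ : QState} {Q R : (ℕ → ℕ) → QState → Prop}

theorem ND.mono (h : ND inp V P N mem ψ Q) (hN : N ≤ N')
    (hQ : ∀ mem' ψ', (∀ i, mem' i ≤ V) → Q mem' ψ' → R mem' ψ') : ND inp V P N' mem ψ R := by
  intro hi hm t
  obtain ⟨l, hl, hb, hw⟩ := h hi hm t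
  exact ⟨l, hl, fun b hbl => ⟨(hb b hbl).1.trans (by gcongr), (hb b hbl).2.1,
    hQ _ _ (hb b hbl).2.1 (hb b hbl).2.2⟩, hw⟩

theorem ND.weaken (h : ND inp V P N mem ψ Q) (hQ : ∀ mem' ψ', Q mem' ψ' → R mem' ψ') :
    ND inp V P N mem ψ R := h.mono le_rfl fun _ _ _ => hQ _ _

theorem ND.steps (h : ND inp V P N mem ψ Q) (hN : N ≤ N') : ND inp V P N' mem ψ Q :=
  h.mono hN fun _ _ _ => id

theorem ND.skip (h : Q mem ψ) : ND inp V .skip 0 mem ψ Q := fun _ hm t =>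
  ⟨[⟨t, mem, ψ⟩], .of_succ fun _ => rfl, by simpa using ⟨hm, h⟩, by simp⟩

theorem sum_weight_flatMap {l : List Branch} {k : Branch → List Branch}
    (h : ∀ b ∈ l, ((k b).map fun b => weight b.state).sum = weight b.state) :
    ((l.flatMap k).map fun b => weight b.state).sum = (l.map fun b => weight b.state).sum := by
  induction l with
  | nil => simp
  | cons b l ih =>
    rw [List.flatMap_cons, List.map_append, List.sum_append, List.map_cons, List.sum_cons,
      h b (by simp), ih fun b' hb' => h b' (by simp [hb'])]

theorem ND.seq {N₁ N₂ : ℕ} (h : ND inp V P N₁ mem ψ fun mem' ψ' => ND inp V P' N₂ mem' ψ' Q) :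
    ND inp V (.seq P P') (N₁ + N₂) mem ψ Q := by
  classical
  intro hi hm t
  obtain ⟨l, hl, hb, hw⟩ := h hi hm t
  -- The continuation is chosen branch by branch; off `l` its value does not matter, and the empty
  -- list is a default.
  have hk : ∀ b : Branch, ∃ l', b ∈ l → Runs inp P' b l' ∧
      (∀ b' ∈ l', b'.time ≤ b.time + N₂ * P'.tick V ∧ (∀ i, b'.mem i ≤ V) ∧ Q b'.mem b'.state) ∧
      (l'.map fun b => weight b.state).sum = weight b.state := by
    intro b
    by_cases hbl : b ∈ l
    · obtain ⟨l', h'⟩ := (hb b hbl).2.2 hi (hb b hbl).2.1 b.time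
      exact ⟨l', fun _ => h'⟩
    · exact ⟨[], fun h => absurd h hbl⟩
  choose k hk using hk
  refine ⟨l.flatMap k, hl.seq fun b hbl => (hk b hbl).1, ?_, ?_⟩
  · intro b' hb'
    obtain ⟨b, hbl, hb'⟩ := List.mem_flatMap.1 hb'
    obtain ⟨h1, h2⟩ := (hk b hbl).2.1 b' hb'
    refine ⟨h1.trans ?_, h2⟩
    have h3 := (hb b hbl).1
    have h4 : P.tick V ≤ (Prog.seq P P').tick V := Prog.tick_le (le_max_left _ _)
    have h5 : P'.tick V ≤ (Prog.seq P P').tick V := Prog.tick_le (le_max_right _ _)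
    have h6 := Nat.mul_le_mul_left N₁ h4
    have h7 := Nat.mul_le_mul_left N₂ h5
    rw [add_mul]; omega
  · rw [sum_weight_flatMap fun b hbl => (hk b hbl).2.2, hw]

theorem ND.store {a e : AExp} (he : e.eval inp mem ≤ V)
    (h : Q (update mem (a.eval inp mem) (e.eval inp mem)) ψ) :
    ND inp V (.store a e) 1 mem ψ Q := by
  intro hi hm t
  refine ⟨_, .of_succ fun _ => rfl, ?_, by simp⟩
  simp only [List.mem_singleton, forall_eq, one_mul]
  refine ⟨?_, fun i => ?_, h⟩
  · have h1 := AExp.cost_le hi hm a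
    have h2 := cost_add_one_le hi hm e le_rfl
    simp only [Prog.tick, Prog.unit]
    nlinarith
  · rw [update_apply]; split_ifs; exacts [he, hm i]

theorem ND.gate {g : Gate AExp} (h : Q mem ((g.map fun a => a.eval inp mem).op ψ)) :
    ND inp V (.gate g) 1 mem ψ Q := by
  intro hi hm t
  refine ⟨_, .of_succ fun _ => rfl, ?_, by simp [weight_op]⟩
  simp only [List.mem_singleton, forall_eq, one_mul]
  refine ⟨?_, hm, h⟩
  have h1 := sum_cost_le hi hm g.qubits
  have hB : 1 ≤ (V.size + 1) ^ 2 := Nat.one_le_pow _ _ (by omega)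
  simp only [Prog.tick, Prog.unit]
  nlinarith

theorem ND.meas {q a : AExp} (hV : 1 ≤ V)
    (h : ∀ v : Bool, Q (update mem (a.eval inp mem) v.toNat) (project (q.eval inp mem) v ψ)) :
    ND inp V (.meas q a) 1 mem ψ Q := by
  intro hi hm t
  have hB : 1 ≤ (V.size + 1) ^ 2 := Nat.one_le_pow _ _ (by omega)
  have h1 := AExp.cost_le hi hm q
  have h2 := AExp.cost_le hi hm a
  have ht : q.cost inp mem + a.cost inp mem + 1 ≤ 1 * (Prog.meas q a).tick V := by
    simp only [Prog.tick, Prog.unit]; nlinarith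
  refine ⟨_, .of_succ fun _ => rfl, ?_, by simp [weight_project_add]⟩
  simp only [List.mem_cons, List.not_mem_nil, or_false, forall_eq_or_imp, forall_eq]
  refine ⟨⟨by omega, fun i => ?_, h false⟩, ⟨by omega, fun i => ?_, h true⟩⟩
  all_goals rw [update_apply]; split_ifs; exacts [by omega, hm i]

theorem ND.ite {e : AExp}
    (h₁ : e.eval inp mem ≠ 0 → ND inp V P N mem ψ Q)
    (h₂ : e.eval inp mem = 0 → ND inp V P' N mem ψ Q) :
    ND inp V (.ite e P P') (N + 1) mem ψ Q := by
  intro hi hm t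
  have hc : e.cost inp mem + 1 ≤ (Prog.ite e P P').tick V :=
    cost_add_one_le hi hm e (le_max_left _ _)
  have hP : P.tick V ≤ (Prog.ite e P P').tick V :=
    Prog.tick_le (le_max_of_le_right (le_max_left _ _))
  have hP' : P'.tick V ≤ (Prog.ite e P P').tick V :=
    Prog.tick_le (le_max_of_le_right (le_max_right _ _))
  have key : ∃ l, Runs inp (if e.eval inp mem ≠ 0 then P else P')
      ⟨t + e.cost inp mem + 1, mem, ψ⟩ l ∧ (∀ b ∈ l, b.time ≤ t + e.cost inp mem + 1 +
        N * (Prog.ite e P P').tick V ∧ (∀ i, b.mem i ≤ V) ∧ Q b.mem b.state) ∧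
      (l.map fun b => weight b.state).sum = weight ψ := by
    by_cases he : e.eval inp mem = 0
    · obtain ⟨l, hl, hb, hw⟩ := h₂ he hi hm (t + e.cost inp mem + 1)
      refine ⟨l, by rwa [if_neg (not_not.2 he)], fun b hbl => ⟨(hb b hbl).1.trans ?_, (hb b hbl).2⟩, hw⟩
      gcongr
    · obtain ⟨l, hl, hb, hw⟩ := h₁ he hi hm (t + e.cost inp mem + 1)
      refine ⟨l, by rwa [if_pos he], fun b hbl => ⟨(hb b hbl).1.trans ?_, (hb b hbl).2⟩, hw⟩
      gcongr
  obtain ⟨l, hl, hb, hw⟩ := key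
  refine ⟨l, .ite hl, fun b hbl => ⟨(hb b hbl).1.trans ?_, (hb b hbl).2⟩, hw⟩
  rw [add_mul, one_mul]; omega

/-- Induction on the number `M - i` of rounds left. A round costs `N` for the body and one for the
test; the last `+ 1` is the test that fails. -/
theorem ND.loop {e : AExp} (Inv : ℕ → (ℕ → ℕ) → QState → Prop)
    (hs : ∀ i < M, ∀ mem ψ, (∀ i, mem i ≤ V) → Inv i mem ψ →
      e.eval inp mem ≠ 0 ∧ ND inp V P N mem ψ (Inv (i + 1)))
    (hM : ∀ mem ψ, (∀ i, mem i ≤ V) → Inv M mem ψ → e.eval inp mem = 0) :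
    ∀ i ≤ M, ∀ mem ψ, Inv i mem ψ → ND inp V (.loop e P) ((M - i) * (N + 1) + 1) mem ψ (Inv M) := by
  classical
  have hP : P.tick V ≤ (Prog.loop e P).tick V := Prog.tick_le (le_max_right _ _)
  intro i hiM
  induction hd : M - i generalizing i with
  | zero =>
    obtain rfl : i = M := by omega
    intro mem ψ h hi hm t
    have he := hM mem ψ hm h
    have hc : e.cost inp mem + 1 ≤ (Prog.loop e P).tick V :=
      cost_add_one_le hi hm e (le_max_left _ _)
    refine ⟨_, .loop_false he, ?_, by simp⟩
    simp only [List.mem_singleton, forall_eq, zero_mul, zero_add, one_mul]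
    exact ⟨by omega, hm, h⟩
  | succ d ih =>
    intro mem ψ h hi hm t
    have hlt : i < M := by omega
    have hc : e.cost inp mem + 1 ≤ (Prog.loop e P).tick V :=
      cost_add_one_le hi hm e (le_max_left _ _)
    obtain ⟨he, hnd⟩ := hs i hlt mem ψ hm h
    obtain ⟨l, hl, hb, hw⟩ := hnd hi hm (t + e.cost inp mem + 1)
    have hk : ∀ b : Branch, ∃ l', b ∈ l → Runs inp (.loop e P) b l' ∧
        (∀ b' ∈ l', b'.time ≤ b.time + (d * (N + 1) + 1) * (Prog.loop e P).tick V ∧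
          (∀ i, b'.mem i ≤ V) ∧ Inv M b'.mem b'.state) ∧
        (l'.map fun b => weight b.state).sum = weight b.state := by
      intro b
      by_cases hbl : b ∈ l
      · obtain ⟨l', h'⟩ := ih (i + 1) hlt (by omega) b.mem b.state (hb b hbl).2.2 hi (hb b hbl).2.1 b.time
        exact ⟨l', fun _ => h'⟩
      · exact ⟨[], fun h => absurd h hbl⟩
    choose k hk using hk
    refine ⟨l.flatMap k, .loop_true he hl fun b hbl => (hk b hbl).1, ?_, ?_⟩
    · intro b' hb'
      obtain ⟨b, hbl, hb'⟩ := List.mem_flatMap.1 hb'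
      obtain ⟨h1, h2⟩ := (hk b hbl).2.1 b' hb'
      refine ⟨h1.trans ?_, h2⟩
      have h3 := (hb b hbl).1
      have h6 := Nat.mul_le_mul_left N hP
      have : ((d + 1) * (N + 1) + 1) * (Prog.loop e P).tick V =
        (Prog.loop e P).tick V + N * (Prog.loop e P).tick V +
          (d * (N + 1) + 1) * (Prog.loop e P).tick V := by ring
      rw [this]; omega
    · rw [sum_weight_flatMap fun b hbl => (hk b hbl).2.2, hw]

/-! ## Registers and counted loops -/

/-- The register `c`, kept behind the output cells. -/
def reg (c : ℕ) : AExp := .load (.add (.input (.lit 0)) (.lit c))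

/-- Assignment to a register. -/
def setReg (c : ℕ) (e : AExp) : Prog := .store (.add (.input (.lit 0)) (.lit c)) e

@[simp] theorem eval_reg (c : ℕ) : (reg c).eval inp mem = mem (inp 0 + c) := rfl

/-- Run `P` for `c = 0, …, bound - 1`. -/
def forLoop (c : ℕ) (bound : AExp) (P : Prog) : Prog :=
  .seq (setReg c (.lit 0))
    (.loop (.sub bound (reg c)) (.seq P (setReg c (.add (reg c) (.lit 1)))))

theorem ND.setReg {c : ℕ} {e : AExp} (he : e.eval inp mem ≤ V)
    (h : Q (update mem (inp 0 + c) (e.eval inp mem)) ψ) : ND inp V (setReg c e) 1 mem ψ Q :=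
  ND.store he h

/-- The loop tests the truncated difference of bound and counter, nonzero exactly while the counter
is below the bound. The bound is evaluated anew in every test, so its value has to follow from the
invariant throughout. -/
theorem ND.forLoop {c : ℕ} {bound : AExp} (Inv : ℕ → (ℕ → ℕ) → QState → Prop) (hM : M ≤ V)
    (h0 : Inv 0 (update mem (inp 0 + c) 0) ψ)
    (hb : ∀ i ≤ M, ∀ mem ψ, mem (inp 0 + c) = i → Inv i mem ψ → bound.eval inp mem = M)
    (hs : ∀ i < M, ∀ mem ψ, (∀ i, mem i ≤ V) → mem (inp 0 + c) = i → Inv i mem ψ →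
      ND inp V P N mem ψ fun mem' ψ' =>
        mem' (inp 0 + c) = i ∧ Inv (i + 1) (update mem' (inp 0 + c) (i + 1)) ψ')
    (hQ : ∀ mem ψ, mem (inp 0 + c) = M → Inv M mem ψ → Q mem ψ) :
    ND inp V (forLoop c bound P) (M * (N + 2) + 2) mem ψ Q := by
  have key := ND.loop (inp := inp) (V := V) (e := .sub bound (reg c))
    (P := .seq P (QMachine.setReg c (.add (reg c) (.lit 1)))) (N := N + 1) (M := M)
    (fun i mem ψ => mem (inp 0 + c) = i ∧ Inv i mem ψ) (fun i hi mem ψ hm h => ⟨?_, ?_⟩)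
    (fun mem ψ hm h => ?_) 0 (Nat.zero_le _) (update mem (inp 0 + c) 0) ψ ⟨by simp, h0⟩
  · refine ND.steps (N := 1 + ((M - 0) * (N + 1 + 1) + 1)) (.seq (.setReg (Nat.zero_le _) ?_)) ?_
    · exact key.weaken fun mem ψ h => hQ mem ψ h.1 h.2
    · rw [Nat.sub_zero, show N + 1 + 1 = N + 2 from rfl]; omega
  · simp only [AExp.eval, eval_reg, hb i hi.le mem ψ h.1 h.2, h.1]; omega
  · refine .seq ((hs i hi mem ψ hm h.1 h.2).weaken fun mem' ψ' h' => ?_)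
    refine .setReg ?_ ?_
    · simp only [AExp.eval, eval_reg, h'.1]; omega
    · simp only [AExp.eval, eval_reg, h'.1]
      exact ⟨by simp, h'.2⟩
  · simp only [AExp.eval, eval_reg, hb M le_rfl mem ψ h.1 h.2, h.1]; omega

end QMachine

namespace QMachine

open Finsupp ComplexConjugate

/-! ## Amplitude amplification -/

/-- The iteration is a rotation by `2θ` in the plane of `g` and `b`. The factor `(-1) ^ t` appears
because `R` is minus the usual reflection about `g + b`. The coefficients are multiplied by sine and
cosine instead of being solved for, so that vanishing sine or cosine needs no separate case. -/
theorem grover_iterate {R Z : QState →ₗ[ℂ] QState} {g b : QState}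
    {θ : ℝ} (hZg : Z g = -g) (hZb : Z b = b) (hR : R (g + b) = -(g + b))
    (hRg : R g = g - ((2 * Real.sin θ ^ 2 : ℝ) : ℂ) • (g + b)) (t : ℕ) :
    ∃ α β : ℝ, ((R ∘ₗ Z) ^ t) (g + b) = (α : ℂ) • g + (β : ℂ) • b ∧
      Real.sin θ * α = (-1) ^ t * Real.sin ((2 * t + 1 : ℕ) * θ) ∧
      Real.cos θ * β = (-1) ^ t * Real.cos ((2 * t + 1 : ℕ) * θ) := by
  induction t with
  | zero => exact ⟨1, 1, by simp, by simp, by simp⟩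
  | succ t ih =>
    obtain ⟨α, β, h, hα, hβ⟩ := ih
    have hRb : R b = -(g + b) - (g - ((2 * Real.sin θ ^ 2 : ℝ) : ℂ) • (g + b)) := by
      rw [← hR, ← hRg, map_add]; abel
    -- When `g` and `b` are orthogonal of squared norms `sin² θ` and `cos² θ`, the overlap of `-α g
    -- + β b` with `g + b` is `-α sin² θ + β cos² θ`; `R` subtracts twice this multiple of `g + b`.
    refine ⟨-α - 2 * (-α * Real.sin θ ^ 2 + β * Real.cos θ ^ 2),
      β - 2 * (-α * Real.sin θ ^ 2 + β * Real.cos θ ^ 2), ?_, ?_, ?_⟩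
    · rw [pow_succ', Module.End.mul_apply, h, LinearMap.comp_apply, map_add, map_smul, map_smul, hZg,
        hZb, map_add, map_smul, map_smul, map_neg, hRg, hRb, Real.cos_sq']
      push_cast
      module
    · have e : ((2 * (t + 1) + 1 : ℕ) : ℝ) * θ = (2 * t + 1 : ℕ) * θ + 2 * θ := by push_cast; ring
      rw [e, Real.sin_add, Real.sin_two_mul, Real.cos_two_mul, pow_succ]
      have hc := Real.cos_sq' θ
      linear_combination (-1 + 2 * Real.sin θ ^ 2) * hα - 2 * Real.sin θ * Real.cos θ * hβ +
        2 * (-1) ^ t * Real.sin ((2 * t + 1 : ℕ) * θ) * hc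
    · have e : ((2 * (t + 1) + 1 : ℕ) : ℝ) * θ = (2 * t + 1 : ℕ) * θ + 2 * θ := by push_cast; ring
      rw [e, Real.cos_add, Real.sin_two_mul, Real.cos_two_mul, pow_succ]
      have hc := Real.cos_sq' θ
      linear_combination (1 - 2 * Real.cos θ ^ 2) * hβ + 2 * Real.sin θ * Real.cos θ * hα

/-- Some power of three turns an angle in `(0, π/2]` into one with sine at least `1/2`. -/
theorem exists_three_pow_sin {θ : ℝ} (h0 : 0 < θ) (h1 : θ ≤ Real.pi / 2) :
    ∃ i : ℕ, 3 ^ i * θ ≤ Real.pi / 2 ∧ 1 / 2 ≤ Real.sin (3 ^ i * θ) := by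
  -- Take the last power of three that keeps the angle at most π/2. The next one exceeds π/2, so the
  -- angle is already above π/6, whose sine is 1/2.
  have hex : ∃ i : ℕ, Real.pi / 2 < 3 ^ i * θ := by
    obtain ⟨i, hi⟩ := pow_unbounded_of_one_lt (Real.pi / 2 / θ) (by norm_num : (1 : ℝ) < 3)
    exact ⟨i, by rwa [div_lt_iff₀ h0] at hi⟩
  classical
  have hn0 : Nat.find hex ≠ 0 := by
    intro h
    have := Nat.find_spec hex
    rw [h] at this
    simp only [pow_zero, one_mul] at this
    linarith
  obtain ⟨i, hi⟩ := Nat.exists_eq_succ_of_ne_zero hn0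
  have hle : 3 ^ i * θ ≤ Real.pi / 2 := not_lt.1 (Nat.find_min hex (by omega))
  have hgt : Real.pi / 2 < 3 ^ (i + 1) * θ := by have := Nat.find_spec hex; rwa [hi] at this
  refine ⟨i, hle, ?_⟩
  rw [← Real.sin_pi_div_six]
  refine Real.sin_le_sin_of_le_of_le_pi_div_two (by linarith [Real.pi_pos]) hle ?_
  rw [pow_succ] at hgt
  nlinarith

/-- An iteration number that amplifies success probability `p` to at least `1/4`. -/
theorem exists_amplification {p : ℝ} (h0 : 0 < p) (h1 : p ≤ 1) :
    ∃ (θ : ℝ) (i : ℕ), Real.sin θ ^ 2 = p ∧ (3 ^ i : ℝ) ^ 2 * p ≤ 5 / 2 ∧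
      1 / 4 ≤ Real.sin (((2 * ((3 ^ i - 1) / 2) + 1 : ℕ) : ℝ) * θ) ^ 2 := by
  have hs0 : 0 < Real.sqrt p := Real.sqrt_pos.2 h0
  have hs1 : Real.sqrt p ≤ 1 := Real.sqrt_le_one.2 h1
  have hsin : Real.sin (Real.arcsin (Real.sqrt p)) = Real.sqrt p :=
    Real.sin_arcsin (by linarith) hs1
  obtain ⟨i, hi, hi'⟩ := exists_three_pow_sin (Real.arcsin_pos.2 hs0)
    (Real.arcsin_le_pi_div_two (Real.sqrt p))
  -- Powers of three are odd, so `(3 ^ i - 1) / 2` rounds multiply the angle by exactly `3 ^ i`.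
  have hodd : 2 * ((3 ^ i - 1) / 2) + 1 = 3 ^ i := by
    have : 3 ^ i % 2 = 1 := Nat.odd_iff.1 (Odd.pow (by decide))
    generalize 3 ^ i = x at this ⊢
    omega
  refine ⟨Real.arcsin (Real.sqrt p), i, ?_, ?_, ?_⟩
  · rw [hsin, Real.sq_sqrt h0.le]
  -- Since `sin x ≤ x`, the number `3 ^ i * √p` is at most π/2 < 1.58, and 1.58² < 5/2.
  · have h2 : Real.sqrt p ≤ Real.arcsin (Real.sqrt p) := by
      conv_lhs => rw [← hsin]
      exact Real.sin_le (Real.arcsin_pos.2 hs0).le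
    have h3 : 3 ^ i * Real.sqrt p ≤ Real.pi / 2 := le_trans (by gcongr) hi
    have h4 : Real.pi / 2 ≤ 1.58 := by linarith [Real.pi_lt_d2]
    calc (3 ^ i : ℝ) ^ 2 * p = (3 ^ i * Real.sqrt p) ^ 2 := by
          rw [mul_pow, Real.sq_sqrt h0.le]
      _ ≤ 1.58 ^ 2 := by gcongr; linarith
      _ ≤ _ := by norm_num
  · rw [hodd]
    push_cast
    nlinarith

theorem mem_supported_iff {M : Set (Finset ℕ)} {ψ : QState} :
    ψ ∈ supported ℂ ℂ M ↔ ∀ s, s ∉ M → ψ s = 0 := by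
  rw [mem_supported']

theorem diagOp_mem_supported {M : Set (Finset ℕ)} {ψ : QState} (h : ψ ∈ supported ℂ ℂ M)
    (φ : Finset ℕ → ℂ) : diagOp φ ψ ∈ supported ℂ ℂ M := by
  rw [mem_supported_iff] at *
  intro s hs
  rw [diagOp_apply, h s hs, mul_zero]

theorem filter_mem_supported {M : Set (Finset ℕ)} {ψ : QState} (h : ψ ∈ supported ℂ ℂ M)
    (G : Finset ℕ → Prop) [DecidablePred G] : ψ.filter G ∈ supported ℂ ℂ M := by
  rw [mem_supported_iff] at *
  intro s hs
  rw [filter_apply, h s hs, ite_self]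

/-- Filtering is an orthogonal projection, so ⟨ψ, Pψ⟩ = ‖Pψ‖². -/
theorem ip_filter_self (ψ : QState) (G : Finset ℕ → Prop) [DecidablePred G] :
    ip ψ (ψ.filter G) = weight (ψ.filter G) := by
  rw [ofReal_weight, ip_apply, ip_apply]
  refine Finsupp.sum_congr fun s hs => ?_
  rw [Finsupp.support_filter, Finset.mem_filter] at hs
  rw [filter_apply_pos _ _ hs.2]

/-- A sign that singles out `s₀` within `M₀` acts as `1 - 2|s₀⟩⟨s₀|` on states living there.
Restricting to `M₀` matters because the oracles are correct only on labels whose work qubits are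
zero. -/
theorem diagOp_reflection {M₀ : Set (Finset ℕ)} {s₀ : Finset ℕ} {φ₀ : Finset ℕ → ℂ} (hs₀ : s₀ ∈ M₀)
    (hφ₀ : ∀ s ∈ M₀, φ₀ s = if s = s₀ then -1 else 1) {χ : QState} (hχ : χ ∈ supported ℂ ℂ M₀) :
    diagOp φ₀ χ = χ - (2 * χ s₀) • ket s₀ := by
  ext s
  rw [diagOp_apply, Finsupp.sub_apply, Finsupp.smul_apply]
  by_cases hs : s ∈ M₀
  · rw [hφ₀ s hs]
    by_cases h : s = s₀
    · subst h; rw [if_pos rfl, single_eq_same, smul_eq_mul]; ring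
    · rw [if_neg h, single_eq_of_ne h, smul_zero]; ring
  · have : s ≠ s₀ := fun h => hs (h ▸ hs₀)
    rw [mem_supported_iff.1 hχ s hs, single_eq_of_ne this, smul_zero, mul_zero, sub_zero]

theorem diagOp_filter {M : Set (Finset ℕ)} {G : Finset ℕ → Prop} [DecidablePred G]
    {φ : Finset ℕ → ℂ} {Ψ : QState} (hΨ : Ψ ∈ supported ℂ ℂ M)
    (hφ : ∀ s ∈ M, φ s = if G s then -1 else 1) : diagOp φ (Ψ.filter G) = -Ψ.filter G := by
  ext s
  rw [diagOp_apply, Finsupp.neg_apply, filter_apply]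
  by_cases hs : s ∈ M
  · rw [hφ s hs]; split_ifs
    · ring
    · ring
  · rw [mem_supported_iff.1 hΨ s hs, ite_self, mul_zero, neg_zero]

theorem diagOp_filter_not {M : Set (Finset ℕ)} {G : Finset ℕ → Prop} [DecidablePred G]
    {φ : Finset ℕ → ℂ} {Ψ : QState} (hΨ : Ψ ∈ supported ℂ ℂ M)
    (hφ : ∀ s ∈ M, φ s = if G s then -1 else 1) :
    diagOp φ (Ψ.filter fun s => ¬ G s) = Ψ.filter fun s => ¬ G s := by
  ext s
  rw [diagOp_apply, filter_apply]
  by_cases hs : s ∈ M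
  · rw [hφ s hs]; split_ifs
    · ring
    · ring
  · rw [mem_supported_iff.1 hΨ s hs, ite_self, mul_zero]

theorem conj_diagOp_apply {W W' : QState →ₗ[ℂ] QState} {φ₀ : Finset ℕ → ℂ} {s₀ : Finset ℕ}
    (hinv : W' (W (ket s₀)) = ket s₀) (hφ₀ : φ₀ s₀ = -1) :
    (W ∘ₗ diagOp φ₀ ∘ₗ W') (W (ket s₀)) = -W (ket s₀) := by
  rw [LinearMap.comp_apply, LinearMap.comp_apply, hinv, diagOp_single, hφ₀, one_mul, single_neg,
    map_neg]

/-- The component of `W'` of the good part at `s₀` is the overlap of the good part with the whole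
state, that is, the good weight `sin² θ`. -/
theorem conj_diagOp_apply_filter {W W' : QState →ₗ[ℂ] QState} (hW : UPair W W') {s₀ : Finset ℕ}
    {M₀ : Set (Finset ℕ)} {G : Finset ℕ → Prop} [DecidablePred G] {φ₀ : Finset ℕ → ℂ}
    (hs₀ : s₀ ∈ M₀) (hg : W' ((W (ket s₀)).filter G) ∈ supported ℂ ℂ M₀)
    (hφ₀ : ∀ s ∈ M₀, φ₀ s = if s = s₀ then -1 else 1) {θ : ℝ}
    (hθ : Real.sin θ ^ 2 = weight ((W (ket s₀)).filter G)) :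
    (W ∘ₗ diagOp φ₀ ∘ₗ W') ((W (ket s₀)).filter G) =
      (W (ket s₀)).filter G - ((2 * Real.sin θ ^ 2 : ℝ) : ℂ) • W (ket s₀) := by
  have hp : (W' ((W (ket s₀)).filter G)) s₀ = ((Real.sin θ ^ 2 : ℝ) : ℂ) := by
    rw [← ip_ket_left, ← hW.adj, ip_filter_self, hθ]
  rw [LinearMap.comp_apply, LinearMap.comp_apply, diagOp_reflection hs₀ hφ₀ hg, map_sub, map_smul,
    hp, hW.symm.inv_apply, Complex.ofReal_mul, Complex.ofReal_ofNat]

/-- `grover_iterate` for the good and bad parts of `W|s₀⟩`. The set `M` carries this state and `M₀`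
carries what `W'` makes of its good part; the two oracles need to be right only there. -/
theorem amplify {W W' : QState →ₗ[ℂ] QState} (hW : UPair W W') {s₀ : Finset ℕ}
    {M M₀ : Set (Finset ℕ)} {G : Finset ℕ → Prop} [DecidablePred G] {φ φ₀ : Finset ℕ → ℂ}
    (hΨ : W (ket s₀) ∈ supported ℂ ℂ M) (hφ : ∀ s ∈ M, φ s = if G s then -1 else 1)
    (hs₀ : s₀ ∈ M₀) (hg : W' ((W (ket s₀)).filter G) ∈ supported ℂ ℂ M₀)
    (hφ₀ : ∀ s ∈ M₀, φ₀ s = if s = s₀ then -1 else 1) {θ : ℝ}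
    (hθ : Real.sin θ ^ 2 = weight ((W (ket s₀)).filter G)) (t : ℕ) :
    ∃ α β : ℝ, (((W ∘ₗ diagOp φ₀ ∘ₗ W') ∘ₗ diagOp φ) ^ t) (W (ket s₀)) =
        (α : ℂ) • (W (ket s₀)).filter G + (β : ℂ) • (W (ket s₀)).filter (fun s => ¬ G s) ∧
      Real.sin θ * α = (-1) ^ t * Real.sin ((2 * t + 1 : ℕ) * θ) ∧
      Real.cos θ * β = (-1) ^ t * Real.cos ((2 * t + 1 : ℕ) * θ) := by
  have h1 := conj_diagOp_apply (φ₀ := φ₀) (hW.inv_apply (ket s₀)) (by rw [hφ₀ _ hs₀, if_pos rfl])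
  have h2 := conj_diagOp_apply_filter hW hs₀ hg hφ₀ hθ
  generalize W ∘ₗ diagOp φ₀ ∘ₗ W' = A at *
  generalize W (ket s₀) = Ψ at *
  have hsum : Ψ.filter G + Ψ.filter (fun s => ¬ G s) = Ψ := filter_add_filter_not Ψ G
  have := grover_iterate (R := A) (Z := diagOp φ) (g := Ψ.filter G)
    (b := Ψ.filter fun s => ¬ G s) (θ := θ) (diagOp_filter hΨ hφ) (diagOp_filter_not hΨ hφ)
    (by rw [hsum, h1]) (by rw [hsum, h2]) t
  rwa [hsum] at this

/-! ## Layers of gates -/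

/-- The operator of a list of gates, the first of which is applied first. -/
noncomputable def gatesOp : List (Gate ℕ) → (QState →ₗ[ℂ] QState)
  | [] => LinearMap.id
  | g :: L => gatesOp L ∘ₗ g.op

theorem gatesOp_append (L L' : List (Gate ℕ)) : gatesOp (L ++ L') = gatesOp L' ∘ₗ gatesOp L := by
  induction L with
  | nil => rfl
  | cons g L ih => rw [List.cons_append, gatesOp, ih, gatesOp, LinearMap.comp_assoc]

theorem gatesOp_singleton (g : Gate ℕ) : gatesOp [g] = g.op := rfl

theorem UPair.gatesOp {L : List (Gate ℕ)} (h : ∀ g ∈ L, UPair g.op g.op) :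
    UPair (gatesOp L) (gatesOp L.reverse) := by
  induction L with
  | nil => exact .id
  | cons g L ih =>
    rw [List.reverse_cons, gatesOp_append, gatesOp_singleton]
    exact (ih fun g hg => h g (by simp [hg])).comp (h g (by simp))

theorem gatesOp_mem_supported {M : Set (Finset ℕ)} {L : List (Gate ℕ)}
    (h : ∀ g ∈ L, ∀ ψ ∈ supported ℂ ℂ M, g.op ψ ∈ supported ℂ ℂ M) :
    ∀ ψ ∈ supported ℂ ℂ M, gatesOp L ψ ∈ supported ℂ ℂ M := by
  induction L with
  | nil => exact fun ψ hψ => hψ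
  | cons g L ih => exact fun ψ hψ => ih (fun g hg => h g (by simp [hg])) _ (h g (by simp) ψ hψ)

theorem map_mem_supported {M M' : Set (Finset ℕ)} {A : QState →ₗ[ℂ] QState}
    (h : ∀ s ∈ M, A (ket s) ∈ supported ℂ ℂ M') :
    ∀ ψ ∈ supported ℂ ℂ M, A ψ ∈ supported ℂ ℂ M' := by
  intro ψ hψ
  rw [← Finsupp.sum_single ψ, map_finsuppSum]
  refine Submodule.sum_mem _ fun s hs => ?_
  have : single s (ψ s) = ψ s • ket s := by simp
  change A (single s (ψ s)) ∈ _
  rw [this, map_smul]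
  exact Submodule.smul_mem _ _ (h s ((mem_supported ℂ ψ).1 hψ hs))

theorem op_h_mem_supported {M : Set (Finset ℕ)} {q : ℕ}
    (h : ∀ s ∈ M, insert q s ∈ M ∧ s.erase q ∈ M) :
    ∀ ψ ∈ supported ℂ ℂ M, (Gate.h q).op ψ ∈ supported ℂ ℂ M :=
  map_mem_supported fun s hs => by
    rw [op_h_ket]
    exact Submodule.add_mem _ (single_mem_supported ℂ _ (h s hs).2)
      (single_mem_supported ℂ _ (h s hs).1)

theorem permOp_mem_supported {M M' : Set (Finset ℕ)} {π : Finset ℕ → Finset ℕ}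
    (h : ∀ s ∈ M, π s ∈ M') : ∀ ψ ∈ supported ℂ ℂ M, permOp π ψ ∈ supported ℂ ℂ M' :=
  map_mem_supported fun s hs => by
    rw [permOp_single]; exact single_mem_supported ℂ _ (h s hs)

/-- Hadamard gates on zero qubits produce the uniform superposition. -/
theorem gatesOp_h_ket {l : List ℕ} (hl : l.Nodup) {s₀ : Finset ℕ} (hs : ∀ q ∈ l, q ∉ s₀) :
    gatesOp (l.map Gate.h) (ket s₀) =
      (1 / (Real.sqrt 2 : ℂ)) ^ l.length • ∑ Y ∈ l.toFinset.powerset, ket (s₀ ∪ Y) := by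
  induction l generalizing s₀ with
  | nil => simp [gatesOp]
  | cons q l ih =>
    have hq : q ∉ s₀ := hs q (by simp)
    have hql : q ∉ l := (List.nodup_cons.1 hl).1
    have e1 : single s₀ (1 / (Real.sqrt 2 : ℂ)) = (1 / (Real.sqrt 2 : ℂ)) • ket s₀ := by simp
    have e2 : single (insert q s₀) (1 / (Real.sqrt 2 : ℂ)) =
        (1 / (Real.sqrt 2 : ℂ)) • ket (insert q s₀) := by simp
    rw [List.map_cons, gatesOp, LinearMap.comp_apply, op_h_ket, Finset.erase_eq_of_notMem hq,
      if_neg hq, e1, e2, map_add, map_smul, map_smul,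
      ih hl.of_cons fun r hr => hs r (by simp [hr]), ih hl.of_cons fun r hr => ?_,
      List.toFinset_cons, Finset.sum_powerset_insert (by simpa using hql), List.length_cons, pow_succ',
      mul_smul, ← smul_add, ← smul_add]
    · simp [Finset.insert_union, Finset.union_insert]
    · rw [Finset.mem_insert, not_or]
      exact ⟨fun h => hql (h ▸ hr), hs r (by simp [hr])⟩

theorem norm_inv_sqrt_two_pow (s : ℕ) : ‖(1 / (Real.sqrt 2 : ℂ)) ^ s‖ ^ 2 = 1 / 2 ^ s := by
  rw [norm_pow, norm_div, norm_one, Complex.norm_real, ← pow_mul, mul_comm s 2, pow_mul, div_pow,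
    Real.norm_eq_abs, sq_abs, Real.sq_sqrt (by norm_num), one_pow, div_pow, one_pow]

end QMachine

namespace QMachine

open Finsupp ComplexConjugate

/-! ## The three-stage search -/

/-- `t` rounds of amplitude amplification of `W`. -/
noncomputable def ampOp (W W' Z R : QState →ₗ[ℂ] QState) (t : ℕ) : QState →ₗ[ℂ] QState :=
  (((W ∘ₗ R ∘ₗ W') ∘ₗ Z) ^ t) ∘ₗ W

/-- The inverse of `ampOp` when `Z` and `R` are involutions. -/
noncomputable def ampOpInv (W W' Z R : QState →ₗ[ℂ] QState) (t : ℕ) : QState →ₗ[ℂ] QState :=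
  W' ∘ₗ ((Z ∘ₗ W ∘ₗ R ∘ₗ W') ^ t)

theorem UPair.ampOp {W W' Z R : QState →ₗ[ℂ] QState} (hW : UPair W W') (hZ : UPair Z Z)
    (hR : UPair R R) (t : ℕ) : UPair (ampOp W W' Z R t) (ampOpInv W W' Z R t) := by
  have h1 : UPair ((W ∘ₗ R ∘ₗ W') ∘ₗ Z) (Z ∘ₗ W ∘ₗ R ∘ₗ W') := by
    have := (hW.comp (hR.comp hW.symm)).comp hZ
    rwa [LinearMap.comp_assoc W' R W] at this
  exact (h1.pow t).comp hW

theorem pow_mem_supported {M : Set (Finset ℕ)} {A : QState →ₗ[ℂ] QState}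
    (h : ∀ ψ ∈ supported ℂ ℂ M, A ψ ∈ supported ℂ ℂ M) (t : ℕ) :
    ∀ ψ ∈ supported ℂ ℂ M, (A ^ t) ψ ∈ supported ℂ ℂ M := by
  induction t with
  | zero => exact fun ψ hψ => hψ
  | succ t ih => intro ψ hψ; rw [pow_succ', Module.End.mul_apply]; exact h _ (ih ψ hψ)

theorem ampOp_mem_supported {M : Set (Finset ℕ)} {W W' : QState →ₗ[ℂ] QState} {φ φ₀ : Finset ℕ → ℂ}
    (hW : ∀ ψ ∈ supported ℂ ℂ M, W ψ ∈ supported ℂ ℂ M)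
    (hW' : ∀ ψ ∈ supported ℂ ℂ M, W' ψ ∈ supported ℂ ℂ M) (t : ℕ) :
    ∀ ψ ∈ supported ℂ ℂ M, ampOp W W' (diagOp φ) (diagOp φ₀) t ψ ∈ supported ℂ ℂ M :=
  fun ψ hψ => pow_mem_supported (A := (W ∘ₗ diagOp φ₀ ∘ₗ W') ∘ₗ diagOp φ) (fun χ hχ => hW _
    (diagOp_mem_supported (hW' _ (diagOp_mem_supported hχ φ)) φ₀)) t _ (hW _ hψ)

theorem ampOpInv_mem_supported {M : Set (Finset ℕ)} {W W' : QState →ₗ[ℂ] QState}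
    {φ φ₀ : Finset ℕ → ℂ} (hW : ∀ ψ ∈ supported ℂ ℂ M, W ψ ∈ supported ℂ ℂ M)
    (hW' : ∀ ψ ∈ supported ℂ ℂ M, W' ψ ∈ supported ℂ ℂ M) (t : ℕ) :
    ∀ ψ ∈ supported ℂ ℂ M, ampOpInv W W' (diagOp φ) (diagOp φ₀) t ψ ∈ supported ℂ ℂ M :=
  fun ψ hψ => hW' _ (pow_mem_supported (A := diagOp φ ∘ₗ W ∘ₗ diagOp φ₀ ∘ₗ W') (fun χ hχ =>
    diagOp_mem_supported (hW _ (diagOp_mem_supported (hW' _ hχ) φ₀)) φ) t _ hψ)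

/-- A layer of Hadamard gates. -/
noncomputable def hadOp (l : List ℕ) : QState →ₗ[ℂ] QState := gatesOp (l.map Gate.h)

theorem UPair.had (l : List ℕ) : UPair (hadOp l) (hadOp l.reverse) := by
  rw [hadOp, hadOp, List.map_reverse]
  exact .gatesOp fun g hg => by
    obtain ⟨q, _, rfl⟩ := List.mem_map.1 hg
    exact .h q

theorem hadOp_mem_supported {M : Set (Finset ℕ)} {l : List ℕ}
    (h : ∀ q ∈ l, ∀ s ∈ M, insert q s ∈ M ∧ s.erase q ∈ M) :
    ∀ ψ ∈ supported ℂ ℂ M, hadOp l ψ ∈ supported ℂ ℂ M :=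
  gatesOp_mem_supported fun g hg => by
    obtain ⟨q, hq, rfl⟩ := List.mem_map.1 hg
    exact op_h_mem_supported (h q hq)

section
variable {l : List ℕ} {s₀ : Finset ℕ} {G : Finset ℕ → Prop} [DecidablePred G]

theorem filter_sum_ket (F : Finset (Finset ℕ)) (c : ℂ) (f : Finset ℕ → Finset ℕ) :
    (c • ∑ Y ∈ F, ket (f Y)).filter G = c • ∑ Y ∈ F with G (f Y), ket (f Y) := by
  rw [Finsupp.filter_smul, Finset.sum_filter]
  congr 1
  have h : ∀ ψ : QState, ψ.filter G = Finsupp.filterAddHom (M := ℂ) G ψ := fun _ => rfl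
  rw [h, map_sum]
  refine Finset.sum_congr rfl fun Y _ => ?_
  rw [← h]
  split_ifs with hG
  · exact Finsupp.filter_single_of_pos _ hG
  · exact Finsupp.filter_single_of_neg _ hG

theorem weight_sum_ket {ι : Type*} (F : Finset ι) (c : ι → ℂ) (f : ι → Finset ℕ)
    (hf : Set.InjOn f F) : weight (∑ Y ∈ F, single (f Y) (c Y)) = ∑ Y ∈ F, ‖c Y‖ ^ 2 := by
  classical
  have happ : ∀ Y ∈ F, (∑ Y ∈ F, single (f Y) (c Y)) (f Y) = c Y := by
    intro Y hY
    rw [Finsupp.finsetSum_apply, Finset.sum_eq_single Y]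
    · simp
    · intro Z hZ hne
      exact Finsupp.single_eq_of_ne fun h => hne (hf hZ hY h.symm)
    · exact fun h => absurd hY h
  rw [weight_eq_sum (F := F.image f), Finset.sum_image hf]
  · exact Finset.sum_congr rfl fun Y hY => by rw [happ Y hY]
  · intro s hs
    by_contra h
    rw [Finsupp.mem_support_iff, Finsupp.finsetSum_apply] at hs
    refine hs (Finset.sum_eq_zero fun Y hY => Finsupp.single_eq_of_ne fun e => h ?_)
    exact e ▸ Finset.mem_image_of_mem f hY

theorem union_injOn {S : Finset ℕ} (h : Disjoint s₀ S) :
    Set.InjOn (fun Y => s₀ ∪ Y) (S.powerset : Set (Finset ℕ)) := by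
  intro Y hY Z hZ e
  simp only [Finset.coe_powerset, Set.mem_preimage, Set.mem_powerset_iff, Finset.coe_subset] at hY hZ
  ext q
  have := congrArg (q ∈ ·) e
  simp only [Finset.mem_union, eq_iff_iff] at this
  by_cases hq : q ∈ s₀
  · have hS : q ∉ S := Finset.disjoint_left.1 h hq
    exact ⟨fun h' => absurd (hY h') hS, fun h' => absurd (hZ h') hS⟩
  · simpa [hq] using this

theorem weight_filter_had (hl : l.Nodup) (hs : ∀ q ∈ l, q ∉ s₀) :
    weight ((hadOp l (ket s₀)).filter G) =
      ({Y ∈ l.toFinset.powerset | G (s₀ ∪ Y)}.card : ℝ) / 2 ^ l.length := by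
  have hd : Disjoint s₀ l.toFinset := Finset.disjoint_right.2 fun q hq => hs q (by simpa using hq)
  rw [hadOp, gatesOp_h_ket hl hs, filter_sum_ket, weight_smul, norm_inv_sqrt_two_pow,
    weight_sum_ket _ _ _ ((union_injOn hd).mono
      (Finset.coe_subset.2 (Finset.filter_subset _ _)))]
  simp
  ring

/-- A uniform superposition keeps one common amplitude on good and one on bad labels. Only the good
one is given a formula, since later bounds count good labels alone. -/
theorem ampOp_had (hl : l.Nodup) (hs : ∀ q ∈ l, q ∉ s₀) {φ φ₀ : Finset ℕ → ℂ}
    (hφ : ∀ Y ⊆ l.toFinset, φ (s₀ ∪ Y) = if G (s₀ ∪ Y) then -1 else 1)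
    (hφ₀ : ∀ Y ⊆ l.toFinset, φ₀ (s₀ ∪ Y) = if Y = ∅ then -1 else 1) {θ : ℝ}
    (hθ : Real.sin θ ^ 2 = ({Y ∈ l.toFinset.powerset | G (s₀ ∪ Y)}.card : ℝ) / 2 ^ l.length)
    (t : ℕ) :
    ∃ α β : ℝ, ampOp (hadOp l) (hadOp l.reverse) (diagOp φ) (diagOp φ₀) t (ket s₀) =
        (1 / (Real.sqrt 2 : ℂ)) ^ l.length •
          ∑ Y ∈ l.toFinset.powerset, single (s₀ ∪ Y) ((if G (s₀ ∪ Y) then α else β : ℝ) : ℂ) ∧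
      Real.sin θ * α = (-1) ^ t * Real.sin ((2 * t + 1 : ℕ) * θ) := by
  have hd : Disjoint s₀ l.toFinset := Finset.disjoint_right.2 fun q hq => hs q (by simpa using hq)
  -- This set is closed under Hadamard gates on `l`, so it serves both as `M` and as `M₀`.
  set M : Set (Finset ℕ) := {s | ∃ Y ⊆ l.toFinset, s = s₀ ∪ Y} with hM
  have hclosed : ∀ q ∈ l, ∀ s ∈ M, insert q s ∈ M ∧ s.erase q ∈ M := by
    rintro q hq s ⟨Y, hY, rfl⟩
    refine ⟨⟨insert q Y, Finset.insert_subset (by simpa using hq) hY, by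
      rw [Finset.union_insert]⟩, ⟨Y.erase q, (Finset.erase_subset _ _).trans hY, ?_⟩⟩
    rw [Finset.erase_union_distrib, Finset.erase_eq_of_notMem (hs q hq)]
  have hs₀ : s₀ ∈ M := ⟨∅, by simp, by simp⟩
  have hΨ : hadOp l (ket s₀) ∈ supported ℂ ℂ M :=
    hadOp_mem_supported hclosed _ (single_mem_supported ℂ _ hs₀)
  obtain ⟨α, β, h, hα, -⟩ := amplify (UPair.had l) (s₀ := s₀) (M := M) (M₀ := M) (G := G) (φ := φ)
    (φ₀ := φ₀) (θ := θ) hΨ (by rintro s ⟨Y, hY, rfl⟩; exact hφ Y hY) hs₀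
    (hadOp_mem_supported (fun q hq => hclosed q (by simpa using hq)) _ (filter_mem_supported hΨ G))
    (by
      rintro s ⟨Y, hY, rfl⟩
      rw [hφ₀ Y hY]
      congr 1
      rw [eq_iff_iff]
      exact ⟨fun e => by simp [e], fun e => union_injOn hd (Finset.mem_coe.2 (Finset.mem_powerset.2 hY))
        (Finset.mem_coe.2 (Finset.empty_mem_powerset _)) (by simpa using e)⟩)
    (by rw [weight_filter_had hl hs, hθ]) t
  refine ⟨α, β, ?_, hα⟩
  rw [ampOp, LinearMap.comp_apply, h, hadOp, gatesOp_h_ket hl hs, filter_sum_ket, filter_sum_ket,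
    smul_comm, smul_comm (β : ℂ), ← smul_add, Finset.smul_sum, Finset.smul_sum]
  congr 1
  rw [Finset.sum_filter, Finset.sum_filter, ← Finset.sum_add_distrib]
  refine Finset.sum_congr rfl fun Y _ => ?_
  by_cases hG : G (s₀ ∪ Y) <;> simp [hG]

end

end QMachine

/-! ### Moving qubits aside, and the unitaries of the search -/

namespace QMachine

open Finsupp ComplexConjugate

/-- The gates that move the qubits `q ∈ l` to the qubits `n + q`. -/
def moveGates (n : ℕ) (l : List ℕ) : List (Gate ℕ) :=
  l.flatMap fun q => [.cnot q (n + q), .cnot (n + q) q]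

/-- The label after moving the qubits in `S`. -/
def moved (n : ℕ) (S s : Finset ℕ) : Finset ℕ := (s \ S) ∪ (s ∩ S).image (n + ·)

theorem mem_moved {n q : ℕ} {S s : Finset ℕ} :
    q ∈ moved n S s ↔ (q ∈ s ∧ q ∉ S) ∨ ∃ r, r ∈ s ∧ r ∈ S ∧ n + r = q := by
  simp [moved, and_assoc]

theorem op_cnot_ket (c q : ℕ) (s : Finset ℕ) :
    (Gate.cnot c q).op (ket s) = ket (tof (c, c, q) s) := by rw [op_cnot, permOp_single]

/-- The first CNOT copies a bit to an empty qubit and the second one clears the original. That the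
later target qubits are still empty survives the induction because the qubits in `l` are distinct
and below `n`. -/
theorem moveGates_ket {n : ℕ} {l : List ℕ} (hl : l.Nodup) (hn : ∀ q ∈ l, q < n) {s : Finset ℕ}
    (hs : ∀ q ∈ l, n + q ∉ s) :
    gatesOp (moveGates n l) (ket s) = ket (moved n l.toFinset s) := by
  induction l generalizing s with
  | nil => simp [moveGates, gatesOp, moved]
  | cons q l ih =>
    have hq : n + q ∉ s := hs q (by simp)
    have hqn : q < n := hn q (by simp)
    have hql : q ∉ l := (List.nodup_cons.1 hl).1
    have h1 : tof (n + q, n + q, q) (tof (q, q, n + q) s) =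
        if q ∈ s then insert (n + q) (s.erase q) else s := by
      have e1 : n ≠ 0 := by omega
      by_cases h : q ∈ s
      · ext r
        by_cases hr : r = q
        · simp [tof, h, hr, flipBit, hq, e1]
        · simp [tof, h, hr, flipBit, hq, e1]
      · simp [tof, h, hq]
    have h2 : gatesOp (moveGates n (q :: l)) (ket s) =
        gatesOp (moveGates n l) (ket (tof (n + q, n + q, q) (tof (q, q, n + q) s))) := by
      rw [moveGates, List.flatMap_cons, gatesOp_append]
      simp only [gatesOp, LinearMap.comp_apply, LinearMap.id_apply, op_cnot_ket]
      rfl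
    rw [h2, h1, ih hl.of_cons fun r hr => hn r (by simp [hr])]
    · congr 1
      ext r
      simp only [mem_moved, List.mem_toFinset, List.mem_cons]
      by_cases h : q ∈ s
      · simp only [if_pos h, Finset.mem_insert, Finset.mem_erase]
        constructor
        · rintro (⟨rfl | ⟨h3, h4⟩, h5⟩ | ⟨a, (rfl | ⟨h3, h4⟩), h5, rfl⟩)
          · exact .inr ⟨q, h, by simp, rfl⟩
          · exact .inl ⟨h4, by simp [h3, h5]⟩
          · exact absurd (hn _ (List.mem_cons_of_mem _ h5)) (by omega)
          · exact .inr ⟨a, h4, .inr h5, rfl⟩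
        · rintro (⟨h3, h4⟩ | ⟨a, h3, rfl | h4, rfl⟩)
          · rw [not_or] at h4
            exact .inl ⟨.inr ⟨h4.1, h3⟩, h4.2⟩
          · exact .inl ⟨.inl rfl, fun h' => absurd (hn _ (List.mem_cons_of_mem _ h')) (by omega)⟩
          · exact .inr ⟨a, .inr ⟨fun e => hql (e ▸ h4), h3⟩, h4, rfl⟩
      · simp only [if_neg h]
        constructor
        · rintro (⟨h3, h4⟩ | ⟨a, h3, h4, rfl⟩)
          · exact .inl ⟨h3, by rintro (rfl | h'); exacts [h h3, h4 h']⟩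
          · exact .inr ⟨a, h3, .inr h4, rfl⟩
        · rintro (⟨h3, h4⟩ | ⟨a, h3, rfl | h4, rfl⟩)
          · exact .inl ⟨h3, fun h' => h4 (.inr h')⟩
          · exact absurd h3 h
          · exact .inr ⟨a, h3, h4, rfl⟩
    · intro r hr
      have hrl := hn r (List.mem_cons_of_mem _ hr)
      have hrq : r ≠ q := fun e => hql (e ▸ hr)
      split_ifs with h
      · simp only [Finset.mem_insert, Finset.mem_erase, not_or]
        exact ⟨by omega, fun h' => hs r (List.mem_cons_of_mem _ hr) h'.2⟩
      · exact hs r (List.mem_cons_of_mem _ hr)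

theorem UPair.moveGates (n : ℕ) (l : List ℕ) :
    UPair (QMachine.gatesOp (QMachine.moveGates n l))
      (QMachine.gatesOp (QMachine.moveGates n l).reverse) :=
  .gatesOp fun g hg => by
    simp only [QMachine.moveGates, List.mem_flatMap, List.mem_cons, List.not_mem_nil, or_false] at hg
    obtain ⟨q, _, rfl | rfl⟩ := hg <;> rw [op_cnot] <;> exact .tof _

theorem tof_subset {N : ℕ} {g : ℕ × ℕ × ℕ} (hg : g.2.2 < N) {s : Finset ℕ}
    (hs : s ⊆ Finset.range N) : tof g s ⊆ Finset.range N := by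
  unfold tof
  split_ifs
  · intro r hr
    rw [mem_flipBit] at hr
    split_ifs at hr with h
    · rw [h]; simpa using hg
    · exact hs hr
  · exact hs

/-- The labels that involve only the first `N` qubits. -/
abbrev labels (N : ℕ) : Set (Finset ℕ) := {s | s ⊆ Finset.range N}

theorem moveGates_mem_supported {n : ℕ} {l : List ℕ} (hn : ∀ q ∈ l, q < n) {L : List (Gate ℕ)}
    (hL : ∀ g ∈ L, g ∈ moveGates n l) :
    ∀ ψ ∈ supported ℂ ℂ (labels (2 * n)), gatesOp L ψ ∈ supported ℂ ℂ (labels (2 * n)) :=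
  gatesOp_mem_supported fun g hg => by
    have hg := hL g hg
    simp only [moveGates, List.mem_flatMap, List.mem_cons, List.not_mem_nil, or_false] at hg
    obtain ⟨q, hq, rfl | rfl⟩ := hg <;> rw [op_cnot] <;>
      exact permOp_mem_supported fun s hs => tof_subset (by have := hn q hq; dsimp; omega) hs

theorem had_labels {N : ℕ} {l : List ℕ} (hn : ∀ q ∈ l, q < N) :
    ∀ ψ ∈ supported ℂ ℂ (labels N), hadOp l ψ ∈ supported ℂ ℂ (labels N) :=
  hadOp_mem_supported fun q hq s hs =>
    ⟨Finset.insert_subset (by simpa using hn q hq) hs, (Finset.erase_subset _ _).trans hs⟩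

/-- Amplification of Hadamard gates on the qubits in `l`. -/
noncomputable def hadAmp (l : List ℕ) (φ φ₀ : Finset ℕ → ℂ) (t : ℕ) : QState →ₗ[ℂ] QState :=
  ampOp (hadOp l) (hadOp l.reverse) (diagOp φ) (diagOp φ₀) t

noncomputable def hadAmpInv (l : List ℕ) (φ φ₀ : Finset ℕ → ℂ) (t : ℕ) : QState →ₗ[ℂ] QState :=
  ampOpInv (hadOp l) (hadOp l.reverse) (diagOp φ) (diagOp φ₀) t

/-- Prepare an approximation to the superposition of the labels with phase `φL`, move the qubits in
`l` away and search over the new values of these. -/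
noncomputable def prepOp (n : ℕ) (l : List ℕ) (φL φG φ₀ φS : Finset ℕ → ℂ) (t₁ t₂ : ℕ) :
    QState →ₗ[ℂ] QState :=
  hadAmp l φG φS t₂ ∘ₗ gatesOp (moveGates n l) ∘ₗ hadAmp (List.range n) φL φ₀ t₁

noncomputable def prepOpInv (n : ℕ) (l : List ℕ) (φL φG φ₀ φS : Finset ℕ → ℂ) (t₁ t₂ : ℕ) :
    QState →ₗ[ℂ] QState :=
  (hadAmpInv (List.range n) φL φ₀ t₁ ∘ₗ gatesOp (moveGates n l).reverse) ∘ₗ hadAmpInv l φG φS t₂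

/-- The search: amplification of `prepOp`. -/
noncomputable def searchOp (n : ℕ) (l : List ℕ) (φL φG φ₀ φS : Finset ℕ → ℂ) (t₁ t₂ t₃ : ℕ) :
    QState →ₗ[ℂ] QState :=
  ampOp (prepOp n l φL φG φ₀ φS t₁ t₂) (prepOpInv n l φL φG φ₀ φS t₁ t₂) (diagOp φG) (diagOp φ₀) t₃

/-- Phases are signs. -/
def IsSign (φ : Finset ℕ → ℂ) : Prop := ∀ s, φ s = 1 ∨ φ s = -1

theorem IsSign.uPair {φ : Finset ℕ → ℂ} (h : IsSign φ) : UPair (diagOp φ) (diagOp φ) := by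
  have e : (fun s => conj (φ s)) = φ := by
    ext s; rcases h s with h | h <;> simp [h]
  have := UPair.diag (φ := φ) fun s => by rcases h s with h | h <;> simp [h]
  rwa [e] at this

section
variable {n : ℕ} {l : List ℕ} {φL φG φ₀ φS : Finset ℕ → ℂ}

theorem UPair.prepOp (hL : IsSign φL) (hG : IsSign φG) (h₀ : IsSign φ₀) (hS : IsSign φS) (t₁ t₂ : ℕ) :
    UPair (QMachine.prepOp n l φL φG φ₀ φS t₁ t₂) (prepOpInv n l φL φG φ₀ φS t₁ t₂) :=
  (UPair.ampOp (.had l) hG.uPair hS.uPair t₂).comp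
    ((UPair.moveGates n l).comp (.ampOp (.had _) hL.uPair h₀.uPair t₁))

theorem hadAmp_labels {N : ℕ} {l : List ℕ} (hn : ∀ q ∈ l, q < N) (φ φ₀ : Finset ℕ → ℂ) (t : ℕ) :
    ∀ ψ ∈ supported ℂ ℂ (labels N), hadAmp l φ φ₀ t ψ ∈ supported ℂ ℂ (labels N) :=
  ampOp_mem_supported (had_labels hn) (had_labels (by simpa using hn)) t

theorem hadAmpInv_labels {N : ℕ} {l : List ℕ} (hn : ∀ q ∈ l, q < N) (φ φ₀ : Finset ℕ → ℂ) (t : ℕ) :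
    ∀ ψ ∈ supported ℂ ℂ (labels N), hadAmpInv l φ φ₀ t ψ ∈ supported ℂ ℂ (labels N) :=
  ampOpInv_mem_supported (had_labels hn) (had_labels (by simpa using hn)) t

theorem prepOp_labels (hn : ∀ q ∈ l, q < n) (t₁ t₂ : ℕ) : ∀ ψ ∈ supported ℂ ℂ (labels (2 * n)),
    prepOp n l φL φG φ₀ φS t₁ t₂ ψ ∈ supported ℂ ℂ (labels (2 * n)) := fun ψ hψ =>
  hadAmp_labels (fun q hq => by have := hn q hq; omega) _ _ _ _ (moveGates_mem_supported hn
    (fun _ => id) _ (hadAmp_labels (fun q hq => by rw [List.mem_range] at hq; omega) _ _ _ _ hψ))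

theorem prepOpInv_labels (hn : ∀ q ∈ l, q < n) (t₁ t₂ : ℕ) : ∀ ψ ∈ supported ℂ ℂ (labels (2 * n)),
    prepOpInv n l φL φG φ₀ φS t₁ t₂ ψ ∈ supported ℂ ℂ (labels (2 * n)) := fun ψ hψ =>
  hadAmpInv_labels (fun q hq => by rw [List.mem_range] at hq; omega) _ _ _ _
    (moveGates_mem_supported hn (fun g hg => by simpa using hg) _
      (hadAmpInv_labels (fun q hq => by have := hn q hq; omega) _ _ _ _ hψ))

theorem searchOp_labels (hn : ∀ q ∈ l, q < n) (t₁ t₂ t₃ : ℕ) :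
    searchOp n l φL φG φ₀ φS t₁ t₂ t₃ (ket ∅) ∈ supported ℂ ℂ (labels (2 * n)) :=
  ampOp_mem_supported (prepOp_labels hn t₁ t₂) (prepOpInv_labels hn t₁ t₂) t₃ _
    (single_mem_supported ℂ _ (by simp))

theorem ket_empty_mem (N : ℕ) : ket ∅ ∈ supported ℂ ℂ (labels N) :=
  single_mem_supported ℂ _ (by simp)

end

end QMachine

/-! ### Amplitudes and success probability of the three stages -/

namespace QMachine

open Finsupp ComplexConjugate

/-- The first `n` qubits again hold an assignment: the old one off the window and the new value on
it. The displaced bits sit at `n` and beyond. -/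
theorem moved_union_inter {n : ℕ} {S x Y : Finset ℕ} (hY : Y ⊆ S) (hS : S ⊆ Finset.range n)
    (hx : x ⊆ Finset.range n) : (moved n S x ∪ Y) ∩ Finset.range n = (x \ S) ∪ Y := by
  ext q
  simp only [Finset.mem_inter, Finset.mem_union, mem_moved, Finset.mem_range, Finset.mem_sdiff]
  constructor
  · rintro ⟨(h | ⟨r, _, _, rfl⟩) | h, h'⟩
    · exact .inl h
    · omega
    · exact .inr h
  · rintro (h | h)
    · exact ⟨.inl (.inl h), by simpa using hx h.1⟩
    · exact ⟨.inr h, by simpa using hS (hY h)⟩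

/-- A label remembers both the displaced old bits and the new ones. Distinct pairs therefore do not
interfere, and amplitudes can be read off one by one. -/
theorem moved_union_injOn {n : ℕ} {S : Finset ℕ} (hS : S ⊆ Finset.range n) :
    Set.InjOn (fun z : Finset ℕ × Finset ℕ => moved n S z.1 ∪ z.2)
      ((Finset.range n).powerset ×ˢ S.powerset : Finset (Finset ℕ × Finset ℕ)) := by
  rintro ⟨x, Y⟩ h ⟨x', Y'⟩ h' e
  simp only [Finset.coe_product, Finset.coe_powerset, Set.mem_prod, Set.mem_preimage,
    Set.mem_powerset_iff, Finset.coe_subset] at h h'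
  have e' : ∀ q, q ∈ moved n S x ∪ Y ↔ q ∈ moved n S x' ∪ Y' := fun q => by
    simp only at e; rw [e]
  simp only [Finset.mem_union, mem_moved] at e'
  have hlt : ∀ {q}, q ∈ x → q < n := fun hq => by simpa using h.1 hq
  have hlt' : ∀ {q}, q ∈ x' → q < n := fun hq => by simpa using h'.1 hq
  have hltS : ∀ {q}, q ∈ S → q < n := fun hq => by simpa using hS hq
  have hxx : x = x' := by
    ext q
    by_cases hq : q ∈ S
    · have := e' (n + q)
      have a1 : n + q ∉ x := fun h => by have := hlt h; omega
      have a2 : n + q ∉ x' := fun h => by have := hlt' h; omega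
      have a3 : n + q ∉ Y := fun hh => by have := hltS (h.2 hh); omega
      have a4 : n + q ∉ Y' := fun hh => by have := hltS (h'.2 hh); omega
      simpa [a1, a2, a3, a4, hq] using this
    · have := e' q
      have a3 : q ∉ Y := fun hh => hq (h.2 hh)
      have a4 : q ∉ Y' := fun hh => hq (h'.2 hh)
      constructor
      · intro hqx
        rcases this.1 (.inl (.inl ⟨hqx, hq⟩)) with (h1 | ⟨r, _, _, rfl⟩) | h1
        · exact h1.1
        · have := hlt hqx; omega
        · exact absurd h1 a4
      · intro hqx
        rcases this.2 (.inl (.inl ⟨hqx, hq⟩)) with (h1 | ⟨r, _, _, rfl⟩) | h1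
        · exact h1.1
        · have := hlt' hqx; omega
        · exact absurd h1 a3
  subst hxx
  have hYY : ∀ {Y Y' : Finset ℕ}, Y ⊆ S → moved n S x ∪ Y = moved n S x ∪ Y' → Y ⊆ Y' := by
    intro Y Y' hY e q hq
    have hqS := hY hq
    have : q ∈ moved n S x ∪ Y' := e ▸ Finset.mem_union_right _ hq
    rcases Finset.mem_union.1 this with h1 | h1
    · rcases mem_moved.1 h1 with h2 | ⟨r, _, _, rfl⟩
      · exact absurd hqS h2.2
      · have := hltS hqS; omega
    · exact h1
  rw [Finset.Subset.antisymm (hYY h.2 e) (hYY h'.2 e.symm)]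

section
variable {n : ℕ} {l : List ℕ} {φL φG φ₀ φS : Finset ℕ → ℂ} {PL PG : Finset ℕ → Prop}
  [DecidablePred PL] [DecidablePred PG]

theorem hadAmp_range (hφL : ∀ s ⊆ Finset.range (2 * n), φL s = if PL (s ∩ Finset.range n) then -1 else 1)
    (hφ₀ : ∀ s ⊆ Finset.range (2 * n), φ₀ s = if s = ∅ then -1 else 1)
    {θ : ℝ} (hθ : Real.sin θ ^ 2 = ({x ∈ (Finset.range n).powerset | PL x}.card : ℝ) / 2 ^ n) (t : ℕ) :
    ∃ α β : ℝ, hadAmp (List.range n) φL φ₀ t (ket ∅) =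
        (1 / (Real.sqrt 2 : ℂ)) ^ n •
          ∑ x ∈ (Finset.range n).powerset, single x ((if PL x then α else β : ℝ) : ℂ) ∧
      Real.sin θ * α = (-1) ^ t * Real.sin ((2 * t + 1 : ℕ) * θ) := by
  have hsub : ∀ {Y}, Y ⊆ Finset.range n → Y ⊆ Finset.range (2 * n) := fun h =>
    h.trans (by simp; omega)
  have hcard : {x ∈ (Finset.range n).powerset | PL x} =
      {Y ∈ (List.range n).toFinset.powerset | PL ((∅ ∪ Y) ∩ Finset.range n)} := by
    rw [List.toFinset_range]
    ext Y
    simp only [Finset.mem_filter, Finset.mem_powerset, Finset.empty_union]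
    exact and_congr_right fun h => by rw [Finset.inter_eq_left.2 h]
  obtain ⟨α, β, h, hα⟩ := ampOp_had (l := List.range n) (s₀ := ∅) (φ := φL) (φ₀ := φ₀) (θ := θ)
    (G := fun s => PL (s ∩ Finset.range n)) List.nodup_range (by simp)
    (fun Y hY => hφL _ (by rw [List.toFinset_range] at hY; simpa using hsub hY))
    (fun Y hY => by
      rw [hφ₀ _ (by rw [List.toFinset_range] at hY; simpa using hsub hY), Finset.empty_union])
    (by rw [List.length_range, ← hcard, hθ]) t
  refine ⟨α, β, ?_, hα⟩
  rw [hadAmp, h, List.length_range, List.toFinset_range]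
  congr 1
  refine Finset.sum_congr rfl fun Y hY => ?_
  rw [Finset.empty_union, Finset.inter_eq_left.2 (Finset.mem_powerset.1 hY)]

/-- With the window emptied, the second stage starts from zeros there, so it amplifies a uniform
superposition of window values for each fixed old label. The sign `φS` looks at the window only and
is therefore the right reflection for all old labels at once. -/
theorem hadAmp_moved (hl : l.Nodup) (hn : ∀ q ∈ l, q < n)
    (hφG : ∀ s ⊆ Finset.range (2 * n), φG s = if PG (s ∩ Finset.range n) then -1 else 1)
    (hφS : ∀ s ⊆ Finset.range (2 * n), φS s = if Disjoint s l.toFinset then -1 else 1)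
    {x : Finset ℕ} (hx : x ⊆ Finset.range n) {θ : ℝ}
    (hθ : Real.sin θ ^ 2 =
      ({Y ∈ l.toFinset.powerset | PG ((x \ l.toFinset) ∪ Y)}.card : ℝ) / 2 ^ l.length) (t : ℕ) :
    ∃ α β : ℝ, hadAmp l φG φS t (ket (moved n l.toFinset x)) =
        (1 / (Real.sqrt 2 : ℂ)) ^ l.length • ∑ Y ∈ l.toFinset.powerset,
          single (moved n l.toFinset x ∪ Y)
            ((if PG ((x \ l.toFinset) ∪ Y) then α else β : ℝ) : ℂ) ∧
      Real.sin θ * α = (-1) ^ t * Real.sin ((2 * t + 1 : ℕ) * θ) := by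
  have hS : l.toFinset ⊆ Finset.range n := fun q hq => by simpa using hn q (by simpa using hq)
  have hlt : ∀ {q}, q ∈ x → q < n := fun hq => by simpa using hx hq
  have hdis : ∀ q ∈ l, q ∉ moved n l.toFinset x := by
    intro q hq h
    rcases mem_moved.1 h with h | ⟨r, _, _, rfl⟩
    · exact h.2 (by simpa using hq)
    · have := hn _ hq; omega
  have hsub : ∀ {Y}, Y ⊆ l.toFinset → moved n l.toFinset x ∪ Y ⊆ Finset.range (2 * n) := by
    intro Y hY q hq
    rw [Finset.mem_range]
    rcases Finset.mem_union.1 hq with h | h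
    · rcases mem_moved.1 h with h | ⟨r, hr, _, rfl⟩
      · have := hlt h.1; omega
      · have := hlt hr; omega
    · have := Finset.mem_range.1 (hS (hY h)); omega
  have hcard : {Y ∈ l.toFinset.powerset | PG ((x \ l.toFinset) ∪ Y)} =
      {Y ∈ l.toFinset.powerset | PG ((moved n l.toFinset x ∪ Y) ∩ Finset.range n)} := by
    ext Y
    simp only [Finset.mem_filter, Finset.mem_powerset]
    exact and_congr_right fun h => by rw [moved_union_inter h hS hx]
  obtain ⟨α, β, h, hα⟩ := ampOp_had (l := l) (s₀ := moved n l.toFinset x) (φ := φG) (φ₀ := φS)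
    (θ := θ) (G := fun s => PG (s ∩ Finset.range n)) hl hdis
    (fun Y hY => hφG _ (hsub hY))
    (fun Y hY => by
      rw [hφS _ (hsub hY)]
      congr 1
      rw [eq_iff_iff, Finset.disjoint_union_left]
      constructor
      · intro h
        exact (Finset.disjoint_self_iff_empty Y).1 (h.2.mono_right hY)
      · rintro rfl
        exact ⟨Finset.disjoint_right.2 fun q hq => hdis q (by simpa using hq), by simp⟩)
    (by rw [hθ, hcard]) t
  refine ⟨α, β, ?_, hα⟩
  rw [hadAmp, h]
  congr 1
  refine Finset.sum_congr rfl fun Y hY => ?_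
  rw [moved_union_inter (Finset.mem_powerset.1 hY) hS hx]

/-- By linearity the second amplification acts on every old label `x` separately, with an angle of
its own but with a common number of rounds. -/
theorem prepOp_ket (hl : l.Nodup) (hn : ∀ q ∈ l, q < n)
    (hφL : ∀ s ⊆ Finset.range (2 * n), φL s = if PL (s ∩ Finset.range n) then -1 else 1)
    (hφG : ∀ s ⊆ Finset.range (2 * n), φG s = if PG (s ∩ Finset.range n) then -1 else 1)
    (hφ₀ : ∀ s ⊆ Finset.range (2 * n), φ₀ s = if s = ∅ then -1 else 1)
    (hφS : ∀ s ⊆ Finset.range (2 * n), φS s = if Disjoint s l.toFinset then -1 else 1)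
    {θ₁ : ℝ} (hθ₁ : Real.sin θ₁ ^ 2 = ({x ∈ (Finset.range n).powerset | PL x}.card : ℝ) / 2 ^ n)
    {θ : Finset ℕ → ℝ} (hθ : ∀ x, Real.sin (θ x) ^ 2 =
      ({Y ∈ l.toFinset.powerset | PG ((x \ l.toFinset) ∪ Y)}.card : ℝ) / 2 ^ l.length) (t₁ t₂ : ℕ) :
    ∃ (α β : ℝ) (a b : Finset ℕ → ℝ), prepOp n l φL φG φ₀ φS t₁ t₂ (ket ∅) =
        ∑ z ∈ (Finset.range n).powerset ×ˢ l.toFinset.powerset,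
          single (moved n l.toFinset z.1 ∪ z.2)
            (((1 / (Real.sqrt 2 : ℂ)) ^ n * (1 / (Real.sqrt 2 : ℂ)) ^ l.length) *
              (((if PL z.1 then α else β) *
                (if PG ((z.1 \ l.toFinset) ∪ z.2) then a z.1 else b z.1) : ℝ) : ℂ)) ∧
      Real.sin θ₁ * α = (-1) ^ t₁ * Real.sin ((2 * t₁ + 1 : ℕ) * θ₁) ∧
      ∀ x ⊆ Finset.range n, Real.sin (θ x) * a x = (-1) ^ t₂ * Real.sin ((2 * t₂ + 1 : ℕ) * θ x) := by
  obtain ⟨α, β, h₁, hα⟩ := hadAmp_range hφL hφ₀ hθ₁ t₁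
  have h₂ := fun (x : Finset ℕ) (hx : x ⊆ Finset.range n) =>
    hadAmp_moved hl hn hφG hφS hx (hθ x) t₂
  choose! a b h₂ ha using h₂
  refine ⟨α, β, a, b, ?_, hα, ha⟩
  rw [prepOp, LinearMap.comp_apply, LinearMap.comp_apply, h₁, map_smul, map_smul, map_sum, map_sum,
    Finset.sum_product, Finset.smul_sum]
  refine Finset.sum_congr rfl fun x hx => ?_
  rw [Finset.mem_powerset] at hx
  have e : ∀ c : ℂ, single x c = c • ket x := by simp
  rw [e, map_smul, map_smul, moveGates_ket hl hn fun q _ h => ?_, h₂ x hx, Finset.smul_sum,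
    Finset.smul_sum, Finset.smul_sum]
  · refine Finset.sum_congr rfl fun Y _ => ?_
    rw [smul_single, smul_single, smul_single]
    congr 1
    simp only [smul_eq_mul]
    push_cast
    ring
  · have := Finset.mem_range.1 (hx h); omega

/-- Only pairs of an old label in `PL` that agrees with `x₀` off the window and a new window value
that is good are counted. There are `|A| |B|` of them, and their squared amplitudes are at least `1
/ (4 |Λ|)` times `1 / (4 |B|)`. So `|B|` cancels. -/
theorem weight_filter_prepOp (hl : l.Nodup) (hn : ∀ q ∈ l, q < n)
    (hφL : ∀ s ⊆ Finset.range (2 * n), φL s = if PL (s ∩ Finset.range n) then -1 else 1)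
    (hφG : ∀ s ⊆ Finset.range (2 * n), φG s = if PG (s ∩ Finset.range n) then -1 else 1)
    (hφ₀ : ∀ s ⊆ Finset.range (2 * n), φ₀ s = if s = ∅ then -1 else 1)
    (hφS : ∀ s ⊆ Finset.range (2 * n), φS s = if Disjoint s l.toFinset then -1 else 1)
    {x₀ : Finset ℕ} (hx₀ : x₀ ⊆ Finset.range n) (hG : PG x₀) {θ₁ θ₂ : ℝ}
    (hθ₁ : Real.sin θ₁ ^ 2 = ({x ∈ (Finset.range n).powerset | PL x}.card : ℝ) / 2 ^ n)
    (hθ₂ : Real.sin θ₂ ^ 2 =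
      ({Y ∈ l.toFinset.powerset | PG ((x₀ \ l.toFinset) ∪ Y)}.card : ℝ) / 2 ^ l.length) {t₁ t₂ : ℕ}
    (ht₁ : 1 / 4 ≤ Real.sin ((2 * t₁ + 1 : ℕ) * θ₁) ^ 2)
    (ht₂ : 1 / 4 ≤ Real.sin ((2 * t₂ + 1 : ℕ) * θ₂) ^ 2) :
    ({Y ∈ l.toFinset.powerset | PL ((x₀ \ l.toFinset) ∪ Y)}.card : ℝ) /
        (16 * ({x ∈ (Finset.range n).powerset | PL x}.card : ℝ)) ≤
      weight ((prepOp n l φL φG φ₀ φS t₁ t₂ (ket ∅)).filter fun s => PG (s ∩ Finset.range n)) := by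
  set S := l.toFinset with hSdef
  have hS : S ⊆ Finset.range n := fun q hq => by simpa using hn q (by simpa [S] using hq)
  -- Labels that agree with `x₀` off the window have the same good window values, so they all share
  -- the angle `θ₂` for which `t₂` is chosen. Elsewhere any angle with the right sine will do.
  have hθ : ∀ x : Finset ℕ, ∃ θ : ℝ, Real.sin θ ^ 2 =
      ({Y ∈ S.powerset | PG ((x \ S) ∪ Y)}.card : ℝ) / 2 ^ l.length ∧ (x \ S = x₀ \ S → θ = θ₂) := by
    intro x
    by_cases hx : x \ S = x₀ \ S
    · exact ⟨θ₂, by rw [hx, hθ₂], fun _ => rfl⟩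
    · set p := ({Y ∈ S.powerset | PG ((x \ S) ∪ Y)}.card : ℝ) / 2 ^ l.length
      have hp0 : 0 ≤ p := by positivity
      have hp1 : p ≤ 1 := by
        refine div_le_one_of_le₀ ?_ (by positivity)
        have : S.powerset.card = 2 ^ l.length := by
          rw [Finset.card_powerset, hSdef, List.toFinset_card_of_nodup hl]
        exact_mod_cast this ▸ Finset.card_filter_le _ _
      refine ⟨Real.arcsin (Real.sqrt p), ?_, fun h => absurd h hx⟩
      rw [Real.sin_arcsin (by linarith [Real.sqrt_nonneg p]) (Real.sqrt_le_one.2 hp1), Real.sq_sqrt hp0]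
  choose θ hθ hθ' using hθ
  obtain ⟨α, β, a, b, hΨ, hα, ha⟩ := prepOp_ket hl hn hφL hφG hφ₀ hφS hθ₁ hθ t₁ t₂
  rw [← hSdef] at hΨ
  set Ψ := prepOp n l φL φG φ₀ φS t₁ t₂ (ket ∅)
  set A := {Y ∈ S.powerset | PL ((x₀ \ S) ∪ Y)}
  set B := {Y ∈ S.powerset | PG ((x₀ \ S) ∪ Y)}
  set Λ := {x ∈ (Finset.range n).powerset | PL x}
  have hmemA : ∀ {Y}, Y ∈ A → Y ⊆ S ∧ PL ((x₀ \ S) ∪ Y) := fun h => by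
    simpa [A] using h
  have hmemB : ∀ {Y}, Y ∈ B → Y ⊆ S ∧ PG ((x₀ \ S) ∪ Y) := fun h => by
    simpa [B] using h
  have hx : ∀ {X}, X ⊆ S → (x₀ \ S) ∪ X ⊆ Finset.range n := fun h =>
    Finset.union_subset (Finset.sdiff_subset.trans hx₀) (h.trans hS)
  have hxS : ∀ {X}, X ⊆ S → ((x₀ \ S) ∪ X) \ S = x₀ \ S := fun h => by
    rw [Finset.union_sdiff_distrib, Finset.sdiff_eq_empty_iff_subset.2 h, Finset.union_empty,
      Finset.sdiff_idem]
  have hinj := moved_union_injOn hS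
  have hval : ∀ z ∈ A ×ˢ B,
      ‖(Ψ.filter fun s => PG (s ∩ Finset.range n)) (moved n S ((x₀ \ S) ∪ z.1) ∪ z.2)‖ ^ 2 =
        (1 / 2 ^ n * α ^ 2) * (1 / 2 ^ l.length * (a ((x₀ \ S) ∪ z.1)) ^ 2) := by
    rintro ⟨X, Y⟩ hz
    obtain ⟨hXA, hYB⟩ := Finset.mem_product.1 hz
    obtain ⟨hXS, hX⟩ := hmemA hXA
    obtain ⟨hYS, hY⟩ := hmemB hYB
    have hmem : ((x₀ \ S) ∪ X, Y) ∈ (Finset.range n).powerset ×ˢ S.powerset :=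
      Finset.mem_product.2 ⟨Finset.mem_powerset.2 (hx hXS), Finset.mem_powerset.2 hYS⟩
    rw [Finsupp.filter_apply_pos, hΨ, Finsupp.finsetSum_apply, Finset.sum_eq_single_of_mem _ hmem]
    · simp only [single_eq_same, if_pos hX, hxS hXS, if_pos hY]
      rw [norm_mul, norm_mul, mul_pow, mul_pow, norm_inv_sqrt_two_pow, norm_inv_sqrt_two_pow,
        Complex.norm_real, Real.norm_eq_abs, sq_abs]
      ring
    · intro z hz hne
      exact Finsupp.single_eq_of_ne fun e => hne (hinj (Finset.mem_coe.2 hz) (Finset.mem_coe.2 hmem) e.symm)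
    · simp only
      rw [moved_union_inter hYS hS (hx hXS), hxS hXS]
      exact hY
  have hle := sum_norm_sq_le_weight (Ψ.filter fun s => PG (s ∩ Finset.range n)) (A ×ˢ B)
    (fun z => moved n S ((x₀ \ S) ∪ z.1) ∪ z.2) (by
      rintro ⟨X, Y⟩ hz ⟨X', Y'⟩ hz' e
      obtain ⟨hXA, hYB⟩ := Finset.mem_product.1 (Finset.mem_coe.1 hz)
      obtain ⟨hXA', hYB'⟩ := Finset.mem_product.1 (Finset.mem_coe.1 hz')
      have := @hinj ((x₀ \ S) ∪ X, Y) (Finset.mem_coe.2 (Finset.mem_product.2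
        ⟨Finset.mem_powerset.2 (hx (hmemA hXA).1), Finset.mem_powerset.2 (hmemB hYB).1⟩))
        ((x₀ \ S) ∪ X', Y') (Finset.mem_coe.2 (Finset.mem_product.2
        ⟨Finset.mem_powerset.2 (hx (hmemA hXA').1), Finset.mem_powerset.2 (hmemB hYB').1⟩)) e
      rw [Prod.mk.injEq] at this
      have h1 := union_injOn (S := S) (s₀ := x₀ \ S) Finset.sdiff_disjoint
        (Finset.mem_coe.2 (Finset.mem_powerset.2 (hmemA hXA).1))
        (Finset.mem_coe.2 (Finset.mem_powerset.2 (hmemA hXA').1)) this.1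
      rw [Prod.mk.injEq]
      exact ⟨h1, this.2⟩)
  rw [Finset.sum_congr rfl hval] at hle
  have hBne : 0 < (B.card : ℝ) := by
    rw [Nat.cast_pos, Finset.card_pos]
    exact ⟨x₀ ∩ S, by simp only [B, Finset.mem_filter, Finset.mem_powerset]; exact
      ⟨Finset.inter_subset_right, by rwa [Finset.sdiff_union_inter]⟩⟩
  by_cases hA0 : A.card = 0
  · rw [hA0]; simp [weight_nonneg]
  have hΛ : 0 < (Λ.card : ℝ) := by
    obtain ⟨X, hX⟩ := Finset.card_pos.1 (Nat.pos_of_ne_zero hA0)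
    rw [Nat.cast_pos, Finset.card_pos]
    exact ⟨_, by simp only [Λ, Finset.mem_filter, Finset.mem_powerset]; exact
      ⟨hx (hmemA hX).1, (hmemA hX).2⟩⟩
  -- The labels in `Λ` carry total weight `sin² ((2 t₁ + 1) θ₁) ≥ 1/4`, spread evenly.
  have h1 : 1 / (4 * Λ.card : ℝ) ≤ 1 / 2 ^ n * α ^ 2 := by
    have : (Λ.card : ℝ) / 2 ^ n * α ^ 2 = Real.sin ((2 * t₁ + 1 : ℕ) * θ₁) ^ 2 := by
      rw [← hθ₁, ← mul_pow, hα, mul_pow, ← pow_mul, mul_comm t₁, pow_mul, neg_one_sq, one_pow, one_mul]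
    rw [← this] at ht₁
    rw [div_le_iff₀ (by positivity)]
    calc (1 : ℝ) ≤ 4 * ((Λ.card : ℝ) / 2 ^ n * α ^ 2) := by linarith
      _ = _ := by ring
  have h2 : ∀ X ∈ A, 1 / (4 * B.card : ℝ) ≤ 1 / 2 ^ l.length * a ((x₀ \ S) ∪ X) ^ 2 := by
    intro X hX
    have hX' := hmemA hX
    have hax := ha _ (hx hX'.1)
    have hθx := hθ ((x₀ \ S) ∪ X)
    rw [hθ' _ (hxS hX'.1)] at hax hθx
    rw [hxS hX'.1] at hθx
    have : (B.card : ℝ) / 2 ^ l.length * a ((x₀ \ S) ∪ X) ^ 2 =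
        Real.sin ((2 * t₂ + 1 : ℕ) * θ₂) ^ 2 := by
      rw [← hθx, ← mul_pow, hax, mul_pow, ← pow_mul, mul_comm t₂, pow_mul, neg_one_sq, one_pow, one_mul]
    rw [← this] at ht₂
    rw [div_le_iff₀ (by positivity)]
    calc (1 : ℝ) ≤ 4 * ((B.card : ℝ) / 2 ^ l.length * a ((x₀ \ S) ∪ X) ^ 2) := by linarith
      _ = _ := by ring
  refine le_trans ?_ hle
  calc (A.card : ℝ) / (16 * Λ.card) = ∑ z ∈ A ×ˢ B, 1 / (4 * Λ.card : ℝ) * (1 / (4 * B.card : ℝ)) := by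
        rw [Finset.sum_const, Finset.card_product, nsmul_eq_mul]
        push_cast
        field_simp
        norm_num
    _ ≤ _ := by
        refine Finset.sum_le_sum fun z hz => ?_
        exact mul_le_mul h1 (h2 _ (Finset.mem_product.1 hz).1) (by positivity) (by positivity)

/-- If at least half of the values of the qubits in `l` turn the solution `x₀` into a point of `PL`,
suitable powers of three as iteration numbers make the search succeed with constant probability. -/
theorem exists_search (hl : l.Nodup) (hn : ∀ q ∈ l, q < n)
    (hL : IsSign φL) (hG : IsSign φG) (h₀ : IsSign φ₀) (hS : IsSign φS)
    (hφL : ∀ s ⊆ Finset.range (2 * n), φL s = if PL (s ∩ Finset.range n) then -1 else 1)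
    (hφG : ∀ s ⊆ Finset.range (2 * n), φG s = if PG (s ∩ Finset.range n) then -1 else 1)
    (hφ₀ : ∀ s ⊆ Finset.range (2 * n), φ₀ s = if s = ∅ then -1 else 1)
    (hφS : ∀ s ⊆ Finset.range (2 * n), φS s = if Disjoint s l.toFinset then -1 else 1)
    {x₀ : Finset ℕ} (hx₀ : x₀ ⊆ Finset.range n) (hGx : PG x₀)
    (hhalf : 2 ^ l.length ≤ 2 * {Y ∈ l.toFinset.powerset | PL ((x₀ \ l.toFinset) ∪ Y)}.card) :
    ∃ i₁ i₂ i₃ : ℕ,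
      ((3 ^ i₁ : ℕ) : ℝ) ^ 2 * ({x ∈ (Finset.range n).powerset | PL x}.card : ℝ) ≤ 5 / 2 * 2 ^ n ∧
      ((3 ^ i₂ : ℕ) : ℝ) ^ 2 ≤ 5 / 2 * 2 ^ l.length ∧
      ((3 ^ i₃ : ℕ) : ℝ) ^ 2 * 2 ^ l.length ≤ 80 * ({x ∈ (Finset.range n).powerset | PL x}.card : ℝ) ∧
      1 / 4 ≤ weight ((searchOp n l φL φG φ₀ φS ((3 ^ i₁ - 1) / 2) ((3 ^ i₂ - 1) / 2)
        ((3 ^ i₃ - 1) / 2) (ket ∅)).filter fun s => PG (s ∩ Finset.range n)) := by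
  have hhalf' : (2 : ℝ) ^ l.length ≤
      2 * ({Y ∈ l.toFinset.powerset | PL ((x₀ \ l.toFinset) ∪ Y)}.card : ℝ) := by
    exact_mod_cast hhalf
  have hSn : l.toFinset ⊆ Finset.range n := fun q hq => by simpa using hn q (by simpa using hq)
  have hA0 : 0 < ({Y ∈ l.toFinset.powerset | PL ((x₀ \ l.toFinset) ∪ Y)}.card : ℝ) := by
    have : (0 : ℝ) < 2 ^ l.length := by positivity
    linarith
  have hB0 : 1 ≤ ({Y ∈ l.toFinset.powerset | PG ((x₀ \ l.toFinset) ∪ Y)}.card : ℝ) := by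
    rw [Nat.one_le_cast, Nat.succ_le_iff, Finset.card_pos]
    exact ⟨x₀ ∩ l.toFinset, by
      simp only [Finset.mem_filter, Finset.mem_powerset]
      exact ⟨Finset.inter_subset_right, by rwa [Finset.sdiff_union_inter]⟩⟩
  have hB1 : ({Y ∈ l.toFinset.powerset | PG ((x₀ \ l.toFinset) ∪ Y)}.card : ℝ) ≤ 2 ^ l.length := by
    have : l.toFinset.powerset.card = 2 ^ l.length := by
      rw [Finset.card_powerset, List.toFinset_card_of_nodup hl]
    exact_mod_cast this ▸ Finset.card_filter_le _ _
  have hΛ0 : 0 < ({x ∈ (Finset.range n).powerset | PL x}.card : ℝ) := by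
    obtain ⟨Y, hY⟩ := Finset.card_pos.1 (Nat.cast_pos.1 hA0)
    rw [Nat.cast_pos, Finset.card_pos]
    simp only [Finset.mem_filter, Finset.mem_powerset] at hY
    exact ⟨_, by
      simp only [Finset.mem_filter, Finset.mem_powerset]
      exact ⟨Finset.union_subset (Finset.sdiff_subset.trans hx₀) (hY.1.trans hSn), hY.2⟩⟩
  have hΛ1 : ({x ∈ (Finset.range n).powerset | PL x}.card : ℝ) ≤ 2 ^ n := by
    have : (Finset.range n).powerset.card = 2 ^ n := by
      rw [Finset.card_powerset, Finset.card_range]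
    exact_mod_cast this ▸ Finset.card_filter_le _ _
  obtain ⟨θ₁, i₁, hθ₁, hi₁, ht₁⟩ := exists_amplification (div_pos hΛ0 (pow_pos two_pos n))
    (div_le_one_of_le₀ hΛ1 (by positivity))
  obtain ⟨θ₂, i₂, hθ₂, hi₂, ht₂⟩ := exists_amplification
    (div_pos (zero_lt_one.trans_le hB0) (pow_pos two_pos l.length))
    (div_le_one_of_le₀ hB1 (by positivity))
  have hw := weight_filter_prepOp hl hn hφL hφG hφ₀ hφS hx₀ hGx hθ₁ hθ₂ ht₁ ht₂
  set W := prepOp n l φL φG φ₀ φS ((3 ^ i₁ - 1) / 2) ((3 ^ i₂ - 1) / 2) with hWdef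
  have hU := UPair.prepOp (n := n) (l := l) hL hG h₀ hS ((3 ^ i₁ - 1) / 2) ((3 ^ i₂ - 1) / 2)
  have hWlab : W (ket ∅) ∈ supported ℂ ℂ (labels (2 * n)) :=
    prepOp_labels hn _ _ _ (ket_empty_mem _)
  have hw1 : weight ((W (ket ∅)).filter fun s => PG (s ∩ Finset.range n)) ≤ 1 := by
    have h1 : weight (W (ket ∅)) = 1 := by rw [hU.weight]; simp
    rw [← h1, weight_eq_sum (F := (W (ket ∅)).support) (by
      rw [Finsupp.support_filter]; exact Finset.filter_subset _ _), weight, Finsupp.sum]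
    refine Finset.sum_le_sum fun s _ => ?_
    rw [Finsupp.filter_apply]
    split_ifs
    · exact le_rfl
    · rw [norm_zero, zero_pow two_ne_zero]; positivity
  -- The outer stage treats the whole preparation as one unitary. Its angle is that of the true
  -- success weight, of which only the lower bound `hw` is known.
  obtain ⟨θ₃, i₃, hθ₃, hi₃, ht₃⟩ := exists_amplification (lt_of_lt_of_le (div_pos hA0 (mul_pos (by norm_num) hΛ0)) hw) hw1
  refine ⟨i₁, i₂, i₃, ?_, ?_, ?_, ?_⟩
  · rw [← mul_div_assoc, div_le_iff₀ (by positivity)] at hi₁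
    exact_mod_cast hi₁
  -- The number of good window values is unknown, but it is at least one because of `x₀`.
  · rw [← mul_div_assoc, div_le_iff₀ (by positivity)] at hi₂
    push_cast
    nlinarith [sq_nonneg ((3 : ℝ) ^ i₂)]
  -- Half of the subcube being in `PL` makes the success weight at least `2 ^ l.length / (32 |Λ|)`,
  -- where `Λ` is the set of labels in `PL`; and 80 = 32 · 5/2.
  · have h3 := (mul_le_mul_of_nonneg_left hw (sq_nonneg ((3 : ℝ) ^ i₃))).trans hi₃
    rw [← mul_div_assoc, div_le_iff₀ (mul_pos (by norm_num) hΛ0)] at h3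
    push_cast
    nlinarith [sq_nonneg ((3 : ℝ) ^ i₃)]
  · obtain ⟨α, β, h, hα, -⟩ := amplify hU (s₀ := ∅) (M := labels (2 * n)) (M₀ := labels (2 * n))
      (G := fun s => PG (s ∩ Finset.range n)) (φ := φG) (φ₀ := φ₀) (θ := θ₃) hWlab
      (fun s hs => hφG s hs) (by simp) (prepOpInv_labels hn _ _ _ (filter_mem_supported hWlab _))
      (fun s hs => hφ₀ s hs) hθ₃ ((3 ^ i₃ - 1) / 2)
    have hf : (searchOp n l φL φG φ₀ φS ((3 ^ i₁ - 1) / 2) ((3 ^ i₂ - 1) / 2) ((3 ^ i₃ - 1) / 2)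
        (ket ∅)).filter (fun s => PG (s ∩ Finset.range n)) =
        (α : ℂ) • (W (ket ∅)).filter fun s => PG (s ∩ Finset.range n) := by
      rw [searchOp, ampOp, LinearMap.comp_apply, h]
      ext s
      simp only [Finsupp.filter_apply, Finsupp.add_apply, Finsupp.smul_apply]
      split_ifs <;> simp [hWdef]
    rw [hf, weight_smul, Complex.norm_real, Real.norm_eq_abs, sq_abs, ← hθ₃, mul_comm, ← mul_pow, hα,
      mul_pow, ← pow_mul, mul_comm _ 2, pow_mul, neg_one_sq, one_pow, one_mul]
    exact ht₃

end

end QMachine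

namespace QMachine

open Finsupp ComplexConjugate

/-! ## Circuits of Toffoli gates -/

/-- Action of a list of Toffoli gates on labels. -/
def tofs (C : List (ℕ × ℕ × ℕ)) (s : Finset ℕ) : Finset ℕ := C.foldl (fun s g => tof g s) s

theorem tofs_append (C C' : List (ℕ × ℕ × ℕ)) (s : Finset ℕ) :
    tofs (C ++ C') s = tofs C' (tofs C s) := List.foldl_append

theorem tofs_cons (g : ℕ × ℕ × ℕ) (C : List (ℕ × ℕ × ℕ)) (s : Finset ℕ) :
    tofs (g :: C) s = tofs C (tof g s) := rfl

theorem tofs_reverse_tofs (C : List (ℕ × ℕ × ℕ)) (s : Finset ℕ) : tofs C.reverse (tofs C s) = s := by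
  induction C generalizing s with
  | nil => rfl
  | cons g C ih => rw [List.reverse_cons, tofs_append, tofs_cons g C, ih]; exact tof_tof g s

theorem tofs_tofs_reverse (C : List (ℕ × ℕ × ℕ)) (s : Finset ℕ) : tofs C (tofs C.reverse s) = s := by
  have := tofs_reverse_tofs C.reverse s
  rwa [List.reverse_reverse] at this

/-- The circuit does not touch qubit `r`. -/
def Avoids (r : ℕ) (C : List (ℕ × ℕ × ℕ)) : Prop := ∀ g ∈ C, g.1 ≠ r ∧ g.2.1 ≠ r ∧ g.2.2 ≠ r

theorem tof_insert {r : ℕ} {g : ℕ × ℕ × ℕ} (h : g.1 ≠ r ∧ g.2.1 ≠ r ∧ g.2.2 ≠ r) (s : Finset ℕ) :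
    tof g (insert r s) = insert r (tof g s) := by
  obtain ⟨c, d, q⟩ := g
  obtain ⟨h1, h2, h3⟩ := h
  dsimp only at h1 h2 h3
  simp only [tof, Finset.mem_insert, h1, h2, false_or]
  split_ifs
  · ext t
    simp only [mem_flipBit, Finset.mem_insert, h3, false_or]
    by_cases ht : t = q
    · subst ht; simp [h3]
    · simp [ht]
  · rfl

theorem Avoids.tofs_insert {r : ℕ} {C : List (ℕ × ℕ × ℕ)} (h : Avoids r C) (s : Finset ℕ) :
    tofs C (insert r s) = insert r (tofs C s) := by
  induction C generalizing s with
  | nil => rfl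
  | cons g C ih =>
    rw [tofs_cons, tofs_cons, tof_insert (h g (by simp)), ih fun g hg => h g (by simp [hg])]

/-- The sign accumulated by an oracle: the circuit `C` is run on a label with qubit `a` flipped, and
each of the qubits `c₀, …, c₀ + m - 1` that has value one contributes a factor `-1`. -/
noncomputable def phase (a : ℕ) (C : List (ℕ × ℕ × ℕ)) (c₀ m : ℕ) (s : Finset ℕ) : ℂ :=
  ∏ r ∈ Finset.range m, if c₀ + r ∈ tofs C (flipBit a s) then -1 else 1

theorem isSign_phase (a : ℕ) (C : List (ℕ × ℕ × ℕ)) (c₀ m : ℕ) : IsSign (phase a C c₀ m) := by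
  intro s
  unfold phase
  induction m with
  | zero => simp
  | succ m ih =>
    rw [Finset.prod_range_succ]
    rcases ih with h | h <;> rw [h] <;> split_ifs <;> simp

/-- Running the circuit backwards restores every label, so `C` may leave arbitrary junk behind; only
the sign survives. -/
theorem oracle_op (a : ℕ) (C : List (ℕ × ℕ × ℕ)) (c₀ m : ℕ) :
    permOp (flipBit a) ∘ₗ permOp (tofs C.reverse) ∘ₗ
      diagOp (fun s => ∏ r ∈ Finset.range m, if c₀ + r ∈ s then -1 else 1) ∘ₗ permOp (tofs C) ∘ₗ
        permOp (flipBit a) = diagOp (phase a C c₀ m) := by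
  have h := permOp_diagOp_permOp (π := tofs C ∘ flipBit a) (σ := flipBit a ∘ tofs C.reverse)
    (fun s => by simp [tofs_reverse_tofs, flipBit_flipBit])
    (fun s => ∏ r ∈ Finset.range m, if c₀ + r ∈ s then -1 else 1)
  rw [← permOp_comp, ← permOp_comp] at h
  exact h

/-- The sign of a one-hot counter. -/
theorem phase_of_mem_iff {a c₀ m v : ℕ} {C : List (ℕ × ℕ × ℕ)} {s : Finset ℕ}
    (h : ∀ r < m, c₀ + r ∈ tofs C (flipBit a s) ↔ r = v) :
    phase a C c₀ m s = if v < m then -1 else 1 := by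
  unfold phase
  rw [Finset.prod_congr rfl fun r hr => by rw [if_congr (h r (Finset.mem_range.1 hr)) rfl rfl]]
  rw [Finset.prod_ite_eq']
  simp

/-! ### Reflections -/

/-- The token leaves qubit `a` if one of the qubits `q i` has value one. -/
def reflGates (a : ℕ) (q : ℕ → ℕ) (m : ℕ) : List (ℕ × ℕ × ℕ) :=
  (List.range m).flatMap fun i => [(a, q i, a + 1 + i), (a + 1 + i, a + 1 + i, a)]

theorem reflGates_succ (a : ℕ) (q : ℕ → ℕ) (m : ℕ) :
    reflGates a q (m + 1) =
      reflGates a q m ++ [(a, q m, a + 1 + m), (a + 1 + m, a + 1 + m, a)] := by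
  simp [reflGates, List.range_succ]

/-- The token stays at `a` until the first `i` with `q i` set. It is then copied to `a + 1 + i` and
erased at `a`, and with `a` empty no later gate fires. All work qubits are initially empty because
`s` lies below `a`. -/
theorem tofs_reflGates {a : ℕ} {q : ℕ → ℕ} {m : ℕ} (hq : ∀ i < m, q i < a) {s : Finset ℕ}
    (hs : ∀ r ∈ s, r < a) :
    ((∀ i < m, q i ∉ s) ∧ tofs (reflGates a q m) (insert a s) = insert a s) ∨
      ((¬ ∀ i < m, q i ∉ s) ∧ ∃ i < m, tofs (reflGates a q m) (insert a s) = insert (a + 1 + i) s) := by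
  have ha : ∀ j, a + j ∉ s := fun j h => by have := hs _ h; omega
  induction m with
  | zero => exact .inl ⟨by simp, rfl⟩
  | succ m ih =>
    have hqm := hq m (by omega)
    rw [reflGates_succ, tofs_append]
    rcases ih fun i hi => hq i (by omega) with ⟨h1, h2⟩ | ⟨h1, i, hi, h2⟩
    · rw [h2]
      by_cases h : q m ∈ s
      · refine .inr ⟨fun h' => h' m (by omega) h, m, by omega, ?_⟩
        have e1 : tof (a, q m, a + 1 + m) (insert a s) = insert (a + 1 + m) (insert a s) := by
          have := ha (1 + m)
          simp [tof, flipBit, h, show q m ≠ a + (1 + m) by omega, add_assoc, this]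
        have e2 : tof (a + 1 + m, a + 1 + m, a) (insert (a + 1 + m) (insert a s)) =
            insert (a + 1 + m) s := by
          have := ha 0
          ext r
          by_cases hr : r = a
          · subst hr
            simp [tof, flipBit, add_assoc, this]; simpa using this
          · simp [tof, flipBit, hr, add_assoc]
        rw [tofs_cons, e1, tofs_cons, e2]; rfl
      · refine .inl ⟨fun i hi => ?_, ?_⟩
        · rcases Nat.lt_succ_iff_lt_or_eq.1 hi with h' | rfl
          exacts [h1 i h', h]
        · have := ha (1 + m)
          have e1 : tof (a, q m, a + 1 + m) (insert a s) = insert a s := by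
            simp [tof, h, show q m ≠ a by omega]
          have e2 : tof (a + 1 + m, a + 1 + m, a) (insert a s) = insert a s := by
            simp [tof, add_assoc, this]
          rw [tofs_cons, e1, tofs_cons, e2]; rfl
    · refine .inr ⟨fun h' => h1 fun i hi => h' i (by omega), i, by omega, ?_⟩
      have e1 : tof (a, q m, a + 1 + m) (insert (a + 1 + i) s) = insert (a + 1 + i) s := by
        have := ha 0
        simp only [add_zero] at this
        simp [tof, this, add_assoc]
      have e2 : tof (a + 1 + m, a + 1 + m, a) (insert (a + 1 + i) s) = insert (a + 1 + i) s := by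
        have := ha (1 + m)
        simp [tof, add_assoc, this, show m ≠ i by omega]
      rw [h2, tofs_cons, e1, tofs_cons, e2]; rfl

theorem phase_reflGates {a : ℕ} {q : ℕ → ℕ} {m : ℕ} (hq : ∀ i < m, q i < a) {s : Finset ℕ}
    (hs : ∀ r ∈ s, r < a) :
    phase a (reflGates a q m) a 1 s = if ∀ i < m, q i ∉ s then -1 else 1 := by
  have ha : a ∉ s := fun h => by have := hs _ h; omega
  have hf : flipBit a s = insert a s := by simp [flipBit, ha]
  rw [phase, Finset.prod_range_one, hf]
  rcases tofs_reflGates hq hs with ⟨h1, h2⟩ | ⟨h1, i, hi, h2⟩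
  · rw [h2, if_pos (by simp), if_pos h1]
  · rw [h2, if_neg (by simp [ha]; omega), if_neg h1]

/-! ### Counters -/

/-- Move a token at `A + p` to `A + p + w` if qubit `x` has value one. -/
def pairGates (A x w : ℕ) (m : ℕ) : List (ℕ × ℕ × ℕ) :=
  (List.range m).flatMap fun p => [(A + p, x, A + p + w), (A + p + w, A + p + w, A + p)]

theorem pairGates_succ (A x w m : ℕ) : pairGates A x w (m + 1) =
    pairGates A x w m ++ [(A + m, x, A + m + w), (A + m + w, A + m + w, A + m)] := by
  simp [pairGates, List.range_succ]

/-- Each pair of gates copies the token ahead and erases the original. As `m ≤ w`, all destinations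
lie beyond all sources, so the token moves at most once. -/
theorem tofs_pairGates {A x w p m : ℕ} (hm : m ≤ w) (hp : p < w) {s : Finset ℕ} (hs : ∀ r ∈ s, r < A)
    (hx : x < A) : tofs (pairGates A x w m) (insert (A + p) s) =
      insert (A + p + if x ∈ s ∧ p < m then w else 0) s := by
  have ha : ∀ j, A + j ∉ s := fun j h => by have := hs _ h; omega
  induction m with
  | zero => simp [pairGates, tofs]
  | succ m ih =>
    have a1 := ha m
    have a2 := ha (m + w)
    have a3 := ha p
    have a4 := ha (p + w)
    rw [pairGates_succ, tofs_append, ih (by omega), tofs_cons, tofs_cons]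
    change tof _ (tof _ _) = _
    rcases lt_trichotomy p m with h | rfl | h
    · by_cases hxs : x ∈ s
      · simp [h, hxs, show p < m + 1 by omega, tof, add_assoc, a1, a2, show m ≠ p + w by omega,
          show m ≠ p by omega]
      · simp [hxs, tof, add_assoc, a1, a2, show m ≠ p by omega, show m + w ≠ p by omega]
    · by_cases hxs : x ∈ s
      · have hw : w ≠ 0 := by omega
        have e1 : tof (A + p, x, A + p + w) (insert (A + p) s) = insert (A + p + w) (insert (A + p) s) := by
          simp [tof, flipBit, hxs, hw, add_assoc, a4, show x ≠ A + (p + w) by omega]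
        have e2 : tof (A + p + w, A + p + w, A + p) (insert (A + p + w) (insert (A + p) s)) =
            insert (A + p + w) s := by
          ext r
          by_cases hr : r = A + p
          · subst hr
            simp [tof, flipBit, add_assoc, a3, hw]
          · simp [tof, flipBit, hr, add_assoc, hw]
        simp only [lt_irrefl, and_false, if_false, add_zero]
        rw [e1, e2, if_pos ⟨hxs, by omega⟩]
      · have hw : w ≠ 0 := by omega
        simp [hxs, tof, add_assoc, a2, a4, show x ≠ A + p by omega, hw]
    · simp [show ¬ p < m by omega, show ¬ p < m + 1 by omega, tof, add_assoc, a1, a2,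
        show m ≠ p by omega, show m + w ≠ p by omega]

/-- Copy a token at `A + p` to `d p`. -/
def copyGates (A : ℕ) (d : ℕ → ℕ) (m : ℕ) : List (ℕ × ℕ × ℕ) :=
  (List.range m).map fun p => (A + p, A + p, d p)

theorem copyGates_succ (A : ℕ) (d : ℕ → ℕ) (m : ℕ) :
    copyGates A d (m + 1) = copyGates A d m ++ [(A + m, A + m, d m)] := by
  simp [copyGates, List.range_succ]

/-- The destinations `d` need not be distinct, so the token cannot be moved reversibly and is
copied. The old token remains as junk until the circuit is undone. That all destinations are at
least `B`, beyond all sources, keeps the copy from triggering further gates. -/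
theorem tofs_copyGates {A B p m M : ℕ} {d : ℕ → ℕ} (hm : m ≤ M) (hB : A + M ≤ B)
    (hd : ∀ p < M, B ≤ d p) (hp : p < M) {s : Finset ℕ} (hs : ∀ r ∈ s, r < A) :
    tofs (copyGates A d m) (insert (A + p) s) =
      if p < m then insert (d p) (insert (A + p) s) else insert (A + p) s := by
  have ha : ∀ j, A + j ∉ s := fun j h => by have := hs _ h; omega
  induction m with
  | zero => simp [copyGates, tofs]
  | succ m ih =>
    have a1 := ha m
    have hdm := hd m (by omega)
    have hdp := hd p hp
    rw [copyGates_succ, tofs_append, ih (by omega)]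
    change tof _ _ = _
    rcases lt_trichotomy p m with h | rfl | h
    · rw [if_pos h, if_pos (by omega)]
      simp [tof, a1, show m ≠ p by omega, show A + m ≠ d p by omega]
    · rw [if_neg (lt_irrefl _), if_pos (by omega)]
      have : d p ∉ s := fun h => by have := hs _ h; omega
      simp [tof, show A + p ≠ d p by omega, show d p ≠ A + p by omega, flipBit, this]
    · rw [if_neg (by omega), if_neg (by omega)]
      simp [tof, a1, show m ≠ p by omega]

/-- The number whose binary digits are the values of the qubits `xs 0, …, xs (a - 1)`. -/
def bitIndex (xs : ℕ → ℕ) (s : Finset ℕ) : ℕ → ℕ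
  | 0 => 0
  | a + 1 => bitIndex xs s a + if xs a ∈ s then 2 ^ a else 0

theorem bitIndex_lt (xs : ℕ → ℕ) (s : Finset ℕ) (a : ℕ) : bitIndex xs s a < 2 ^ a := by
  induction a with
  | zero => simp [bitIndex]
  | succ a ih => rw [bitIndex, pow_succ]; split_ifs <;> omega

theorem testBit_bitIndex (xs : ℕ → ℕ) (s : Finset ℕ) {a l : ℕ} (h : l < a) :
    (bitIndex xs s a).testBit l = decide (xs l ∈ s) := by
  induction a with
  | zero => omega
  | succ a ih =>
    have hlt := bitIndex_lt xs s a
    rw [bitIndex]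
    rcases Nat.lt_succ_iff_lt_or_eq.1 h with h | rfl
    · split_ifs
      · rw [add_comm, Nat.testBit_two_pow_add_gt h, ih h]
      · exact ih h
    · split_ifs with hs
      · rw [add_comm, Nat.testBit_two_pow_add_eq, Nat.testBit_lt_two_pow hlt]; simp [hs]
      · rw [add_zero, Nat.testBit_lt_two_pow hlt]; simp [hs]

/-- Shift the token from `A + r` to `A + r + R * bitIndex`. -/
def selectGates (A R : ℕ) (xs : ℕ → ℕ) (a : ℕ) : List (ℕ × ℕ × ℕ) :=
  (List.range a).flatMap fun l => pairGates A (xs l) (R * 2 ^ l) (R * 2 ^ l)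

theorem selectGates_succ (A R : ℕ) (xs : ℕ → ℕ) (a : ℕ) : selectGates A R xs (a + 1) =
    selectGates A R xs a ++ pairGates A (xs a) (R * 2 ^ a) (R * 2 ^ a) := by
  simp [selectGates, List.range_succ]

/-- The position encodes a pair: the remainder modulo `R` is the cost so far, the quotient is the
index into the truth table. Bit `l` adds `R * 2 ^ l`, and before that the token is among the first
`R * 2 ^ l` places, as `tofs_pairGates` requires. -/
theorem tofs_selectGates {A R r a : ℕ} {xs : ℕ → ℕ} (hr : r < R) {s : Finset ℕ}
    (hs : ∀ r ∈ s, r < A) (hx : ∀ l < a, xs l < A) :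
    tofs (selectGates A R xs a) (insert (A + r) s) = insert (A + (r + R * bitIndex xs s a)) s := by
  induction a with
  | zero => simp [selectGates, tofs, bitIndex]
  | succ a ih =>
    have hlt := bitIndex_lt xs s a
    have hp : r + R * bitIndex xs s a < R * 2 ^ a := by nlinarith
    rw [selectGates_succ, tofs_append, ih fun l hl => hx l (by omega),
      tofs_pairGates le_rfl hp hs (hx a (by omega)), bitIndex]
    congr 1
    simp only [hp, and_true]
    split_ifs <;> ring

/-- The layer of one constraint. -/
def layerGates (A R K a w : ℕ) (xs tab : ℕ → ℕ) : List (ℕ × ℕ × ℕ) :=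
  selectGates A R xs a ++
    copyGates A (fun p => A + R * K + (p % R + (1 - tab (p / R)) * w)) (R * 2 ^ a)

/-- Selection turns the cost `r` into the pair of `r` and the table index; the copy decodes it by
remainder and quotient, adds the weight if the entry is zero, and opens the next layer. The set `s'`
is `s` with the token left behind. -/
theorem tofs_layerGates {A R K r a w : ℕ} {xs tab : ℕ → ℕ} (hr : r < R) (hK : 2 ^ a ≤ K)
    {s : Finset ℕ} (hs : ∀ r ∈ s, r < A) (hx : ∀ l < a, xs l < A) :
    ∃ s', (∀ q < A, q ∈ s' ↔ q ∈ s) ∧ (∀ q ∈ s', q < A + R * K) ∧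
      tofs (layerGates A R K a w xs tab) (insert (A + r) s) =
        insert (A + R * K + (r + (1 - tab (bitIndex xs s a)) * w)) s' := by
  have hlt := bitIndex_lt xs s a
  have hp : r + R * bitIndex xs s a < R * 2 ^ a := by nlinarith
  have hRK : R * 2 ^ a ≤ R * K := Nat.mul_le_mul_left _ hK
  refine ⟨insert (A + (r + R * bitIndex xs s a)) s, fun q hq => ?_, fun q hq => ?_, ?_⟩
  · rw [Finset.mem_insert]; constructor
    · rintro (h | h); exacts [by omega, h]
    · exact .inr
  · rcases Finset.mem_insert.1 hq with h | h
    · omega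
    · have := hs q h; omega
  · rw [layerGates, tofs_append, tofs_selectGates hr hs hx, tofs_copyGates le_rfl (by omega)
      (fun p _ => Nat.le_add_right _ _) hp hs, if_pos hp, Nat.add_mul_mod_self_left, Nat.mod_eq_of_lt hr,
      Nat.add_mul_div_left _ _ (by omega : 0 < R), Nat.div_eq_of_lt hr, zero_add]

theorem Avoids.append {r : ℕ} {C C' : List (ℕ × ℕ × ℕ)} (h : Avoids r C) (h' : Avoids r C') :
    Avoids r (C ++ C') := fun g hg => (List.mem_append.1 hg).elim (h g) (h' g)

theorem avoids_layerGates {A R K r a w : ℕ} {xs tab : ℕ → ℕ} (hA : r < A) (hx : ∀ l < a, xs l ≠ r) :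
    Avoids r (layerGates A R K a w xs tab) := by
  refine .append (fun g hg => ?_) fun g hg => ?_
  · obtain ⟨l, hl, hg⟩ := List.mem_flatMap.1 hg
    have := hx l (List.mem_range.1 hl)
    obtain ⟨p, -, hg⟩ := List.mem_flatMap.1 hg
    simp only [List.mem_cons, List.not_mem_nil, or_false] at hg
    rcases hg with rfl | rfl <;> dsimp only <;> omega
  · obtain ⟨p, -, rfl⟩ := List.mem_map.1 hg
    dsimp only
    omega

end QMachine

/-! ## Bounded differences on the cube -/

/-- Hoeffding's lemma for two equally likely values, from `cosh x ≤ exp (x² / 2)` at half the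
difference. -/
theorem exp_add_exp_le (a b c : ℝ) (h : |a - b| ≤ c) :
    Real.exp a + Real.exp b ≤ 2 * (Real.exp ((a + b) / 2) * Real.exp (c ^ 2 / 8)) := by
  have h1 : Real.cosh ((a - b) / 2) ≤ Real.exp (c ^ 2 / 8) := by
    refine (Real.cosh_le_exp_half_sq _).trans (Real.exp_le_exp.2 ?_)
    have := sq_le_sq' (by linarith [neg_abs_le (a - b), abs_nonneg (a - b)])
      ((le_abs_self (a - b)).trans h)
    linarith
  have h2 : Real.exp a + Real.exp b = 2 * (Real.exp ((a + b) / 2) * Real.cosh ((a - b) / 2)) := by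
    rw [Real.cosh_eq, mul_div_assoc', mul_add, ← Real.exp_add, ← Real.exp_add]
    ring_nf
  rw [h2]
  gcongr

/-- The number of places in which two points differ, weighted by `c`. -/
def weightedDist {n : ℕ} (c : Fin n → ℝ) (x y : Fin n → Bool) : ℝ :=
  ∑ i, if x i ≠ y i then c i else 0

theorem sum_cube_succ {n : ℕ} (f : (Fin (n + 1) → Bool) → ℝ) :
    ∑ x, f x = ∑ x : Fin n → Bool, (f (Fin.cons false x) + f (Fin.cons true x)) := by
  rw [← (Fin.consEquiv fun _ => Bool).sum_comp, Fintype.sum_prod_type, Fintype.sum_bool,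
    Finset.sum_add_distrib, add_comm]
  rfl

/-- Induction on the coordinates by averaging over the first one. The average inherits the Lipschitz
bound with the remaining constants, and the two-point inequality contributes `exp (c 0 ^ 2 / 8)`. -/
theorem sum_exp_le_of_lipschitz {n : ℕ} (f : (Fin n → Bool) → ℝ) (c : Fin n → ℝ)
    (hf : ∀ x y, |f x - f y| ≤ weightedDist c x y) :
    ∑ x, Real.exp (f x) ≤ 2 ^ n * Real.exp ((∑ x, f x) / 2 ^ n + (∑ i, c i ^ 2) / 8) := by
  induction n with
  | zero => simp
  | succ n ih =>
    set g : (Fin n → Bool) → ℝ := fun x => (f (Fin.cons false x) + f (Fin.cons true x)) / 2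
    have hg : ∀ x y, |g x - g y| ≤ weightedDist (fun i => c i.succ) x y := by
      intro x y
      have h : ∀ b, |f (Fin.cons b x) - f (Fin.cons b y)| ≤ weightedDist (fun i => c i.succ) x y := by
        intro b
        refine (hf _ _).trans (le_of_eq ?_)
        simp [weightedDist, Fin.sum_univ_succ]
      have h0 := abs_le.1 (h false)
      have h1 := abs_le.1 (h true)
      simp only [g]
      rw [abs_le]
      constructor <;> linarith
    have hc : ∀ x, |f (Fin.cons false x) - f (Fin.cons true x)| ≤ c 0 := by
      intro x
      refine (hf _ _).trans (le_of_eq ?_)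
      simp [weightedDist, Fin.sum_univ_succ]
    rw [sum_cube_succ]
    calc ∑ x : Fin n → Bool, (Real.exp (f (Fin.cons false x)) + Real.exp (f (Fin.cons true x)))
        ≤ ∑ x : Fin n → Bool, 2 * (Real.exp (g x) * Real.exp (c 0 ^ 2 / 8)) :=
          Finset.sum_le_sum fun x _ => exp_add_exp_le _ _ _ (hc x)
      _ = 2 * Real.exp (c 0 ^ 2 / 8) * ∑ x, Real.exp (g x) := by
          rw [Finset.mul_sum]; exact Finset.sum_congr rfl fun x _ => by ring
      _ ≤ 2 * Real.exp (c 0 ^ 2 / 8) *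
            (2 ^ n * Real.exp ((∑ x, g x) / 2 ^ n + (∑ i : Fin n, c i.succ ^ 2) / 8)) := by
          gcongr; exact ih g _ hg
      _ = 2 ^ (n + 1) * Real.exp ((∑ x, f x) / 2 ^ (n + 1) + (∑ i, c i ^ 2) / 8) := by
          rw [Fin.sum_univ_succ, sum_cube_succ, ← Finset.sum_div]
          rw [show ((∑ x : Fin n → Bool, (f (Fin.cons false x) + f (Fin.cons true x))) / 2 ^ (n + 1) +
            (c 0 ^ 2 + ∑ i : Fin n, c i.succ ^ 2) / 8) = c 0 ^ 2 / 8 +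
            ((∑ x : Fin n → Bool, (f (Fin.cons false x) + f (Fin.cons true x))) / 2 / 2 ^ n +
              (∑ i : Fin n, c i.succ ^ 2) / 8) by rw [pow_succ]; field_simp; ring,
            Real.exp_add (c 0 ^ 2 / 8)]
          generalize Real.exp (c 0 ^ 2 / 8) = u
          generalize Real.exp _ = v
          ring

/-- McDiarmid's inequality on the cube. -/
theorem card_le_of_lipschitz {n : ℕ} (f : (Fin n → Bool) → ℝ) (c : Fin n → ℝ)
    (hf : ∀ x y, |f x - f y| ≤ weightedDist c x y) (h0 : ∑ x, f x = 0) {C t : ℝ} (hC : 0 < C)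
    (hCc : ∑ i, c i ^ 2 = C) (ht : 0 ≤ t) :
    ((Finset.univ.filter fun x => f x ≤ -t).card : ℝ) ≤ 2 ^ n * Real.exp (-(2 * t ^ 2 / C)) := by
  -- Chernoff's method bounds the count by `2 ^ n * exp (-a t + a² C / 8)`, which is smallest at
  -- this `a`.
  set a := 4 * t / C
  have ha : 0 ≤ a := by positivity
  have h := sum_exp_le_of_lipschitz (fun x => -a * f x) (fun i => a * c i) fun x y => by
    rw [← mul_sub, abs_mul, abs_neg, abs_of_nonneg ha]
    calc a * |f x - f y| ≤ a * weightedDist c x y := by gcongr; exact hf x y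
      _ = weightedDist (fun i => a * c i) x y := by
        simp only [weightedDist, Finset.mul_sum, mul_ite, mul_zero]
  have h1 : ((Finset.univ.filter fun x => f x ≤ -t).card : ℝ) * Real.exp (a * t) ≤
      ∑ x, Real.exp (-a * f x) := by
    rw [← nsmul_eq_mul, ← Finset.sum_const]
    refine (Finset.sum_le_sum fun x hx => ?_).trans (Finset.sum_le_sum_of_subset_of_nonneg
      (Finset.filter_subset (fun x => f x ≤ -t) _) fun _ _ _ => (Real.exp_pos _).le)
    rw [Real.exp_le_exp]
    have := (Finset.mem_filter.1 hx).2
    nlinarith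
  rw [← Finset.mul_sum, h0, mul_zero, zero_div, zero_add] at h
  have hs : ∑ i, (a * c i) ^ 2 = a ^ 2 * C := by
    rw [← hCc, Finset.mul_sum]
    exact Finset.sum_congr rfl fun i _ => mul_pow _ _ _
  rw [hs] at h
  have h2 := h1.trans h
  rw [← le_div_iff₀ (Real.exp_pos _), mul_div_assoc, ← Real.exp_sub] at h2
  refine h2.trans (le_of_eq ?_)
  congr 2
  have : C ≠ 0 := hC.ne'
  simp only [a]
  field_simp
  ring

/-! ### Single constraints: gap, mean and bounded differences -/

namespace CSPConstraint

variable {k n : ℕ} (C : CSPConstraint k n)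

theorem numSat_lt : C.numSat < 2 ^ C.arity := by
  obtain ⟨a, ha⟩ := C.exists_unsat
  have : C.numSat < (Finset.univ : Finset (Fin C.arity → Bool)).card :=
    Finset.card_lt_card (Finset.filter_ssubset.2 ⟨a, Finset.mem_univ _, by simp [ha]⟩)
  simpa using this

theorem numSat_pos : 0 < C.numSat := by
  obtain ⟨a, ha⟩ := C.exists_sat
  exact Finset.card_pos.2 ⟨a, by simp [ha]⟩

theorem sub_pos : (0 : ℝ) < 2 ^ C.arity - C.numSat := by
  have : (C.numSat : ℝ) < 2 ^ C.arity := by exact_mod_cast C.numSat_lt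
  linarith

theorem one_le_gap : 1 ≤ C.gap := by
  rw [gap, le_div_iff₀ C.sub_pos]
  have : (0 : ℝ) ≤ C.numSat := by positivity
  linarith

theorem gap_pos : 0 < C.gap := zero_lt_one.trans_le C.one_le_gap

/-- At least one assignment is violating, so the denominator is at least one. -/
theorem gap_le : C.gap ≤ 2 ^ k := by
  rw [gap, div_le_iff₀ C.sub_pos]
  have h : (1 : ℝ) ≤ 2 ^ C.arity - C.numSat := by
    have : (C.numSat : ℝ) + 1 ≤ 2 ^ C.arity := by exact_mod_cast C.numSat_lt
    linarith
  have h2 : (2 : ℝ) ^ C.arity ≤ 2 ^ k := pow_le_pow_right₀ (by norm_num) C.arity_le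
  have h3 : (0 : ℝ) < 2 ^ k := by positivity
  nlinarith

/-- A nonconstant predicate of one variable has exactly one satisfying value. This case is what
saves the factor two in `MaxCSP.two_mul_abs_Hmin_le`. -/
theorem gap_of_arity_eq_one (h : C.arity = 1) : C.gap = 2 := by
  have h1 := C.numSat_lt
  have h2 := C.numSat_pos
  have h3 : C.numSat = 1 := by rw [h] at h1; omega
  rw [gap, h, h3]; norm_num

/-- The constraint is violated by `x`. -/
def Violated (x : Fin n → Bool) : Prop := C.pred (fun l => x (C.scope l)) = false

instance (x : Fin n → Bool) : Decidable (C.Violated x) := inferInstanceAs (Decidable (_ = _))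

/-- From `s / (2^a - s) + 1 = 2^a / (2^a - s)`: the value depends on violation alone and jumps by
the gap. -/
theorem value_eq (x : Fin n → Bool) : C.value x = -1 + if C.Violated x then C.gap else 0 := by
  have := C.sub_pos
  unfold value Violated gap
  rcases Bool.eq_false_or_eq_true (C.pred fun l => x (C.scope l)) with h | h
  · simp [h]
  · simp only [h, Bool.false_eq_true, if_false, if_true]
    field_simp
    ring

/-- Translating the cube by a pattern `b` on the scope permutes it, so the sum is the same for every
translate. Summing over all `b` first makes the restriction run through all local assignments. -/
theorem sum_comp_scope (f : (Fin C.arity → Bool) → ℝ) :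
    2 ^ C.arity * ∑ x : Fin n → Bool, f (fun l => x (C.scope l)) = 2 ^ n * ∑ a, f a := by
  have shift : ∀ {ι : Type} [Fintype ι] [DecidableEq ι] (b : ι → Bool) (g : (ι → Bool) → ℝ),
      ∑ x : ι → Bool, g (fun i => xor (x i) (b i)) = ∑ x, g x := by
    intro ι _ _ b g
    exact Fintype.sum_bijective (fun (x : ι → Bool) i => xor (x i) (b i))
      (Function.Involutive.bijective fun x => by funext i; simp) _ _ fun _ => rfl
  have key : ∀ b : Fin C.arity → Bool, ∑ x : Fin n → Bool, f (fun l => x (C.scope l)) =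
      ∑ x : Fin n → Bool, f (fun l => xor (b l) (x (C.scope l))) := by
    intro b
    rw [← shift (Function.extend C.scope b fun _ => false) fun x => f fun l => x (C.scope l)]
    refine Finset.sum_congr rfl fun x _ => ?_
    congr 1
    ext l
    change xor (x (C.scope l)) (Function.extend C.scope b (fun _ => false) (C.scope l)) = _
    rw [C.scope.injective.extend_apply, Bool.xor_comm]
  calc 2 ^ C.arity * ∑ x : Fin n → Bool, f (fun l => x (C.scope l))
      = ∑ b : Fin C.arity → Bool, ∑ x : Fin n → Bool, f (fun l => x (C.scope l)) := by simp
    _ = ∑ b : Fin C.arity → Bool, ∑ x : Fin n → Bool, f (fun l => xor (b l) (x (C.scope l))) :=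
        Finset.sum_congr rfl fun b _ => key b
    _ = ∑ x : Fin n → Bool, ∑ a, f a := by
        rw [Finset.sum_comm]
        exact Finset.sum_congr rfl fun x _ => shift _ f
    _ = _ := by simp

/-- This is what the centering is for: `s` satisfying assignments contribute `-s`, and the `2^a - s`
violating ones contribute `s` in total. -/
theorem sum_value : ∑ x, C.value x = 0 := by
  have h := C.sum_comp_scope fun a => if C.pred a = true then (-1 : ℝ)
    else (C.numSat : ℝ) / (2 ^ C.arity - C.numSat)
  have h2 : ∑ a : Fin C.arity → Bool, (if C.pred a = true then (-1 : ℝ)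
      else (C.numSat : ℝ) / (2 ^ C.arity - C.numSat)) = 0 := by
    have hc : ((Finset.univ.filter fun a : Fin C.arity → Bool => ¬ C.pred a = true).card : ℝ) =
        2 ^ C.arity - C.numSat := by
      have := Finset.card_filter_add_card_filter_not (s := (Finset.univ : Finset (Fin C.arity → Bool)))
        (fun a => C.pred a = true)
      rw [Finset.card_univ, Fintype.card_fun, Fintype.card_bool, Fintype.card_fin] at this
      have h' : (C.numSat : ℝ) +
        ((Finset.univ.filter fun a : Fin C.arity → Bool => ¬ C.pred a = true).card : ℝ) =
          2 ^ C.arity := by exact_mod_cast this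
      linarith
    rw [Finset.sum_ite, Finset.sum_const, Finset.sum_const, nsmul_eq_mul, nsmul_eq_mul, hc,
      mul_div_cancel₀ _ C.sub_pos.ne']
    simp [numSat]
  rw [h2, mul_zero] at h
  exact (mul_eq_zero.1 h).resolve_left (by positivity)

/-- If the two points differ somewhere on the scope, a single such variable already pays the whole
gap; otherwise the values agree. -/
theorem abs_value_sub_le (x y : Fin n → Bool) : |C.value x - C.value y| ≤
    ∑ i, if x i ≠ y i then (if i ∈ Set.range C.scope then C.gap else 0) else 0 := by
  have hg := C.gap_pos
  have hnn : ∀ i ∈ Finset.univ, (0 : ℝ) ≤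
      if x i ≠ y i then (if i ∈ Set.range C.scope then C.gap else 0) else 0 := by
    intro i _; split_ifs <;> linarith
  by_cases h : ∃ l, x (C.scope l) ≠ y (C.scope l)
  · obtain ⟨l, hl⟩ := h
    refine le_trans ?_ (Finset.single_le_sum hnn (Finset.mem_univ (C.scope l)))
    rw [if_pos hl, if_pos ⟨l, rfl⟩, value_eq, value_eq]
    split_ifs <;> simp [abs_of_pos hg, hg.le]
  · push Not at h
    have : C.value x = C.value y := by unfold value; simp only [h]
    rw [this, sub_self, abs_zero]
    exact Finset.sum_nonneg hnn

end CSPConstraint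

/-! ### Concentration of the objective, and comparison of the exponents -/

namespace MaxCSP

variable {k n m : ℕ} (I : MaxCSP k n m)

theorem exists_H_eq_Hmin : ∃ x, I.H x = I.Hmin := exists_eq_ciInf_of_finite

theorem Hmin_le (x : Fin n → Bool) : I.Hmin ≤ I.H x := ciInf_le (Set.finite_range _).bddBelow x

theorem sum_H : ∑ x, I.H x = 0 := by
  simp only [H]
  rw [Finset.sum_comm]
  exact Finset.sum_eq_zero fun j _ => (I j).sum_value

/-- A positive minimum would contradict mean zero. -/
theorem Hmin_nonpos : I.Hmin ≤ 0 := by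
  by_contra h
  have : 0 < ∑ x, I.H x := Finset.sum_pos (fun x _ => (not_le.1 h).trans_le (I.Hmin_le x))
    Finset.univ_nonempty
  rw [I.sum_H] at this
  exact lt_irrefl _ this

theorem neg_le_H (x : Fin n → Bool) : -(m : ℝ) ≤ I.H x := by
  have : ∑ _j : Fin m, (-1 : ℝ) ≤ I.H x := Finset.sum_le_sum fun j _ => by
    rw [(I j).value_eq]
    have := (I j).gap_pos
    split_ifs <;> linarith
  simpa using this

theorem abs_Hmin_le : |I.Hmin| ≤ m := by
  obtain ⟨x, hx⟩ := I.exists_H_eq_Hmin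
  rw [abs_of_nonpos I.Hmin_nonpos, ← hx]
  linarith [I.neg_le_H x]

theorem gap_le_maxGap (j : Fin m) : (I j).gap ≤ I.maxGap :=
  le_ciSup (f := fun j => (I j).gap) (Set.finite_range _).bddAbove j

theorem one_le_maxGap (hm : 0 < m) : 1 ≤ I.maxGap :=
  ((I ⟨0, hm⟩).one_le_gap).trans (I.gap_le_maxGap _)

theorem maxGap_le (hm : 0 < m) : I.maxGap ≤ 2 ^ k := by
  have : Nonempty (Fin m) := ⟨⟨0, hm⟩⟩
  exact ciSup_le fun j => (I j).gap_le

theorem deg_cast (i : Fin n) :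
    (I.deg i : ℝ) = ∑ j, if i ∈ Set.range (I j).scope then (1 : ℝ) else 0 := by
  rw [deg, Finset.sum_boole]

theorem abs_H_sub_le (x y : Fin n → Bool) :
    |I.H x - I.H y| ≤ weightedDist (fun i => I.maxGap * I.deg i) x y := by
  unfold H weightedDist
  rw [← Finset.sum_sub_distrib]
  refine (Finset.abs_sum_le_sum_abs _ _).trans
    ((Finset.sum_le_sum fun j _ => (I j).abs_value_sub_le x y).trans ?_)
  rw [Finset.sum_comm]
  refine Finset.sum_le_sum fun i _ => ?_
  by_cases h : x i ≠ y i
  · simp only [if_pos h]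
    rw [I.deg_cast, Finset.mul_sum]
    refine Finset.sum_le_sum fun j _ => ?_
    split_ifs
    · rw [mul_one]; exact I.gap_le_maxGap j
    · rw [mul_zero]
  · simp [if_neg h]

theorem totalDeg_eq : I.totalDeg = ∑ j, ((I j).arity : ℝ) := by
  unfold totalDeg
  simp_rw [I.deg_cast]
  rw [Finset.sum_comm]
  refine Finset.sum_congr rfl fun j _ => ?_
  rw [Finset.sum_boole]
  congr 1
  have : (Finset.univ.filter fun i => i ∈ Set.range (I j).scope) =
      Finset.univ.map (I j).scope := by ext i; simp
  rw [this, Finset.card_map, Finset.card_univ, Fintype.card_fin]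

theorem le_totalDeg : (m : ℝ) ≤ I.totalDeg := by
  rw [totalDeg_eq]
  have : ∑ _j : Fin m, (1 : ℝ) ≤ ∑ j, ((I j).arity : ℝ) :=
    Finset.sum_le_sum fun j _ => by exact_mod_cast (I j).one_le_arity
  simpa using this

/-- One has |H_min| ≤ m. Either some arity is one, so that Λ ≥ 2 while Σ ≥ m, or all arities are at
least two, so that Σ ≥ 2m while Λ ≥ 1. The factor two bounds the cost of the window by E/2 and the
argument of the entropy by 1/4. -/
theorem two_mul_abs_Hmin_le (hm : 0 < m) : 2 * |I.Hmin| ≤ I.maxGap * I.totalDeg := by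
  have h1 := I.abs_Hmin_le
  have h2 := I.le_totalDeg
  have h3 := I.one_le_maxGap hm
  have hm' : (0 : ℝ) < m := by exact_mod_cast hm
  by_cases h : ∃ j, (I j).arity = 1
  · obtain ⟨j, hj⟩ := h
    have := (I j).gap_of_arity_eq_one hj ▸ I.gap_le_maxGap j
    nlinarith
  · push Not at h
    have : 2 * (m : ℝ) ≤ I.totalDeg := by
      rw [totalDeg_eq]
      have : ∑ _j : Fin m, (2 : ℝ) ≤ ∑ j, ((I j).arity : ℝ) := Finset.sum_le_sum fun j _ => by
        have h1 := (I j).one_le_arity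
        have h2 := h j
        exact_mod_cast (by omega : 2 ≤ (I j).arity)
      simpa [mul_comm] using this
    nlinarith

/-- The sum of the squares of the degrees. -/
def sqDeg : ℕ := ∑ i, I.deg i ^ 2

theorem sqDeg_cast : (I.sqDeg : ℝ) = ∑ i, (I.deg i : ℝ) ^ 2 := by simp [sqDeg]

/-- The Cauchy–Schwarz inequality. -/
theorem totalDeg_sq_le : I.totalDeg ^ 2 ≤ n * I.sqDeg := by
  rw [sqDeg_cast, totalDeg]
  simpa using sq_sum_le_card_mul_sum_sq (s := Finset.univ) (f := fun i => (I.deg i : ℝ))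

theorem sqDeg_pos (hm : 0 < m) : 0 < I.sqDeg := by
  have h1 := I.le_totalDeg
  have h2 := I.totalDeg_sq_le
  have hm' : (0 : ℝ) < m := by exact_mod_cast hm
  by_contra h
  have h0 : I.sqDeg = 0 := by omega
  rw [h0] at h2
  norm_num at h2
  rw [h2] at h1
  linarith

theorem n_pos {k n m : ℕ} (I : MaxCSP k n m) (hm : 0 < m) : 0 < n :=
  Fin.pos ((I ⟨0, hm⟩).scope ⟨0, (I ⟨0, hm⟩).one_le_arity⟩)

theorem k_pos {k n m : ℕ} (I : MaxCSP k n m) (hm : 0 < m) : 0 < k :=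
  Nat.lt_of_lt_of_le (I ⟨0, hm⟩).one_le_arity (I ⟨0, hm⟩).arity_le

/-- Few points are far below zero. -/
theorem card_H_le (hm : 0 < m) {t : ℝ} (ht : 0 ≤ t) :
    ((Finset.univ.filter fun x => I.H x ≤ -t).card : ℝ) ≤
      2 ^ n * Real.exp (-(2 * t ^ 2 / (I.maxGap ^ 2 * I.sqDeg))) := by
  have h1 := I.one_le_maxGap hm
  have h2 : (0 : ℝ) < I.sqDeg := by exact_mod_cast I.sqDeg_pos hm
  refine card_le_of_lipschitz I.H _ I.abs_H_sub_le I.sum_H (by positivity) ?_ ht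
  rw [sqDeg_cast, Finset.mul_sum]
  exact Finset.sum_congr rfl fun i _ => by rw [mul_pow]

/-- The total degree cancels, and what remains is directly comparable with the width of the window.
-/
theorem gammaExp_half (hm : 0 < m) : I.gammaExp (1 / 2) =
    1 / (2 * Real.log 2) * (|I.Hmin| ^ 2 / (I.maxGap ^ 2 * (n * I.sqDeg))) := by
  have h1 := I.one_le_maxGap hm
  have h2 : (0 : ℝ) < I.sqDeg := by exact_mod_cast I.sqDeg_pos hm
  have h3 : (0 : ℝ) < n := by exact_mod_cast I.n_pos hm
  have h4 : (0 : ℝ) < I.totalDeg := lt_of_lt_of_le (by exact_mod_cast hm) I.le_totalDeg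
  rw [gammaExp, irregularityAvg, ← sqDeg_cast]
  field_simp
  ring

/-- Concavity puts the entropy above its chord from 0 to 1/2. -/
theorem le_binEntropy {p : ℝ} (h0 : 0 ≤ p) (h1 : p ≤ 1 / 2) :
    2 * p * Real.log 2 ≤ Real.binEntropy p := by
  have hc : ConcaveOn ℝ (Set.Icc 0 1) Real.binEntropy := Real.strictConcave_binEntropy.concaveOn
  have h := hc.2 (show (0 : ℝ) ∈ Set.Icc 0 1 by norm_num) (show (1 / 2 : ℝ) ∈ Set.Icc 0 1 by norm_num)
    (show 0 ≤ 1 - 2 * p by linarith) (show 0 ≤ 2 * p by linarith) (by ring)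
  have h2 : Real.binEntropy (1 / 2) = Real.log 2 := by
    rw [one_div, Real.binEntropy_two_inv]
  simp only [smul_eq_mul, Real.binEntropy_zero, mul_zero, zero_add, h2] at h
  rwa [show 2 * p * (1 / 2) = p by ring] at h

/-- The entropy term is never the minimum. With z = |H_min| / (ΛΣ) ≤ 1/2, Cauchy–Schwarz gives γ ≤
z² / (2 ln 2), and the chord bound gives h(z/2) / 2 ≥ z/2. The comparison reduces to z ≤ ln 2. -/
theorem gammaExp_le_cClassical (hm : 0 < m) : I.gammaExp (1 / 2) ≤ I.cClassical := by
  refine le_min le_rfl ?_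
  have h1 := I.one_le_maxGap hm
  have h4 : (0 : ℝ) < I.totalDeg := lt_of_lt_of_le (by exact_mod_cast hm) I.le_totalDeg
  have h2 := I.two_mul_abs_Hmin_le hm
  have hl := Real.log_two_gt_d9
  have h3 : (0 : ℝ) < I.maxGap * I.totalDeg := by positivity
  set z := |I.Hmin| / (I.maxGap * I.totalDeg) with hz
  have hz0 : 0 ≤ z := by positivity
  have hz1 : z ≤ 1 / 2 := by rw [hz, div_le_iff₀ h3]; linarith
  have hθ : I.theta (1 / 2) = z / 2 := by rw [theta, hz]; ring
  have hγ : I.gammaExp (1 / 2) ≤ 1 / (2 * Real.log 2) * z ^ 2 := by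
    rw [I.gammaExp_half hm, hz, div_pow, mul_pow]
    have := I.totalDeg_sq_le
    gcongr
  have he := le_binEntropy (p := z / 2) (by linarith) (by linarith)
  rw [hθ]
  have h5 : z / 2 ≤ Real.binEntropy (z / 2) / Real.log 2 / 2 := by
    have hl0 : 0 < Real.log 2 := by linarith
    clear_value z
    rw [le_div_iff₀ (by norm_num), le_div_iff₀ hl0]
    linarith
  refine hγ.trans (le_trans ?_ h5)
  rw [div_mul_eq_mul_div, one_mul, div_le_iff₀ (by positivity)]
  nlinarith

/-- In both expressions `k` and `m` cancel, or the total degree does. What is left is Λ ≤ 2^k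
together with 1 / (2 ln 2) = 0.72134…. -/
theorem cClassical_lower_bound (hm : 0 < m) :
    0.7213 * (I.optScale ^ 2 / (2 ^ (2 * k) * (k : ℝ) ^ 2 * I.irregularity)) ≤ I.cClassical := by
  refine le_trans ?_ (I.gammaExp_le_cClassical hm)
  have h1 := I.one_le_maxGap hm
  have h1' := I.maxGap_le hm
  have h2 : (0 : ℝ) < I.sqDeg := by exact_mod_cast I.sqDeg_pos hm
  have h3 : (0 : ℝ) < n := by exact_mod_cast I.n_pos hm
  have hm' : (0 : ℝ) < m := by exact_mod_cast hm
  have hk : (0 : ℝ) < k := by exact_mod_cast I.k_pos hm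
  have hl := Real.log_two_lt_d9
  have hl0 : 0 < Real.log 2 := Real.log_pos (by norm_num)
  have e : I.optScale ^ 2 / (2 ^ (2 * k) * (k : ℝ) ^ 2 * I.irregularity) =
      |I.Hmin| ^ 2 / ((2 ^ k) ^ 2 * (n * I.sqDeg)) := by
    rw [optScale, irregularity, ← sqDeg_cast, mul_comm 2 k, pow_mul]
    field_simp
  rw [e, I.gammaExp_half hm]
  have h4 : (0.7213 : ℝ) ≤ 1 / (2 * Real.log 2) := by
    rw [le_div_iff₀ (by positivity)]; linarith
  gcongr

/-- The two scales differ by Δ / (2^k k) ≤ 1, and 0.0578 < 0.7213; the inequality is strict because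
Δ is positive. -/
theorem cShortPath_lt (hm : 0 < m) (hΔ : 0 < I.optScale) : I.cShortPath < I.cClassical := by
  refine lt_of_lt_of_le ?_ (I.cClassical_lower_bound hm)
  have h2 : (0 : ℝ) < I.sqDeg := by exact_mod_cast I.sqDeg_pos hm
  have h3 : (0 : ℝ) < n := by exact_mod_cast I.n_pos hm
  have hm' : (0 : ℝ) < m := by exact_mod_cast hm
  have hk : (1 : ℝ) ≤ k := by exact_mod_cast I.k_pos hm
  have hD : 0 < I.irregularity := by rw [irregularity, ← sqDeg_cast]; positivity
  have hΔ1 : I.optScale ≤ 1 := by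
    rw [optScale, div_le_one hm']; exact I.abs_Hmin_le
  have hp : (1 : ℝ) ≤ 2 ^ k := one_le_pow₀ (by norm_num)
  rw [cShortPath]
  have e : I.optScale ^ 3 / (2 ^ (3 * k) * (k : ℝ) ^ 3 * I.irregularity) =
      I.optScale / (2 ^ k * k) * (I.optScale ^ 2 / (2 ^ (2 * k) * (k : ℝ) ^ 2 * I.irregularity)) := by
    rw [show 3 * k = k + 2 * k by ring, pow_add]
    field_simp
  rw [e, ← mul_assoc]
  have h5 : I.optScale / (2 ^ k * k) ≤ 1 := by
    rw [div_le_one (by positivity)]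
    nlinarith
  have h6 : 0 < I.optScale ^ 2 / (2 ^ (2 * k) * (k : ℝ) ^ 2 * I.irregularity) := by positivity
  gcongr
  linarith

end MaxCSP

namespace QMachine

open Finset

/-! ## The constraints as read from the input -/

section
variable (inp : ℕ → ℕ)

/-- The input position of constraint `j`. -/
def ptr : ℕ → ℕ
  | 0 => 2
  | j + 1 => ptr j + 1 + inp (ptr j) + 2 ^ inp (ptr j)

/-- The arity of constraint `j`. -/
def ar (j : ℕ) : ℕ := inp (ptr inp j)

/-- Variable `l` of constraint `j`. -/
def vr (j l : ℕ) : ℕ := inp (ptr inp j + 1 + l)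

/-- Entry `i` of the truth table of constraint `j`. -/
def tb (j i : ℕ) : ℕ := inp (ptr inp j + 1 + ar inp j + i)

/-- The number of satisfying assignments of constraint `j`. -/
def sat (j : ℕ) : ℕ := ∑ i ∈ range (2 ^ ar inp j), tb inp j i

/-- The gap of constraint `j`, scaled by `Q`. -/
def wt (Q j : ℕ) : ℕ := Q * 2 ^ ar inp j / (2 ^ ar inp j - sat inp j)

/-- The number of occurrences of variable `i` in the first `j` constraints. -/
def dg (j i : ℕ) : ℕ := ∑ j' ∈ range j, ∑ l ∈ range (ar inp j'), if vr inp j' l = i then 1 else 0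

/-- The scaled cost of the violated ones of the first `j` constraints. -/
def cost (Q j : ℕ) (s : Finset ℕ) : ℕ :=
  ∑ j' ∈ range j, (1 - tb inp j' (bitIndex (vr inp j') s (ar inp j'))) * wt inp Q j'

/-- The largest scaled gap among the first `j` constraints. -/
def wmax (Q : ℕ) : ℕ → ℕ
  | 0 => 0
  | j + 1 => wmax Q j + (wt inp Q j - wmax Q j)

/-- The circuit that counts the costs of the first `j` constraints. -/
def costGates (A R K Q : ℕ) : ℕ → List (ℕ × ℕ × ℕ)
  | 0 => []
  | j + 1 => costGates A R K Q j ++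
      layerGates (A + j * (R * K)) R K (ar inp j) (wt inp Q j) (vr inp j) (tb inp j)

/-- The input has `m` constraints of arity at most `k` on `n` variables. -/
structure WF (k n m : ℕ) : Prop where
  ar_le : ∀ j < m, ar inp j ≤ k
  vr_lt : ∀ j < m, ∀ l < ar inp j, vr inp j l < n
  sat_lt : ∀ j < m, sat inp j < 2 ^ ar inp j

end

variable {inp : ℕ → ℕ} {k n m : ℕ}

/-- With truncated subtraction `w + (x - w)` is the maximum, so the machine needs no comparison. -/
theorem wmax_eq (Q j : ℕ) : wmax inp Q j = (range j).sup (wt inp Q) := by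
  induction j with
  | zero => rfl
  | succ j ih => rw [wmax, ih, range_add_one, sup_insert, Nat.max_def]; split_ifs <;> omega

theorem WF.wt_le (h : WF inp k n m) (Q : ℕ) {j : ℕ} (hj : j < m) : wt inp Q j ≤ Q * 2 ^ k := by
  have h1 := h.sat_lt j hj
  rw [wt]
  refine (Nat.div_le_self _ _).trans ?_
  have := Nat.pow_le_pow_right (show 0 < 2 by norm_num) (h.ar_le j hj)
  gcongr

theorem WF.wmax_le (h : WF inp k n m) (Q : ℕ) {j : ℕ} (hj : j ≤ m) : wmax inp Q j ≤ Q * 2 ^ k := by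
  rw [wmax_eq]
  exact Finset.sup_le fun i hi => h.wt_le Q (by rw [Finset.mem_range] at hi; omega)

theorem WF.cost_le (h : WF inp k n m) (Q : ℕ) {j : ℕ} (hj : j ≤ m) (s : Finset ℕ) :
    cost inp Q j s ≤ Q * 2 ^ k * j := by
  rw [mul_comm (Q * 2 ^ k)]
  calc cost inp Q j s ≤ ∑ _j' ∈ range j, Q * 2 ^ k := Finset.sum_le_sum fun i hi => by
        have := h.wt_le Q (show i < m by rw [Finset.mem_range] at hi; omega)
        calc _ ≤ 1 * wt inp Q i := Nat.mul_le_mul_right _ (Nat.sub_le _ _)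
          _ ≤ _ := by omega
    _ = _ := by simp

theorem bitIndex_congr {xs : ℕ → ℕ} {s s' : Finset ℕ} {a : ℕ} (h : ∀ l < a, (xs l ∈ s ↔ xs l ∈ s')) :
    bitIndex xs s a = bitIndex xs s' a := by
  induction a with
  | zero => rfl
  | succ a ih => rw [bitIndex, bitIndex, ih fun l hl => h l (by omega), if_congr (h a (by omega)) rfl rfl]

theorem WF.cost_congr (h : WF inp k n m) (Q : ℕ) {s s' : Finset ℕ}
    (hs : ∀ i < n, (i ∈ s ↔ i ∈ s')) : cost inp Q m s = cost inp Q m s' := by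
  refine Finset.sum_congr rfl fun j hj => ?_
  rw [Finset.mem_range] at hj
  rw [bitIndex_congr fun l hl => hs _ (h.vr_lt j hj l hl)]

/-- Layer `j` receives the token at the cost of the first `j` constraints. By `hR` this cost is
below `R`, so a layer never overflows into the next one. The set `s'` collects the junk of the
earlier layers, all of it below the current one. -/
theorem WF.tofs_costGates (h : WF inp k n m) {A R Q : ℕ} (hA : n ≤ A) (hR : Q * 2 ^ k * m < R)
    {s : Finset ℕ} (hs : ∀ r ∈ s, r < A) {j : ℕ} (hj : j ≤ m) :
    ∃ s', (∀ q < A, q ∈ s' ↔ q ∈ s) ∧ (∀ q ∈ s', q < A + j * (R * 2 ^ k)) ∧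
      tofs (costGates inp A R (2 ^ k) Q j) (insert A s) =
        insert (A + j * (R * 2 ^ k) + cost inp Q j s) s' := by
  induction j with
  | zero => exact ⟨s, fun _ _ => Iff.rfl, by simpa using hs, by simp [costGates, tofs, cost]⟩
  | succ j ih =>
    obtain ⟨s', h1, h2, h3⟩ := ih (by omega)
    have hc : cost inp Q j s < R := (h.cost_le Q (by omega) s).trans_lt
      (lt_of_le_of_lt (Nat.mul_le_mul_left _ (by omega)) hR)
    have hx : ∀ l < ar inp j, vr inp j l < A := fun l hl => (h.vr_lt j (by omega) l hl).trans_le hA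
    obtain ⟨s'', g1, g2, g3⟩ := tofs_layerGates (w := wt inp Q j) (tab := tb inp j)
      (xs := vr inp j) (a := ar inp j) (K := 2 ^ k) hc
      (Nat.pow_le_pow_right (by norm_num) (h.ar_le j (by omega))) h2
      fun l hl => (hx l hl).trans_le (Nat.le_add_right _ _)
    have e : A + (j + 1) * (R * 2 ^ k) = A + j * (R * 2 ^ k) + R * 2 ^ k := by ring
    refine ⟨s'', fun q hq => (g1 q (by omega)).trans (h1 q hq), fun q hq => ?_, ?_⟩
    · rw [e]; exact g2 q hq
    · have hc' : cost inp Q (j + 1) s = cost inp Q j s +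
          (1 - tb inp j (bitIndex (vr inp j) s (ar inp j))) * wt inp Q j := Finset.sum_range_succ _ _
      rw [costGates, tofs_append, h3, g3, e, hc', bitIndex_congr fun l hl => h1 _ (hx l hl)]

theorem WF.avoids_costGates (h : WF inp k n m) {A R K Q r : ℕ} (hr : n ≤ r) (hA : r < A) {j : ℕ}
    (hj : j ≤ m) : Avoids r (costGates inp A R K Q j) := by
  induction j with
  | zero => intro g hg; simp [costGates] at hg
  | succ j ih =>
    exact .append (ih (by omega)) (avoids_layerGates (by omega) fun l hl => by
      have := h.vr_lt j (by omega) l hl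
      omega)

theorem WF.mem_tofs_costGates (h : WF inp k n m) {A R Q : ℕ} (hA : n ≤ A) (hR : Q * 2 ^ k * m < R)
    {s : Finset ℕ} (hs : ∀ r ∈ s, r < A) (r : ℕ) :
    A + m * (R * 2 ^ k) + r ∈ tofs (costGates inp A R (2 ^ k) Q m) (flipBit A s) ↔
      r = cost inp Q m s := by
  have hf : flipBit A s = insert A s := by
    have : A ∉ s := fun h => (hs A h).ne rfl
    simp [flipBit, this]
  obtain ⟨s', -, h2, h3⟩ := h.tofs_costGates hA hR hs le_rfl
  rw [hf, h3, Finset.mem_insert]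
  constructor
  · rintro (h | h)
    · omega
    · have := h2 _ h; omega
  · rintro rfl; exact .inl rfl

theorem WF.phase_costGates (h : WF inp k n m) {A R Q : ℕ} (hA : n ≤ A) (hR : Q * 2 ^ k * m < R)
    {s : Finset ℕ} (hs : ∀ r ∈ s, r < A) (c : ℕ) :
    phase A (costGates inp A R (2 ^ k) Q m) (A + m * (R * 2 ^ k)) c s =
      if cost inp Q m s < c then -1 else 1 :=
  phase_of_mem_iff fun r _ => h.mem_tofs_costGates hA hR hs r

end QMachine

open QMachine

/-! ## The encoding of an instance -/

namespace MaxCSP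

open Finset

variable {k n m : ℕ} (I : MaxCSP k n m)

/-- The input tape. -/
def tape (i : ℕ) : ℕ := I.encode.getD i 0

theorem tape_zero : I.tape 0 = n := rfl

theorem tape_one : I.tape 1 = m := rfl

theorem length_encode (C : CSPConstraint k n) : C.encode.length = 1 + C.arity + 2 ^ C.arity := by
  simp [CSPConstraint.encode]; omega

theorem length_encode_pos (C : CSPConstraint k n) : 0 < C.encode.length := by
  have := Nat.two_pow_pos C.arity
  rw [length_encode]; omega

theorem getD_flatten {L : List (List ℕ)} {j t : ℕ} (hj : j < L.length) (ht : t < L[j].length) :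
    L.flatten.getD ((L.take j).flatten.length + t) 0 = L[j].getD t 0 := by
  have e : L.flatten = (L.take j).flatten ++ (L[j] :: L.drop (j + 1)).flatten := by
    rw [← List.drop_eq_getElem_cons hj, ← List.flatten_append, List.take_append_drop]
  rw [e, List.getD_append_right _ _ _ _ (by omega), Nat.add_sub_cancel_left,
    List.flatten_cons, List.getD_append _ _ _ _ ht]

theorem tape_block (j : Fin m) {t : ℕ} (ht : t < (I j).encode.length) :
    I.tape (2 + ((List.ofFn fun j => (I j).encode).take j).flatten.length + t) =
      (I j).encode.getD t 0 := by
  have h : I.tape (2 + ((List.ofFn fun j => (I j).encode).take j).flatten.length + t) =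
      (List.ofFn fun j => (I j).encode).flatten.getD
        (((List.ofFn fun j => (I j).encode).take j).flatten.length + t) 0 := by
    rw [tape, encode, List.getD_append_right _ _ _ _ (by simp; omega)]
    congr 1
    simp; omega
  rw [h, getD_flatten (by simp) (by simpa using ht)]
  simp

/-- Every block begins with its arity, which determines its length; so following the tape agrees
with the lengths of the encoded blocks. -/
theorem ptr_eq {j : ℕ} (hj : j ≤ m) :
    ptr I.tape j = 2 + ((List.ofFn fun j => (I j).encode).take j).flatten.length := by
  induction j with
  | zero => simp [ptr]
  | succ j ih =>
    have h := I.tape_block ⟨j, hj⟩ (t := 0) (length_encode_pos _)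
    have ha : I.tape (ptr I.tape j) = (I ⟨j, hj⟩).arity := by
      rw [ih (by omega)]; exact h
    rw [ptr, ha, List.take_add_one, List.flatten_append, List.length_append, ih (by omega)]
    have h2 : (List.ofFn fun j => (I j).encode)[j]? = some (I ⟨j, hj⟩).encode := by
      rw [List.getElem?_ofFn, dif_pos (show j < m by omega)]
    rw [h2]
    simp only [Option.toList_some, List.flatten_cons, List.flatten_nil, List.append_nil, length_encode]
    omega

theorem tape_ptr (j : Fin m) {t : ℕ} (ht : t < (I j).encode.length) :
    I.tape (ptr I.tape j + t) = (I j).encode.getD t 0 := by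
  rw [I.ptr_eq j.2.le, I.tape_block j ht]

theorem ar_eq (j : Fin m) : ar I.tape j = (I j).arity :=
  I.tape_ptr j (t := 0) (length_encode_pos _)

theorem vr_eq (j : Fin m) (l : Fin (I j).arity) : vr I.tape j l = (I j).scope l := by
  have h := I.tape_ptr j (t := 1 + l) (by
    have := l.2
    have := Nat.two_pow_pos (I j).arity
    rw [length_encode]; omega)
  rw [vr, add_assoc, h, CSPConstraint.encode, List.getD_append _ _ _ _ (by
      have := l.2
      simp; omega),
    List.getD_append_right _ _ _ _ (by simp)]
  simp

theorem tb_eq (j : Fin m) {i : ℕ} (hi : i < 2 ^ (I j).arity) : tb I.tape j i =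
    if (I j).pred (fun l => i.testBit l) = true then 1 else 0 := by
  have h := I.tape_ptr j (t := 1 + (I j).arity + i) (by rw [length_encode]; omega)
  rw [tb, ar_eq, add_assoc, add_assoc, ← add_assoc 1, h, CSPConstraint.encode,
    List.getD_append_right _ _ _ _ (by simp; omega)]
  have : 1 + (I j).arity + i - ([(I j).arity] ++ List.ofFn fun l => ((I j).scope l : ℕ)).length = i := by
    simp; omega
  rw [this, List.getD_eq_getElem _ _ (by simpa using hi)]
  simp

/-- Numbers below `2 ^ a` have no higher bits, so the digits determine them; equal cardinalities do
the rest. -/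
theorem testBit_bijective (a : ℕ) :
    Function.Bijective fun (i : Fin (2 ^ a)) (l : Fin a) => (i : ℕ).testBit l := by
  rw [Fintype.bijective_iff_injective_and_card]
  refine ⟨fun i i' h => Fin.ext (Nat.eq_of_testBit_eq fun l => ?_), by simp⟩
  by_cases hl : l < a
  · exact congrFun h ⟨l, hl⟩
  · have h2 : 2 ^ a ≤ 2 ^ l := Nat.pow_le_pow_right (by norm_num) (by omega)
    rw [Nat.testBit_lt_two_pow (i.2.trans_le h2), Nat.testBit_lt_two_pow (i'.2.trans_le h2)]

theorem sat_eq (j : Fin m) : sat I.tape j = (I j).numSat := by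
  rw [sat, ar_eq, CSPConstraint.numSat, Finset.card_filter, Finset.sum_range,
    ← (testBit_bijective (I j).arity).sum_comp]
  exact Finset.sum_congr rfl fun i _ => I.tb_eq j i.2

theorem wf : WF I.tape k n m where
  ar_le j hj := by rw [I.ar_eq ⟨j, hj⟩]; exact (I ⟨j, hj⟩).arity_le
  vr_lt j hj l hl := by
    rw [I.ar_eq ⟨j, hj⟩] at hl
    rw [I.vr_eq ⟨j, hj⟩ ⟨l, hl⟩]; exact Fin.is_lt _
  sat_lt j hj := by rw [I.ar_eq ⟨j, hj⟩, I.sat_eq ⟨j, hj⟩]; exact (I ⟨j, hj⟩).numSat_lt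

/-- The denominator of the gap lies between 1 and `2 ^ k`, so it divides the factorial and the
integer division on the machine is exact. -/
theorem wt_eq (j : Fin m) : (wt I.tape (2 ^ k).factorial j : ℝ) = (2 ^ k).factorial * (I j).gap := by
  have h := (I j).numSat_lt
  have h2 : (2 ^ (I j).arity - (I j).numSat : ℕ) ∣ (2 ^ k).factorial * 2 ^ (I j).arity :=
    (Nat.dvd_factorial (by omega) ((Nat.sub_le _ _).trans
      (Nat.pow_le_pow_right (by norm_num) (I j).arity_le))).mul_right _
  rw [wt, ar_eq, sat_eq, Nat.cast_div h2 (by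
    rw [Nat.cast_ne_zero]; omega), Nat.cast_sub h.le, CSPConstraint.gap]
  push_cast
  rw [mul_div_assoc]

/-- The assignment that a basis label stands for. -/
def assignment (n : ℕ) (s : Finset ℕ) : Fin n → Bool := fun i => decide ((i : ℕ) ∈ s)

theorem tb_bitIndex (j : Fin m) (s : Finset ℕ) :
    tb I.tape j (bitIndex (vr I.tape j) s (ar I.tape j)) =
      if (I j).Violated (assignment n s) then 0 else 1 := by
  have hlt := bitIndex_lt (vr I.tape j) s (ar I.tape j)
  rw [I.ar_eq] at hlt ⊢
  rw [I.tb_eq j hlt]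
  have : (fun l : Fin (I j).arity => (bitIndex (vr I.tape j) s (I j).arity).testBit l) =
      fun l => assignment n s ((I j).scope l) := by
    ext l
    rw [testBit_bitIndex _ _ l.2, I.vr_eq]
    rfl
  rw [this]
  unfold CSPConstraint.Violated
  rcases Bool.eq_false_or_eq_true ((I j).pred fun l => assignment n s ((I j).scope l)) with h | h <;>
    simp [h]

/-- Each constraint contributes -1 plus its gap if violated; adding `m` removes the -1's, so that
only violations cost. -/
theorem cost_eq (s : Finset ℕ) : (cost I.tape (2 ^ k).factorial m s : ℝ) =
    (2 ^ k).factorial * (I.H (assignment n s) + m) := by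
  have : (m : ℝ) = ∑ _j : Fin m, (1 : ℝ) := by simp
  rw [cost, Finset.sum_range, H, this, ← Finset.sum_add_distrib, Finset.mul_sum]
  push_cast
  refine Finset.sum_congr rfl fun j _ => ?_
  rw [I.tb_bitIndex, (I j).value_eq, I.wt_eq]
  split_ifs <;> simp

theorem wmax_eq_maxGap (hm : 0 < m) :
    (wmax I.tape (2 ^ k).factorial m : ℝ) = (2 ^ k).factorial * I.maxGap := by
  have : Nonempty (Fin m) := ⟨⟨0, hm⟩⟩
  have hQ : (0 : ℝ) < (2 ^ k).factorial := by exact_mod_cast Nat.factorial_pos _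
  apply le_antisymm
  · obtain ⟨j, hj, h⟩ := Finset.exists_mem_eq_sup (range m) ⟨0, by simpa using hm⟩
      (wt I.tape (2 ^ k).factorial)
    rw [wmax_eq, h, I.wt_eq ⟨j, by simpa using hj⟩]
    gcongr
    exact I.gap_le_maxGap _
  · rw [← le_div_iff₀' hQ]
    refine ciSup_le fun j => ?_
    rw [le_div_iff₀' hQ, ← I.wt_eq, wmax_eq]
    exact_mod_cast Finset.le_sup (f := wt I.tape (2 ^ k).factorial) (by simp : (j : ℕ) ∈ range m)

/-- A scope is injective, so a constraint contains a variable at most once and occurrences count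
constraints. -/
theorem dg_eq (i : Fin n) : dg I.tape m i = I.deg i := by
  rw [dg, deg, Finset.card_filter, Finset.sum_range]
  refine Finset.sum_congr rfl fun j _ => ?_
  rw [I.ar_eq, Finset.sum_range]
  have h : ∀ l : Fin (I j).arity, (if vr I.tape j l = i then 1 else 0) =
      if (I j).scope l = i then 1 else 0 := fun l => by
    rw [I.vr_eq]; exact if_congr Fin.ext_iff.symm rfl rfl
  simp only [h]
  split_ifs with hi
  · obtain ⟨l, rfl⟩ := hi
    simp
  · exact Finset.sum_eq_zero fun l _ => if_neg fun e => hi ⟨l, e⟩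

theorem sqDeg_eq : ∑ i ∈ range n, dg I.tape m i ^ 2 = I.sqDeg := by
  rw [Finset.sum_range, sqDeg]
  exact Finset.sum_congr rfl fun i _ => by rw [I.dg_eq]

theorem tape_le (i : ℕ) : I.tape i ≤ n + m + k + 1 := by
  have h : ∀ x ∈ I.encode, x ≤ n + m + k + 1 := by
    intro x hx
    simp only [encode, List.mem_append, List.mem_cons, List.not_mem_nil, or_false, List.mem_flatten,
      List.mem_ofFn] at hx
    rcases hx with (rfl | rfl) | ⟨l, ⟨j, rfl⟩, hx⟩
    · omega
    · omega
    · simp only [CSPConstraint.encode, List.mem_append, List.mem_singleton, List.mem_ofFn] at hx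
      rcases hx with (rfl | ⟨l, rfl⟩) | ⟨i, rfl⟩
      · have := (I j).arity_le; omega
      · have := ((I j).scope l).2; omega
      · split_ifs <;> omega
  rw [tape, List.getD_eq_getElem?_getD]
  rcases lt_or_ge i I.encode.length with hi | hi
  · rw [List.getElem?_eq_getElem hi]; exact h _ (List.getElem_mem hi)
  · rw [List.getElem?_eq_none hi]; simp

end MaxCSP

namespace QMachine

open Finset

/-! ## The parameters of an attempt -/

/-- `s` consecutive variables, cyclically, from `b` on. -/
def window (n b s : ℕ) : List ℕ := (List.range s).map fun i => (b + i) % n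

theorem length_window (n b s : ℕ) : (window n b s).length = s := by simp [window]

theorem lt_of_mem_window {n b s q : ℕ} (hn : 0 < n) (h : q ∈ window n b s) : q < n := by
  obtain ⟨i, -, rfl⟩ := List.mem_map.1 h
  exact Nat.mod_lt _ hn

theorem nodup_window {n b s : ℕ} (hs : s ≤ n) : (window n b s).Nodup := by
  refine List.Nodup.map_on (fun i hi j hj h => ?_) List.nodup_range
  rw [List.mem_range] at hi hj
  have h2 : i ≡ j [MOD n] := Nat.ModEq.add_left_cancel' b h
  exact h2.eq_of_lt_of_lt (by omega) (by omega)

section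
variable (inp : ℕ → ℕ) (k Q : ℕ)

/-- The sum of the squares of the degrees. -/
def sqd : ℕ := ∑ i ∈ range (inp 0), dg inp (inp 1) i ^ 2

/-- The number of variables of the second stage when the target cost is `v`. -/
def width (v : ℕ) : ℕ :=
  (Q * inp 1 - v) * (Q * inp 1 - v) / (wmax inp Q (inp 1) * wmax inp Q (inp 1) * sqd inp)

/-- The costs below this bound are those of the first stage. -/
def thr (v : ℕ) : ℕ := (4 * (Q * inp 1) - 3 * (Q * inp 1 - v)) / 4 + 1

/-- The sign of the labels of cost less than `c`. -/
noncomputable def phaseCost (c : ℕ) : Finset ℕ → ℂ :=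
  phase (2 * inp 0 + 1) (costGates inp (2 * inp 0 + 1) (Q * 2 ^ k * inp 1 + 1) (2 ^ k) Q (inp 1))
    (2 * inp 0 + 1 + inp 1 * ((Q * 2 ^ k * inp 1 + 1) * 2 ^ k)) c

/-- The sign of the labels in which the qubits `q 0, …, q (m - 1)` are zero. -/
noncomputable def phaseRefl (q : ℕ → ℕ) (m : ℕ) : Finset ℕ → ℂ :=
  phase (2 * inp 0 + 1) (reflGates (2 * inp 0 + 1) q m) (2 * inp 0 + 1) 1

/-- The operator of an attempt. -/
noncomputable def attemptOp (v b i₁ i₂ i₃ : ℕ) : QState →ₗ[ℂ] QState :=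
  searchOp (inp 0) (window (inp 0) b (width inp Q v)) (phaseCost inp k Q (thr inp Q v))
    (phaseCost inp k Q (v + 1)) (phaseRefl inp id (2 * inp 0))
    (phaseRefl inp (fun i => (b + i) % inp 0) (width inp Q v))
    ((3 ^ i₁ - 1) / 2) ((3 ^ i₂ - 1) / 2) ((3 ^ i₃ - 1) / 2)

end

end QMachine

open QMachine

/-! ### A cheap window, and half of a subcube -/

namespace MaxCSP

open Finset

variable {k n m : ℕ} (I : MaxCSP k n m)

/-- Averaging over the starting point: each of the `s` places of a window runs once through all
variables. Places are counted with multiplicity in `key`, so windows that wrap around more than once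
do no harm. -/
theorem exists_window (c : Fin n → ℝ) (hc : ∀ i, 0 ≤ c i) (hn : 0 < n) (s : ℕ) :
    ∃ b < n, (∑ i : Fin n, if (i : ℕ) ∈ window n b s then c i else 0) * n ≤ s * ∑ i, c i := by
  have : NeZero n := ⟨hn.ne'⟩
  have key : ∀ b : Fin n, (∑ i : Fin n, if (i : ℕ) ∈ window n b s then c i else 0) ≤
      ∑ t ∈ range s, c (b + Fin.ofNat n t) := by
    intro b
    have h : ∀ i : Fin n, (if (i : ℕ) ∈ window n b s then c i else 0) ≤
        ∑ t ∈ range s, if b + Fin.ofNat n t = i then c i else 0 := by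
      intro i
      have hnn : ∀ t ∈ range s, (0 : ℝ) ≤ if b + Fin.ofNat n t = i then c i else 0 := by
        intro t _; split_ifs; exacts [hc i, le_rfl]
      split_ifs with hi
      · obtain ⟨t, ht, e⟩ := List.mem_map.1 hi
        rw [List.mem_range] at ht
        refine le_trans (le_of_eq ?_) (Finset.single_le_sum hnn (Finset.mem_range.2 ht))
        rw [if_pos]
        ext
        simpa [Fin.val_add] using e
      · exact Finset.sum_nonneg hnn
    refine (Finset.sum_le_sum fun i _ => h i).trans (le_of_eq ?_)
    rw [Finset.sum_comm]
    exact Finset.sum_congr rfl fun t _ => by simp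
  have htot : ∑ b : Fin n, ∑ t ∈ range s, c (b + Fin.ofNat n t) = s * ∑ i, c i := by
    rw [Finset.sum_comm]
    have : ∀ t ∈ range s, ∑ b : Fin n, c (b + Fin.ofNat n t) = ∑ i, c i := fun t _ =>
      Equiv.sum_comp (Equiv.addRight (Fin.ofNat n t)) c
    rw [Finset.sum_congr rfl this]
    simp
  obtain ⟨b, -, hb⟩ := Finset.exists_le_of_sum_le (s := (univ : Finset (Fin n))) ⟨0, mem_univ _⟩
    (f := fun b : Fin n => (∑ i : Fin n, if (i : ℕ) ∈ window n b s then c i else 0) * n)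
    (g := fun _ => s * ∑ i, c i) (by
      rw [← Finset.sum_mul, Finset.sum_const, card_univ, Fintype.card_fin, nsmul_eq_mul, mul_comm]
      gcongr
      exact (Finset.sum_le_sum fun b _ => key b).trans htot.le)
  exact ⟨b, b.2, hb⟩

/-- If flipping all of `S` costs little, half of the subcube through an optimum is good. -/
theorem half_subcube {x S : Finset ℕ} {t : ℝ} (hS : S ⊆ range n)
    (h : (∑ i : Fin n, if (i : ℕ) ∈ S then I.maxGap * I.deg i else 0) ≤ 2 * t)
    (P : Finset ℕ → Prop) [DecidablePred P]
    (hP : ∀ y, I.H (assignment n y) ≤ I.H (assignment n x) + t → P y) :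
    2 ^ S.card ≤ 2 * {Y ∈ S.powerset | P ((x \ S) ∪ Y)}.card := by
  have hdeg : ∀ i, 0 ≤ I.maxGap * I.deg i := by
    intro i
    refine mul_nonneg ?_ (Nat.cast_nonneg _)
    exact Real.iSup_nonneg fun j => (I j).gap_pos.le
  -- The window values `Y` and `S \ Y` differ from `x` in complementary subsets of `S`, so their
  -- distances from `x` add up to the weight of `S`. One of them is at most `t`.
  have key : ∀ Y ∈ S.powerset, P ((x \ S) ∪ Y) ∨ P ((x \ S) ∪ (S \ Y)) := by
    intro Y hY
    rw [Finset.mem_powerset] at hY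
    by_contra hcon
    rw [not_or] at hcon
    have h1 := mt (hP _) hcon.1
    have h2 := mt (hP _) hcon.2
    have d1 := I.abs_H_sub_le (assignment n ((x \ S) ∪ Y)) (assignment n x)
    have d2 := I.abs_H_sub_le (assignment n ((x \ S) ∪ (S \ Y))) (assignment n x)
    have d3 : weightedDist (fun i => I.maxGap * I.deg i) (assignment n ((x \ S) ∪ Y)) (assignment n x) +
        weightedDist (fun i => I.maxGap * I.deg i) (assignment n ((x \ S) ∪ (S \ Y))) (assignment n x) ≤
        2 * t := by
      refine le_trans ?_ h
      unfold weightedDist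
      rw [← Finset.sum_add_distrib]
      refine Finset.sum_le_sum fun i _ => ?_
      have := hdeg i
      by_cases h1 : (i : ℕ) ∈ S <;> by_cases h2 : (i : ℕ) ∈ Y <;> by_cases h3 : (i : ℕ) ∈ x <;>
        simp [assignment, h1, h2, h3, this]
      all_goals exact absurd (hY h2) h1
    have := le_abs_self (I.H (assignment n ((x \ S) ∪ Y)) - I.H (assignment n x))
    have := le_abs_self (I.H (assignment n ((x \ S) ∪ (S \ Y))) - I.H (assignment n x))
    linarith
  set T := {Y ∈ S.powerset | P ((x \ S) ∪ Y)} with hT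
  -- The good values together with their complements cover the subcube.
  have hsub : S.powerset ⊆ T ∪ T.image (S \ ·) := by
    intro Y hY
    have hY' := Finset.mem_powerset.1 hY
    rw [Finset.mem_union, Finset.mem_image]
    rcases key Y hY with h | h
    · exact .inl (Finset.mem_filter.2 ⟨hY, h⟩)
    · exact .inr ⟨S \ Y, Finset.mem_filter.2 ⟨Finset.mem_powerset.2 Finset.sdiff_subset, h⟩,
        Finset.sdiff_sdiff_eq_self hY'⟩
  rw [← Finset.card_powerset]
  have h1 := Finset.card_le_card hsub
  have h2 := Finset.card_union_le T (T.image (S \ ·))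
  have h3 := Finset.card_image_le (s := T) (f := (S \ ·))
  omega

theorem assignment_injOn : Set.InjOn (assignment n) ((range n).powerset : Finset (Finset ℕ)) := by
  intro x hx y hy h
  rw [Finset.mem_coe, Finset.mem_powerset] at hx hy
  ext i
  by_cases hi : i < n
  · have := congrFun h ⟨i, hi⟩
    simpa [assignment] using this
  · exact ⟨fun h => absurd (Finset.mem_range.1 (hx h)) hi, fun h => absurd (Finset.mem_range.1 (hy h)) hi⟩

theorem exists_assignment (x : Fin n → Bool) : ∃ s ⊆ range n, assignment n s = x := by
  refine ⟨(univ.filter fun i => x i = true).map Fin.valEmbedding, fun i hi => ?_, ?_⟩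
  · obtain ⟨j, -, rfl⟩ := Finset.mem_map.1 hi
    simp
  · ext i
    simp only [assignment, mem_map, mem_filter, mem_univ, true_and, Fin.valEmbedding_apply]
    rcases Bool.eq_false_or_eq_true (x i) with h | h
    · rw [h, decide_eq_true_iff]; exact ⟨i, h, rfl⟩
    · rw [h, decide_eq_false_iff_not]
      rintro ⟨j, hj, e⟩
      rw [Fin.ext e, h] at hj
      exact absurd hj (by simp)

theorem scale_pos (k : ℕ) : (0 : ℝ) < (2 ^ k).factorial := by exact_mod_cast Nat.factorial_pos _

theorem sqd_eq : sqd I.tape = I.sqDeg := I.sqDeg_eq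

/-- For every target, (Qm - v)² ≤ Q² m² ≤ Q² Σ² ≤ (QΛ)² n S, the last step by Cauchy–Schwarz and Λ ≥
1. So a window always has distinct variables. -/
theorem width_le (hm : 0 < m) (v : ℕ) : width I.tape (2 ^ k).factorial v ≤ n := by
  have hw := I.wmax_eq_maxGap hm
  have h1 := I.one_le_maxGap hm
  have h2 := I.le_totalDeg
  have h3 := I.totalDeg_sq_le
  have hQ := scale_pos k
  rw [width, sqd_eq]
  refine Nat.div_le_of_le_mul ?_
  have hv : (((2 ^ k).factorial * m - v : ℕ) : ℝ) ≤ (2 ^ k).factorial * m := by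
    exact_mod_cast Nat.sub_le _ _
  have hm' : (0 : ℝ) ≤ m := Nat.cast_nonneg m
  have hwQ : ((2 ^ k).factorial : ℝ) ≤ wmax I.tape (2 ^ k).factorial m := by
    rw [hw]; nlinarith
  have : (((2 ^ k).factorial * m - v : ℕ) : ℝ) * (((2 ^ k).factorial * m - v : ℕ) : ℝ) ≤
      wmax I.tape (2 ^ k).factorial m * wmax I.tape (2 ^ k).factorial m * I.sqDeg * n := by
    calc _ ≤ ((2 ^ k).factorial * m : ℝ) * ((2 ^ k).factorial * m) := by gcongr
      _ = ((2 ^ k).factorial * (2 ^ k).factorial : ℝ) * (m ^ 2) := by ring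
      _ ≤ (wmax I.tape (2 ^ k).factorial m * wmax I.tape (2 ^ k).factorial m) * (n * I.sqDeg) := by
          gcongr
          exact (pow_le_pow_left₀ hm' h2 2).trans h3
      _ = _ := by ring
  exact_mod_cast this

end MaxCSP

open QMachine

/-! ### Existence of the right parameters -/

namespace MaxCSP

open Finset

variable {k n m : ℕ} (I : MaxCSP k n m)

/-- After clearing denominators both sides say 4 · cost ≤ 4Qm - 3QE. The `+ 1` in `thr` turns the
floor with a strict inequality into this non-strict one. -/
theorem thr_iff {x : Finset ℕ} {v : ℕ} {E : ℝ} (hv : v ≤ (2 ^ k).factorial * m)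
    (hE : (v : ℝ) = (2 ^ k).factorial * (m - E)) :
    cost I.tape (2 ^ k).factorial m x < thr I.tape (2 ^ k).factorial v ↔
      I.H (assignment n x) ≤ -(3 / 4 * E) := by
  have hQ := scale_pos k
  have hc := I.cost_eq x
  have he : (((2 ^ k).factorial * m - v : ℕ) : ℝ) = (2 ^ k).factorial * E := by
    rw [Nat.cast_sub hv, hE]; push_cast; ring
  rw [thr, Nat.lt_succ_iff, Nat.le_div_iff_mul_le (by norm_num),
    Nat.le_sub_iff_add_le (by rw [tape_one]; omega), tape_one, ← Nat.cast_le (α := ℝ)]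
  push_cast
  rw [hc, he]
  constructor
  · intro h
    have : ((2 ^ k).factorial : ℝ) * (4 * I.H (assignment n x) + 3 * E) ≤ 0 := by linarith
    have := nonpos_of_mul_nonpos_right this hQ
    linarith
  · intro h
    have : ((2 ^ k).factorial : ℝ) * (4 * I.H (assignment n x) + 3 * E) ≤ 0 :=
      mul_nonpos_of_nonneg_of_nonpos hQ.le (by linarith)
    linarith

/-- The scale Q² cancels from the quotient, and rounding down loses at most one. -/
theorem width_cast_le (hm : 0 < m) {v : ℕ} {E : ℝ} (hv : v ≤ (2 ^ k).factorial * m)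
    (hE : (v : ℝ) = (2 ^ k).factorial * (m - E)) :
    (width I.tape (2 ^ k).factorial v : ℝ) ≤ E ^ 2 / (I.maxGap ^ 2 * I.sqDeg) ∧
      E ^ 2 / (I.maxGap ^ 2 * I.sqDeg) - 1 ≤ width I.tape (2 ^ k).factorial v := by
  have hQ := scale_pos k
  have he : (((2 ^ k).factorial * m - v : ℕ) : ℝ) = (2 ^ k).factorial * E := by
    rw [Nat.cast_sub hv, hE]; push_cast; ring
  have h1 := I.one_le_maxGap hm
  have hD : (0 : ℝ) < I.sqDeg := by exact_mod_cast I.sqDeg_pos hm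
  have e : E ^ 2 / (I.maxGap ^ 2 * I.sqDeg) = ((((2 ^ k).factorial * m - v) *
      ((2 ^ k).factorial * m - v) : ℕ) : ℝ) / ((wmax I.tape (2 ^ k).factorial m *
        wmax I.tape (2 ^ k).factorial m * I.sqDeg : ℕ) : ℝ) := by
    push_cast
    rw [he, I.wmax_eq_maxGap hm]
    field_simp
  have hden : 0 < wmax I.tape (2 ^ k).factorial m * wmax I.tape (2 ^ k).factorial m * I.sqDeg := by
    have : (0 : ℝ) < wmax I.tape (2 ^ k).factorial m := by rw [I.wmax_eq_maxGap hm]; positivity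
    have : 0 < wmax I.tape (2 ^ k).factorial m := by exact_mod_cast this
    have := I.sqDeg_pos hm
    positivity
  rw [e, width, sqd_eq, tape_one]
  refine ⟨Nat.cast_div_le, ?_⟩
  rw [sub_le_iff_le_add, div_le_iff₀ (by exact_mod_cast hden)]
  exact_mod_cast (Nat.lt_mul_div_succ _ hden).le.trans (Nat.mul_comm _ _).le

set_option maxHeartbeats 1000000 in
/-- The right parameters lead to an attempt that succeeds with probability at least `1 / 4`. -/
theorem exists_attempt (hm : 0 < m) : ∃ v b i₁ i₂ i₃ : ℕ, v ≤ (2 ^ k).factorial * m ∧ b < n ∧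
    i₁ < n + 6 ∧ i₂ < n + 6 ∧ i₃ < n + 6 ∧
    (∀ x, cost I.tape (2 ^ k).factorial m x ≤ v → I.IsOptimal (assignment n x)) ∧
    I.gammaExp (1 / 2) * n - 1 ≤ width I.tape (2 ^ k).factorial v ∧
    (3 ^ i₁ * 3 ^ i₃) ^ 2 ≤ 256 * 2 ^ (n - width I.tape (2 ^ k).factorial v) ∧
    (3 ^ i₂ * 3 ^ i₃) ^ 2 ≤ 256 * 2 ^ (n - width I.tape (2 ^ k).factorial v) ∧
    1 / 4 ≤ weight ((attemptOp I.tape k (2 ^ k).factorial v b i₁ i₂ i₃ (ket ∅)).filter fun s =>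
      cost I.tape (2 ^ k).factorial m s ≤ v) := by
  obtain ⟨x', hx'⟩ := I.exists_H_eq_Hmin
  obtain ⟨x, hx, rfl⟩ := exists_assignment x'
  set Q := (2 ^ k).factorial with hQdef
  have hQ : (0 : ℝ) < Q := scale_pos k
  set E := -I.Hmin with hEdef
  have hE0 : 0 ≤ E := by have := I.Hmin_nonpos; linarith
  have habs : |I.Hmin| = E := abs_of_nonpos I.Hmin_nonpos
  -- The target is the exact cost of an optimum, so cost at most `v` characterizes optimality.
  set v := cost I.tape Q m x with hvdef
  have hvE : (v : ℝ) = Q * (m - E) := by rw [hvdef, I.cost_eq, hx', hEdef]; ring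
  have hvm : v ≤ Q * m := by
    have : (v : ℝ) ≤ Q * m := by rw [hvE]; gcongr; linarith
    exact_mod_cast this
  have hn : 0 < n := I.n_pos hm
  have hn' : (0 : ℝ) < n := by exact_mod_cast hn
  have hΛ := I.one_le_maxGap hm
  have hD : (0 : ℝ) < I.sqDeg := by exact_mod_cast I.sqDeg_pos hm
  have hT : (0 : ℝ) < I.totalDeg := lt_of_lt_of_le (by exact_mod_cast hm) I.le_totalDeg
  set s := width I.tape Q v with hs
  have hsn : s ≤ n := I.width_le hm v
  obtain ⟨hs1, hs2⟩ := I.width_cast_le hm hvm hvE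
  rw [← hQdef, ← hs] at hs1 hs2
  have hsE : (s : ℝ) * (I.maxGap ^ 2 * I.sqDeg) ≤ E ^ 2 := by
    rwa [le_div_iff₀ (by positivity)] at hs1
  -- the window
  obtain ⟨b, hb, hwin⟩ := exists_window (fun i => I.maxGap * I.deg i)
    (fun i => by positivity) hn s
  rw [← Finset.mul_sum, ← totalDeg] at hwin
  have hS : (window n b s).toFinset ⊆ range n := fun q hq => by
    rw [List.mem_toFinset] at hq
    exact Finset.mem_range.2 (lt_of_mem_window hn hq)
  -- From s Λ² S ≤ E² and Cauchy–Schwarz, s (ΛΣ)² ≤ E² n. Dividing by ΛΣ ≥ 2E bounds the average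
  -- window weight s ΛΣ / n by E/2.
  have hwin2 : (∑ i : Fin n, if (i : ℕ) ∈ (window n b s).toFinset then I.maxGap * I.deg i else 0) ≤
      2 * (1 / 4 * E) := by
    simp only [List.mem_toFinset]
    refine le_of_mul_le_mul_right (hwin.trans ?_) hn'
    have h2 := I.two_mul_abs_Hmin_le hm
    rw [habs] at h2
    have h3 := I.totalDeg_sq_le
    have h4 : (s : ℝ) * (I.maxGap * I.totalDeg) * (I.maxGap * I.totalDeg) ≤ E ^ 2 * n := by
      calc (s : ℝ) * (I.maxGap * I.totalDeg) * (I.maxGap * I.totalDeg)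
          = s * I.maxGap ^ 2 * I.totalDeg ^ 2 := by ring
        _ ≤ s * I.maxGap ^ 2 * (n * I.sqDeg) := by gcongr
        _ = (s * (I.maxGap ^ 2 * I.sqDeg)) * n := by ring
        _ ≤ E ^ 2 * n := by gcongr
    have h5 : E ^ 2 * n ≤ 2 * (1 / 4 * E) * n * (I.maxGap * I.totalDeg) := by
      calc E ^ 2 * n = 1 / 2 * E * n * (2 * E) := by ring
        _ ≤ 1 / 2 * E * n * (I.maxGap * I.totalDeg) := by gcongr
        _ = _ := by ring
    exact le_of_mul_le_mul_right (h4.trans h5) (by positivity)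
  have hPL : ∀ y, cost I.tape Q m y < thr I.tape Q v ↔ I.H (assignment n y) ≤ -(3 / 4 * E) :=
    fun y => I.thr_iff hvm hvE
  have hhalf := I.half_subcube (x := x) hS hwin2 (fun y => cost I.tape Q m y < thr I.tape Q v)
    fun y hy => (hPL y).2 (by rw [hx'] at hy; linarith)
  rw [List.toFinset_card_of_nodup (nodup_window hsn), length_window] at hhalf
  -- the number of labels of the first stage
  have hcard : ((({y ∈ (range n).powerset | cost I.tape Q m y < thr I.tape Q v}).card : ℕ) : ℝ) ≤
      2 ^ (n - s) := by
    have h1 : ({y ∈ (range n).powerset | cost I.tape Q m y < thr I.tape Q v}).card ≤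
        (univ.filter fun y => I.H y ≤ -(3 / 4 * E)).card := by
      refine Finset.card_le_card_of_injOn (assignment n) (fun y hy => ?_)
        (assignment_injOn.mono (Finset.coe_subset.2 (Finset.filter_subset _ _)))
      rw [Finset.mem_coe, Finset.mem_filter] at hy
      exact Finset.mem_coe.2 (Finset.mem_filter.2 ⟨mem_univ _, (hPL y).1 hy.2⟩)
    have h2 := I.card_H_le hm (t := 3 / 4 * E) (by positivity)
    -- The constant 2 (3/4)² = 9/8 exceeds ln 2, so each unit of width halves the bound.
    have h3 : Real.exp (-(2 * (3 / 4 * E) ^ 2 / (I.maxGap ^ 2 * I.sqDeg))) ≤ (1 / 2) ^ s := by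
      have h4 : ((1 : ℝ) / 2) ^ s = Real.exp (-(s * Real.log 2)) := by
        rw [Real.exp_neg, mul_comm, Real.exp_mul, Real.exp_log (by norm_num), Real.rpow_natCast,
          one_div, inv_pow]
      rw [h4, Real.exp_le_exp, neg_le_neg_iff]
      have h5 := Real.log_two_lt_d9
      have h6 : 2 * (3 / 4 * E) ^ 2 / (I.maxGap ^ 2 * I.sqDeg) =
          9 / 8 * (E ^ 2 / (I.maxGap ^ 2 * I.sqDeg)) := by ring
      rw [h6]
      have : (0 : ℝ) ≤ s := Nat.cast_nonneg s
      nlinarith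
    calc _ ≤ (((univ.filter fun y => I.H y ≤ -(3 / 4 * E)).card : ℕ) : ℝ) := by exact_mod_cast h1
      _ ≤ 2 ^ n * Real.exp (-(2 * (3 / 4 * E) ^ 2 / (I.maxGap ^ 2 * I.sqDeg))) := h2
      _ ≤ 2 ^ n * (1 / 2) ^ s := by gcongr
      _ = 2 ^ (n - s) := by
        rw [pow_sub₀ _ (by norm_num) hsn, one_div, inv_pow]
  have hpos : (1 : ℝ) ≤ ((({y ∈ (range n).powerset | cost I.tape Q m y < thr I.tape Q v}).card : ℕ) : ℝ) := by
    rw [Nat.one_le_cast, Nat.succ_le_iff, Finset.card_pos]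
    exact ⟨x, Finset.mem_filter.2 ⟨Finset.mem_powerset.2 hx, (hPL x).2 (by rw [hx']; linarith)⟩⟩
  -- the phases
  have hin : ∀ y ⊆ range (2 * n), ∀ r ∈ y, r < 2 * n + 1 := fun y hy r hr => by
    have := Finset.mem_range.1 (hy hr); omega
  have hcost : ∀ c, ∀ y ⊆ range (2 * n), phaseCost I.tape k Q c y =
      if cost I.tape Q m (y ∩ range n) < c then -1 else 1 := by
    intro c y hy
    rw [phaseCost, tape_zero, tape_one, I.wf.phase_costGates (by omega) (by omega) (hin y hy),
      I.wf.cost_congr Q (s := y ∩ range n) (s' := y) fun i hi => by simp [hi]]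
  obtain ⟨i₁, i₂, i₃, h1, h2, h3, h4⟩ := exists_search (n := n) (l := window n b s)
    (φL := phaseCost I.tape k Q (thr I.tape Q v)) (φG := phaseCost I.tape k Q (v + 1))
    (φ₀ := phaseRefl I.tape id (2 * n)) (φS := phaseRefl I.tape (fun i => (b + i) % n) s)
    (PL := fun y => cost I.tape Q m y < thr I.tape Q v) (PG := fun y => cost I.tape Q m y < v + 1)
    (x₀ := x) (nodup_window hsn) (fun q hq => lt_of_mem_window hn hq)
    (isSign_phase _ _ _ _) (isSign_phase _ _ _ _) (isSign_phase _ _ _ _) (isSign_phase _ _ _ _)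
    (hcost _) (hcost _)
    (fun y hy => by
      rw [phaseRefl, tape_zero, phase_reflGates (fun i hi => by simp only [id]; omega) (hin y hy)]
      refine if_congr ?_ rfl rfl
      rw [Finset.eq_empty_iff_forall_notMem]
      exact ⟨fun h r hr => h r (Finset.mem_range.1 (hy hr)) hr, fun h i _ => h i⟩)
    (fun y hy => by
      rw [phaseRefl, tape_zero, phase_reflGates (fun i hi => by
        have := Nat.mod_lt (b + i) hn; omega) (hin y hy)]
      refine if_congr ?_ rfl rfl
      rw [Finset.disjoint_right]
      constructor
      · intro h q hq
        obtain ⟨i, hi, rfl⟩ := List.mem_map.1 (List.mem_toFinset.1 hq)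
        exact h i (List.mem_range.1 hi)
      · exact fun h i hi => h (List.mem_toFinset.2 (List.mem_map.2 ⟨i, List.mem_range.2 hi, rfl⟩)))
    hx (Nat.lt_succ_self _) (by rw [length_window]; exact hhalf)
  rw [length_window] at h2 h3
  set c := ((({y ∈ (range n).powerset | cost I.tape Q m y < thr I.tape Q v}).card : ℕ) : ℝ)
  have h2n : (2 : ℝ) ^ n = 2 ^ (n - s) * 2 ^ s := by rw [← pow_add, Nat.sub_add_cancel hsn]
  have hps : (0 : ℝ) < 2 ^ s := by positivity
  have hps1 : (1 : ℝ) ≤ 2 ^ s := one_le_pow₀ (by norm_num)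
  -- A generous range of exponents: all three squares are at most `80 * 2 ^ n`, while `(3 ^ (n + 6))
  -- ^ 2` is larger.
  have hbig : ∀ i : ℕ, ((3 ^ i : ℕ) : ℝ) ^ 2 ≤ 80 * 2 ^ n → i < n + 6 := by
    intro i hi
    by_contra hcon
    push Not at hcon
    have h5 : (3 ^ i) ^ 2 ≤ 80 * 2 ^ n := by exact_mod_cast hi
    have h6 : 3 ^ (n + 6) ≤ 3 ^ i := Nat.pow_le_pow_right (by norm_num) hcon
    have h7 : 2 ^ n ≤ 3 ^ n := Nat.pow_le_pow_left (by norm_num) n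
    have h8 : 1 ≤ 3 ^ n := Nat.one_le_pow _ _ (by norm_num)
    rw [pow_add] at h6
    nlinarith
  have hle : (2 : ℝ) ^ s ≤ 2 ^ n := pow_le_pow_right₀ (by norm_num) hsn
  have hle' : (2 : ℝ) ^ (n - s) ≤ 2 ^ n := pow_le_pow_right₀ (by norm_num) (Nat.sub_le _ _)
  have a1 : (0 : ℝ) ≤ ((3 ^ i₁ : ℕ) : ℝ) ^ 2 := by positivity
  have a2 : (0 : ℝ) ≤ ((3 ^ i₂ : ℕ) : ℝ) ^ 2 := by positivity
  have a3 : (0 : ℝ) ≤ ((3 ^ i₃ : ℕ) : ℝ) ^ 2 := by positivity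
  refine ⟨v, b, i₁, i₂, i₃, hvm, hb, hbig _ (by nlinarith), hbig _ (by nlinarith),
    hbig _ (by nlinarith), ?_, ?_, ?_, ?_, ?_⟩
  · intro y hy
    have hy' : (cost I.tape Q m y : ℝ) ≤ v := by exact_mod_cast hy
    rw [I.cost_eq, hvE] at hy'
    have := le_of_mul_le_mul_left hy' hQ
    intro z
    have := I.Hmin_le z
    linarith
  -- Here γ n is E² / (Λ² S) times 1 / (2 ln 2) ≤ 1, so only the rounding has to be paid for.
  · rw [I.gammaExp_half hm, habs]
    refine le_trans ?_ hs2
    gcongr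
    have hl := Real.log_two_gt_d9
    have e : 1 / (2 * Real.log 2) * (E ^ 2 / (I.maxGap ^ 2 * (n * I.sqDeg))) * n =
        1 / (2 * Real.log 2) * (E ^ 2 / (I.maxGap ^ 2 * I.sqDeg)) := by field_simp
    rw [e]
    have : 1 / (2 * Real.log 2) ≤ 1 := by rw [div_le_one (by positivity)]; linarith
    exact mul_le_of_le_one_left (by positivity) this
  -- The first stage costs at most 5/2 · 2^n / c and the outer one at most 80 c / 2^s, both squared.
  -- The size `c` of the sublevel set cancels, and the factor 200 is rounded up to 256 = 16².
  · have h : (((3 ^ i₁ : ℕ) : ℝ) * ((3 ^ i₃ : ℕ) : ℝ)) ^ 2 ≤ 256 * 2 ^ (n - s) := by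
      have hp : (0 : ℝ) < 2 ^ s * c := by positivity
      refine le_of_mul_le_mul_right ?_ hp
      calc (((3 ^ i₁ : ℕ) : ℝ) * ((3 ^ i₃ : ℕ) : ℝ)) ^ 2 * (2 ^ s * c)
          = (((3 ^ i₁ : ℕ) : ℝ) ^ 2 * c) * (((3 ^ i₃ : ℕ) : ℝ) ^ 2 * 2 ^ s) := by ring
        _ ≤ (5 / 2 * 2 ^ n) * (80 * c) := by gcongr
        _ = 200 * 2 ^ (n - s) * (2 ^ s * c) := by rw [h2n]; ring
        _ ≤ 256 * 2 ^ (n - s) * (2 ^ s * c) := by gcongr; norm_num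
    exact_mod_cast h
  -- Now `2 ^ s` cancels and `c` remains, which the concentration bound keeps below `2 ^ (n - s)`.
  · have h : (((3 ^ i₂ : ℕ) : ℝ) * ((3 ^ i₃ : ℕ) : ℝ)) ^ 2 ≤ 256 * 2 ^ (n - s) := by
      refine le_of_mul_le_mul_right ?_ hps
      calc (((3 ^ i₂ : ℕ) : ℝ) * ((3 ^ i₃ : ℕ) : ℝ)) ^ 2 * 2 ^ s
          = ((3 ^ i₂ : ℕ) : ℝ) ^ 2 * (((3 ^ i₃ : ℕ) : ℝ) ^ 2 * 2 ^ s) := by ring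
        _ ≤ (5 / 2 * 2 ^ s) * (80 * c) := by gcongr
        _ = 200 * c * 2 ^ s := by ring
        _ ≤ 256 * 2 ^ (n - s) * 2 ^ s := by gcongr; norm_num
    exact_mod_cast h
  · refine h4.trans (le_of_eq ?_)
    have e : ∀ y, cost I.tape Q m (y ∩ range n) < v + 1 ↔ cost I.tape Q m y ≤ v := fun y => by
      rw [Nat.lt_succ_iff, I.wf.cost_congr Q (s := y ∩ range n) (s' := y) fun i hi => by simp [hi]]
    simp only [e]
    rfl

end MaxCSP

namespace QMachine

open Function Finsupp

variable {inp : ℕ → ℕ} {V : ℕ}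

/-! ## Programs that implement operators -/

/-- `mem'` agrees with `mem` outside the first `l` temporary registers. -/
def Fix (inp mem : ℕ → ℕ) (l : ℕ) (mem' : ℕ → ℕ) : Prop :=
  ∀ i, (i < inp 0 + 40 ∨ inp 0 + 40 + l ≤ i) → mem' i = mem i

theorem Fix.refl (mem : ℕ → ℕ) (l : ℕ) : Fix inp mem l mem := fun _ _ => rfl

theorem Fix.trans {mem mem' mem'' : ℕ → ℕ} {l l' : ℕ} (h : Fix inp mem l mem')
    (h' : Fix inp mem' l' mem'') (hl : l' ≤ l) : Fix inp mem l mem'' :=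
  fun i hi => (h' i (by omega)).trans (h i hi)

theorem Fix.lift {mem mem' : ℕ → ℕ} {l l' : ℕ} (h : Fix inp mem l mem') (hl : l ≤ l') :
    Fix inp mem l' mem' := fun i hi => h i (by omega)

theorem Fix.update {mem mem' : ℕ → ℕ} {l : ℕ} (h : Fix inp mem (l + 1) mem') (x : ℕ) :
    Fix inp mem (l + 1) (update mem' (inp 0 + (40 + l)) x) := fun i hi => by
  rw [update_of_ne (by omega)]; exact h i hi

theorem Fix.reg {mem mem' : ℕ → ℕ} {l c : ℕ} (h : Fix inp mem l mem') (hc : c < 40) :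
    mem' (inp 0 + c) = mem (inp 0 + c) := h _ (.inl (by omega))

/-- In all memories that differ from `mem` at most in temporary registers, the program `P` applies
the operator `A` in at most `N` steps, changing only the first `l` temporary registers. -/
def Impl (inp : ℕ → ℕ) (V : ℕ) (mem : ℕ → ℕ) (l : ℕ) (P : Prog) (N : ℕ)
    (A : QState →ₗ[ℂ] QState) : Prop :=
  ∀ mem', Fix inp mem 24 mem' → ∀ ψ, ND inp V P N mem' ψ fun mem'' ψ' =>
    ψ' = A ψ ∧ Fix inp mem' l mem''

variable {mem : ℕ → ℕ} {l l' N N' M : ℕ} {P P' : Prog} {A A' : QState →ₗ[ℂ] QState}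

theorem Impl.lift (h : Impl inp V mem l P N A) (hl : l ≤ l') : Impl inp V mem l' P N A :=
  fun mem' hm ψ => (h mem' hm ψ).weaken fun _ _ h => ⟨h.1, h.2.lift hl⟩

theorem Impl.steps (h : Impl inp V mem l P N A) (hN : N ≤ N') : Impl inp V mem l P N' A :=
  fun mem' hm ψ => (h mem' hm ψ).steps hN

theorem Impl.seq (hl : l ≤ 24) (h : Impl inp V mem l P N A) (h' : Impl inp V mem l P' N' A') :
    Impl inp V mem l (.seq P P') (N + N') (A' ∘ₗ A) := fun mem' hm ψ =>
  .seq <| (h mem' hm ψ).weaken fun mem₁ ψ₁ h₁ => by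
    refine (h' mem₁ (hm.trans h₁.2 hl) ψ₁).weaken fun mem₂ ψ₂ h₂ => ⟨?_, h₁.2.trans h₂.2 le_rfl⟩
    rw [h₂.1, h₁.1]; rfl

theorem Impl.gate {g : Gate AExp} {g' : Gate ℕ}
    (h : ∀ mem', Fix inp mem 24 mem' → (g.map fun a => a.eval inp mem') = g') :
    Impl inp V mem 0 (.gate g) 1 g'.op := fun mem' hm ψ => .gate ⟨by rw [h mem' hm], .refl _ _⟩

/-- The composition of `A 0`, …, `A (M - 1)`, the first one applied first. -/
noncomputable def iter (A : ℕ → QState →ₗ[ℂ] QState) : ℕ → QState →ₗ[ℂ] QState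
  | 0 => LinearMap.id
  | M + 1 => A M ∘ₗ iter A M

theorem iter_const (A : QState →ₗ[ℂ] QState) (M : ℕ) : iter (fun _ => A) M = A ^ M := by
  induction M with
  | zero => rfl
  | succ M ih => rw [iter, ih, pow_succ']; rfl

/-- Nested loops use the counters `40 + l` of increasing levels. A body of level `l` changes only
temporaries below its own counter, so the counter survives, and the loop as a whole has level `l +
1`. -/
theorem Impl.forLoop {A : ℕ → QState →ₗ[ℂ] QState} {bound : AExp} (hl : l < 24) (hM : M ≤ V)
    (hb : ∀ mem', Fix inp mem 24 mem' → bound.eval inp mem' = M)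
    (h : ∀ i < M, ∀ mem', Fix inp mem 24 mem' → mem' (inp 0 + (40 + l)) = i → ∀ ψ,
      ND inp V P N mem' ψ fun mem'' ψ' => ψ' = A i ψ ∧ Fix inp mem' l mem'') :
    Impl inp V mem (l + 1) (forLoop (40 + l) bound P) (M * (N + 2) + 2) (iter A M) := by
  intro mem' hm ψ
  refine ND.forLoop (fun i mem₁ ψ₁ => ψ₁ = iter A i ψ ∧ Fix inp mem' (l + 1) mem₁) hM
    ⟨rfl, (Fix.refl _ _).update 0⟩ (fun i _ mem₁ ψ₁ _ h₁ => hb _ (hm.trans h₁.2 hl)) ?_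
    (fun mem₁ ψ₁ _ h₁ => h₁)
  intro i hi mem₁ ψ₁ _ hc h₁
  refine (h i hi mem₁ (hm.trans h₁.2 hl) hc ψ₁).weaken fun mem₂ ψ₂ h₂ => ⟨?_, ?_, ?_⟩
  · rw [h₂.2 _ (.inr (by omega)), hc]
  · rw [h₂.1, h₁.1]; rfl
  · exact (h₁.2.trans h₂.2 (by omega)).update _

theorem Impl.iterate {bound : AExp} (hl : l < 24) (hM : M ≤ V)
    (hb : ∀ mem', Fix inp mem 24 mem' → bound.eval inp mem' = M) (h : Impl inp V mem l P N A) :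
    Impl inp V mem (l + 1) (QMachine.forLoop (40 + l) bound P) (M * (N + 2) + 2) (A ^ M) := by
  rw [← iter_const]
  exact .forLoop hl hM hb fun i _ mem' hm _ => h mem' hm

/-- The default is never reached, because the index stays below the length. -/
theorem iter_gatesOp {α : Type} [Inhabited α] (L : List α) (f : α → List (Gate ℕ)) {j : ℕ}
    (hj : j ≤ L.length) :
    iter (fun i => gatesOp (f (L.getD i default))) j = gatesOp ((L.take j).flatMap f) := by
  induction j with
  | zero => simp [iter, gatesOp]
  | succ j ih =>
    rw [iter, ih (by omega), List.take_add_one, List.flatMap_append, gatesOp_append,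
      List.getElem?_eq_getElem hj, List.getD_eq_getElem _ _ hj]
    simp

theorem Impl.gateLoop {α : Type} [Inhabited α] {L : List α} {f : α → List (Gate ℕ)} {bound : AExp}
    (hM : L.length ≤ V) (hb : ∀ mem', Fix inp mem 24 mem' → bound.eval inp mem' = L.length)
    (h : ∀ i (hi : i < L.length), ∀ mem', Fix inp mem 24 mem' → mem' (inp 0 + 40) = i → ∀ ψ,
      ND inp V P N mem' ψ fun mem'' ψ' => ψ' = gatesOp (f L[i]) ψ ∧ mem'' = mem') :
    Impl inp V mem 1 (QMachine.forLoop 40 bound P) (L.length * (N + 2) + 2)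
      (gatesOp (L.flatMap f)) := by
  have := Impl.forLoop (l := 0) (A := fun i => gatesOp (f (L.getD i default))) (N := N) (P := P)
    (by norm_num) hM hb fun i hi mem' hm hc ψ => (h i hi mem' hm hc ψ).weaken fun mem'' ψ' h' => by
      rw [h'.1, h'.2, List.getD_eq_getElem _ _ hi]
      exact ⟨rfl, .refl _ _⟩
  rwa [iter_gatesOp L f le_rfl, List.take_length] at this

/-! ### Amplification -/

/-- `t` rounds of amplitude amplification, with a counter at level `l`. -/
def ampProg (l : ℕ) (W W' Z R : Prog) (t : AExp) : Prog :=
  .seq W (forLoop (40 + l) t (.seq Z (.seq W' (.seq R W))))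

def ampProgInv (l : ℕ) (W W' Z R : Prog) (t : AExp) : Prog :=
  .seq (forLoop (40 + l) t (.seq W' (.seq R (.seq W Z)))) W'

section
variable {W W' Z R : Prog} {B B' C D : QState →ₗ[ℂ] QState} {t : AExp} {tv a : ℕ}

/-- Besides the initial call, each of the `tv` rounds calls `W` and `W'` once; this makes `2 tv + 1`
calls. -/
theorem Impl.amp (hl : l < 24) (ht : tv ≤ V)
    (hb : ∀ mem', Fix inp mem 24 mem' → t.eval inp mem' = tv)
    (hW : Impl inp V mem l W a B) (hW' : Impl inp V mem l W' a B')
    (hZ : Impl inp V mem l Z N C) (hR : Impl inp V mem l R N D) :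
    Impl inp V mem (l + 1) (ampProg l W W' Z R t) ((2 * tv + 1) * (a + N + 2))
      (ampOp B B' C D tv) := by
  have h := Impl.seq (by omega) hZ (.seq (by omega) hW' (.seq (by omega) hR hW))
  have := Impl.seq (by omega) (hW.lift (Nat.le_succ l)) (Impl.iterate hl ht hb h)
  exact this.steps (by nlinarith)

theorem Impl.ampInv (hl : l < 24) (ht : tv ≤ V)
    (hb : ∀ mem', Fix inp mem 24 mem' → t.eval inp mem' = tv)
    (hW : Impl inp V mem l W a B) (hW' : Impl inp V mem l W' a B')
    (hZ : Impl inp V mem l Z N C) (hR : Impl inp V mem l R N D) :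
    Impl inp V mem (l + 1) (ampProgInv l W W' Z R t) ((2 * tv + 1) * (a + N + 2))
      (ampOpInv B B' C D tv) := by
  have h := Impl.seq (by omega) hW' (.seq (by omega) hR (.seq (by omega) hW hZ))
  have := Impl.seq (by omega) (Impl.iterate hl ht hb h) (hW'.lift (Nat.le_succ l))
  exact this.steps (by nlinarith)

end

/-! ### Stored circuits -/

/-- Component `j` of the stored gate `g`. -/
def gateCell (g : AExp) (j : ℕ) : AExp :=
  .load (.add (.add (.mul (.lit 2) (.input (.lit 0))) (.lit (64 + j))) (.mul (.lit 3) g))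

/-- The circuit `C` is stored from gate number `o` on. -/
def Stored (inp mem : ℕ → ℕ) (o : ℕ) (C : List (ℕ × ℕ × ℕ)) : Prop :=
  ∀ i (h : i < C.length), mem (2 * inp 0 + (64 + 0) + 3 * (o + i)) = C[i].1 ∧
    mem (2 * inp 0 + (64 + 1) + 3 * (o + i)) = C[i].2.1 ∧
    mem (2 * inp 0 + (64 + 2) + 3 * (o + i)) = C[i].2.2

theorem Stored.fix {mem' : ℕ → ℕ} {o : ℕ} {C : List (ℕ × ℕ × ℕ)} (h : Stored inp mem o C)
    (hm : Fix inp mem 24 mem') : Stored inp mem' o C := fun i hi => by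
  rw [hm _ (.inr (by omega)), hm _ (.inr (by omega)), hm _ (.inr (by omega))]
  exact h i hi

/-- Apply the stored gate `g`. -/
def storedGate (g : AExp) : Prog :=
  .gate (.toffoli (gateCell g 0) (gateCell g 1) (gateCell g 2))

/-- Apply the `c` stored gates from number `o` on. -/
def fwd (o c : AExp) : Prog := forLoop 40 c (storedGate (.add o (reg 40)))

/-- Apply the `c` stored gates from number `o` on, in reverse order. -/
def bwd (o c : AExp) : Prog :=
  forLoop 40 c (storedGate (.add o (.sub (.sub c (.lit 1)) (reg 40))))

theorem gatesOp_toffoli (C : List (ℕ × ℕ × ℕ)) :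
    gatesOp (C.flatMap fun g => [.toffoli g.1 g.2.1 g.2.2]) = permOp (tofs C) := by
  induction C with
  | nil => exact permOp_id.symm
  | cons g C ih =>
    rw [List.flatMap_cons, gatesOp_append, ih, gatesOp_singleton, op_toffoli, permOp_comp]
    rfl

section
variable {o c : AExp} {ov : ℕ} {C : List (ℕ × ℕ × ℕ)}

theorem Impl.fwd (hV : C.length ≤ V) (hS : Stored inp mem ov C)
    (ho : ∀ mem', Fix inp mem 24 mem' → o.eval inp mem' = ov)
    (hc : ∀ mem', Fix inp mem 24 mem' → c.eval inp mem' = C.length) :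
    Impl inp V mem 1 (QMachine.fwd o c) (C.length * 3 + 2) (permOp (tofs C)) := by
  rw [← gatesOp_toffoli]
  refine .gateLoop hV hc fun i hi mem' hm hi' ψ => .gate ⟨?_, rfl⟩
  have h := hS.fix hm i hi
  simp only [Gate.map, gateCell, AExp.eval, ho mem' hm, eval_reg, hi', gatesOp_singleton, h]

theorem Impl.bwd (hV : C.length ≤ V) (hS : Stored inp mem ov C)
    (ho : ∀ mem', Fix inp mem 24 mem' → o.eval inp mem' = ov)
    (hc : ∀ mem', Fix inp mem 24 mem' → c.eval inp mem' = C.length) :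
    Impl inp V mem 1 (QMachine.bwd o c) (C.length * 3 + 2) (permOp (tofs C.reverse)) := by
  rw [← gatesOp_toffoli, ← C.length_reverse]
  refine .gateLoop (by simpa using hV) (by simpa using hc) fun i hi mem' hm hi' ψ => .gate ⟨?_, rfl⟩
  rw [List.length_reverse] at hi
  have h := hS.fix hm (C.length - 1 - i) (by omega)
  simp only [Gate.map, gateCell, AExp.eval, ho mem' hm, hc mem' hm, eval_reg, hi', gatesOp_singleton,
    h, List.getElem_reverse]

/-! ### Oracles -/

/-- The qubit in which the token of an oracle starts. -/
def tokenQubit : AExp := .add (.mul (.lit 2) (.input (.lit 0))) (.lit 1)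

theorem eval_tokenQubit (mem : ℕ → ℕ) : tokenQubit.eval inp mem = 2 * inp 0 + 1 := rfl

/-- Run the stored circuit, apply `P`, and undo the circuit. -/
def conjProg (o c : AExp) (P : Prog) : Prog :=
  .seq (.gate (.x tokenQubit)) (.seq (fwd o c) (.seq P (.seq (bwd o c) (.gate (.x tokenQubit)))))

theorem Impl.conjProg (hV : C.length ≤ V) (hS : Stored inp mem ov C)
    (ho : ∀ mem', Fix inp mem 24 mem' → o.eval inp mem' = ov)
    (hc : ∀ mem', Fix inp mem 24 mem' → c.eval inp mem' = C.length) (hP : Impl inp V mem 1 P N A) :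
    Impl inp V mem 1 (QMachine.conjProg o c P) (N + C.length * 6 + 6)
      (permOp (flipBit (2 * inp 0 + 1)) ∘ₗ permOp (tofs C.reverse) ∘ₗ A ∘ₗ permOp (tofs C) ∘ₗ
        permOp (flipBit (2 * inp 0 + 1))) := by
  have hx : Impl inp V mem 1 (.gate (.x tokenQubit)) 1 (permOp (flipBit (2 * inp 0 + 1))) := by
    rw [← op_x]
    exact (Impl.gate fun mem' _ => rfl).lift (by norm_num)
  have := Impl.seq (by norm_num) hx (.seq (by norm_num) (.fwd hV hS ho hc) (.seq (by norm_num) hP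
    (.seq (by norm_num) (.bwd hV hS ho hc) hx)))
  exact this.steps (by omega)

/-- Change the sign of the labels in which qubit `q` is one. -/
def signProg (q : AExp) : Prog :=
  .seq (.gate (.t q)) (.seq (.gate (.t q)) (.seq (.gate (.t q)) (.gate (.t q))))

/-- The phase oracle with circuit `(o, c)`. -/
def oracle (o c q m : AExp) : Prog := conjProg o c (forLoop 40 m (signProg (.add q (reg 40))))

theorem iter_diagOp (f : ℕ → Finset ℕ → ℂ) (M : ℕ) :
    iter (fun r => diagOp (f r)) M = diagOp fun s => ∏ r ∈ Finset.range M, f r s := by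
  induction M with
  | zero => simp [iter, diagOp_one]
  | succ M ih =>
    rw [iter, ih, diagOp_comp]
    congr 1
    ext s
    rw [Finset.prod_range_succ, mul_comm]

theorem Impl.oracle {q m : AExp} {qv mv : ℕ} (hV : C.length ≤ V) (hmV : mv ≤ V)
    (hS : Stored inp mem ov C)
    (ho : ∀ mem', Fix inp mem 24 mem' → o.eval inp mem' = ov)
    (hc : ∀ mem', Fix inp mem 24 mem' → c.eval inp mem' = C.length)
    (hq : ∀ mem', Fix inp mem 24 mem' → q.eval inp mem' = qv)
    (hm : ∀ mem', Fix inp mem 24 mem' → m.eval inp mem' = mv) :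
    Impl inp V mem 1 (QMachine.oracle o c q m) (mv * 6 + C.length * 6 + 8)
      (diagOp (phase (2 * inp 0 + 1) C qv mv)) := by
  rw [← oracle_op]
  refine (Impl.conjProg hV hS ho hc (N := mv * 6 + 2) ?_).steps (by omega)
  rw [← iter_diagOp (fun r s => if qv + r ∈ s then -1 else 1)]
  refine Impl.forLoop (l := 0) (by norm_num) hmV hm fun i hi mem' hfix hi' ψ => ?_
  have e : (AExp.add q (reg 40)).eval inp mem' = qv + i := by
    simp only [AExp.eval, hq mem' hfix, eval_reg]; rw [← hi']
  refine .seq (N₁ := 1) (N₂ := 3) (.gate (.seq (N₁ := 1) (N₂ := 2) (.gate (.seq (N₁ := 1) (N₂ := 1)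
    (.gate (.gate ⟨?_, .refl _ _⟩))))))
  rw [← op_t_pow_four]
  simp only [Gate.map, e, LinearMap.comp_apply]

end

end QMachine

namespace QMachine

open Function Finsupp

variable {inp : ℕ → ℕ} {V : ℕ} {mem : ℕ → ℕ}

/-! ## The search program -/

/-- The number of variables. -/
def numVars : AExp := .input (.lit 0)

/-- The remainder of `x` modulo `y`. -/
def modExp (x y : AExp) : AExp := .sub x (.mul (.div x y) y)

theorem eval_modExp (x y : AExp) :
    (modExp x y).eval inp mem = x.eval inp mem % y.eval inp mem := by
  simp only [modExp, AExp.eval]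
  rw [mul_comm, Nat.mod_eq_sub]

/-- Variable number `i` of the window. -/
def windowVar (i : AExp) : AExp := modExp (.add (reg 19) i) numVars

/-- Counting down: `c - 1 - i` for the counter `i`. -/
def downFrom (c : AExp) : AExp := .sub (.sub c (.lit 1)) (reg 40)

/-- Hadamard gates on the qubits `q` for the values of the counter below `c`. -/
def hadProg (c q : AExp) : Prog := forLoop 40 c (.gate (.h q))

def moveProg (c q : AExp) : Prog :=
  forLoop 40 c (.seq (.gate (.cnot q (.add numVars q))) (.gate (.cnot (.add numVars q) q)))

def moveProgInv (c q : AExp) : Prog :=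
  forLoop 40 c (.seq (.gate (.cnot (.add numVars q) q)) (.gate (.cnot q (.add numVars q))))

section
variable {c q : AExp} {l : List ℕ}

theorem hadOp_eq (l : List ℕ) : hadOp l = gatesOp (l.flatMap fun q => [.h q]) := by
  rw [hadOp, ← List.map_eq_flatMap]

theorem Impl.hadProg (hV : l.length ≤ V)
    (hc : ∀ mem', Fix inp mem 24 mem' → c.eval inp mem' = l.length)
    (hq : ∀ i (hi : i < l.length), ∀ mem', Fix inp mem 24 mem' → mem' (inp 0 + 40) = i →
      q.eval inp mem' = l[i]) :
    Impl inp V mem 1 (QMachine.hadProg c q) (l.length * 3 + 2) (hadOp l) := by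
  rw [hadOp_eq]
  exact .gateLoop hV hc fun i hi mem' hm hi' ψ => .gate ⟨by
    rw [Gate.map, hq i hi mem' hm hi', gatesOp_singleton], rfl⟩

theorem Impl.moveProg (hV : l.length ≤ V)
    (hc : ∀ mem', Fix inp mem 24 mem' → c.eval inp mem' = l.length)
    (hq : ∀ i (hi : i < l.length), ∀ mem', Fix inp mem 24 mem' → mem' (inp 0 + 40) = i →
      q.eval inp mem' = l[i]) :
    Impl inp V mem 1 (QMachine.moveProg c q) (l.length * 4 + 2) (gatesOp (moveGates (inp 0) l)) :=
  .gateLoop hV hc fun i hi mem' hm hi' ψ => .seq (N₁ := 1) (N₂ := 1) (.gate (.gate ⟨by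
    simp only [Gate.map, AExp.eval, numVars, hq i hi mem' hm hi', gatesOp, LinearMap.comp_apply,
      LinearMap.id_apply], rfl⟩))

theorem Impl.moveProgInv (hV : l.length ≤ V)
    (hc : ∀ mem', Fix inp mem 24 mem' → c.eval inp mem' = l.length)
    (hq : ∀ i (hi : i < l.length), ∀ mem', Fix inp mem 24 mem' → mem' (inp 0 + 40) = i →
      q.eval inp mem' = l.reverse[i]'(by simpa using hi)) :
    Impl inp V mem 1 (QMachine.moveProgInv c q) (l.length * 4 + 2)
      (gatesOp (moveGates (inp 0) l).reverse) := by
  rw [moveGates, List.reverse_flatMap, ← l.length_reverse]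
  refine .gateLoop (by simpa using hV) (by simpa using hc) fun i hi mem' hm hi' ψ =>
    .seq (N₁ := 1) (N₂ := 1) (.gate (.gate ⟨?_, rfl⟩))
  rw [List.length_reverse] at hi
  simp only [Gate.map, AExp.eval, numVars, hq i hi mem' hm hi', Function.comp_apply,
    List.reverse_cons, List.reverse_nil, List.nil_append, List.singleton_append, gatesOp,
    LinearMap.comp_apply, LinearMap.id_apply]

end

/-- Phase oracle for costs less than `m`. -/
def costOracle (m : AExp) : Prog := oracle (.lit 0) (reg 15) (reg 1) m

/-- Reflection about zero of all qubits. -/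
def zeroOracle : Prog := oracle (reg 15) (.sub (reg 34) (reg 15)) tokenQubit (.lit 1)

/-- Reflection about zero of the qubits in the window. -/
def windowOracle : Prog := oracle (reg 34) (.sub (reg 35) (reg 34)) tokenQubit (.lit 1)

def targetExp : AExp := .add (reg 18) (.lit 1)

def firstStage : Prog := ampProg 1 (hadProg numVars (reg 40)) (hadProg numVars (downFrom numVars))
  (costOracle (reg 25)) zeroOracle (reg 20)

def firstStageInv : Prog := ampProgInv 1 (hadProg numVars (reg 40))
  (hadProg numVars (downFrom numVars)) (costOracle (reg 25)) zeroOracle (reg 20)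

def secondStage : Prog := ampProg 1 (hadProg (reg 24) (windowVar (reg 40)))
  (hadProg (reg 24) (windowVar (downFrom (reg 24)))) (costOracle targetExp) windowOracle (reg 21)

def secondStageInv : Prog := ampProgInv 1 (hadProg (reg 24) (windowVar (reg 40)))
  (hadProg (reg 24) (windowVar (downFrom (reg 24)))) (costOracle targetExp) windowOracle (reg 21)

def prepProg : Prog :=
  .seq firstStage (.seq (moveProg (reg 24) (windowVar (reg 40))) secondStage)

def prepProgInv : Prog :=
  .seq secondStageInv (.seq (moveProgInv (reg 24) (windowVar (downFrom (reg 24)))) firstStageInv)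

def searchProg : Prog :=
  ampProg 2 prepProg prepProgInv (costOracle targetExp) zeroOracle (reg 22)

/-- The memory holds the circuits and parameters of a search. -/
structure Ready (inp mem : ℕ → ℕ) (b s t₁ t₂ t₃ cL v q : ℕ) (C C₀ C₁ : List (ℕ × ℕ × ℕ)) : Prop where
  r1 : mem (inp 0 + 1) = q
  r15 : mem (inp 0 + 15) = C.length
  r34 : mem (inp 0 + 34) = C.length + C₀.length
  r35 : mem (inp 0 + 35) = C.length + C₀.length + C₁.length
  r18 : mem (inp 0 + 18) = v
  r19 : mem (inp 0 + 19) = b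
  r24 : mem (inp 0 + 24) = s
  r25 : mem (inp 0 + 25) = cL
  r20 : mem (inp 0 + 20) = t₁
  r21 : mem (inp 0 + 21) = t₂
  r22 : mem (inp 0 + 22) = t₃
  stored : Stored inp mem 0 C
  stored₀ : Stored inp mem C.length C₀
  stored₁ : Stored inp mem (C.length + C₀.length) C₁

section
variable {b s t₁ t₂ t₃ cL v q B : ℕ} {C C₀ C₁ : List (ℕ × ℕ × ℕ)}

/-- `B` bounds every oracle call, every Hadamard layer and the move. The step count is then the
nesting of the three numbers of rounds, where an outer round runs the two inner stages forwards and
backwards. -/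
theorem Ready.searchProg (h : Ready inp mem b s t₁ t₂ t₃ cL v q C C₀ C₁)
    (hs : s ≤ inp 0) (hBV : B ≤ V) (hn : inp 0 * 4 + 2 ≤ B) (hv : (v + 1) * 6 + C.length * 6 + 8 ≤ B)
    (hL : cL * 6 + C.length * 6 + 8 ≤ B) (h₀ : C₀.length * 6 + 14 ≤ B) (h₁ : C₁.length * 6 + 14 ≤ B)
    (ht₁ : t₁ ≤ V) (ht₂ : t₂ ≤ V) (ht₃ : t₃ ≤ V) :
    Impl inp V mem 3 QMachine.searchProg
      ((2 * t₃ + 1) * (((2 * t₁ + 1) * (2 * B + 2) + B + (2 * t₂ + 1) * (2 * B + 2)) + B + 2))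
      (searchOp (inp 0) (window (inp 0) b s) (phase (2 * inp 0 + 1) C q cL)
        (phase (2 * inp 0 + 1) C q (v + 1)) (phase (2 * inp 0 + 1) C₀ (2 * inp 0 + 1) 1)
        (phase (2 * inp 0 + 1) C₁ (2 * inp 0 + 1) 1) t₁ t₂ t₃) := by
  have hr : ∀ c < 40, ∀ mem', Fix inp mem 24 mem' → (reg c).eval inp mem' = mem (inp 0 + c) :=
    fun c hc mem' hm => hm.reg hc
  have hcost : ∀ (e : AExp) (x : ℕ), x * 6 + C.length * 6 + 8 ≤ B →
      (∀ mem', Fix inp mem 24 mem' → e.eval inp mem' = x) →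
      Impl inp V mem 1 (costOracle e) B (diagOp (phase (2 * inp 0 + 1) C q x)) := fun e x hx he =>
    (Impl.oracle (by omega) (by omega) h.stored (fun _ _ => rfl)
      (fun m hm => (hr 15 (by norm_num) m hm).trans h.r15)
      (fun m hm => (hr 1 (by norm_num) m hm).trans h.r1) he).steps hx
  have hzG := hcost targetExp (v + 1) hv fun m hm => by
    rw [targetExp, AExp.eval, hr 18 (by norm_num) m hm, h.r18]; rfl
  have hzL := hcost (reg 25) cL hL fun m hm => (hr 25 (by norm_num) m hm).trans h.r25
  have hz0 : Impl inp V mem 1 zeroOracle B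
      (diagOp (phase (2 * inp 0 + 1) C₀ (2 * inp 0 + 1) 1)) :=
    (Impl.oracle (by omega) (by omega) h.stored₀ (fun m hm => (hr 15 (by norm_num) m hm).trans h.r15)
      (fun m hm => by
        rw [AExp.eval, hr 34 (by norm_num) m hm, hr 15 (by norm_num) m hm, h.r34, h.r15,
          Nat.add_sub_cancel_left])
      (fun m _ => rfl) (fun _ _ => rfl)).steps (by omega)
  have hz1 : Impl inp V mem 1 windowOracle B
      (diagOp (phase (2 * inp 0 + 1) C₁ (2 * inp 0 + 1) 1)) :=
    (Impl.oracle (by omega) (by omega) h.stored₁ (fun m hm => (hr 34 (by norm_num) m hm).trans h.r34)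
      (fun m hm => by
        rw [AExp.eval, hr 35 (by norm_num) m hm, hr 34 (by norm_num) m hm, h.r35, h.r34,
          Nat.add_sub_cancel_left])
      (fun m _ => rfl) (fun _ _ => rfl)).steps (by omega)
  have hd : ∀ (c : AExp) (x i : ℕ) mem', c.eval inp mem' = x → mem' (inp 0 + 40) = i →
      (downFrom c).eval inp mem' = x - 1 - i := fun c x i mem' hc hi => by
    simp only [downFrom, AExp.eval, hc, eval_reg, hi]
  have hwv : ∀ (e : AExp) (i : ℕ) mem', Fix inp mem 24 mem' → e.eval inp mem' = i →
      (windowVar e).eval inp mem' = (b + i) % inp 0 := fun e i mem' hm he => by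
    rw [windowVar, eval_modExp]
    simp only [AExp.eval, hr 19 (by norm_num) mem' hm, h.r19, he, numVars]
  have hr24 := fun m hm => (hr 24 (by norm_num) m hm).trans h.r24
  have hH : Impl inp V mem 1 (QMachine.hadProg numVars (reg 40)) B (hadOp (List.range (inp 0))) :=
    (Impl.hadProg (by simp; omega) (fun _ _ => by simp [numVars, AExp.eval])
      fun i hi mem' hm hi' => by rw [eval_reg, hi', List.getElem_range]).steps (by simp; omega)
  have hH' : Impl inp V mem 1 (QMachine.hadProg numVars (downFrom numVars)) B
      (hadOp (List.range (inp 0)).reverse) :=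
    (Impl.hadProg (by simp; omega) (fun _ _ => by simp [numVars, AExp.eval])
      fun i hi mem' hm hi' => by
        rw [hd numVars (inp 0) i mem' rfl hi', List.getElem_reverse, List.getElem_range,
          List.length_range]).steps (by simp; omega)
  have hwl := length_window (inp 0) b s
  have hH1 : Impl inp V mem 1 (QMachine.hadProg (reg 24) (windowVar (reg 40))) B
      (hadOp (window (inp 0) b s)) :=
    (Impl.hadProg (by omega) (fun m hm => by rw [hwl]; exact hr24 m hm)
      fun i hi mem' hm hi' => by
        rw [hwv (reg 40) i mem' hm hi']; simp [window]).steps (by omega)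
  have hdown : ∀ i < s, ∀ mem', Fix inp mem 24 mem' → mem' (inp 0 + 40) = i →
      (windowVar (downFrom (reg 24))).eval inp mem' = (b + (s - 1 - i)) % inp 0 :=
    fun i hi mem' hm hi' => hwv _ _ mem' hm (hd _ _ _ mem' (hr24 mem' hm) hi')
  have hH1' : Impl inp V mem 1 (QMachine.hadProg (reg 24) (windowVar (downFrom (reg 24)))) B
      (hadOp (window (inp 0) b s).reverse) :=
    (Impl.hadProg (by simp; omega) (fun m hm => by rw [List.length_reverse, hwl]; exact hr24 m hm)
      fun i hi mem' hm hi' => by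
        rw [List.length_reverse, hwl] at hi
        rw [hdown i hi mem' hm hi']; simp [window]).steps (by simp; omega)
  have hM : Impl inp V mem 1 (QMachine.moveProg (reg 24) (windowVar (reg 40))) B
      (gatesOp (moveGates (inp 0) (window (inp 0) b s))) :=
    (Impl.moveProg (by omega) (fun m hm => by rw [hwl]; exact hr24 m hm)
      fun i hi mem' hm hi' => by
        rw [hwv (reg 40) i mem' hm hi']; simp [window]).steps (by omega)
  have hM' : Impl inp V mem 1 (QMachine.moveProgInv (reg 24) (windowVar (downFrom (reg 24)))) B
      (gatesOp (moveGates (inp 0) (window (inp 0) b s)).reverse) :=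
    (Impl.moveProgInv (by omega) (fun m hm => by rw [hwl]; exact hr24 m hm)
      fun i hi mem' hm hi' => by
        rw [hwl] at hi
        rw [hdown i hi mem' hm hi']; simp [window]).steps (by omega)
  have ht20 := fun m hm => (hr 20 (by norm_num) m hm).trans h.r20
  have ht21 := fun m hm => (hr 21 (by norm_num) m hm).trans h.r21
  have ht22 := fun m hm => (hr 22 (by norm_num) m hm).trans h.r22
  have a1 := Impl.amp (by norm_num) ht₁ ht20 hH hH' hzL hz0
  have a1' := Impl.ampInv (by norm_num) ht₁ ht20 hH hH' hzL hz0
  have a2 := Impl.amp (by norm_num) ht₂ ht21 hH1 hH1' hzG hz1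
  have a2' := Impl.ampInv (by norm_num) ht₂ ht21 hH1 hH1' hzG hz1
  have p := (Impl.seq (by norm_num) a1 (.seq (by norm_num) (hM.lift (by norm_num)) a2)).steps
    (N' := (2 * t₁ + 1) * (2 * B + 2) + B + (2 * t₂ + 1) * (2 * B + 2)) (le_of_eq (by ring))
  have p' := (Impl.seq (by norm_num) a2' (.seq (by norm_num) (hM'.lift (by norm_num)) a1')).steps
    (N' := (2 * t₁ + 1) * (2 * B + 2) + B + (2 * t₂ + 1) * (2 * B + 2)) (le_of_eq (by ring))
  exact Impl.amp (by norm_num) ht₃ ht22 p p' (hzG.lift (by norm_num)) (hz0.lift (by norm_num))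

end

end QMachine

namespace QMachine

open Function Finsupp

variable {inp : ℕ → ℕ} {V : ℕ} {mem : ℕ → ℕ}

/-! ## Marking good labels -/

/-- The qubit that tells whether a label is good. -/
def flagQubit : AExp := .mul (.lit 2) numVars

/-- Flip the flag qubit on the labels of cost at most the target. -/
def markProg : Prog := conjProg (.lit 0) (reg 15)
  (forLoop 40 targetExp (.gate (.cnot (.add (reg 1) (reg 40)) flagQubit)))

/-- Action of the marking program on labels. -/
def mark (a : ℕ) (C : List (ℕ × ℕ × ℕ)) (q f c : ℕ) (s : Finset ℕ) : Finset ℕ :=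
  flipBit a (tofs C.reverse (tofs ((List.range c).map fun r => (q + r, q + r, f))
    (tofs C (flipBit a s))))

theorem gatesOp_cnot (C : List (ℕ × ℕ)) :
    gatesOp (C.flatMap fun g => [.cnot g.1 g.2]) =
      permOp (tofs (C.map fun g => (g.1, g.1, g.2))) := by
  induction C with
  | nil => exact permOp_id.symm
  | cons g C ih =>
    rw [List.flatMap_cons, gatesOp_append, ih, gatesOp_singleton, op_cnot, permOp_comp]
    rfl

theorem UPair.tofs (C : List (ℕ × ℕ × ℕ)) :
    UPair (permOp (QMachine.tofs C)) (permOp (QMachine.tofs C.reverse)) :=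
  .perm (tofs_reverse_tofs C) (tofs_tofs_reverse C)

theorem mark_op (a : ℕ) (C : List (ℕ × ℕ × ℕ)) (q f c : ℕ) :
    permOp (flipBit a) ∘ₗ permOp (tofs C.reverse) ∘ₗ
      permOp (tofs ((List.range c).map fun r => (q + r, q + r, f))) ∘ₗ permOp (tofs C) ∘ₗ
        permOp (flipBit a) = permOp (mark a C q f c) := by
  simp only [permOp_comp]
  rfl

theorem weight_mark (a : ℕ) (C : List (ℕ × ℕ × ℕ)) (q f c : ℕ) (ψ : QState) :
    weight (permOp (mark a C q f c) ψ) = weight ψ := by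
  rw [← mark_op]
  have h := UPair.tofs C.reverse
  rw [List.reverse_reverse] at h
  exact ((UPair.flip a).comp (h.comp ((UPair.tofs _).comp ((UPair.tofs C).comp (.flip a))))).weight ψ

theorem mem_tof_of_ne {r : ℕ} {g : ℕ × ℕ × ℕ} (h : g.2.2 ≠ r) (s : Finset ℕ) :
    r ∈ tof g s ↔ r ∈ s := by
  unfold tof
  split_ifs
  · rw [mem_flipBit, if_neg (Ne.symm h)]
  · rfl

theorem mem_tofs_of_ne {r : ℕ} {C : List (ℕ × ℕ × ℕ)} (h : ∀ g ∈ C, g.2.2 ≠ r) (s : Finset ℕ) :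
    r ∈ tofs C s ↔ r ∈ s := by
  induction C generalizing s with
  | nil => rfl
  | cons g C ih =>
    rw [tofs_cons, ih fun g hg => h g (by simp [hg]), mem_tof_of_ne (h g (by simp))]

/-- At most one qubit of the one-hot counter is set, so at most one CNOT fires and the flag is never
flipped twice. -/
theorem tofs_flag {q f v c : ℕ} (hf : f < q) {s : Finset ℕ} (hs : ∀ r, q + r ∈ s ↔ r = v)
    (hfs : f ∉ s) : tofs ((List.range c).map fun r => (q + r, q + r, f)) s =
      if v < c then insert f s else s := by
  induction c with
  | zero => simp [tofs]
  | succ c ih =>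
    rw [List.range_succ, List.map_append, tofs_append, ih]
    change tof _ _ = _
    have hne : ∀ r, q + r ≠ f := fun r => by omega
    have hne' : ∀ r, ¬ f = q + r := fun r => by omega
    rcases lt_trichotomy v c with h | rfl | h
    · rw [if_pos h, if_pos (by omega)]
      have : q + c ∉ s := fun h' => h.ne ((hs c).1 h').symm
      simp [tof, this, hne]
    · rw [if_neg (lt_irrefl _), if_pos (by omega)]
      simp [tof, (hs v).2 rfl, hne, flipBit, hfs]
    · rw [if_neg (by omega), if_neg (by omega)]
      have : q + c ∉ s := fun h' => h.ne ((hs c).1 h')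
      simp [tof, this, hne]

/-- The circuit does not touch the flag, so undoing it commutes with the flag having been set, and
everything else returns to its original value. -/
theorem mark_eq {a q f c v : ℕ} {C : List (ℕ × ℕ × ℕ)} {s : Finset ℕ} (ha : f < a) (hf : f < q)
    (hC : Avoids f C) (hs : ∀ r, q + r ∈ tofs C (flipBit a s) ↔ r = v) (hfs : f ∉ s) :
    mark a C q f c s = if v < c then insert f s else s := by
  have h1 : f ∉ tofs C (flipBit a s) := by
    rw [mem_tofs_of_ne fun g hg => (hC g hg).2.2, mem_flipBit, if_neg ha.ne]; exact hfs
  rw [mark, tofs_flag hf hs h1]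
  split_ifs
  · have hC' : Avoids f C.reverse := fun g hg => hC g (by simpa using hg)
    rw [hC'.tofs_insert, tofs_reverse_tofs]
    ext r
    by_cases hr : r = a
    · subst hr; simp [mem_flipBit, ha.ne']
    · simp [mem_flipBit, hr]
  · rw [tofs_reverse_tofs, flipBit_flipBit]

theorem WF.mark_eq {k m Q : ℕ} (h : WF inp k (inp 0) m) {R : ℕ} (hR : Q * 2 ^ k * m < R) {s : Finset ℕ}
    (hs : s ⊆ Finset.range (2 * inp 0)) (c : ℕ) :
    mark (2 * inp 0 + 1) (costGates inp (2 * inp 0 + 1) R (2 ^ k) Q m)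
      (2 * inp 0 + 1 + m * (R * 2 ^ k)) (2 * inp 0) c s =
        if cost inp Q m s < c then insert (2 * inp 0) s else s := by
  have hlt : ∀ r ∈ s, r < 2 * inp 0 := fun r hr => Finset.mem_range.1 (hs hr)
  exact QMachine.mark_eq (by omega) (by omega) (h.avoids_costGates (by omega) (by omega) le_rfl)
    (h.mem_tofs_costGates (by omega) hR fun r hr => by have := hlt r hr; omega)
    fun hr => by have := hlt _ hr; omega

theorem Impl.markProg {v q : ℕ} {C : List (ℕ × ℕ × ℕ)} (hV : C.length ≤ V) (hvV : v + 1 ≤ V)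
    (hS : Stored inp mem 0 C) (h1 : mem (inp 0 + 1) = q) (h15 : mem (inp 0 + 15) = C.length)
    (h18 : mem (inp 0 + 18) = v) :
    Impl inp V mem 1 QMachine.markProg ((v + 1) * 3 + C.length * 6 + 8)
      (permOp (mark (2 * inp 0 + 1) C q (2 * inp 0) (v + 1))) := by
  rw [← mark_op]
  refine (Impl.conjProg (c := reg 15) (N := (v + 1) * 3 + 2) hV hS (fun _ _ => rfl)
    (fun m hm => (hm.reg (c := 15) (by norm_num)).trans h15) ?_).steps (by omega)
  have ht : ∀ m, Fix inp mem 24 m → targetExp.eval inp m = v + 1 := fun m hm => by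
    simp only [targetExp, AExp.eval, eval_reg, hm.reg (show 18 < 40 by norm_num), h18]
  have := Impl.gateLoop (inp := inp) (V := V) (mem := mem)
    (L := (List.range (v + 1)).map fun r => (q + r, 2 * inp 0)) (N := 1)
    (f := fun g => [.cnot g.1 g.2]) (P := .gate (.cnot (.add (reg 1) (reg 40)) flagQubit))
    (bound := targetExp) (by simpa using hvV) (by simpa using ht) fun i hi m hm hi' ψ => .gate ⟨by
      simp only [Gate.map, AExp.eval, eval_reg, hm.reg (show 1 < 40 by norm_num), h1, hi', flagQubit,
        numVars, gatesOp_singleton, List.getElem_map, List.getElem_range], rfl⟩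
  rw [gatesOp_cnot] at this
  simpa [comp_def] using this

section
variable {ψ : QState} {F : Finset ℕ → Finset ℕ} {f : ℕ} {G : Finset ℕ → Prop} [DecidablePred G]

theorem mapDomain_mark (hF : ∀ s ∈ ψ.support, F s = if G s then insert f s else s) :
    permOp F ψ = mapDomain (insert f) (ψ.filter G) + ψ.filter fun s => ¬ G s := by
  conv_lhs => rw [← Finsupp.filter_add_filter_not ψ G]
  rw [map_add]
  have h1 : permOp F (ψ.filter G) = mapDomain (insert f) (ψ.filter G) :=
    Finsupp.mapDomain_congr fun s hs => by
      rw [Finsupp.support_filter, Finset.mem_filter] at hs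
      rw [hF s hs.1, if_pos hs.2]
  have h2 : permOp F (ψ.filter fun s => ¬ G s) = ψ.filter fun s => ¬ G s := by
    conv_rhs => rw [← Finsupp.mapDomain_id (v := ψ.filter fun s => ¬ G s)]
    exact Finsupp.mapDomain_congr fun s hs => by
      rw [Finsupp.support_filter, Finset.mem_filter] at hs
      rw [hF s hs.1, if_neg hs.2]; rfl
  rw [h1, h2]

theorem project_add (q : ℕ) (v : Bool) (ψ φ : QState) :
    project q v (ψ + φ) = project q v ψ + project q v φ := Finsupp.filter_add

/-- Marking puts `f` into exactly the labels that satisfy `G`, and none had it before, so the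
measurement of `f` separates the two parts of the state. -/
theorem project_mark (hF : ∀ s ∈ ψ.support, F s = if G s then insert f s else s)
    (hf : ∀ s ∈ ψ.support, f ∉ s) :
    project f true (permOp F ψ) = permOp F (ψ.filter G) ∧
      project f false (permOp F ψ) = ψ.filter fun s => ¬ G s := by
  have h1 : ∀ s ∈ (mapDomain (insert f) (ψ.filter G)).support, f ∈ s := fun s hs => by
    obtain ⟨t, -, rfl⟩ := Finset.mem_image.1 (Finsupp.mapDomain_support hs)
    exact Finset.mem_insert_self _ _
  have h2 : ∀ s ∈ (ψ.filter fun s => ¬ G s).support, f ∉ s := fun s hs =>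
    hf s (by rw [Finsupp.support_filter] at hs; exact (Finset.mem_filter.1 hs).1)
  have h3 : permOp F (ψ.filter G) = mapDomain (insert f) (ψ.filter G) :=
    Finsupp.mapDomain_congr fun s hs => by
      rw [Finsupp.support_filter, Finset.mem_filter] at hs
      rw [hF s hs.1, if_pos hs.2]
  have key : ∀ (v : Bool) (χ : QState), (∀ s ∈ χ.support, decide (f ∈ s) = v) →
      project f v χ = χ ∧ project f (!v) χ = 0 := by
    intro v χ hχ
    constructor
    · exact Finsupp.filter_eq_self_iff _ _ |>.2 fun s hs => hχ s (Finsupp.mem_support_iff.2 hs)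
    · refine Finsupp.filter_eq_zero_iff _ _ |>.2 fun s hs => ?_
      by_contra h
      rw [hχ s (Finsupp.mem_support_iff.2 h)] at hs
      cases v <;> simp at hs
  have k1 := key true _ fun s hs => by simpa using h1 s hs
  have k2 := key false _ fun s hs => by simpa using h2 s hs
  rw [mapDomain_mark hF, project_add, project_add, h3]
  exact ⟨by rw [k1.1, show true = !false from rfl, k2.2, add_zero],
    by rw [k2.1, show false = !true from rfl, k1.2, zero_add]⟩

end

/-! ## Measuring all qubits -/

/-- Measure qubit `q` into the cell `a` and reset it. -/
def measReset (q a : AExp) : Prog := .seq (.meas q a) (.ite (.load a) (.gate (.x q)) .skip)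

/-- Measure and reset the first `2 n` qubits; the outcomes of the first `n` are kept. -/
def clearProg : Prog :=
  .seq (forLoop 40 numVars (measReset (reg 40) (reg 40)))
    (forLoop 40 numVars (measReset (.add numVars (reg 40)) (.add numVars (.lit 36))))

/-- Within a branch the outcome is classical, so a NOT conditioned on it returns the qubit to zero,
and the stored outcome is the erased bit of every surviving label. -/
theorem ND.measReset {ψ : QState} {q a : AExp} {qv av : ℕ} (hV : 1 ≤ V) (hq : q.eval inp mem = qv)
    (ha : a.eval inp mem = av)
    (hq' : ∀ x, q.eval inp (update mem av x) = qv) (ha' : ∀ x, a.eval inp (update mem av x) = av) :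
    ND inp V (QMachine.measReset q a) 3 mem ψ fun mem' ψ' => (∀ j, j ≠ av → mem' j = mem j) ∧
      ∀ s ∈ ψ'.support, ∃ s' ∈ ψ.support, s = s'.erase qv ∧ (mem' av ≠ 0 ↔ qv ∈ s') := by
  refine .seq (N₁ := 1) (N₂ := 2) (.meas hV fun v => ?_)
  rw [ha, hq]
  have hl : (AExp.load a).eval inp (update mem av v.toNat) = v.toNat := by
    rw [AExp.eval, ha', Function.update_self]
  have hsup : ∀ s ∈ (project qv v ψ).support, s ∈ ψ.support ∧ decide (qv ∈ s) = v := fun s hs => by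
    rw [project, Finsupp.support_filter, Finset.mem_filter] at hs
    exact hs
  cases v with
  | false =>
    refine .ite (N := 1) (fun h => absurd hl h) fun _ => (ND.skip ⟨fun j hj => update_of_ne hj _ _,
      fun s hs => ⟨s, (hsup s hs).1, ?_, ?_⟩⟩).steps (Nat.zero_le _)
    · rw [Finset.erase_eq_of_notMem]
      simpa using (hsup s hs).2
    · simpa using (hsup s hs).2
  | true =>
    refine .ite (N := 1) (fun _ => .gate ⟨fun j hj => update_of_ne hj _ _, fun s hs => ?_⟩)
      fun h => absurd (hl.symm.trans h) (by simp)
    rw [Gate.map, hq', op_x] at hs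
    obtain ⟨t, ht, rfl⟩ := Finset.mem_image.1 (Finsupp.mapDomain_support hs)
    have h2 : qv ∈ t := by simpa using (hsup t ht).2
    exact ⟨t, (hsup t ht).1, by simp [flipBit, h2], by simp [h2]⟩

/-- The next attempt has to start with zero qubits. The second loop clears the displaced window
bits, whose outcomes are written to a scratch register. Each surviving label comes from an original
one that has the recorded bits. -/
theorem ND.clearProg {ψ : QState} (hV : inp 0 + 1 ≤ V) :
    ND inp V QMachine.clearProg (inp 0 * 10 + 4) mem ψ fun mem' ψ' =>
      (∀ j, inp 0 ≤ j → j ≠ inp 0 + 36 → j ≠ inp 0 + 40 → mem' j = mem j) ∧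
      ∀ s ∈ ψ'.support, ∃ s' ∈ ψ.support, s = s' \ Finset.range (2 * inp 0) ∧
        ∀ q < inp 0, (mem' q ≠ 0 ↔ q ∈ s') := by
  refine ND.steps (N := (inp 0 * (3 + 2) + 2) + (inp 0 * (3 + 2) + 2)) (.seq (.forLoop
    (fun i mem' ψ' => (∀ j, inp 0 ≤ j → j ≠ inp 0 + 40 → mem' j = mem j) ∧
      ∀ s ∈ ψ'.support, ∃ s' ∈ ψ.support, s = s' \ Finset.range i ∧
        ∀ q < i, (mem' q ≠ 0 ↔ q ∈ s')) (by omega) ?_ (fun _ _ _ _ _ _ => rfl) ?_ ?_)) (by omega)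
  · exact ⟨fun j _ hj => update_of_ne hj _ _, fun s hs => ⟨s, hs, by simp, by omega⟩⟩
  · intro i hi mem₁ ψ₁ _ hc ⟨h1, h2⟩
    have hr : ∀ x, (reg 40).eval inp (update mem₁ i x) = i := fun x => by
      rw [eval_reg, update_of_ne (by omega), hc]
    refine (ND.measReset (q := reg 40) (a := reg 40) (by omega) hc hc hr hr).weaken fun mem₂ ψ₂ ⟨g1, g2⟩ => ⟨?_, ?_, ?_⟩
    · rw [g1 _ (by omega), hc]
    · intro j hj hj'
      rw [update_of_ne hj', g1 _ (by omega), h1 j hj hj']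
    · intro s hs
      obtain ⟨t, ht, rfl, e⟩ := g2 s hs
      obtain ⟨u, hu, rfl, e'⟩ := h2 t ht
      refine ⟨u, hu, ?_, fun q hq => ?_⟩
      · ext r
        simp only [Finset.mem_erase, Finset.mem_sdiff, Finset.mem_range, not_lt]
        constructor
        · rintro ⟨h3, h4, h5⟩; exact ⟨h4, by omega⟩
        · rintro ⟨h3, h4⟩; exact ⟨by omega, h3, by omega⟩
      · rw [update_of_ne (by omega)]
        rcases Nat.lt_succ_iff_lt_or_eq.1 hq with hq | rfl
        · rw [g1 q hq.ne, e' q hq]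
        · rw [e]; simp
  · intro mem₁ ψ₁ _ ⟨h1, h2⟩
    refine .forLoop (fun i mem' ψ' =>
      (∀ j, j ≠ inp 0 + 36 → j ≠ inp 0 + 40 → mem' j = mem₁ j) ∧
      ∀ s ∈ ψ'.support, ∃ s' ∈ ψ₁.support, ∀ r, r ∈ s ↔ r ∈ s' ∧ ¬ (inp 0 ≤ r ∧ r < inp 0 + i))
      (by omega) ⟨fun j _ hj => update_of_ne hj _ _, fun s hs => ⟨s, hs, fun r => by
        simp only [add_zero]; exact ⟨fun h => ⟨h, by omega⟩, fun h => h.1⟩⟩⟩ (fun _ _ _ _ _ _ => rfl) ?_ ?_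
    · intro i hi mem₂ ψ₂ _ hc ⟨g1, g2⟩
      have hr : ∀ x, (AExp.add numVars (reg 40)).eval inp (update mem₂ (inp 0 + 36) x) = inp 0 + i := by
        intro x
        simp only [AExp.eval, eval_reg, numVars]
        rw [update_of_ne (by omega), hc]
      have hr0 : (AExp.add numVars (reg 40)).eval inp mem₂ = inp 0 + i := by
        simp only [AExp.eval, eval_reg, numVars]; rw [hc]
      refine (ND.measReset (by omega) hr0 (av := inp 0 + 36) rfl hr fun _ => rfl).weaken
        fun mem₃ ψ₃ ⟨f1, f2⟩ => ⟨?_, ?_, ?_⟩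
      · rw [f1 _ (by omega), hc]
      · intro j hj hj'
        rw [update_of_ne hj', f1 _ hj, g1 j hj hj']
      · intro s hs
        obtain ⟨t, ht, rfl, -⟩ := f2 s hs
        obtain ⟨u, hu, e⟩ := g2 t ht
        refine ⟨u, hu, fun r => ?_⟩
        rw [Finset.mem_erase, e]
        constructor
        · rintro ⟨h3, h4, h5⟩; exact ⟨h4, by omega⟩
        · rintro ⟨h3, h4⟩; exact ⟨by omega, h3, by omega⟩
    · intro mem₂ ψ₂ _ ⟨g1, g2⟩
      refine ⟨fun j hj hj' hj'' => by rw [g1 j hj' hj'', h1 j hj hj''], fun s hs => ?_⟩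
      obtain ⟨t, ht, e⟩ := g2 s hs
      obtain ⟨u, hu, rfl, e'⟩ := h2 t ht
      refine ⟨u, hu, ?_, fun q hq => ?_⟩
      · ext r
        rw [e]
        simp only [Finset.mem_sdiff, Finset.mem_range, not_lt]
        constructor
        · rintro ⟨⟨h3, h4⟩, h5⟩; exact ⟨h3, by omega⟩
        · rintro ⟨h3, h4⟩; exact ⟨⟨h3, by omega⟩, by omega⟩
      · rw [g1 q (by omega) (by omega), e' q hq]

end QMachine

namespace QMachine

open Function

variable {inp : ℕ → ℕ} {V : ℕ} {mem mem' : ℕ → ℕ}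

/-! ## Storing circuits -/

/-- The cell of component `j` of gate number `g`. -/
def gateAddr (g : AExp) (j : ℕ) : AExp :=
  .add (.add (.mul (.lit 2) (.input (.lit 0))) (.lit (64 + j))) (.mul (.lit 3) g)

/-- Append a gate to the stored circuit. -/
def emit (e : AExp × AExp × AExp) : Prog :=
  .seq (.store (gateAddr (reg 3) 0) e.1) (.seq (.store (gateAddr (reg 3) 1) e.2.1)
    (.seq (.store (gateAddr (reg 3) 2) e.2.2) (setReg 3 (.add (reg 3) (.lit 1)))))

/-- Append several gates. -/
def emits : List (AExp × AExp × AExp) → Prog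
  | [] => .skip
  | e :: es => .seq (emit e) (emits es)

/-- Append gates for each value of the counter below `c`. -/
def emitLoop (c : AExp) (es : List (AExp × AExp × AExp)) : Prog := forLoop 11 c (emits es)

/-- The stored circuit is `C`. -/
def Emitted (inp mem : ℕ → ℕ) (C : List (ℕ × ℕ × ℕ)) : Prop :=
  Stored inp mem 0 C ∧ mem (inp 0 + 3) = C.length

/-- Nothing below the stored circuit changes but its length and the registers in `l`. -/
def Keep (inp : ℕ → ℕ) (l : List ℕ) (mem mem' : ℕ → ℕ) : Prop :=
  ∀ i < 2 * inp 0 + 64, i ≠ inp 0 + 3 → (∀ c ∈ l, i ≠ inp 0 + c) → mem' i = mem i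

theorem Keep.refl (l : List ℕ) (mem : ℕ → ℕ) : Keep inp l mem mem := fun _ _ _ _ => rfl

theorem Keep.trans {l : List ℕ} {mem'' : ℕ → ℕ} (h : Keep inp l mem mem') (h' : Keep inp l mem' mem'') :
    Keep inp l mem mem'' := fun i h1 h2 h3 => (h' i h1 h2 h3).trans (h i h1 h2 h3)

theorem Keep.mono {l l' : List ℕ} (h : Keep inp l mem mem') (hl : l ⊆ l') : Keep inp l' mem mem' :=
  fun i h1 h2 h3 => h i h1 h2 fun c hc => h3 c (hl hc)

theorem Keep.reg {l : List ℕ} (h : Keep inp l mem mem') {c : ℕ} (hc : c < 64) (h3 : c ≠ 3)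
    (hl : c ∉ l) : mem' (inp 0 + c) = mem (inp 0 + c) :=
  h _ (by omega) (by omega) fun d hd e => hl ((Nat.add_left_cancel e) ▸ hd)

theorem Keep.update {l : List ℕ} (h : Keep inp l mem mem') {c : ℕ} (hc : c ∈ l) (x : ℕ) :
    Keep inp l mem (update mem' (inp 0 + c) x) := fun i h1 h2 h3 => by
  rw [update_of_ne (h3 c hc)]; exact h i h1 h2 h3

theorem Emitted.update {C : List (ℕ × ℕ × ℕ)} (h : Emitted inp mem C) {a : ℕ}
    (ha : a < 2 * inp 0 + 64) (ha' : a ≠ inp 0 + 3) (x : ℕ) : Emitted inp (update mem a x) C := by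
  refine ⟨fun i hi => ?_, by rw [update_of_ne ha'.symm, h.2]⟩
  rw [update_of_ne (by omega), update_of_ne (by omega), update_of_ne (by omega)]
  exact h.1 i hi

theorem Emitted.update_reg {C : List (ℕ × ℕ × ℕ)} (h : Emitted inp mem C) {c : ℕ} (hc : c < 64)
    (hc' : c ≠ 3) (x : ℕ) : Emitted inp (Function.update mem (inp 0 + c) x) C :=
  h.update (by omega) (by omega) x

/-- The later components are evaluated when earlier ones have already been written. Hence the values
are required in all memories that agree below the stored circuit. -/
theorem ND.emit {ψ : QState} {C : List (ℕ × ℕ × ℕ)} {e : AExp × AExp × AExp} {g : ℕ × ℕ × ℕ}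
    (hC : Emitted inp mem C) (hV : C.length < V) (hg : g.1 ≤ V ∧ g.2.1 ≤ V ∧ g.2.2 ≤ V)
    (he : ∀ mem', Keep inp [] mem mem' →
      (e.1.eval inp mem', e.2.1.eval inp mem', e.2.2.eval inp mem') = g) :
    ND inp V (emit e) 4 mem ψ fun mem' ψ' => ψ' = ψ ∧ Keep inp [] mem mem' ∧
      Emitted inp mem' (C ++ [g]) := by
  obtain ⟨h1, h2⟩ := hC
  have key : ∀ j mem', mem' (inp 0 + 3) = C.length →
      (gateAddr (reg 3) j).eval inp mem' = 2 * inp 0 + (64 + j) + 3 * C.length := fun j mem' h => by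
    simp only [gateAddr, AExp.eval, eval_reg, h]
  have hne : ∀ j, inp 0 + 3 ≠ 2 * inp 0 + (64 + j) + 3 * C.length := fun j => by omega
  have k1 : ∀ j x mem', Keep inp [] mem mem' →
      Keep inp [] mem (update mem' (2 * inp 0 + (64 + j) + 3 * C.length) x) :=
    fun j x mem' h i hi h3 h4 => by rw [update_of_ne (by omega)]; exact h i hi h3 h4
  have e0 := he mem (Keep.refl _ _)
  have e1 := he _ (k1 0 g.1 mem (Keep.refl _ _))
  have e2 := he _ (k1 1 g.2.1 _ (k1 0 g.1 mem (Keep.refl _ _)))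
  rw [Prod.ext_iff, Prod.ext_iff] at e0 e1 e2
  dsimp only at e0 e1 e2
  refine .seq (N₁ := 1) (N₂ := 3) (.store (by rw [e0.1]; exact hg.1) ?_)
  rw [key 0 mem h2, e0.1]
  refine .seq (N₁ := 1) (N₂ := 2) (.store (by rw [e1.2.1]; exact hg.2.1) ?_)
  rw [key 1 _ (by rw [update_of_ne (hne _), h2]), e1.2.1]
  refine .seq (N₁ := 1) (N₂ := 1) (.store (by rw [e2.2.2]; exact hg.2.2) ?_)
  rw [key 2 _ (by rw [update_of_ne (hne _), update_of_ne (hne _), h2]), e2.2.2]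
  have e3 : ∀ x y z, (AExp.add (reg 3) (.lit 1)).eval inp (update (update (update mem
      (2 * inp 0 + (64 + 0) + 3 * C.length) x) (2 * inp 0 + (64 + 1) + 3 * C.length) y)
      (2 * inp 0 + (64 + 2) + 3 * C.length) z) = C.length + 1 := fun x y z => by
    simp only [AExp.eval, eval_reg]
    rw [update_of_ne (hne _), update_of_ne (hne _), update_of_ne (hne _), h2]
  refine .setReg (by rw [e3]; omega) ⟨rfl, ?_, ?_, ?_⟩
  · exact fun i hi h3 h4 => by
      rw [update_of_ne h3]; exact k1 2 _ _ (k1 1 _ _ (k1 0 _ _ (Keep.refl _ _))) i hi h3 h4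
  · intro i hi
    rw [List.length_append, List.length_singleton] at hi
    rcases Nat.lt_succ_iff_lt_or_eq.1 hi with hi | rfl
    · have : ∀ j < 3, ∀ x y z w, update (update (update (update mem
          (2 * inp 0 + (64 + 0) + 3 * C.length) x) (2 * inp 0 + (64 + 1) + 3 * C.length) y)
          (2 * inp 0 + (64 + 2) + 3 * C.length) z) (inp 0 + 3) w (2 * inp 0 + (64 + j) + 3 * (0 + i)) =
          mem (2 * inp 0 + (64 + j) + 3 * (0 + i)) := fun j hj x y z w => by
        rw [update_of_ne (by omega), update_of_ne (by omega), update_of_ne (by omega),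
          update_of_ne (by omega)]
      rw [this 0 (by norm_num), this 1 (by norm_num), this 2 (by norm_num),
        List.getElem_append_left hi]
      exact h1 i hi
    · rw [List.getElem_append_right le_rfl, zero_add]
      refine ⟨?_, ?_, ?_⟩
      · rw [update_of_ne (by omega), update_of_ne (by omega), update_of_ne (by omega), update_self]
        simp
      · rw [update_of_ne (by omega), update_of_ne (by omega), update_self]
        simp
      · rw [update_of_ne (by omega), update_self]
        simp
  · rw [update_self, e3, List.length_append, List.length_singleton]

theorem ND.emits {ψ : QState} {C L : List (ℕ × ℕ × ℕ)} {es : List (AExp × AExp × AExp)}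
    (hC : Emitted inp mem C) (hV : C.length + L.length ≤ V)
    (hL : ∀ g ∈ L, g.1 ≤ V ∧ g.2.1 ≤ V ∧ g.2.2 ≤ V)
    (he : ∀ mem', Keep inp [] mem mem' →
      (es.map fun e => (e.1.eval inp mem', e.2.1.eval inp mem', e.2.2.eval inp mem')) = L) :
    ND inp V (emits es) (4 * es.length) mem ψ fun mem' ψ' => ψ' = ψ ∧ Keep inp [] mem mem' ∧
      Emitted inp mem' (C ++ L) := by
  induction es generalizing mem ψ C L with
  | nil =>
    have := he mem (Keep.refl _ _)
    subst this
    exact .skip ⟨rfl, Keep.refl _ _, by simpa using hC⟩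
  | cons e es ih =>
    cases L with
    | nil => exact absurd (he mem (Keep.refl _ _)) (by simp)
    | cons g L =>
      have he' := fun mem' h => List.cons_eq_cons.1 (he mem' h)
      rw [List.length_cons] at hV
      refine ND.steps (N := 4 + 4 * es.length) (.seq ((ND.emit hC (by omega) (hL g (by simp))
        fun mem' h => (he' mem' h).1).weaken fun mem₁ ψ₁ ⟨h1, h2, h3⟩ => ?_))
        (by rw [List.length_cons]; omega)
      refine (ih h3 (by simp; omega) (fun g' hg' => hL g' (by simp [hg']))
        fun mem' h => (he' mem' (h2.trans h)).2).weaken fun mem₂ ψ₂ ⟨g1, g2, g3⟩ =>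
          ⟨by rw [g1, h1], h2.trans g2, by simpa using g3⟩

theorem ND.emitLoop {ψ : QState} {C : List (ℕ × ℕ × ℕ)} {L : ℕ → List (ℕ × ℕ × ℕ)}
    {es : List (AExp × AExp × AExp)} {c : AExp} {M : ℕ} (hC : Emitted inp mem C) (hM : M ≤ V)
    (hV : C.length + ((List.range M).flatMap L).length ≤ V)
    (hL : ∀ p < M, ∀ g ∈ L p, g.1 ≤ V ∧ g.2.1 ≤ V ∧ g.2.2 ≤ V)
    (hc : ∀ mem', Keep inp [11] mem mem' → c.eval inp mem' = M)
    (he : ∀ p < M, ∀ mem', Keep inp [11] mem mem' → mem' (inp 0 + 11) = p →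
      (es.map fun e => (e.1.eval inp mem', e.2.1.eval inp mem', e.2.2.eval inp mem')) = L p) :
    ND inp V (emitLoop c es) (M * (4 * es.length + 2) + 2) mem ψ fun mem' ψ' => ψ' = ψ ∧
      Keep inp [11] mem mem' ∧ Emitted inp mem' (C ++ (List.range M).flatMap L) := by
  refine .forLoop (fun i mem' ψ' => ψ' = ψ ∧ Keep inp [11] mem mem' ∧
    Emitted inp mem' (C ++ (List.range i).flatMap L)) hM ⟨rfl, (Keep.refl _ _).update (by simp) _,
      by simpa using hC.update_reg (c := 11) (by norm_num) (by norm_num) 0⟩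
    (fun i _ mem₁ ψ₁ _ h => hc _ h.2.1) ?_ fun _ _ _ h => h
  intro i hi mem₁ ψ₁ _ hi' ⟨h1, h2, h3⟩
  have hlen : ((List.range i).flatMap L).length + (L i).length ≤ ((List.range M).flatMap L).length := by
    have : ((List.range (i + 1)).flatMap L).length ≤ ((List.range M).flatMap L).length := by
      exact ((List.range_sublist.2 hi).flatMap L).length_le
    simpa [List.range_succ] using this
  refine (ND.emits h3 (by simp only [List.length_append]; omega) (hL i hi) fun mem' h =>
    he i hi mem' (h2.trans (h.mono (by simp))) ?_).weaken fun mem₂ ψ₂ ⟨g1, g2, g3⟩ =>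
      ⟨?_, by rw [g1, h1], (h2.trans (g2.mono (by simp))).update (by simp) _, ?_⟩
  · rw [h.reg (by norm_num) (by norm_num) (by simp), hi']
  · rw [g2.reg (by norm_num) (by norm_num) (by simp), hi']
  · have := g3.update_reg (c := 11) (by norm_num) (by norm_num) (i + 1)
    simpa [List.range_succ] using this

end QMachine

namespace QMachine

open Function

variable {inp : ℕ → ℕ} {V : ℕ} {mem mem' : ℕ → ℕ} {k Q m : ℕ}

/-! ## Scanning the constraints -/

theorem length_pairGates (A x w m : ℕ) : (pairGates A x w m).length = 2 * m := by
  simp [pairGates, mul_comm]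

/-- A geometric sum, written additively to avoid truncated subtraction. -/
theorem length_selectGates (A R : ℕ) (xs : ℕ → ℕ) (a : ℕ) :
    (selectGates A R xs a).length + 2 * R = 2 * (R * 2 ^ a) := by
  induction a with
  | zero => simp [selectGates]
  | succ a ih =>
    rw [selectGates_succ, List.length_append, length_pairGates, pow_succ]
    have : R * (2 ^ a * 2) = R * 2 ^ a + R * 2 ^ a := by ring
    omega

theorem length_layerGates_le (A R K a w : ℕ) (xs tab : ℕ → ℕ) :
    (layerGates A R K a w xs tab).length ≤ 3 * (R * 2 ^ a) := by
  have := length_selectGates A R xs a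
  simp only [layerGates, List.length_append, copyGates, List.length_map, List.length_range]
  omega

theorem WF.length_costGates_le {n : ℕ} (h : WF inp k n m) (A R : ℕ) {j : ℕ} (hj : j ≤ m) :
    (costGates inp A R (2 ^ k) Q j).length ≤ j * (3 * (R * 2 ^ k)) := by
  induction j with
  | zero => simp [costGates]
  | succ j ih =>
    have h1 := length_layerGates_le (A + j * (R * 2 ^ k)) R (2 ^ k) (ar inp j) (wt inp Q j) (vr inp j)
      (tb inp j)
    have h2 : R * 2 ^ ar inp j ≤ R * 2 ^ k :=
      Nat.mul_le_mul_left _ (Nat.pow_le_pow_right (by norm_num) (h.ar_le j (by omega)))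
    have h3 := ih (by omega)
    rw [costGates, List.length_append, add_mul]
    omega

/-- The number of occurrences of variable `i` in the first `j` constraints and in the first `l`
variables of constraint `j`. -/
def dgp (inp : ℕ → ℕ) (j l i : ℕ) : ℕ :=
  dg inp j i + ∑ l' ∈ Finset.range l, if vr inp j l' = i then 1 else 0

theorem dgp_zero (j : ℕ) : dgp inp j 0 = dg inp j := by ext i; simp [dgp]

theorem dgp_last (j : ℕ) : dgp inp j (ar inp j) = dg inp (j + 1) := by
  ext i; rw [dgp, dg, dg, Finset.sum_range_succ]

theorem dgp_succ (j l i : ℕ) :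
    dgp inp j (l + 1) i = dgp inp j l i + if vr inp j l = i then 1 else 0 := by
  rw [dgp, Finset.sum_range_succ, dgp, add_assoc]

/-- From (d + 1)² = d² + (2d + 1): the sum of squares is maintained while the occurrences are read,
without a second pass over the degrees. -/
theorem sum_dgp_succ {j l n : ℕ} (h : vr inp j l < n) : ∑ i ∈ Finset.range n, dgp inp j (l + 1) i ^ 2 =
    ∑ i ∈ Finset.range n, dgp inp j l i ^ 2 + (2 * dgp inp j l (vr inp j l) + 1) := by
  have h1 : ∀ i ∈ Finset.range n, dgp inp j (l + 1) i ^ 2 =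
      dgp inp j l i ^ 2 + if vr inp j l = i then 2 * dgp inp j l i + 1 else 0 := by
    intro i _
    rw [dgp_succ]
    split_ifs <;> ring
  rw [Finset.sum_congr rfl h1, Finset.sum_add_distrib, Finset.sum_ite_eq, if_pos (by simpa using h)]

theorem WF.dgp_le {n : ℕ} (h : WF inp k n m) {j l : ℕ} (hj : j < m) (hl : l ≤ ar inp j) (i : ℕ) :
    dgp inp j l i ≤ m * k := by
  have h1 : ∀ j' < m, ∀ l' ≤ ar inp j',
      (∑ l ∈ Finset.range l', if vr inp j' l = i then 1 else 0) ≤ k := fun j' hj' l' hl' => by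
    calc _ ≤ ∑ _l ∈ Finset.range l', 1 := Finset.sum_le_sum fun l _ => by split_ifs <;> omega
      _ = l' := by simp
      _ ≤ k := hl'.trans (h.ar_le j' hj')
  have h2 : dg inp j i ≤ j * k := by
    calc dg inp j i ≤ ∑ _j' ∈ Finset.range j, k := Finset.sum_le_sum fun j' hj' =>
          h1 j' (by rw [Finset.mem_range] at hj'; omega) _ le_rfl
      _ = j * k := by simp
  have h3 := h1 j hj l hl
  have h4 : (j + 1) * k ≤ m * k := Nat.mul_le_mul_right _ hj
  rw [add_mul] at h4
  rw [dgp]; omega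

theorem WF.ptr_le {n : ℕ} (h : WF inp k n m) {j : ℕ} (hj : j ≤ m) :
    ptr inp j ≤ 2 + j * (1 + k + 2 ^ k) := by
  induction j with
  | zero => simp [ptr]
  | succ j ih =>
    have h1 : inp (ptr inp j) ≤ k := h.ar_le j (by omega)
    have h2 : 2 ^ inp (ptr inp j) ≤ 2 ^ k := Nat.pow_le_pow_right (by norm_num) h1
    have h3 := ih (by omega)
    rw [ptr, add_mul]
    omega

/-- The parts of the memory that the scan of the constraints works on. -/
structure Scan (inp : ℕ → ℕ) (R A p wm D : ℕ) (d : ℕ → ℕ) (C : List (ℕ × ℕ × ℕ)) (mem : ℕ → ℕ) :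
    Prop where
  r0 : mem (inp 0 + 0) = R
  r1 : mem (inp 0 + 1) = A
  r2 : mem (inp 0 + 2) = p
  r5 : mem (inp 0 + 5) = wm
  r6 : mem (inp 0 + 6) = D
  deg : ∀ i < inp 0, mem (inp 0 + 64 + i) = d i
  emitted : Emitted inp mem C

section
variable {R A p wm D : ℕ} {d : ℕ → ℕ} {C C' : List (ℕ × ℕ × ℕ)}

theorem update_reg_ne {c d : ℕ} (h : d ≠ c) (x : ℕ) :
    update mem (inp 0 + c) x (inp 0 + d) = mem (inp 0 + d) := update_of_ne (by omega) _ _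

theorem Scan.update (h : Scan inp R A p wm D d C mem) {c : ℕ} (hc : c < 64)
    (hc' : c ∉ [0, 1, 2, 3, 5, 6]) (x : ℕ) : Scan inp R A p wm D d C (update mem (inp 0 + c) x) := by
  simp only [List.mem_cons, List.not_mem_nil, or_false, not_or] at hc'
  obtain ⟨h0, h1, h2, h3, h5, h6⟩ := hc'
  exact ⟨by rw [update_reg_ne (Ne.symm h0), h.r0], by rw [update_reg_ne (Ne.symm h1), h.r1],
    by rw [update_reg_ne (Ne.symm h2), h.r2], by rw [update_reg_ne (Ne.symm h5), h.r5],
    by rw [update_reg_ne (Ne.symm h6), h.r6],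
    fun i hi => by rw [update_of_ne (by omega), h.deg i hi], h.emitted.update_reg hc h3 x⟩

theorem Scan.keep (h : Scan inp R A p wm D d C mem) (hk : Keep inp [11] mem mem')
    (hC : Emitted inp mem' C') : Scan inp R A p wm D d C' mem' :=
  have hr : ∀ c < 64, c ≠ 3 → c ≠ 11 → mem' (inp 0 + c) = mem (inp 0 + c) := fun c h1 h2 h3 =>
    hk.reg h1 h2 (by simpa using h3)
  ⟨by rw [hr 0 (by norm_num) (by norm_num) (by norm_num), h.r0],
    by rw [hr 1 (by norm_num) (by norm_num) (by norm_num), h.r1],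
    by rw [hr 2 (by norm_num) (by norm_num) (by norm_num), h.r2],
    by rw [hr 5 (by norm_num) (by norm_num) (by norm_num), h.r5],
    by rw [hr 6 (by norm_num) (by norm_num) (by norm_num), h.r6],
    fun i hi => by
      rw [hk _ (by omega) (by omega) fun c hc => by
        simp only [List.mem_singleton] at hc; omega, h.deg i hi], hC⟩

end

/-- The memory is large enough for the scan. -/
structure Fits (V k Q n m : ℕ) : Prop where
  circuit : 2 * n + 2 + (m + 1) * (4 * ((Q * 2 ^ k * m + 1) * 2 ^ k)) ≤ V
  weight : Q * 2 ^ k ≤ V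
  sq : n * (m * k) ^ 2 ≤ V
  deg : m * k + 1 ≤ V
  ptr : 2 + m * (1 + k + 2 ^ k) ≤ V

/-- The cell with the degree of the variable in register 10. -/
def degAddr : AExp := .add (.add numVars (.lit 64)) (reg 10)

/-- Process one variable of a constraint. -/
def varBody : Prog :=
  .seq (setReg 10 (.input (.add (.add (reg 2) (.lit 1)) (reg 9))))
    (.seq (setReg 6 (.add (reg 6) (.add (.mul (.lit 2) (.load degAddr)) (.lit 1))))
      (.seq (.store degAddr (.add (.load degAddr) (.lit 1)))
        (.seq (emitLoop (.mul (reg 0) (reg 8))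
          [(.add (reg 1) (reg 11), reg 10, .add (.add (reg 1) (reg 11)) (.mul (reg 0) (reg 8))),
            (.add (.add (reg 1) (reg 11)) (.mul (reg 0) (reg 8)),
              .add (.add (reg 1) (reg 11)) (.mul (reg 0) (reg 8)), .add (reg 1) (reg 11))])
          (setReg 8 (.mul (.lit 2) (reg 8))))))

/-- State of the scan within a constraint. -/
structure VarInv (inp : ℕ → ℕ) (R A p wm : ℕ) (C : List (ℕ × ℕ × ℕ)) (j l : ℕ) (mem : ℕ → ℕ) : Prop where
  scan : Scan inp R A p wm (∑ i ∈ Finset.range (inp 0), dgp inp j l i ^ 2) (dgp inp j l)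
    (C ++ selectGates A R (vr inp j) l) mem
  r4 : mem (inp 0 + 4) = j
  r7 : mem (inp 0 + 7) = ar inp j
  r8 : mem (inp 0 + 8) = 2 ^ l

/-- The sum of squares is updated before the degree, since its increment uses the old degree. Then
the gates for this bit of the table index are emitted, with the power `2 ^ l` held in register 8 and
doubled at the end. -/
theorem WF.varBody (h : WF inp k (inp 0) m) (hV : Fits V k Q (inp 0) m) {A wm j l : ℕ} {R : ℕ}
    (hR : R = Q * 2 ^ k * m + 1) (hj : j < m) (hl : l < ar inp j)
    (hA : A = 2 * inp 0 + 1 + j * (R * 2 ^ k)) {C : List (ℕ × ℕ × ℕ)}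
    (hC : C.length ≤ j * (3 * (R * 2 ^ k))) {ψ : QState}
    (hI : VarInv inp R A (ptr inp j) wm C j l mem) (h9 : mem (inp 0 + 9) = l) :
    ND inp V QMachine.varBody (R * 2 ^ k * 10 + 6) mem ψ fun mem' ψ' => mem' (inp 0 + 9) = l ∧ ψ' = ψ ∧
      VarInv inp R A (ptr inp j) wm C j (l + 1) (update mem' (inp 0 + 9) (l + 1)) := by
  obtain ⟨S, h4, h7, h8⟩ := hI
  have hx : vr inp j l < inp 0 := h.vr_lt j hj l hl
  have hk : l < k := hl.trans_le (h.ar_le j hj)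
  have hpow : R * 2 ^ l ≤ R * 2 ^ k := Nat.mul_le_mul_left _ (Nat.pow_le_pow_right (by norm_num) hk.le)
  -- The token moves within the first `2 * (R * 2 ^ l)` places; as `l < k` they belong to the layer.
  have hpow2 : 2 * (R * 2 ^ l) ≤ R * 2 ^ k := by
    have := Nat.mul_le_mul_left R (Nat.pow_le_pow_right (show 0 < 2 by norm_num) hk)
    rw [pow_succ] at this
    linarith
  have hcir := hV.circuit
  rw [← hR] at hcir
  have hjm : (j + 1) * (R * 2 ^ k) ≤ m * (R * 2 ^ k) := Nat.mul_le_mul_right _ hj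
  have hRK : 1 ≤ R := by omega
  set RK := R * 2 ^ k with hRKdef
  have e1 : (m + 1) * (4 * RK) = 4 * (m * RK) + 4 * RK := by ring
  have e2 : j * (3 * RK) = 3 * (j * RK) := by ring
  rw [e1] at hcir
  rw [e2] at hC
  rw [add_mul, one_mul] at hjm
  have hd : dgp inp j l (vr inp j l) + 1 ≤ m * k + 1 := by
    have := h.dgp_le hj hl.le (vr inp j l); omega
  have hD : ∑ i ∈ Finset.range (inp 0), dgp inp j (l + 1) i ^ 2 ≤ V := by
    refine le_trans ?_ hV.sq
    calc _ ≤ ∑ _i ∈ Finset.range (inp 0), (m * k) ^ 2 := Finset.sum_le_sum fun i _ =>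
          Nat.pow_le_pow_left (h.dgp_le hj hl i) 2
      _ = _ := by simp
  have hdeg := hV.deg
  -- read the variable
  have v1 : (AExp.input (.add (.add (reg 2) (.lit 1)) (reg 9))).eval inp mem = vr inp j l := by
    simp only [AExp.eval, eval_reg, S.r2, h9, vr]
  refine ND.steps (N := 1 + (1 + (1 + ((R * 2 ^ l * (4 * 2 + 2) + 2) + 1)))) (.seq (.setReg
    (by rw [v1]; omega) ?_)) (by omega)
  rw [v1]
  set x := vr inp j l
  -- update the sum of squares
  have S1 := S.update (c := 10) (by norm_num) (by simp) x
  have d1 : ∀ y z, degAddr.eval inp (update (update mem (inp 0 + 10) x) (inp 0 + y) z) =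
      if y = 10 then inp 0 + 64 + z else inp 0 + 64 + x := fun y z => by
    simp only [degAddr, AExp.eval, numVars, eval_reg]
    split_ifs with hy
    · rw [hy, update_self]
    · rw [update_reg_ne (Ne.symm hy), update_self]
  have d0 : degAddr.eval inp (update mem (inp 0 + 10) x) = inp 0 + 64 + x := by
    simp only [degAddr, AExp.eval, numVars, eval_reg, update_self]
  have v2 : (AExp.add (reg 6) (.add (.mul (.lit 2) (.load degAddr)) (.lit 1))).eval inp
      (update mem (inp 0 + 10) x) = ∑ i ∈ Finset.range (inp 0), dgp inp j (l + 1) i ^ 2 := by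
    simp only [AExp.eval, eval_reg]
    rw [S1.r6, d0, S1.deg _ hx, sum_dgp_succ hx]
  refine .seq (.setReg (by rw [v2]; exact hD) ?_)
  rw [v2]
  -- update the degree
  have v3 : (AExp.add (.load degAddr) (.lit 1)).eval inp (update (update mem (inp 0 + 10) x)
      (inp 0 + 6) (∑ i ∈ Finset.range (inp 0), dgp inp j (l + 1) i ^ 2)) = dgp inp j (l + 1) x := by
    simp only [AExp.eval]
    rw [d1, if_neg (by norm_num), update_of_ne (by omega), S1.deg _ hx, dgp_succ, if_pos rfl]
  refine .seq (.store (by rw [v3, dgp_succ, if_pos rfl]; omega) ?_)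
  rw [v3, d1, if_neg (by norm_num)]
  set mem₁ := update (update (update mem (inp 0 + 10) x) (inp 0 + 6)
    (∑ i ∈ Finset.range (inp 0), dgp inp j (l + 1) i ^ 2)) (inp 0 + 64 + x) (dgp inp j (l + 1) x)
  have hm₁ : ∀ c < 64, c ≠ 10 → c ≠ 6 → mem₁ (inp 0 + c) = mem (inp 0 + c) := fun c hc h10 h6 => by
    simp only [mem₁]
    rw [update_of_ne (by omega), update_reg_ne h6, update_reg_ne h10]
  have S3 : Scan inp R A (ptr inp j) wm (∑ i ∈ Finset.range (inp 0), dgp inp j (l + 1) i ^ 2)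
      (dgp inp j (l + 1)) (C ++ selectGates A R (vr inp j) l) mem₁ := by
    refine ⟨?_, ?_, ?_, ?_, ?_, fun i hi => ?_, ?_⟩
    · rw [hm₁ 0 (by norm_num) (by norm_num) (by norm_num), S.r0]
    · rw [hm₁ 1 (by norm_num) (by norm_num) (by norm_num), S.r1]
    · rw [hm₁ 2 (by norm_num) (by norm_num) (by norm_num), S.r2]
    · rw [hm₁ 5 (by norm_num) (by norm_num) (by norm_num), S.r5]
    · simp only [mem₁]; rw [update_of_ne (by omega), update_self]
    · simp only [mem₁]
      by_cases hix : i = x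
      · rw [hix, update_self]
      · rw [update_of_ne (by omega), update_of_ne (by omega), S1.deg i hi, dgp_succ,
          if_neg (Ne.symm hix), add_zero]
    · exact ((S1.emitted.update_reg (c := 6) (by norm_num) (by norm_num) _).update (by omega)
        (by omega) _)
  have h10 : mem₁ (inp 0 + 10) = x := by
    simp only [mem₁]
    rw [update_of_ne (by omega), update_reg_ne (by norm_num), update_self]
  have hsel := length_selectGates A R (vr inp j) l
  refine .seq ((ND.emitLoop (L := fun p => [(A + p, x, A + p + R * 2 ^ l),
    (A + p + R * 2 ^ l, A + p + R * 2 ^ l, A + p)]) (M := R * 2 ^ l) S3.emitted (by omega) ?_ ?_ ?_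
    ?_).weaken fun mem₂ ψ₂ ⟨g1, g2, g3⟩ => ?_)
  · change _ + (pairGates A x (R * 2 ^ l) (R * 2 ^ l)).length ≤ V
    rw [length_pairGates, List.length_append]
    omega
  · intro p hp g hg
    simp only [List.mem_cons, List.not_mem_nil, or_false] at hg
    rcases hg with rfl | rfl
    · exact ⟨by dsimp only; omega, by dsimp only; omega, by dsimp only; omega⟩
    · exact ⟨by dsimp only; omega, by dsimp only; omega, by dsimp only; omega⟩
  · intro mem₂ hm₂
    simp only [AExp.eval, eval_reg]
    rw [hm₂.reg (by norm_num) (by norm_num) (by simp), hm₂.reg (by norm_num) (by norm_num) (by simp),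
      S3.r0, hm₁ 8 (by norm_num) (by norm_num) (by norm_num), h8]
  · intro p hp mem₂ hm₂ hp'
    have a0 : mem₂ (inp 0 + 0) = R := by
      rw [hm₂.reg (by norm_num) (by norm_num) (by simp), S3.r0]
    have a1 : mem₂ (inp 0 + 1) = A := by
      rw [hm₂.reg (by norm_num) (by norm_num) (by simp), S3.r1]
    have a8 : mem₂ (inp 0 + 8) = 2 ^ l := by
      rw [hm₂.reg (by norm_num) (by norm_num) (by simp), hm₁ 8 (by norm_num) (by norm_num) (by norm_num), h8]
    have a10 : mem₂ (inp 0 + 10) = x := by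
      rw [hm₂.reg (by norm_num) (by norm_num) (by simp), h10]
    simp only [List.map_cons, List.map_nil, AExp.eval, eval_reg, a0, a1, a8, a10, hp']
  · have S4 := S3.keep g2 g3
    have hm₂ : ∀ c < 64, c ≠ 3 → c ≠ 11 → mem₂ (inp 0 + c) = mem₁ (inp 0 + c) := fun c h1 h2 h3 =>
      g2.reg h1 h2 (by simpa using h3)
    have v4 : (AExp.mul (.lit 2) (reg 8)).eval inp mem₂ = 2 ^ (l + 1) := by
      simp only [AExp.eval, eval_reg]
      rw [hm₂ 8 (by norm_num) (by norm_num) (by norm_num),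
        hm₁ 8 (by norm_num) (by norm_num) (by norm_num), h8, pow_succ, mul_comm]
    refine .setReg ?_ ?_
    · rw [v4]
      have : 2 ^ (l + 1) ≤ 2 ^ k := Nat.pow_le_pow_right (by norm_num) hk
      have : 1 * 2 ^ k ≤ RK := Nat.mul_le_mul_right _ hRK
      omega
    · rw [v4]
      refine ⟨?_, g1, ?_, ?_, ?_, ?_⟩
      · rw [update_reg_ne (by norm_num), hm₂ 9 (by norm_num) (by norm_num) (by norm_num),
          hm₁ 9 (by norm_num) (by norm_num) (by norm_num), h9]
      · have := (S4.update (c := 8) (by norm_num) (by simp) (2 ^ (l + 1))).update (c := 9) (by norm_num)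
          (by simp) (l + 1)
        rwa [List.append_assoc, show selectGates A R (vr inp j) l ++ List.flatMap (fun p =>
          [(A + p, x, A + p + R * 2 ^ l), (A + p + R * 2 ^ l, A + p + R * 2 ^ l, A + p)])
            (List.range (R * 2 ^ l)) = selectGates A R (vr inp j) (l + 1) from
              (selectGates_succ _ _ _ _).symm] at this
      · rw [update_reg_ne (by norm_num), update_reg_ne (by norm_num),
          hm₂ 4 (by norm_num) (by norm_num) (by norm_num),
          hm₁ 4 (by norm_num) (by norm_num) (by norm_num), h4]
      · rw [update_reg_ne (by norm_num), update_reg_ne (by norm_num),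
          hm₂ 7 (by norm_num) (by norm_num) (by norm_num),
          hm₁ 7 (by norm_num) (by norm_num) (by norm_num), h7]
      · rw [update_reg_ne (by norm_num), update_self]

end QMachine

namespace QMachine

open Function

variable {inp : ℕ → ℕ} {V : ℕ} {mem mem' : ℕ → ℕ} {k Q m : ℕ}

theorem VarInv.update {R A p wm j l : ℕ} {C : List (ℕ × ℕ × ℕ)} (h : VarInv inp R A p wm C j l mem)
    {c : ℕ} (hc : c < 64) (hc' : 8 < c) (x : ℕ) :
    VarInv inp R A p wm C j l (Function.update mem (inp 0 + c) x) :=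
  ⟨h.scan.update hc (by simp; omega) x, by rw [update_reg_ne (by omega), h.r4],
    by rw [update_reg_ne (by omega), h.r7], by rw [update_reg_ne (by omega), h.r8]⟩

/-- The truth table entry of the current constraint with number `i`. -/
def tabExp (i : AExp) : AExp := .input (.add (.add (.add (reg 2) (.lit 1)) (reg 7)) i)

/-- Process a constraint. -/
def conBody (k Q : ℕ) : Prog :=
  .seq (setReg 7 (.input (reg 2))) (.seq (setReg 8 (.lit 1)) (.seq (forLoop 9 (reg 7) varBody)
    (.seq (setReg 12 (.lit 0))
      (.seq (forLoop 13 (reg 8) (setReg 12 (.add (reg 12) (tabExp (reg 13)))))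
        (.seq (setReg 14 (.div (.mul (.lit Q) (reg 8)) (.sub (reg 8) (reg 12))))
          (.seq (setReg 5 (.add (reg 5) (.sub (reg 14) (reg 5))))
            (.seq (emitLoop (.mul (reg 0) (reg 8)) [(.add (reg 1) (reg 11), .add (reg 1) (reg 11),
                .add (.add (reg 1) (.mul (reg 0) (.lit (2 ^ k)))) (.add (modExp (reg 11) (reg 0))
                  (.mul (.sub (.lit 1) (tabExp (.div (reg 11) (reg 0)))) (reg 14))))])
              (.seq (setReg 1 (.add (reg 1) (.mul (reg 0) (.lit (2 ^ k)))))
                (setReg 2 (.add (.add (.add (reg 2) (.lit 1)) (reg 7)) (reg 8)))))))))))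

theorem WF.sat_le {n : ℕ} (h : WF inp k n m) {j i : ℕ} (hj : j < m) (hi : i ≤ 2 ^ ar inp j) :
    ∑ i' ∈ Finset.range i, tb inp j i' ≤ 2 ^ k :=
  calc _ ≤ sat inp j := Finset.sum_le_sum_of_subset (Finset.range_subset_range.2 hi)
    _ ≤ _ := (h.sat_lt j hj).le.trans (Nat.pow_le_pow_right (by norm_num) (h.ar_le j hj))

/-- The body performs one step of the recursions that define `ptr`, `wmax`, `dg` and `costGates`.
The selection gates are emitted while the variables are read; the copying gates need the weight and
come after the satisfying assignments have been counted. -/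
theorem WF.conBody (h : WF inp k (inp 0) m) (hV : Fits V k Q (inp 0) m) {j R : ℕ}
    (hR : R = Q * 2 ^ k * m + 1) (hj : j < m) {ψ : QState}
    (S : Scan inp R (2 * inp 0 + 1 + j * (R * 2 ^ k)) (ptr inp j) (wmax inp Q j)
      (∑ i ∈ Finset.range (inp 0), dg inp j i ^ 2) (dg inp j)
      (costGates inp (2 * inp 0 + 1) R (2 ^ k) Q j) mem) (h4 : mem (inp 0 + 4) = j) :
    ND inp V (QMachine.conBody k Q) (k * (R * 2 ^ k * 10 + 8) + R * 2 ^ k * 9 + 14) mem ψ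
      fun mem' ψ' => mem' (inp 0 + 4) = j ∧ ψ' = ψ ∧
      Scan inp R (2 * inp 0 + 1 + (j + 1) * (R * 2 ^ k)) (ptr inp (j + 1)) (wmax inp Q (j + 1))
        (∑ i ∈ Finset.range (inp 0), dg inp (j + 1) i ^ 2) (dg inp (j + 1))
        (costGates inp (2 * inp 0 + 1) R (2 ^ k) Q (j + 1)) mem' := by
  have hak := h.ar_le j hj
  have hRR := hR
  have hcir := hV.circuit
  have hCl := h.length_costGates_le (Q := Q) (2 * inp 0 + 1) R (j := j) (by omega)
  rw [← hR] at hcir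
  have hjm : (j + 1) * (R * 2 ^ k) ≤ m * (R * 2 ^ k) := Nat.mul_le_mul_right _ hj
  have hpow : 2 ^ ar inp j ≤ 2 ^ k := Nat.pow_le_pow_right (by norm_num) hak
  have hpowR : R * 2 ^ ar inp j ≤ R * 2 ^ k := Nat.mul_le_mul_left _ hpow
  have hRK1 : 1 * 2 ^ k ≤ R * 2 ^ k := Nat.mul_le_mul_right _ (by omega)
  have hRK2 : R * 1 ≤ R * 2 ^ k := Nat.mul_le_mul_left _ (Nat.one_le_two_pow)
  have hQR : Q * 2 ^ k ≤ R := by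
    have : Q * 2 ^ k * 1 ≤ Q * 2 ^ k * m := Nat.mul_le_mul_left _ (by omega)
    omega
  have hka : ar inp j * (R * 2 ^ k * 10 + 8) ≤ k * (R * 2 ^ k * 10 + 8) := Nat.mul_le_mul_right _ hak
  have hptr := h.ptr_le (j := j + 1) hj
  have hptrV : ptr inp (j + 1) ≤ V := by
    have h1 := hV.ptr
    have h2 : (j + 1) * (1 + k + 2 ^ k) ≤ m * (1 + k + 2 ^ k) := Nat.mul_le_mul_right _ hj
    omega
  have hkV : k ≤ V := by
    have h1 := hV.deg
    have : 1 * k ≤ m * k := Nat.mul_le_mul_right _ (by omega)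
    omega
  set A := 2 * inp 0 + 1 + j * (R * 2 ^ k) with hA
  set C := costGates inp (2 * inp 0 + 1) R (2 ^ k) Q j with hC
  set RK := R * 2 ^ k with hRKdef
  have e1 : (m + 1) * (4 * RK) = 4 * (m * RK) + 4 * RK := by ring
  have e2 : j * (3 * RK) = 3 * (j * RK) := by ring
  rw [e1] at hcir
  rw [add_mul, one_mul] at hjm
  have v1 : (AExp.input (reg 2)).eval inp mem = ar inp j := by
    simp only [AExp.eval, eval_reg, S.r2, ar]
  have hs : ar inp j * (RK * 10 + 6 + 2) = ar inp j * (RK * 10 + 8) := rfl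
  refine ND.steps (N := 1 + (1 + ((ar inp j * (RK * 10 + 6 + 2) + 2) + (1 +
    ((2 ^ ar inp j * (1 + 2) + 2) + (1 + (1 + ((R * 2 ^ ar inp j * (4 * 1 + 2) + 2) + (1 + 1)))))))))
    (.seq (.setReg (by rw [v1]; omega) ?_)) (by omega)
  rw [v1]
  refine .seq (.setReg (show 1 ≤ V by omega) ?_)
  refine .seq (.forLoop (fun l mem' ψ' => ψ' = ψ ∧ VarInv inp R A (ptr inp j) (wmax inp Q j) C j l mem')
    (show ar inp j ≤ V by omega) ⟨rfl, ?_⟩ (fun l _ mem' _ _ hI => hI.2.r7)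
    (fun l hl mem' ψ' _ h9 hI => (h.varBody hV hRR hj hl rfl hCl hI.2 h9).weaken
      fun _ _ h' => ⟨h'.1, h'.2.1.trans hI.1, h'.2.2⟩) fun mem₁ ψ₁ _ hI => ?_)
  · have S1 := (S.update (c := 7) (by norm_num) (by simp) (ar inp j)).update (c := 8) (by norm_num)
      (by simp) 1
    have e : selectGates A R (vr inp j) 0 = [] := rfl
    refine VarInv.update ⟨?_, ?_, ?_, ?_⟩ (by norm_num) (by norm_num) 0
    · rw [dgp_zero, e, List.append_nil]; exact S1
    · rw [update_reg_ne (by norm_num), update_reg_ne (by norm_num), h4]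
    · rw [update_reg_ne (by norm_num), update_self]
    · exact update_self _ _ _
  obtain ⟨rfl, hI⟩ := hI
  clear S h4 v1
  -- count the satisfying assignments
  refine .seq (.setReg (Nat.zero_le _) ?_)
  refine .seq (.forLoop (fun i mem' ψ' => ψ' = ψ₁ ∧
    VarInv inp R A (ptr inp j) (wmax inp Q j) C j (ar inp j) mem' ∧
      mem' (inp 0 + 12) = ∑ i' ∈ Finset.range i, tb inp j i') (M := 2 ^ ar inp j) (by omega)
    ⟨rfl, (hI.update (c := 12) (by norm_num) (by norm_num) _).update (c := 13) (by norm_num)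
      (by norm_num) 0, ?_⟩ (fun i _ mem' _ _ hI' => hI'.2.1.r8)
    (fun i hi mem' ψ' _ h13 ⟨h1, h2, h3⟩ => ?_) fun mem₂ ψ₂ _ hI₂ => ?_)
  · rw [update_reg_ne (by norm_num), update_self]; rfl
  · have v2 : (AExp.add (reg 12) (tabExp (reg 13))).eval inp mem' =
        ∑ i' ∈ Finset.range (i + 1), tb inp j i' := by
      simp only [tabExp, AExp.eval, eval_reg, h3, h2.scan.r2, h2.r7, h13]
      rw [Finset.sum_range_succ, tb]
    refine .setReg ?_ ⟨?_, h1, ?_, ?_⟩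
    · rw [v2]; have := h.sat_le hj (i := i + 1) hi; omega
    · rw [update_reg_ne (by norm_num), h13]
    · exact (h2.update (by norm_num) (by norm_num) _).update (by norm_num) (by norm_num) _
    · rw [update_reg_ne (by norm_num), update_self, v2]
  obtain ⟨rfl, hI₂, h12⟩ := hI₂
  -- the weight and the largest weight
  have v3 : (AExp.div (.mul (.lit Q) (reg 8)) (.sub (reg 8) (reg 12))).eval inp mem₂ = wt inp Q j := by
    simp only [AExp.eval, eval_reg, hI₂.r8, h12]
    rfl
  have hw := h.wt_le Q hj
  refine .seq (.setReg (by rw [v3]; exact hw.trans hV.weight) ?_)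
  rw [v3]
  have hI₃ := hI₂.update (c := 14) (by norm_num) (by norm_num) (wt inp Q j)
  have h14 : update mem₂ (inp 0 + 14) (wt inp Q j) (inp 0 + 14) = wt inp Q j := update_self _ _ _
  set mem₃ := update mem₂ (inp 0 + 14) (wt inp Q j)
  have v4 : (AExp.add (reg 5) (.sub (reg 14) (reg 5))).eval inp mem₃ = wmax inp Q (j + 1) := by
    simp only [AExp.eval, eval_reg, hI₃.scan.r5, h14]
    rfl
  refine .seq (.setReg (by rw [v4]; exact (h.wmax_le Q (j := j + 1) hj).trans hV.weight) ?_)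
  rw [v4]
  set mem₄ := update mem₃ (inp 0 + 5) (wmax inp Q (j + 1))
  have hm₄ : ∀ c ≠ 5, mem₄ (inp 0 + c) = mem₃ (inp 0 + c) := fun c hc => update_reg_ne hc _
  have S₄ : Scan inp R A (ptr inp j) (wmax inp Q (j + 1)) (∑ i ∈ Finset.range (inp 0), dg inp (j + 1) i ^ 2)
      (dg inp (j + 1)) (C ++ selectGates A R (vr inp j) (ar inp j)) mem₄ := by
    have S₃ := hI₃.scan
    rw [dgp_last] at S₃
    exact ⟨by rw [hm₄ 0 (by norm_num), S₃.r0], by rw [hm₄ 1 (by norm_num), S₃.r1],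
      by rw [hm₄ 2 (by norm_num), S₃.r2], update_self _ _ _, by rw [hm₄ 6 (by norm_num), S₃.r6],
      fun i hi => by rw [← S₃.deg i hi]; exact update_of_ne (by omega) _ _,
      S₃.emitted.update_reg (by norm_num) (by norm_num) _⟩
  -- the copying gates
  have hsel := length_selectGates A R (vr inp j) (ar inp j)
  refine .seq ((ND.emitLoop (L := fun p => [(A + p, A + p,
    A + R * 2 ^ k + (p % R + (1 - tb inp j (p / R)) * wt inp Q j))]) (M := R * 2 ^ ar inp j)
      S₄.emitted (by omega) ?_ ?_ ?_ ?_).weaken fun mem₅ ψ₅ ⟨g1, g2, g3⟩ => ?_)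
  · rw [List.length_append]; simp; omega
  · intro p hp g hg
    rw [List.mem_singleton] at hg
    subst hg
    have h1 : p % R < R := Nat.mod_lt _ (by omega)
    have h2 : (1 - tb inp j (p / R)) * wt inp Q j ≤ 1 * wt inp Q j :=
      Nat.mul_le_mul_right _ (Nat.sub_le _ _)
    exact ⟨by dsimp only; omega, by dsimp only; omega, by dsimp only; omega⟩
  · intro mem₅ hm₅
    simp only [AExp.eval, eval_reg]
    rw [hm₅.reg (by norm_num) (by norm_num) (by simp), hm₅.reg (by norm_num) (by norm_num) (by simp),
      S₄.r0, hm₄ 8 (by norm_num), hI₃.r8]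
  · intro p hp mem₅ hm₅ hp'
    have a0 : mem₅ (inp 0 + 0) = R := by
      rw [hm₅.reg (by norm_num) (by norm_num) (by simp), S₄.r0]
    have a1 : mem₅ (inp 0 + 1) = A := by
      rw [hm₅.reg (by norm_num) (by norm_num) (by simp), S₄.r1]
    have a2 : mem₅ (inp 0 + 2) = ptr inp j := by
      rw [hm₅.reg (by norm_num) (by norm_num) (by simp), S₄.r2]
    have a7 : mem₅ (inp 0 + 7) = ar inp j := by
      rw [hm₅.reg (by norm_num) (by norm_num) (by simp), hm₄ 7 (by norm_num), hI₃.r7]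
    have a14 : mem₅ (inp 0 + 14) = wt inp Q j := by
      rw [hm₅.reg (by norm_num) (by norm_num) (by simp), hm₄ 14 (by norm_num), h14]
    simp only [List.map_cons, List.map_nil, AExp.eval, eval_modExp, tabExp, eval_reg, a0, a1, a2, a7,
      a14, hp']
    rfl
  -- the next constraint
  have S₅ := S₄.keep g2 g3
  have hm₅ : ∀ c < 64, c ≠ 3 → c ≠ 11 → c ≠ 5 → mem₅ (inp 0 + c) = mem₃ (inp 0 + c) :=
    fun c h1 h2 h3 h4 => by rw [g2.reg h1 h2 (by simpa using h3), hm₄ c h4]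
  have v5 : (AExp.add (reg 1) (.mul (reg 0) (.lit (2 ^ k)))).eval inp mem₅ =
      2 * inp 0 + 1 + (j + 1) * RK := by
    simp only [AExp.eval, eval_reg, S₅.r1, S₅.r0, hA, hRKdef]; ring
  refine .seq (.setReg (by rw [v5, add_mul]; omega) ?_)
  rw [v5]
  have v6 : ∀ x, (AExp.add (.add (.add (reg 2) (.lit 1)) (reg 7)) (reg 8)).eval inp
      (update mem₅ (inp 0 + 1) x) = ptr inp (j + 1) := fun x => by
    simp only [AExp.eval, eval_reg]
    rw [update_reg_ne (by norm_num), update_reg_ne (by norm_num), update_reg_ne (by norm_num), S₅.r2,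
      hm₅ 7 (by norm_num) (by norm_num) (by norm_num) (by norm_num),
      hm₅ 8 (by norm_num) (by norm_num) (by norm_num) (by norm_num), hI₃.r7, hI₃.r8]
    rfl
  refine .setReg (by rw [v6]; exact hptrV) ?_
  rw [v6]
  refine ⟨?_, g1, ?_, ?_, ?_, ?_, ?_, fun i hi => ?_, ?_⟩
  · rw [update_reg_ne (by norm_num), update_reg_ne (by norm_num),
      hm₅ 4 (by norm_num) (by norm_num) (by norm_num) (by norm_num), hI₃.r4]
  · rw [update_reg_ne (by norm_num), update_reg_ne (by norm_num), S₅.r0]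
  · rw [update_reg_ne (by norm_num), update_self]
  · rw [update_self]
  · rw [update_reg_ne (by norm_num), update_reg_ne (by norm_num), S₅.r5]
  · rw [update_reg_ne (by norm_num), update_reg_ne (by norm_num), S₅.r6]
  · rw [update_of_ne (by omega), update_of_ne (by omega), S₅.deg i hi]
  · have := (S₅.emitted.update_reg (c := 1) (by norm_num) (by norm_num)
      (2 * inp 0 + 1 + (j + 1) * RK)).update_reg (c := 2) (by norm_num) (by norm_num) (ptr inp (j + 1))
    rw [List.append_assoc] at this
    rw [costGates, layerGates, copyGates, List.map_eq_flatMap]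
    exact this

end QMachine

namespace QMachine

open Function

variable {inp : ℕ → ℕ} {V : ℕ} {mem mem' : ℕ → ℕ} {k Q : ℕ}

/-! ## Preparation of the circuits -/

/-- The gates of the circuit that tells whether the qubits `q 0, q 1, …` are zero. -/
def reflExps (q : AExp) : List (AExp × AExp × AExp) :=
  [(tokenQubit, q, .add (.add tokenQubit (.lit 1)) (reg 11)),
    (.add (.add tokenQubit (.lit 1)) (reg 11), .add (.add tokenQubit (.lit 1)) (reg 11), tokenQubit)]

theorem ND.reflLoop {ψ : QState} {C : List (ℕ × ℕ × ℕ)} {q c : AExp} {f : ℕ → ℕ} {M : ℕ}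
    (hC : Emitted inp mem C) (hM : M ≤ V) (hV : C.length + 2 * M ≤ V) (hV' : 2 * inp 0 + 2 + M ≤ V)
    (hf : ∀ i < M, f i ≤ V) (hc : ∀ mem', Keep inp [11] mem mem' → c.eval inp mem' = M)
    (hq : ∀ i < M, ∀ mem', Keep inp [11] mem mem' → mem' (inp 0 + 11) = i → q.eval inp mem' = f i) :
    ND inp V (QMachine.emitLoop c (reflExps q)) (M * 10 + 2) mem ψ fun mem' ψ' => ψ' = ψ ∧
      Keep inp [11] mem mem' ∧ Emitted inp mem' (C ++ reflGates (2 * inp 0 + 1) f M) := by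
  refine QMachine.ND.emitLoop hC hM ?_ ?_ hc ?_
  · rw [List.length_flatMap]
    simpa [mul_comm] using hV
  · intro p hp g hg
    have := hf p hp
    simp only [List.mem_cons, List.not_mem_nil, or_false] at hg
    rcases hg with rfl | rfl
    · exact ⟨by dsimp only; omega, by dsimp only; omega, by dsimp only; omega⟩
    · exact ⟨by dsimp only; omega, by dsimp only; omega, by dsimp only; omega⟩
  · intro p hp mem₁ hm₁ hp'
    simp only [reflExps, List.map_cons, List.map_nil, AExp.eval, eval_tokenQubit, eval_reg, hp',
      hq p hp mem₁ hm₁ hp']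

theorem length_reflGates (a : ℕ) (q : ℕ → ℕ) (M : ℕ) : (reflGates a q M).length = 2 * M := by
  rw [reflGates, List.length_flatMap]; simp [mul_comm]

/-- Scan the input and store the circuits for the cost and for the reflection about zero. -/
def prelude (k Q : ℕ) : Prog :=
  .seq (setReg 0 (.add (.mul (.lit (Q * 2 ^ k)) (.input (.lit 1))) (.lit 1)))
    (.seq (setReg 1 tokenQubit) (.seq (setReg 2 (.lit 2))
      (.seq (forLoop 4 (.input (.lit 1)) (conBody k Q)) (.seq (setReg 15 (reg 3))
        (.seq (emitLoop (.mul (.lit 2) numVars) (reflExps (reg 11))) (.seq (setReg 34 (reg 3))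
          (.seq (setReg 16 (.lit 0)) (setReg 17 (.lit 0)))))))))

/-- The number of token places of a layer. -/
def layerLen (inp : ℕ → ℕ) (k Q : ℕ) : ℕ := (Q * 2 ^ k * inp 1 + 1) * 2 ^ k

/-- The circuit for the cost. -/
def costCircuit (inp : ℕ → ℕ) (k Q : ℕ) : List (ℕ × ℕ × ℕ) :=
  costGates inp (2 * inp 0 + 1) (Q * 2 ^ k * inp 1 + 1) (2 ^ k) Q (inp 1)

/-- The circuit for the reflection about zero. -/
def zeroCircuit (inp : ℕ → ℕ) : List (ℕ × ℕ × ℕ) := reflGates (2 * inp 0 + 1) id (2 * inp 0)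

theorem length_zeroCircuit : (zeroCircuit inp).length = 4 * inp 0 := by
  rw [zeroCircuit, length_reflGates]; ring

/-- The memory holds what the preparation computes. -/
structure Base (inp : ℕ → ℕ) (k Q : ℕ) (mem : ℕ → ℕ) : Prop where
  r1 : mem (inp 0 + 1) = 2 * inp 0 + 1 + inp 1 * layerLen inp k Q
  r5 : mem (inp 0 + 5) = wmax inp Q (inp 1)
  r6 : mem (inp 0 + 6) = sqd inp
  r15 : mem (inp 0 + 15) = (costCircuit inp k Q).length
  r34 : mem (inp 0 + 34) = (costCircuit inp k Q).length + (zeroCircuit inp).length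
  stored : Stored inp mem 0 (costCircuit inp k Q ++ zeroCircuit inp)

/-- The initial zero memory already represents empty circuit, zero degrees and zero maximum, so only
the scale `R`, the token position and the tape position are initialized. -/
theorem WF.prelude (h : WF inp k (inp 0) (inp 1)) (hV : Fits V k Q (inp 0) (inp 1))
    (hV' : (costCircuit inp k Q).length + 4 * inp 0 + 4 ≤ V) {ψ : QState} :
    ND inp V (QMachine.prelude k Q)
      (inp 1 * (k * (layerLen inp k Q * 10 + 8) + layerLen inp k Q * 9 + 16) + inp 0 * 20 + 11)
      (fun _ => 0) ψ fun mem' ψ' => ψ' = ψ ∧ mem' (inp 0 + 16) = 0 ∧ mem' (inp 0 + 17) = 0 ∧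
        Base inp k Q mem' := by
  have hm := hV.ptr
  have hcir := hV.circuit
  have hmk := hV.deg
  set R := Q * 2 ^ k * inp 1 + 1 with hR
  have hL : layerLen inp k Q = R * 2 ^ k := rfl
  have hRK2 : R * 1 ≤ R * 2 ^ k := Nat.mul_le_mul_left _ (Nat.one_le_two_pow)
  have hCl := h.length_costGates_le (Q := Q) (2 * inp 0 + 1) R le_rfl
  have hmV : inp 1 ≤ V := by
    have : inp 1 * 1 ≤ inp 1 * (1 + k + 2 ^ k) := Nat.mul_le_mul_left _ (by rw [add_assoc]; exact Nat.le_add_right _ _)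
    omega
  rw [hL]
  set RK := R * 2 ^ k with hRK
  have e1 : (inp 1 + 1) * (4 * RK) = 4 * (inp 1 * RK) + 4 * RK := by ring
  have e2 : inp 1 * (3 * RK) = 3 * (inp 1 * RK) := by ring
  rw [e1] at hcir
  rw [e2] at hCl
  have v0 : ∀ mem, (AExp.add (.mul (.lit (Q * 2 ^ k)) (.input (.lit 1))) (.lit 1)).eval inp mem = R :=
    fun _ => rfl
  refine ND.steps (N := 1 + (1 + (1 + ((inp 1 * (k * (RK * 10 + 8) + RK * 9 + 14 + 2) + 2) + (1 +
    ((2 * inp 0 * 10 + 2) + (1 + (1 + 1)))))))) (.seq (.setReg (by rw [v0]; omega) ?_)) (by ring_nf; omega)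
  rw [v0]
  refine .seq (.setReg (by rw [eval_tokenQubit]; omega) ?_)
  rw [eval_tokenQubit]
  refine .seq (.setReg (show 2 ≤ V by omega) ?_)
  refine .seq (.forLoop (fun j mem' ψ' => ψ' = ψ ∧
      Scan inp R (2 * inp 0 + 1 + j * RK) (ptr inp j) (wmax inp Q j)
        (∑ i ∈ Finset.range (inp 0), dg inp j i ^ 2) (dg inp j)
        (costGates inp (2 * inp 0 + 1) R (2 ^ k) Q j) mem')
    hmV ⟨rfl, ?_⟩ (fun _ _ _ _ _ _ => rfl)
    (fun j hj mem' ψ' _ h4 hI => (h.conBody hV rfl hj hI.2 h4).weaken fun _ _ h' =>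
      ⟨h'.1, h'.2.1.trans hI.1, h'.2.2.update (by norm_num) (by simp) _⟩) fun mem₁ ψ₁ _ hI => ?_)
  · refine ⟨?_, ?_, ?_, ?_, ?_, fun i hi => ?_, fun i hi => absurd hi (Nat.not_lt_zero _), ?_⟩
    · rw [update_reg_ne (by norm_num), update_reg_ne (by norm_num), update_reg_ne (by norm_num),
        update_self]
    · rw [update_reg_ne (by norm_num), update_reg_ne (by norm_num), update_self, zero_mul, add_zero]
    · rw [update_reg_ne (by norm_num), update_self]; rfl
    · rw [update_reg_ne (by norm_num), update_reg_ne (by norm_num), update_reg_ne (by norm_num),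
        update_reg_ne (by norm_num)]; rfl
    · rw [update_reg_ne (by norm_num), update_reg_ne (by norm_num), update_reg_ne (by norm_num),
        update_reg_ne (by norm_num)]
      simp [dg]
    · rw [update_of_ne (by omega), update_of_ne (by omega), update_of_ne (by omega),
        update_of_ne (by omega)]
      simp [dg]
    · rw [update_reg_ne (by norm_num), update_reg_ne (by norm_num), update_reg_ne (by norm_num),
        update_reg_ne (by norm_num)]; rfl
  obtain ⟨rfl, S⟩ := hI
  change Scan inp R _ _ _ _ _ (costCircuit inp k Q) mem₁ at S
  have hCl' : (costCircuit inp k Q).length ≤ 3 * (inp 1 * RK) := hCl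
  set C := costCircuit inp k Q
  have v3 : (reg 3).eval inp mem₁ = C.length := S.emitted.2
  refine .seq (.setReg (by rw [v3]; omega) ?_)
  rw [v3]
  have S₂ := S.update (c := 15) (by norm_num) (by simp) C.length
  refine .seq ((ND.reflLoop (q := reg 11) (f := id) (M := 2 * inp 0) S₂.emitted (by omega) (by omega) (by omega)
    (fun i hi => by simp only [id]; omega) (fun _ _ => rfl) (fun i hi mem' _ hi' => hi')).weaken
    fun mem₃ ψ₃ ⟨g1, g2, g3⟩ => ?_)
  have S₃ := S₂.keep g2 g3
  have g15 : mem₃ (inp 0 + 15) = C.length := by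
    rw [g2.reg (by norm_num) (by norm_num) (by simp), update_self]
  have v4 : (reg 3).eval inp mem₃ = (C ++ zeroCircuit inp).length := S₃.emitted.2
  have hz := length_zeroCircuit (inp := inp)
  rw [List.length_append] at v4
  refine .seq (.setReg (by rw [v4]; omega) ?_)
  rw [v4]
  refine .seq (.setReg (Nat.zero_le _) (.setReg (Nat.zero_le _) ⟨g1, ?_, update_self _ _ _, ?_⟩))
  · rw [update_reg_ne (by norm_num), update_self]; rfl
  · have S₄ := ((S₃.update (c := 34) (by norm_num) (by simp) (C.length + (zeroCircuit inp).length)).update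
      (c := 16) (by norm_num) (by simp) 0).update (c := 17) (by norm_num) (by simp) 0
    exact ⟨S₄.r1, S₄.r5, S₄.r6,
      by rw [update_reg_ne (by norm_num), update_reg_ne (by norm_num), update_reg_ne (by norm_num), g15],
      by rw [update_reg_ne (by norm_num), update_reg_ne (by norm_num), update_self], S₄.emitted.1⟩

end QMachine

namespace QMachine

open Function

variable {inp : ℕ → ℕ} {V : ℕ} {mem₀ mem mem' : ℕ → ℕ} {k Q : ℕ}

/-! ## Straight-line register programs -/

/-- The memory differs from `mem₀` exactly in the registers listed in `l`, which have the listed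
values. -/
structure Regs (inp : ℕ → ℕ) (l : List (ℕ × ℕ)) (mem₀ mem : ℕ → ℕ) : Prop where
  get : ∀ p ∈ l, mem (inp 0 + p.1) = p.2
  off : ∀ i, (∀ p ∈ l, i ≠ inp 0 + p.1) → mem i = mem₀ i

section
variable {l : List (ℕ × ℕ)} {c x : ℕ} {P : Prog} {N : ℕ} {ψ : QState} {q : (ℕ → ℕ) → QState → Prop}

theorem Regs.reg (h : Regs inp l mem₀ mem) (hc : (c, x) ∈ l) : mem (inp 0 + c) = x := h.get _ hc

theorem Regs.reg_off (h : Regs inp l mem₀ mem) (hc : c ∉ l.map Prod.fst) :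
    mem (inp 0 + c) = mem₀ (inp 0 + c) :=
  h.off _ fun p hp e => hc (List.mem_map.2 ⟨p, hp, (Nat.add_left_cancel e).symm⟩)

theorem Regs.cons (h : Regs inp l mem₀ mem) (hc : c ∉ l.map Prod.fst) (x : ℕ) :
    Regs inp ((c, x) :: l) mem₀ (update mem (inp 0 + c) x) where
  get p hp := by
    rcases List.mem_cons.1 hp with rfl | hp
    · exact update_self _ _ _
    · rw [update_reg_ne (fun e => hc (List.mem_map.2 ⟨p, hp, e⟩)), h.get p hp]
  off i hi := by
    rw [update_of_ne (hi (c, x) (by simp)), h.off i fun p hp => hi p (by simp [hp])]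

/-- Stated with the rest of the program as continuation, so that a long sequence of assignments is
verified by growing one list of register values. Each register is assigned once, which keeps earlier
entries valid. -/
theorem ND.assign {e : AExp} (h : Regs inp l mem₀ mem) (hc : c ∉ l.map Prod.fst)
    (he : e.eval inp mem = x) (hx : x ≤ V)
    (hP : ∀ mem', Regs inp ((c, x) :: l) mem₀ mem' → ND inp V P N mem' ψ q) :
    ND inp V (.seq (QMachine.setReg c e) P) (1 + N) mem ψ q :=
  .seq (.setReg (by rw [he]; exact hx) (by rw [he]; exact hP _ (h.cons hc x)))

/-- Store the power `a ^ e` in register `c`, counting in register `d`. -/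
def powReg (c d a : ℕ) (e : AExp) : Prog :=
  .seq (setReg c (.lit 1)) (forLoop d e (setReg c (.mul (.lit a) (reg c))))

/-- The exponent is evaluated anew in every round while `c` and `d` change, hence it may rely only
on the registers in `l`. -/
theorem ND.powReg {d a i : ℕ} {e : AExp} (h : Regs inp l mem₀ mem) (hc : c ∉ l.map Prod.fst)
    (hd : d ∉ l.map Prod.fst) (hcd : c ≠ d) (ha : 0 < a)
    (he : ∀ mem', (∀ p ∈ l, mem' (inp 0 + p.1) = p.2) → e.eval inp mem' = i) (hi : i ≤ V)
    (hx : a ^ i ≤ V)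
    (hP : ∀ mem', Regs inp ((c, a ^ i) :: (d, i) :: l) mem₀ mem' → ND inp V P N mem' ψ q) :
    ND inp V (.seq (QMachine.powReg c d a e) P) (i * 3 + 3 + N) mem ψ q := by
  have hd' : ∀ x : ℕ, d ∉ (((c, x) :: l).map Prod.fst) := fun x => by
    rw [List.map_cons, List.mem_cons, not_or]; exact ⟨hcd.symm, hd⟩
  have hV1 : ∀ j ≤ i, a ^ j ≤ V := fun j hj => (Nat.pow_le_pow_right ha hj).trans hx
  refine ND.steps (N := (1 + (i * (1 + 2) + 2)) + N) (.seq (.seq (.setReg (hV1 0 (Nat.zero_le _))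
    (.forLoop (fun j mem' ψ' => ψ' = ψ ∧ Regs inp ((d, j) :: (c, a ^ j) :: l) mem₀ mem') hi
      ⟨rfl, (h.cons hc 1).cons (hd' 1) 0⟩ (fun j _ mem' ψ' _ h' => he _ fun p hp =>
        h'.2.get p (by simp [hp])) (fun j hj mem' ψ' _ _ h' => ?_)
      fun mem' ψ' _ h' => ?_)))) (by omega)
  · have v : (AExp.mul (.lit a) (QMachine.reg c)).eval inp mem' = a ^ (j + 1) := by
      simp only [AExp.eval, eval_reg, h'.2.reg (c := c) (x := a ^ j) (by simp), pow_succ, mul_comm]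
    refine .setReg (by rw [v]; exact hV1 _ hj) ?_
    rw [v]
    refine ⟨by rw [update_reg_ne hcd.symm]; exact h'.2.reg (by simp), h'.1, ?_⟩
    refine ⟨fun p hp => ?_, fun i' hi' => ?_⟩
    · rcases List.mem_cons.1 hp with rfl | hp
      · exact update_self _ _ _
      rcases List.mem_cons.1 hp with rfl | hp
      · rw [update_reg_ne hcd]; exact update_self _ _ _
      · rw [update_reg_ne fun e => hd (List.mem_map.2 ⟨p, hp, e⟩),
          update_reg_ne fun e => hc (List.mem_map.2 ⟨p, hp, e⟩), h'.2.get p (by simp [hp])]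
    · rw [update_of_ne (hi' (d, j + 1) (by simp)), update_of_ne (hi' (c, a ^ (j + 1)) (by simp)),
        h'.2.off i' fun p hp => ?_]
      rcases List.mem_cons.1 hp with rfl | hp
      · exact hi' (d, j + 1) (by simp)
      rcases List.mem_cons.1 hp with rfl | hp
      · exact hi' (c, a ^ (j + 1)) (by simp)
      · exact hi' p (by simp [hp])
  · obtain ⟨rfl, h'⟩ := h'
    exact hP mem' ⟨fun p hp => h'.get p (by simp at hp ⊢; tauto),
      fun j hj => h'.off j fun p hp => hj p (by simp at hp ⊢; tauto)⟩

end

end QMachine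

namespace QMachine

open Function

variable {inp : ℕ → ℕ} {V : ℕ} {mem₀ mem mem' : ℕ → ℕ} {k Q M : ℕ}

/-! ## An attempt -/

/-- The number of values of each of the three exponents. -/
def expRange : AExp := .add numVars (.lit 6)

/-- `a` minus `256 · 2 ^ (n - s)` for the square `a` of the product of two powers. -/
def excess (c : ℕ) : AExp :=
  .sub (.mul (.mul (reg c) (reg 30)) (.mul (reg c) (reg 30))) (.mul (.lit 256) (reg 26))

/-- Read the parameters off the counter in register 16. -/
def decodeProg (k Q M : ℕ) (P : Prog) : Prog :=
  .seq (setReg 43 (.div (reg 16) (.lit M))) <|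
  .seq (setReg 33 (modExp (reg 43) expRange)) <|
  .seq (setReg 44 (.div (reg 43) expRange)) <|
  .seq (setReg 32 (modExp (reg 44) expRange)) <|
  .seq (setReg 45 (.div (reg 44) expRange)) <|
  .seq (setReg 31 (modExp (reg 45) expRange)) <|
  .seq (setReg 46 (.div (reg 45) expRange)) <|
  .seq (setReg 19 (modExp (reg 46) numVars)) <|
  .seq (setReg 18 (.div (reg 46) numVars)) <|
  .seq (setReg 23 (.sub (.mul (.lit Q) (.input (.lit 1))) (reg 18))) <|
  .seq (setReg 24 (.div (.mul (reg 23) (reg 23)) (.mul (.mul (reg 5) (reg 5)) (reg 6)))) <|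
  .seq (setReg 25 (.add (.div (.sub (.mul (.lit 4) (.mul (.lit Q) (.input (.lit 1))))
    (.mul (.lit 3) (reg 23))) (.lit 4)) (.lit 1))) <|
  .seq (powReg 28 47 3 (reg 31)) <|
  .seq (powReg 29 48 3 (reg 32)) <|
  .seq (powReg 30 49 3 (reg 33)) <|
  .seq (powReg 26 50 2 (.sub numVars (reg 24))) <|
  .seq (setReg 20 (.div (.sub (reg 28) (.lit 1)) (.lit 2))) <|
  .seq (setReg 21 (.div (.sub (reg 29) (.lit 1)) (.lit 2))) <|
  .seq (setReg 22 (.div (.sub (reg 30) (.lit 1)) (.lit 2))) P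

/-- Search and mark the good labels, unless the exponents are too large. -/
def attemptProg (k Q M : ℕ) : Prog :=
  decodeProg k Q M <| .ite (excess 28) .skip <| .ite (excess 29) .skip <|
    .seq (setReg 3 (reg 34)) <| .seq (emitLoop (reg 24) (reflExps (windowVar (reg 11)))) <|
      .seq (setReg 35 (reg 3)) <| .seq searchProg markProg

/-- The parameters that the counter value `z` stands for. -/
structure Params (n M z v b i₁ i₂ i₃ : ℕ) : Prop where
  v_eq : z / M / (n + 6) / (n + 6) / (n + 6) / n = v
  b_eq : z / M / (n + 6) / (n + 6) / (n + 6) % n = b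
  i₁_eq : z / M / (n + 6) / (n + 6) % (n + 6) = i₁
  i₂_eq : z / M / (n + 6) % (n + 6) = i₂
  i₃_eq : z / M % (n + 6) = i₃

/-- Enough space and steps per oracle call. -/
structure Room (inp : ℕ → ℕ) (V B k Q : ℕ) : Prop where
  le : B ≤ V
  refl : inp 0 * 24 + 20 ≤ B
  circuit : (Q * inp 1 + 1) * 6 + (costCircuit inp k Q).length * 6 + 8 ≤ B
  pow : 3 ^ (inp 0 + 6) ≤ V

/-- The registers after decoding. -/
def decoded (inp : ℕ → ℕ) (Q z M v b i₁ i₂ i₃ : ℕ) : List (ℕ × ℕ) :=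
  [(22, (3 ^ i₃ - 1) / 2), (21, (3 ^ i₂ - 1) / 2), (20, (3 ^ i₁ - 1) / 2),
    (26, 2 ^ (inp 0 - width inp Q v)), (50, inp 0 - width inp Q v), (30, 3 ^ i₃), (49, i₃),
    (29, 3 ^ i₂), (48, i₂), (28, 3 ^ i₁), (47, i₁), (25, thr inp Q v), (24, width inp Q v),
    (23, Q * inp 1 - v), (18, v), (19, b), (46, z / M / (inp 0 + 6) / (inp 0 + 6) / (inp 0 + 6)),
    (31, i₁), (45, z / M / (inp 0 + 6) / (inp 0 + 6)), (32, i₂), (44, z / M / (inp 0 + 6)),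
    (33, i₃), (43, z / M)]

/-- The counter is read in mixed radix. Its lowest digit, below `M`, numbers the repetitions and is
dropped by the first division; the target `v` is the highest digit and so varies slowest. -/
theorem ND.decodeProg {z v b i₁ i₂ i₃ N : ℕ} {P : Prog} {ψ : QState}
    {q : (ℕ → ℕ) → QState → Prop} {B : ℕ}
    (hB : Base inp k Q mem) (hR : Room inp V B k Q) (h16 : mem (inp 0 + 16) = z) (hz : z ≤ V)
    (hp : Params (inp 0) M z v b i₁ i₂ i₃) (hs : width inp Q v ≤ inp 0)
    (hP : ∀ mem', Regs inp (decoded inp Q z M v b i₁ i₂ i₃) mem mem' → ND inp V P N mem' ψ q) :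
    ND inp V (QMachine.decodeProg k Q M P) (inp 0 * 12 + 100 + N) mem ψ q := by
  have hN : ∀ a b c d n N : ℕ, a < n + 6 → b < n + 6 → c < n + 6 → d ≤ n →
      1 + (1 + (1 + (1 + (1 + (1 + (1 + (1 + (1 + (1 + (1 + (1 +
        ((a * 3 + 3) + ((b * 3 + 3) + ((c * 3 + 3) + ((d * 3 + 3) + (1 + (1 + (1 + N)))))))))))))))))) ≤
      n * 12 + 100 + N := by
    intros; linarith
  obtain ⟨h1, h2, h3, h4⟩ := hR
  set s := width inp Q v with hsd
  have hx0 : z / M ≤ V := (Nat.div_le_self _ _).trans hz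
  have hx1 : z / M / (inp 0 + 6) ≤ V := (Nat.div_le_self _ _).trans hx0
  have hx2 : z / M / (inp 0 + 6) / (inp 0 + 6) ≤ V := (Nat.div_le_self _ _).trans hx1
  have hx3 : z / M / (inp 0 + 6) / (inp 0 + 6) / (inp 0 + 6) ≤ V := (Nat.div_le_self _ _).trans hx2
  have hi₁ : i₁ < inp 0 + 6 := by rw [← hp.i₁_eq]; exact Nat.mod_lt _ (by omega)
  have hi₂ : i₂ < inp 0 + 6 := by rw [← hp.i₂_eq]; exact Nat.mod_lt _ (by omega)
  have hi₃ : i₃ < inp 0 + 6 := by rw [← hp.i₃_eq]; exact Nat.mod_lt _ (by omega)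
  have h3V : ∀ i < inp 0 + 6, 3 ^ i ≤ V := fun i hi =>
    (Nat.pow_le_pow_right (by norm_num) hi.le).trans h4
  have h2V : 2 ^ (inp 0 - width inp Q v) ≤ V :=
    (Nat.pow_le_pow_left (show 2 ≤ 3 by norm_num) _).trans (h3V (inp 0 - s) (by omega))
  have hthr : thr inp Q v ≤ V := by rw [thr]; omega
  have h0 : Regs inp [] mem mem := ⟨by simp, fun _ _ => rfl⟩
  refine ND.steps (N := 1 + (1 + (1 + (1 + (1 + (1 + (1 + (1 + (1 + (1 + (1 + (1 +
    ((i₁ * 3 + 3) + ((i₂ * 3 + 3) + ((i₃ * 3 + 3) + (((inp 0 - width inp Q v) * 3 + 3) +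
      (1 + (1 + (1 + N))))))))))))))))))) ?_ (hN _ _ _ _ _ _ hi₁ hi₂ hi₃ (Nat.sub_le _ _))
  refine ND.assign h0 (x := z / M) (by simp) (by simp only [AExp.eval, eval_reg, h16]) hx0 fun m₁ r₁ => ?_
  have g43 : m₁ (inp 0 + 43) = z / M := r₁.reg (by simp)
  refine ND.assign r₁ (x := i₃) (by simp) (by
    simp only [AExp.eval, eval_modExp, eval_reg, expRange, numVars, g43]; exact hp.i₃_eq)
    (by omega) fun m₂ r₂ => ?_
  have g43 : m₂ (inp 0 + 43) = z / M := r₂.reg (by simp)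
  refine ND.assign r₂ (x := z / M / (inp 0 + 6)) (by simp) (by
    simp only [AExp.eval, eval_reg, expRange, numVars, g43]) hx1 fun m₃ r₃ => ?_
  have g44 : m₃ (inp 0 + 44) = z / M / (inp 0 + 6) := r₃.reg (by simp)
  refine ND.assign r₃ (x := i₂) (by simp) (by
    simp only [AExp.eval, eval_modExp, eval_reg, expRange, numVars, g44]; exact hp.i₂_eq)
    (by omega) fun m₄ r₄ => ?_
  have g44 : m₄ (inp 0 + 44) = z / M / (inp 0 + 6) := r₄.reg (by simp)
  refine ND.assign r₄ (x := z / M / (inp 0 + 6) / (inp 0 + 6)) (by simp) (by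
    simp only [AExp.eval, eval_reg, expRange, numVars, g44]) hx2 fun m₅ r₅ => ?_
  have g45 : m₅ (inp 0 + 45) = z / M / (inp 0 + 6) / (inp 0 + 6) := r₅.reg (by simp)
  refine ND.assign r₅ (x := i₁) (by simp) (by
    simp only [AExp.eval, eval_modExp, eval_reg, expRange, numVars, g45]; exact hp.i₁_eq)
    (by omega) fun m₆ r₆ => ?_
  have g45 : m₆ (inp 0 + 45) = z / M / (inp 0 + 6) / (inp 0 + 6) := r₆.reg (by simp)
  refine ND.assign r₆ (x := z / M / (inp 0 + 6) / (inp 0 + 6) / (inp 0 + 6)) (by simp) (by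
    simp only [AExp.eval, eval_reg, expRange, numVars, g45]) hx3 fun m₇ r₇ => ?_
  have g46 : m₇ (inp 0 + 46) = z / M / (inp 0 + 6) / (inp 0 + 6) / (inp 0 + 6) := r₇.reg (by simp)
  refine ND.assign r₇ (x := b) (by simp) (by
    simp only [AExp.eval, eval_modExp, eval_reg, numVars, g46]; exact hp.b_eq)
    (by rw [← hp.b_eq]; exact (Nat.mod_le _ _).trans hx3) fun m₈ r₈ => ?_
  have g46 : m₈ (inp 0 + 46) = z / M / (inp 0 + 6) / (inp 0 + 6) / (inp 0 + 6) := r₈.reg (by simp)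
  refine ND.assign r₈ (x := v) (by simp) (by
    simp only [AExp.eval, eval_reg, numVars, g46]; exact hp.v_eq)
    (by rw [← hp.v_eq]; exact (Nat.div_le_self _ _).trans hx3) fun m₉ r₉ => ?_
  have g18 : m₉ (inp 0 + 18) = v := r₉.reg (by simp)
  refine ND.assign r₉ (x := Q * inp 1 - v) (by simp) (by
    simp only [AExp.eval, eval_reg, g18]) (by omega) fun m₁₀ r₁₀ => ?_
  have g23 : m₁₀ (inp 0 + 23) = Q * inp 1 - v := r₁₀.reg (by simp)
  have g5 : m₁₀ (inp 0 + 5) = _ := (r₁₀.reg_off (by simp)).trans hB.r5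
  have g6 : m₁₀ (inp 0 + 6) = _ := (r₁₀.reg_off (by simp)).trans hB.r6
  refine ND.assign r₁₀ (x := s) (by simp) (by
    simp only [AExp.eval, eval_reg, g23, g5, g6]; rfl) (by omega) fun m₁₁ r₁₁ => ?_
  have g23 : m₁₁ (inp 0 + 23) = Q * inp 1 - v := r₁₁.reg (by simp)
  refine ND.assign r₁₁ (x := thr inp Q v) (by simp) (by
    simp only [AExp.eval, eval_reg, g23]; rfl) hthr fun m₁₂ r₁₂ => ?_
  refine ND.powReg r₁₂ (i := i₁) (by simp) (by simp) (by norm_num) (by norm_num)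
    (fun m hm => hm (31, i₁) (by simp)) (by omega) (h3V _ hi₁) fun m₁₃ r₁₃ => ?_
  refine ND.powReg r₁₃ (i := i₂) (by simp) (by simp) (by norm_num) (by norm_num)
    (fun m hm => hm (32, i₂) (by simp)) (by omega) (h3V _ hi₂) fun m₁₄ r₁₄ => ?_
  refine ND.powReg r₁₄ (i := i₃) (by simp) (by simp) (by norm_num) (by norm_num)
    (fun m hm => hm (33, i₃) (by simp)) (by omega) (h3V _ hi₃) fun m₁₅ r₁₅ => ?_
  refine ND.powReg r₁₅ (i := inp 0 - s) (by simp) (by simp) (by norm_num) (by norm_num)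
    (fun m hm => by rw [AExp.eval, eval_reg, hm (24, s) (by simp)]; rfl) (by omega) h2V
    fun m₁₆ r₁₆ => ?_
  have g28 : m₁₆ (inp 0 + 28) = 3 ^ i₁ := r₁₆.reg (by simp)
  have hhalf : ∀ i < inp 0 + 6, (3 ^ i - 1) / 2 ≤ V := fun i hi =>
    ((Nat.div_le_self _ _).trans (Nat.sub_le _ _)).trans (h3V i hi)
  refine ND.assign r₁₆ (x := (3 ^ i₁ - 1) / 2) (by simp) (by
    simp only [AExp.eval, eval_reg, g28]) (hhalf _ hi₁) fun m₁₇ r₁₇ => ?_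
  have g29 : m₁₇ (inp 0 + 29) = 3 ^ i₂ := r₁₇.reg (by simp)
  refine ND.assign r₁₇ (x := (3 ^ i₂ - 1) / 2) (by simp) (by
    simp only [AExp.eval, eval_reg, g29]) (hhalf _ hi₂) fun m₁₈ r₁₈ => ?_
  have g30 : m₁₈ (inp 0 + 30) = 3 ^ i₃ := r₁₈.reg (by simp)
  exact ND.assign r₁₈ (x := (3 ^ i₃ - 1) / 2) (by simp) (by
    simp only [AExp.eval, eval_reg, g30]) (hhalf _ hi₃) hP

end QMachine

namespace QMachine

open Function

variable {inp : ℕ → ℕ} {V : ℕ} {mem mem' : ℕ → ℕ} {k Q M : ℕ}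

theorem Stored.of_append {o : ℕ} {C C' : List (ℕ × ℕ × ℕ)} (h : Stored inp mem o (C ++ C')) :
    Stored inp mem o C ∧ Stored inp mem (o + C.length) C' := by
  refine ⟨fun i hi => ?_, fun i hi => ?_⟩
  · have := h i (by rw [List.length_append]; omega)
    rwa [List.getElem_append_left hi] at this
  · have := h (C.length + i) (by rw [List.length_append]; omega)
    rw [List.getElem_append_right (Nat.le_add_right _ _)] at this
    simpa [add_assoc] using this

theorem Stored.congr {o : ℕ} {C : List (ℕ × ℕ × ℕ)} (h : Stored inp mem o C)
    (hm : ∀ i, 2 * inp 0 + 64 ≤ i → mem' i = mem i) : Stored inp mem' o C := fun i hi => by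
  rw [hm _ (by omega), hm _ (by omega), hm _ (by omega)]
  exact h i hi

theorem Base.congr (h : Base inp k Q mem)
    (hr : ∀ c ∈ [1, 5, 6, 15, 34], mem' (inp 0 + c) = mem (inp 0 + c))
    (hs : Stored inp mem' 0 (costCircuit inp k Q ++ zeroCircuit inp)) : Base inp k Q mem' :=
  ⟨(hr 1 (by simp)).trans h.r1, (hr 5 (by simp)).trans h.r5, (hr 6 (by simp)).trans h.r6,
    (hr 15 (by simp)).trans h.r15, (hr 34 (by simp)).trans h.r34, hs⟩

/-- The state after an attempt that is made. -/
noncomputable def attemptState (inp : ℕ → ℕ) (k Q v b i₁ i₂ i₃ : ℕ) (ψ : QState) : QState :=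
  permOp (mark (2 * inp 0 + 1) (costCircuit inp k Q) (2 * inp 0 + 1 + inp 1 * layerLen inp k Q)
    (2 * inp 0) (v + 1)) (attemptOp inp k Q v b i₁ i₂ i₃ ψ)

/-- The exponents are small enough. -/
def Allowed (inp : ℕ → ℕ) (Q v i₁ i₂ i₃ : ℕ) : Prop :=
  (3 ^ i₁ * 3 ^ i₃) ^ 2 ≤ 256 * 2 ^ (inp 0 - width inp Q v) ∧
    (3 ^ i₂ * 3 ^ i₃) ^ 2 ≤ 256 * 2 ^ (inp 0 - width inp Q v)

theorem odd_three_pow (i : ℕ) : 2 * ((3 ^ i - 1) / 2) + 1 = 3 ^ i := by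
  have h : Odd (3 ^ i) := Odd.pow (by decide)
  obtain ⟨t, ht⟩ := h
  omega

/-- A bound for the steps of an attempt. -/
def attemptSteps (n B Z : ℕ) : ℕ := Z * (6 * B + 6) + B + (n * 22 + 120)

-- The two tests bound the products `3 ^ i₁ * 3 ^ i₃` and `3 ^ i₂ * 3 ^ i₃` by `Z`. The nested round
-- count of the search is a combination of these products and of `3 ^ i₃`, hence linear in `Z`. A
-- tuple that fails a test costs only the decoding and leaves the quantum state alone.
open Classical in
theorem ND.attemptProg {z v b i₁ i₂ i₃ B Z : ℕ} {ψ : QState}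
    (hB : Base inp k Q mem) (hR : Room inp V B k Q) (h16 : mem (inp 0 + 16) = z) (hz : z ≤ V)
    (hp : Params (inp 0) M z v b i₁ i₂ i₃) (hs : width inp Q v ≤ inp 0) (hn : 0 < inp 0)
    (hv : v ≤ Q * inp 1) (hZ : ∀ x, x ^ 2 ≤ 256 * 2 ^ (inp 0 - width inp Q v) → x ≤ Z) :
    ND inp V (QMachine.attemptProg k Q M) (attemptSteps (inp 0) B Z) mem ψ fun mem' ψ' =>
      mem' (inp 0 + 16) = z ∧ Base inp k Q mem' ∧
        ψ' = if Allowed inp Q v i₁ i₂ i₃ then attemptState inp k Q v b i₁ i₂ i₃ ψ else ψ := by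
  have hi₁ : i₁ < inp 0 + 6 := by rw [← hp.i₁_eq]; exact Nat.mod_lt _ (by omega)
  have hi₂ : i₂ < inp 0 + 6 := by rw [← hp.i₂_eq]; exact Nat.mod_lt _ (by omega)
  have hi₃ : i₃ < inp 0 + 6 := by rw [← hp.i₃_eq]; exact Nat.mod_lt _ (by omega)
  refine ND.steps (N := inp 0 * 12 + 100 + (((1 + ((inp 0 * 10 + 2) + (1 + (Z * (6 * B + 6) + B)))) + 1)
    + 1)) (.decodeProg hB hR h16 hz hp hs fun m₁ r₁ => ?_) (by rw [attemptSteps]; omega)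
  have h3V : ∀ i < inp 0 + 6, (3 ^ i - 1) / 2 ≤ V := fun i hi =>
    ((Nat.div_le_self _ _).trans (Nat.sub_le _ _)).trans
      ((Nat.pow_le_pow_right (by norm_num) hi.le).trans hR.pow)
  have hBV := hR.le
  have hrefl := hR.refl
  have hcir := hR.circuit
  set s := width inp Q v with hsd
  set y := 2 ^ (inp 0 - s) with hyd
  set p₁ := 3 ^ i₁ with hp₁
  set p₂ := 3 ^ i₂ with hp₂
  set p₃ := 3 ^ i₃ with hp₃
  have g28 : m₁ (inp 0 + 28) = p₁ := r₁.reg (by simp [decoded, hp₁])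
  have g29 : m₁ (inp 0 + 29) = p₂ := r₁.reg (by simp [decoded, hp₂])
  have g30 : m₁ (inp 0 + 30) = p₃ := r₁.reg (by simp [decoded, hp₃])
  have g26 : m₁ (inp 0 + 26) = y := r₁.reg (by simp [decoded, hyd, hsd])
  have e₁ : (excess 28).eval inp m₁ = (p₁ * p₃) ^ 2 - 256 * y := by
    simp only [excess, AExp.eval, eval_reg, g28, g30, g26]; rw [sq]
  have e₂ : (excess 29).eval inp m₁ = (p₂ * p₃) ^ 2 - 256 * y := by
    simp only [excess, AExp.eval, eval_reg, g29, g30, g26]; rw [sq]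
  have hst₁ : Stored inp m₁ 0 (costCircuit inp k Q ++ zeroCircuit inp) := hB.stored.congr fun i hi =>
    r₁.off i fun p hp => by
      simp only [decoded, List.mem_cons, List.not_mem_nil, or_false] at hp
      have : p.1 < 64 := by rcases hp with h | h | h | h | h | h | h | h | h | h | h | h | h | h | h |
        h | h | h | h | h | h | h | h <;> rw [h] <;> norm_num
      omega
  have hB₁ : Base inp k Q m₁ := hB.congr (fun c hc => r₁.reg_off (by
    simp only [List.mem_cons, List.not_mem_nil, or_false] at hc
    rcases hc with rfl | rfl | rfl | rfl | rfl <;> simp [decoded])) hst₁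
  have g16 : m₁ (inp 0 + 16) = z := (r₁.reg_off (by simp [decoded])).trans h16
  refine .ite (fun h => ?_) fun h => .ite (fun h' => ?_) fun h' => ?_
  · rw [e₁] at h
    rw [if_neg fun hA : Allowed inp Q v i₁ i₂ i₃ => h (Nat.sub_eq_zero_of_le hA.1)]
    exact (ND.skip ⟨g16, hB₁, rfl⟩).steps (Nat.zero_le _)
  · rw [e₂] at h'
    rw [if_neg fun hA : Allowed inp Q v i₁ i₂ i₃ => h' (Nat.sub_eq_zero_of_le hA.2)]
    exact (ND.skip ⟨g16, hB₁, rfl⟩).steps (Nat.zero_le _)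
  rw [e₁] at h
  rw [e₂] at h'
  have hA₁ : (p₁ * p₃) ^ 2 ≤ 256 * y := Nat.le_of_sub_eq_zero h
  have hA₂ : (p₂ * p₃) ^ 2 ≤ 256 * y := Nat.le_of_sub_eq_zero h'
  rw [if_pos (show Allowed inp Q v i₁ i₂ i₃ from ⟨hA₁, hA₂⟩)]
  have hZ₁ := hZ _ hA₁
  have hZ₂ := hZ _ hA₂
  have hz0 := length_zeroCircuit (inp := inp)
  set C := costCircuit inp k Q with hC
  set C₀ := zeroCircuit inp with hC₀
  clear e₁ e₂ h h'
  have hy : 1 ≤ p₁ ∧ 1 ≤ p₂ ∧ 1 ≤ p₃ := ⟨Nat.one_le_pow _ _ (by norm_num),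
    Nat.one_le_pow _ _ (by norm_num), Nat.one_le_pow _ _ (by norm_num)⟩
  -- Resetting the stored length to the end of the zero circuit lets the new window circuit
  -- overwrite the previous one.
  have v3 : (reg 34).eval inp m₁ = C.length + C₀.length := hB₁.r34
  refine .seq (.setReg (by rw [v3]; omega) ?_)
  rw [v3]
  have hE : Emitted inp (update m₁ (inp 0 + 3) (C.length + C₀.length)) (C ++ C₀) :=
    ⟨hst₁.congr fun i hi => update_of_ne (by omega) _ _, by
      rw [update_self, List.length_append]⟩
  have g19 : m₁ (inp 0 + 19) = b := r₁.reg (by simp [decoded])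
  have g24 : m₁ (inp 0 + 24) = s := r₁.reg (by simp [decoded, hsd])
  set C₁ := reflGates (2 * inp 0 + 1) (fun i => (b + i) % inp 0) s with hC₁
  have hC₁l : C₁.length = 2 * s := length_reflGates _ _ _
  have hk : ∀ m₂, Keep inp [11] (update m₁ (inp 0 + 3) (C.length + C₀.length)) m₂ →
      ∀ c < 64, c ≠ 3 → c ≠ 11 → m₂ (inp 0 + c) = m₁ (inp 0 + c) := fun m₂ hm₂ c h1 h2 h3 => by
    rw [hm₂.reg h1 h2 (by simpa using h3), update_reg_ne h2]
  refine .seq ((ND.reflLoop (M := s) (f := fun i => (b + i) % inp 0) hE (by omega)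
    (by rw [List.length_append]; omega) (by omega)
    (fun i _ => by have := Nat.mod_lt (b + i) hn; omega)
    (fun m₂ hm₂ => by
      rw [eval_reg, hk m₂ hm₂ 24 (by norm_num) (by norm_num) (by norm_num), g24])
    (fun i hi m₂ hm₂ hi' => by
      rw [windowVar, eval_modExp]
      simp only [AExp.eval, eval_reg, numVars, hi',
        hk m₂ hm₂ 19 (by norm_num) (by norm_num) (by norm_num), g19])).mono (by omega)
    fun m₂ ψ₂ _ ⟨f1, f2, f3⟩ => ?_)
  subst f1
  have v35 : (reg 3).eval inp m₂ = C.length + C₀.length + C₁.length := by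
    rw [eval_reg, f3.2, List.length_append, List.length_append]
  refine .seq (.setReg (by rw [v35]; omega) ?_)
  rw [v35]
  set m₃ := update m₂ (inp 0 + 35) (C.length + C₀.length + C₁.length) with hm₃
  have g : ∀ c < 64, c ≠ 3 → c ≠ 11 → c ≠ 35 → m₃ (inp 0 + c) = m₁ (inp 0 + c) :=
    fun c h1 h2 h3 h4 => by rw [hm₃, update_reg_ne h4, hk m₂ f2 c h1 h2 h3]
  have hE₃ := f3.update_reg (c := 35) (by norm_num) (by norm_num) (C.length + C₀.length + C₁.length)
  obtain ⟨hst₃, hst₁'⟩ := hE₃.1.of_append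
  obtain ⟨hstC, hst₀⟩ := hst₃.of_append
  rw [List.length_append, zero_add] at hst₁'
  rw [zero_add] at hst₀
  have g' : ∀ c x, c < 64 → c ≠ 3 → c ≠ 11 → c ≠ 35 → (c, x) ∈ decoded inp Q z M v b i₁ i₂ i₃ →
      m₃ (inp 0 + c) = x := fun c x h1 h2 h3 h4 h5 => (g c h1 h2 h3 h4).trans (r₁.reg h5)
  have hready : Ready inp m₃ b s ((p₁ - 1) / 2) ((p₂ - 1) / 2) ((p₃ - 1) / 2) (thr inp Q v) v
      (2 * inp 0 + 1 + inp 1 * layerLen inp k Q) C C₀ C₁ :=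
    { r1 := (g 1 (by norm_num) (by norm_num) (by norm_num) (by norm_num)).trans hB₁.r1
      r15 := (g 15 (by norm_num) (by norm_num) (by norm_num) (by norm_num)).trans hB₁.r15
      r34 := (g 34 (by norm_num) (by norm_num) (by norm_num) (by norm_num)).trans hB₁.r34
      r35 := update_self _ _ _
      r18 := g' _ _ (by norm_num) (by norm_num) (by norm_num) (by norm_num) (by simp [decoded])
      r19 := g' _ _ (by norm_num) (by norm_num) (by norm_num) (by norm_num) (by simp [decoded])
      r24 := g' _ _ (by norm_num) (by norm_num) (by norm_num) (by norm_num) (by simp [decoded, hsd])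
      r25 := g' _ _ (by norm_num) (by norm_num) (by norm_num) (by norm_num) (by simp [decoded])
      r20 := g' _ _ (by norm_num) (by norm_num) (by norm_num) (by norm_num) (by simp [decoded, hp₁])
      r21 := g' _ _ (by norm_num) (by norm_num) (by norm_num) (by norm_num) (by simp [decoded, hp₂])
      r22 := g' _ _ (by norm_num) (by norm_num) (by norm_num) (by norm_num) (by simp [decoded, hp₃])
      stored := hstC
      stored₀ := hst₀
      stored₁ := hst₁' }
  have hthr : thr inp Q v ≤ Q * inp 1 + 1 := by rw [thr]; omega
  have hsearch := (hready.searchProg hs hBV (by omega) (by omega) (by omega) (by omega) (by omega)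
    (h3V _ hi₁) (h3V _ hi₂) (h3V _ hi₃))
  rw [hp₁, hp₂, hp₃, odd_three_pow, odd_three_pow, odd_three_pow, ← hp₁, ← hp₂, ← hp₃] at hsearch
  have hmark := Impl.markProg (V := V) (v := v) (by omega) (by omega) hstC hready.r1 hready.r15 hready.r18
  have hboth := Impl.seq (by norm_num) hsearch (hmark.lift (show 1 ≤ 3 by norm_num))
  refine ((hboth m₃ (Fix.refl _ _) ψ₂).mono ?_ fun m₄ ψ₄ _ ⟨f4, f5⟩ => ⟨?_, ?_, f4⟩)
  · have a1 : p₃ * p₁ ≤ Z := by rw [mul_comm]; exact hZ₁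
    have a2 : p₃ * p₂ ≤ Z := by rw [mul_comm]; exact hZ₂
    have a3 : p₃ ≤ Z := le_trans (Nat.le_mul_of_pos_right _ (by omega)) a1
    calc p₃ * (p₁ * (2 * B + 2) + B + p₂ * (2 * B + 2) + B + 2) + ((v + 1) * 3 + C.length * 6 + 8)
        = (p₃ * p₁) * (2 * B + 2) + (p₃ * p₂) * (2 * B + 2) + p₃ * (2 * B + 2) +
            ((v + 1) * 3 + C.length * 6 + 8) := by ring
      _ ≤ Z * (2 * B + 2) + Z * (2 * B + 2) + Z * (2 * B + 2) + B := by
          gcongr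
          omega
      _ = _ := by ring
  · rw [f5.reg (by norm_num), g 16 (by norm_num) (by norm_num) (by norm_num) (by norm_num), g16]
  · refine hB₁.congr (fun c hc => ?_) (hst₃.congr fun i hi => f5 i (.inr (by omega)))
    simp only [List.mem_cons, List.not_mem_nil, or_false] at hc
    rcases hc with rfl | rfl | rfl | rfl | rfl <;>
      rw [f5.reg (by norm_num), g _ (by norm_num) (by norm_num) (by norm_num) (by norm_num)]

end QMachine

namespace QMachine

open Function

variable {inp : ℕ → ℕ} {V : ℕ} {mem mem' : ℕ → ℕ} {k Q M : ℕ}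

/-! ## Expectations -/

/-- As `ND`, and the sum of `F` over the branches is at least `r`. -/
def QND (inp : ℕ → ℕ) (V : ℕ) (P : Prog) (N : ℕ) (mem : ℕ → ℕ) (ψ : QState)
    (q : (ℕ → ℕ) → QState → Prop) (F : (ℕ → ℕ) → QState → ℝ) (r : ℝ) : Prop :=
  (∀ i, inp i ≤ V) → (∀ i, mem i ≤ V) → ∀ t, ∃ l, Runs inp P ⟨t, mem, ψ⟩ l ∧
    (∀ b ∈ l, b.time ≤ t + N * P.tick V ∧ (∀ i, b.mem i ≤ V) ∧ q b.mem b.state) ∧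
    (l.map fun b => weight b.state).sum = weight ψ ∧ r ≤ (l.map fun b => F b.mem b.state).sum

section
variable {P P' : Prog} {N N' N₁ N₂ : ℕ} {ψ : QState} {q q' : (ℕ → ℕ) → QState → Prop}
  {F G : (ℕ → ℕ) → QState → ℝ} {r c : ℝ}

/-- The weights of the branches add up to that of `ψ`, so a branchwise bound proportional to the
weight can be summed. -/
theorem ND.expect_weight (h : ND inp V P N mem ψ q) (hF : ∀ mem' ψ', q mem' ψ' → c * weight ψ' ≤ F mem' ψ') :
    QND inp V P N mem ψ q F (c * weight ψ) := by
  intro hi hm t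
  obtain ⟨l, hl, hb, hw⟩ := h hi hm t
  refine ⟨l, hl, hb, hw, ?_⟩
  rw [← hw, ← List.sum_map_mul_left]
  exact List.sum_le_sum fun b hbl => hF _ _ (hb b hbl).2.2

/-- One branch suffices, as the others contribute nonnegative amounts. There may be no branch at all
only if the weight is zero, which `hψ` covers. -/
theorem ND.expect_const (h : ND inp V P N mem ψ q) (hF : ∀ mem' ψ', 0 ≤ F mem' ψ')
    (hr : ∀ mem' ψ', q mem' ψ' → r ≤ F mem' ψ') (hψ : weight ψ = 0 → r ≤ 0) :
    QND inp V P N mem ψ q F r := by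
  intro hi hm t
  obtain ⟨l, hl, hb, hw⟩ := h hi hm t
  refine ⟨l, hl, hb, hw, ?_⟩
  cases l with
  | nil => exact hψ hw.symm
  | cons b l =>
    rw [List.map_cons, List.sum_cons]
    have h1 := hr _ _ (hb b (by simp)).2.2
    have h2 : 0 ≤ (l.map fun b => F b.mem b.state).sum := List.sum_nonneg fun x hx => by
      obtain ⟨b, -, rfl⟩ := List.mem_map.1 hx
      exact hF _ _
    linarith

theorem QND.steps (h : QND inp V P N mem ψ q F r) (hN : N ≤ N') : QND inp V P N' mem ψ q F r := by
  intro hi hm t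
  obtain ⟨l, hl, hb, hw⟩ := h hi hm t
  exact ⟨l, hl, fun b hbl => ⟨(hb b hbl).1.trans (by gcongr), (hb b hbl).2⟩, hw⟩

theorem QND.post (h : QND inp V P N mem ψ q F r) (hq : ∀ mem' ψ', q mem' ψ' → q' mem' ψ') :
    QND inp V P N mem ψ q' F r := by
  intro hi hm t
  obtain ⟨l, hl, hb, hw⟩ := h hi hm t
  exact ⟨l, hl, fun b hbl => ⟨(hb b hbl).1, (hb b hbl).2.1, hq _ _ (hb b hbl).2.2⟩, hw⟩

theorem sum_le_sum_flatMap {g : Branch → ℝ} {f : Branch → ℝ} {l : List Branch}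
    {K : Branch → List Branch} (h : ∀ b ∈ l, g b ≤ ((K b).map f).sum) :
    (l.map g).sum ≤ ((l.flatMap K).map f).sum := by
  induction l with
  | nil => simp
  | cons b l ih =>
    rw [List.flatMap_cons, List.map_append, List.sum_append, List.map_cons, List.sum_cons]
    exact add_le_add (h b (by simp)) (ih fun b' hb' => h b' (by simp [hb']))

/-- Total expectation: `G` is a lower bound for what the second program contributes from an
intermediate branch. -/
theorem QND.seq (h : QND inp V P N₁ mem ψ q' G r)
    (h' : ∀ mem' ψ', q' mem' ψ' → QND inp V P' N₂ mem' ψ' q F (G mem' ψ')) :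
    QND inp V (.seq P P') (N₁ + N₂) mem ψ q F r := by
  classical
  intro hi hm t
  obtain ⟨l, hl, hb, hw, hr⟩ := h hi hm t
  have hk : ∀ b : Branch, ∃ l', b ∈ l → Runs inp P' b l' ∧
      (∀ b' ∈ l', b'.time ≤ b.time + N₂ * P'.tick V ∧ (∀ i, b'.mem i ≤ V) ∧ q b'.mem b'.state) ∧
      (l'.map fun b => weight b.state).sum = weight b.state ∧
      G b.mem b.state ≤ (l'.map fun b => F b.mem b.state).sum := by
    intro b
    by_cases hbl : b ∈ l
    · obtain ⟨l', h''⟩ := h' _ _ (hb b hbl).2.2 hi (hb b hbl).2.1 b.time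
      exact ⟨l', fun _ => h''⟩
    · exact ⟨[], fun h => absurd h hbl⟩
  choose K hk using hk
  refine ⟨l.flatMap K, hl.seq fun b hbl => (hk b hbl).1, ?_, ?_, ?_⟩
  · intro b' hb'
    obtain ⟨b, hbl, hb'⟩ := List.mem_flatMap.1 hb'
    obtain ⟨h1, h2⟩ := (hk b hbl).2.1 b' hb'
    refine ⟨h1.trans ?_, h2⟩
    have h3 := (hb b hbl).1
    have h4 : P.tick V ≤ (Prog.seq P P').tick V := Prog.tick_le (le_max_left _ _)
    have h5 : P'.tick V ≤ (Prog.seq P P').tick V := Prog.tick_le (le_max_right _ _)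
    have h6 := Nat.mul_le_mul_left N₁ h4
    have h7 := Nat.mul_le_mul_left N₂ h5
    rw [add_mul]; omega
  · rw [sum_weight_flatMap fun b hbl => (hk b hbl).2.2.1, hw]
  · exact hr.trans (sum_le_sum_flatMap fun b hbl => (hk b hbl).2.2.2)

/-- Only the outcome one is counted; the other outcome contributes a nonnegative amount. -/
theorem QND.meas {p a : AExp} (hV : 1 ≤ V)
    (h : ∀ v : Bool, q (update mem (a.eval inp mem) v.toNat) (project (p.eval inp mem) v ψ))
    (hr : ∀ mem', mem' = update mem (a.eval inp mem) 1 → r ≤ F mem' (project (p.eval inp mem) true ψ))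
    (hF : ∀ mem' ψ', 0 ≤ F mem' ψ') : QND inp V (.meas p a) 1 mem ψ q F r := by
  intro hi hm t
  have hB : 1 ≤ (V.size + 1) ^ 2 := Nat.one_le_pow _ _ (by omega)
  have h1 := AExp.cost_le hi hm p
  have h2 := AExp.cost_le hi hm a
  have ht : p.cost inp mem + a.cost inp mem + 1 ≤ 1 * (Prog.meas p a).tick V := by
    simp only [Prog.tick, Prog.unit]; nlinarith
  refine ⟨_, .of_succ fun _ => rfl, ?_, by simp [weight_project_add], ?_⟩
  · simp only [List.mem_cons, List.not_mem_nil, or_false, forall_eq_or_imp, forall_eq]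
    refine ⟨⟨by omega, fun i => ?_, h false⟩, ⟨by omega, fun i => ?_, h true⟩⟩
    all_goals rw [update_apply]; split_ifs; exacts [by omega, hm i]
  · simp only [List.map_cons, List.map_nil, List.sum_cons, List.sum_nil, add_zero]
    exact (hr _ rfl).trans (le_add_of_nonneg_left (hF _ _))

end

end QMachine

namespace QMachine

open Function Finsupp

variable {inp : ℕ → ℕ} {V : ℕ} {mem mem' : ℕ → ℕ} {k Q M : ℕ}

/-! ## The body of the main loop -/

/-- Make an attempt, measure whether it succeeded, read out all qubits and count. -/
def attemptBody (k Q M : ℕ) : Prog :=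
  .seq (attemptProg k Q M) (.seq (.meas flagQubit (.add numVars (.lit 17)))
    (.seq clearProg (setReg 16 (.add (reg 16) (.lit 1)))))

theorem attemptOp_labels {v b i₁ i₂ i₃ : ℕ} (hn : 0 < inp 0) (a : ℂ) :
    attemptOp inp k Q v b i₁ i₂ i₃ (single ∅ a) ∈ supported ℂ ℂ (labels (2 * inp 0)) := by
  have e : (single ∅ a : QState) = a • ket ∅ := by simp
  rw [e, map_smul]
  exact Submodule.smul_mem _ _ (searchOp_labels (fun q hq => lt_of_mem_window hn hq) _ _ _)

/-- The states in which the flag qubit tells the labels of cost at most `v`. -/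
structure Flagged (inp : ℕ → ℕ) (Q v : ℕ) (ψ : QState) : Prop where
  good : ∀ s ∈ (project (2 * inp 0) true ψ).support, cost inp Q (inp 1) s ≤ v
  bad : ∀ s ∈ (project (2 * inp 0) false ψ).support, s ⊆ Finset.range (2 * inp 0)

theorem flagged_single {v : ℕ} (a : ℂ) : Flagged inp Q v (single ∅ a) := by
  refine ⟨fun s hs => ?_, fun s hs => ?_⟩
  · rw [project, support_filter, Finset.mem_filter] at hs
    have := support_single_subset hs.1
    rw [Finset.mem_singleton] at this
    simp [this] at hs
  · rw [project, support_filter, Finset.mem_filter] at hs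
    have := support_single_subset hs.1
    rw [Finset.mem_singleton] at this
    simp [this]

/-- The search stays on labels below `2 * inp 0`, so the flag is zero before marking and the outcome
one selects exactly the labels of low cost. Marking preserves weights, and the amplitude `a` factors
out by linearity. -/
theorem WF.project_attemptState (h : WF inp k (inp 0) (inp 1)) {v b i₁ i₂ i₃ : ℕ} (hn : 0 < inp 0)
    (a : ℂ) : Flagged inp Q v (attemptState inp k Q v b i₁ i₂ i₃ (single ∅ a)) ∧
      weight (project (2 * inp 0) true (attemptState inp k Q v b i₁ i₂ i₃ (single ∅ a))) =
        ‖a‖ ^ 2 * weight ((attemptOp inp k Q v b i₁ i₂ i₃ (ket ∅)).filter fun s =>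
          cost inp Q (inp 1) s ≤ v) := by
  classical
  have hlab := attemptOp_labels (k := k) (Q := Q) (v := v) (b := b) (i₁ := i₁) (i₂ := i₂) (i₃ := i₃) hn a
  rw [mem_supported_iff] at hlab
  set χ := attemptOp inp k Q v b i₁ i₂ i₃ (single ∅ a) with hχ
  have hlab' : ∀ s ∈ χ.support, s ⊆ Finset.range (2 * inp 0) := fun s hs => by
    by_contra hcon
    exact mem_support_iff.1 hs (hlab s hcon)
  have hF : ∀ s ∈ χ.support, mark (2 * inp 0 + 1) (costCircuit inp k Q)
      (2 * inp 0 + 1 + inp 1 * layerLen inp k Q) (2 * inp 0) (v + 1) s =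
        if cost inp Q (inp 1) s ≤ v then insert (2 * inp 0) s else s := fun s hs => by
    refine (h.mark_eq (Nat.lt_succ_self _) (hlab' s hs) (v + 1)).trans ?_
    simp only [Nat.lt_succ_iff]
  obtain ⟨h1, h2⟩ := project_mark hF fun s hs hf => by
    have := hlab' s hs hf
    simp at this
  rw [attemptState, ← hχ, h1]
  refine ⟨⟨fun s hs => ?_, fun s hs => ?_⟩, ?_⟩
  · rw [h1] at hs
    obtain ⟨t, ht, rfl⟩ := Finset.mem_image.1 (mapDomain_support hs)
    rw [support_filter, Finset.mem_filter] at ht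
    rw [hF t ht.1, if_pos ht.2, h.cost_congr Q (s' := t) fun i hi => by
      rw [Finset.mem_insert]; exact or_iff_right (by omega)]
    exact ht.2
  · rw [h2, support_filter, Finset.mem_filter] at hs
    exact hlab' s hs.1
  · have e : (single ∅ a : QState) = a • ket ∅ := by simp
    rw [weight_mark, hχ, e, map_smul, filter_smul, weight_smul]

/-- The invariant of the main loop when the counter is `z`. -/
structure MainInv (inp : ℕ → ℕ) (k Q z v : ℕ) (mem : ℕ → ℕ) (ψ : QState) : Prop where
  base : Base inp k Q mem
  counter : mem (inp 0 + 16) = z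
  /-- as long as nothing is found, all qubits are zero -/
  state : mem (inp 0 + 17) = 0 → ∃ a, ψ = single ∅ a
  found : mem (inp 0 + 17) ≠ 0 → ψ ≠ 0 →
    ∃ s, cost inp Q (inp 1) s ≤ v ∧ ∀ q < inp 0, (mem q ≠ 0 ↔ q ∈ s)

open Classical in
/-- The weight if something has been found. -/
noncomputable def foundWeight (inp mem : ℕ → ℕ) (ψ : QState) : ℝ :=
  if mem (inp 0 + 17) = 0 then 0 else weight ψ

theorem foundWeight_nonneg (mem : ℕ → ℕ) (ψ : QState) : 0 ≤ foundWeight inp mem ψ := by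
  unfold foundWeight
  split_ifs
  exacts [le_rfl, weight_nonneg ψ]

/-- The alternative `r ≤ 0` serves rounds with the wrong parameters, where only the invariant is
needed. There `v ≤ v₀` guarantees that anything found is good enough for the final target. -/
theorem WF.attemptBody (h : WF inp k (inp 0) (inp 1)) {z v v₀ b i₁ i₂ i₃ B Z : ℕ} {a : ℂ}
    (hI : MainInv inp k Q z v₀ mem (single ∅ a)) (hR : Room inp V B k Q) (hz : z < V)
    (hp : Params (inp 0) M z v b i₁ i₂ i₃) (hs : width inp Q v ≤ inp 0) (hn : 0 < inp 0)
    (hv : v ≤ Q * inp 1) (hvv : v ≤ v₀)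
    (hZ : ∀ x, x ^ 2 ≤ 256 * 2 ^ (inp 0 - width inp Q v) → x ≤ Z) {r : ℝ} (h0 : a = 0 → r ≤ 0)
    (hr : r ≤ 0 ∨ Allowed inp Q v i₁ i₂ i₃ ∧
      r ≤ ‖a‖ ^ 2 * weight ((attemptOp inp k Q v b i₁ i₂ i₃ (ket ∅)).filter fun s =>
          cost inp Q (inp 1) s ≤ v)) :
    QND inp V (QMachine.attemptBody k Q M) (attemptSteps (inp 0) B Z + (inp 0 * 10 + 6)) mem
      (single ∅ a) (MainInv inp k Q (z + 1) v₀) (foundWeight inp) r := by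
  classical
  have hBV := hR.le
  have hre := hR.refl
  have hproj := h.project_attemptState (Q := Q) (v := v) (b := b) (i₁ := i₁) (i₂ := i₂) (i₃ := i₃) hn a
  have hA := ND.attemptProg (M := M) (ψ := single ∅ a) hI.base hR hI.counter hz.le hp hs hn hv hZ
  refine QND.steps (N := attemptSteps (inp 0) B Z + (1 + (inp 0 * 10 + 4 + 1))) (.seq (G := fun _ ψ' =>
    weight (project (2 * inp 0) true ψ')) (q' := fun mem' ψ' => mem' (inp 0 + 16) = z ∧
      Base inp k Q mem' ∧ Flagged inp Q v ψ') ((hA.weaken (R := fun mem' ψ' => (mem' (inp 0 + 16) = z ∧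
      Base inp k Q mem' ∧ Flagged inp Q v ψ') ∧ r ≤ weight (project (2 * inp 0) true ψ'))
      fun mem' ψ' ⟨f1, f2, f3⟩ => ?_).expect_const (fun _ _ => weight_nonneg _)
      (fun _ _ h' => h'.2) (fun h' => h0 ?_) |>.post fun _ _ h' => h'.1) fun mem₁ ψ₁ ⟨f1, f2, f3⟩ => ?_)
    (by omega)
  · rw [f3]
    refine ⟨⟨f1, f2, ?_⟩, ?_⟩
    · split_ifs
      exacts [hproj.1, flagged_single a]
    · rcases hr with hr | ⟨hall, hr⟩
      · exact hr.trans (weight_nonneg _)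
      · rw [if_pos hall, hproj.2]; exact hr
  · rw [weight_single] at h'
    simpa using h'
  refine .seq (N₁ := 1) (G := foundWeight inp) (q' := fun mem₂ ψ₂ => mem₂ (inp 0 + 16) = z ∧
    Base inp k Q mem₂ ∧ (mem₂ (inp 0 + 17) = 0 → ∀ s ∈ ψ₂.support, s ⊆ Finset.range (2 * inp 0)) ∧
    (mem₂ (inp 0 + 17) ≠ 0 → ∀ s ∈ ψ₂.support, cost inp Q (inp 1) s ≤ v))
    (.meas (by omega) (fun x => ?_) (fun mem₂ hm₂ => ?_) fun _ _ => foundWeight_nonneg _ _)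
    fun mem₂ ψ₂ ⟨g1, g2, g3, g4⟩ => ?_
  · change update mem₁ (inp 0 + 17) _ _ = _ ∧ Base inp k Q (update mem₁ (inp 0 + 17) _) ∧ _
    refine ⟨by rw [update_reg_ne (by norm_num), f1], f2.congr (fun c hc => update_reg_ne (by
      rintro rfl; simp at hc) _) (f2.stored.congr fun i hi => update_of_ne (by omega) _ _), ?_, ?_⟩
    · intro hx
      change update mem₁ (inp 0 + 17) _ _ = _ at hx
      rw [Function.update_self] at hx
      cases x
      · exact f3.bad
      · simp at hx
    · intro hx
      change update mem₁ (inp 0 + 17) _ _ ≠ _ at hx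
      rw [Function.update_self] at hx
      cases x
      · simp at hx
      · exact f3.good
  · rw [foundWeight, if_neg]
    · rfl
    · rw [hm₂]
      change update mem₁ (inp 0 + 17) _ _ ≠ _
      rw [Function.update_self]; norm_num
  -- read out
  have hclear := (ND.clearProg (inp := inp) (V := V) (mem := mem₂) (ψ := ψ₂) (by omega))
  have hfin : ND inp V (.seq clearProg (QMachine.setReg 16 (.add (reg 16) (.lit 1)))) (inp 0 * 10 + 4 + 1)
      mem₂ ψ₂ fun mem' ψ' => MainInv inp k Q (z + 1) v₀ mem' ψ' ∧
        mem' (inp 0 + 17) = mem₂ (inp 0 + 17) := by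
    refine .seq (hclear.weaken fun mem₃ ψ₃ ⟨e1, e2⟩ => ?_)
    have e : ∀ c < 64, c ≠ 36 → c ≠ 40 → mem₃ (inp 0 + c) = mem₂ (inp 0 + c) := fun c h1 h2 h3 =>
      e1 _ (by omega) (by omega) (by omega)
    have v16 : (AExp.add (reg 16) (.lit 1)).eval inp mem₃ = z + 1 := by
      simp only [AExp.eval, eval_reg, e 16 (by norm_num) (by norm_num) (by norm_num), g1]
    refine .setReg (by rw [v16]; omega) ?_
    rw [v16]
    have h17 : update mem₃ (inp 0 + 16) (z + 1) (inp 0 + 17) = mem₂ (inp 0 + 17) := by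
      rw [update_reg_ne (by norm_num), e 17 (by norm_num) (by norm_num) (by norm_num)]
    refine ⟨⟨?_, Function.update_self _ _ _, fun hx => ?_, fun hx hne => ?_⟩, h17⟩
    · refine g2.congr (fun c hc => ?_) (g2.stored.congr fun i hi => ?_)
      · simp only [List.mem_cons, List.not_mem_nil, or_false] at hc
        rcases hc with rfl | rfl | rfl | rfl | rfl <;>
          rw [update_reg_ne (by norm_num), e _ (by norm_num) (by norm_num) (by norm_num)]
      · rw [update_of_ne (by omega), e1 i (by omega) (by omega) (by omega)]
    · rw [h17] at hx
      refine ⟨ψ₃ ∅, ?_⟩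
      rw [← support_subset_singleton]
      intro s hs
      obtain ⟨s', hs', rfl, -⟩ := e2 s hs
      rw [Finset.mem_singleton, Finset.sdiff_eq_empty_iff_subset]
      exact g3 hx s' hs'
    · rw [h17] at hx
      obtain ⟨s, hs⟩ := support_nonempty_iff.2 hne
      obtain ⟨s', hs', -, hbits⟩ := e2 s hs
      refine ⟨s', (g4 hx s' hs').trans hvv, fun q hq => ?_⟩
      rw [update_of_ne (by omega)]
      exact hbits q hq
  -- Reading out leaves the register with the measured flag unchanged, so the weight of a branch
  -- counts in full or not at all.
  have := hfin.expect_weight (F := foundWeight inp) (c := if mem₂ (inp 0 + 17) = 0 then 0 else 1)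
    fun mem' ψ' h' => by
      rw [foundWeight, h'.2]
      split_ifs <;> simp
  convert this.post fun _ _ h' => h'.1 using 1
  rw [foundWeight]
  split_ifs <;> simp

end QMachine

namespace QMachine

open Function

variable {inp : ℕ → ℕ} {V : ℕ} {mem : ℕ → ℕ} {k Q M : ℕ}

/-! ## The main loop -/

theorem probWithin_nonneg (good : (ℕ → ℕ) → Prop) (T : ℝ) (l : List Branch) :
    0 ≤ probWithin good T l := List.sum_nonneg fun x hx => by
  obtain ⟨b, -, rfl⟩ := List.mem_map.1 hx
  split_ifs
  exacts [weight_nonneg _, le_rfl]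

theorem probWithin_mono {good : (ℕ → ℕ) → Prop} {T T' : ℝ} (h : T ≤ T') (l : List Branch) :
    probWithin good T l ≤ probWithin good T' l := List.sum_le_sum fun b _ => by
  split_ifs with h1 h2
  exacts [le_rfl, absurd ⟨h1.1.trans h, h1.2⟩ h2, weight_nonneg _, le_rfl]

/-- In all sufficiently deep runs, the probability of success is at least `r`. -/
def Eventually (inp : ℕ → ℕ) (P : Prog) (good : (ℕ → ℕ) → Prop) (T : ℝ) (b : Branch) (r : ℝ) : Prop :=
  ∃ f₀, ∀ f, f₀ ≤ f → r ≤ probWithin good T (run inp f P b)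

theorem Eventually.bind {P : Prog} {good : (ℕ → ℕ) → Prop} {T : ℝ} {g : Branch → ℝ} :
    ∀ {l : List Branch}, (∀ b ∈ l, Eventually inp P good T b (g b)) →
      ∃ f₀, ∀ f, f₀ ≤ f → (l.map g).sum ≤ probWithin good T (l.flatMap (run inp f P))
  | [], _ => ⟨0, fun _ _ => by simp [probWithin]⟩
  | b :: l, h => by
    obtain ⟨f₁, h₁⟩ := h b (by simp)
    obtain ⟨f₂, h₂⟩ := Eventually.bind (l := l) fun b' hb' => h b' (by simp [hb'])
    refine ⟨max f₁ f₂, fun f hf => ?_⟩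
    have h1 := h₁ f (by omega)
    have h2 := h₂ f (by omega)
    rw [List.map_cons, List.sum_cons, List.flatMap_cons, probWithin, List.map_append, List.sum_append]
    exact add_le_add h1 h2

/-- If each round finds something with enough probability, then so does the loop. -/
theorem eventually_loop {e : AExp} {P : Prog} {N D : ℕ} {good : (ℕ → ℕ) → Prop} {T : ℝ}
    {Inv : ℕ → (ℕ → ℕ) → QState → Prop} {ρ : ℕ → ℝ} (hi : ∀ i, inp i ≤ V)
    (hρ : ∀ d, 0 ≤ ρ d) (hρ0 : ρ 0 = 1)
    (hstep : ∀ d < D, ∀ mem ψ, Inv (d + 1) mem ψ → mem (inp 0 + 17) = 0 → e.eval inp mem ≠ 0 ∧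
      ∃ r, QND inp V P N mem ψ (Inv d) (foundWeight inp) r ∧
        (1 - ρ (d + 1)) * weight ψ ≤ (1 - ρ d) * weight ψ + ρ d * r)
    (hexit : ∀ d mem ψ, Inv d mem ψ → mem (inp 0 + 17) ≠ 0 → e.eval inp mem = 0 ∧ (ψ ≠ 0 → good mem)) :
    ∀ d ≤ D, ∀ mem ψ t, Inv d mem ψ → (∀ i, mem i ≤ V) →
      ((t + (d * (N + 1) + 1) * (Prog.loop e P).tick V : ℕ) : ℝ) ≤ T →
      Eventually inp (.loop e P) good T ⟨t, mem, ψ⟩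
        ((1 - ρ d) * weight ψ + ρ d * foundWeight inp mem ψ) := by
  classical
  have hP : P.tick V ≤ (Prog.loop e P).tick V := Prog.tick_le (le_max_right _ _)
  have hcost : ∀ mem : ℕ → ℕ, (∀ i, mem i ≤ V) → e.cost inp mem + 1 ≤ (Prog.loop e P).tick V :=
    fun mem hm => cost_add_one_le hi hm e (le_max_left _ _)
  -- Once something is found the loop exits with the whole weight, as (1 - ρ) + ρ = 1. Branches with
  -- zero state need not be good, since they contribute nothing.
  have hfound : ∀ d mem ψ t, Inv d mem ψ → (∀ i, mem i ≤ V) → mem (inp 0 + 17) ≠ 0 →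
      ((t + (d * (N + 1) + 1) * (Prog.loop e P).tick V : ℕ) : ℝ) ≤ T →
      Eventually inp (.loop e P) good T ⟨t, mem, ψ⟩
        ((1 - ρ d) * weight ψ + ρ d * foundWeight inp mem ψ) := by
    intro d mem ψ t h hm h17 hT
    obtain ⟨he, hg⟩ := hexit d mem ψ h h17
    obtain ⟨f₀, hf₀⟩ := Runs.loop_false (P := P) (b := ⟨t, mem, ψ⟩) he
    refine ⟨f₀, fun f hf => ?_⟩
    rw [hf₀ f hf, foundWeight, if_neg h17, ← add_mul, sub_add_cancel, one_mul]
    simp only [probWithin, List.map_cons, List.map_nil, List.sum_cons, List.sum_nil, add_zero]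
    by_cases hψ : ψ = 0
    · subst hψ
      simp [weight]
    · rw [if_pos]
      refine ⟨le_trans ?_ hT, hg hψ⟩
      have := hcost mem hm
      have : (Prog.loop e P).tick V ≤ (d * (N + 1) + 1) * (Prog.loop e P).tick V :=
        Nat.le_mul_of_pos_left _ (Nat.succ_pos _)
      exact_mod_cast (by omega)
  intro d
  induction d with
  | zero =>
    intro _ mem ψ t h hm hT
    by_cases h17 : mem (inp 0 + 17) = 0
    -- With no rounds left `ρ 0 = 1`, so nothing is claimed.
    · refine ⟨0, fun f _ => ?_⟩
      rw [foundWeight, if_pos h17, hρ0]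
      simpa using probWithin_nonneg _ _ _
    · exact hfound 0 mem ψ t h hm h17 hT
  | succ d ih =>
    intro hd mem ψ t h hm hT
    by_cases h17 : mem (inp 0 + 17) = 0
    · obtain ⟨he, r, hq, hr⟩ := hstep d hd mem ψ h h17
      obtain ⟨l, ⟨f₁, hf₁⟩, hb, hw, hF⟩ := hq hi hm (t + e.cost inp mem + 1)
      have hsplit : ((d + 1) * (N + 1) + 1) * (Prog.loop e P).tick V =
        (Prog.loop e P).tick V + N * (Prog.loop e P).tick V +
          (d * (N + 1) + 1) * (Prog.loop e P).tick V := by ring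
      have h6 := Nat.mul_le_mul_left N hP
      have hc := hcost mem hm
      obtain ⟨f₂, hf₂⟩ := Eventually.bind (l := l) fun b hbl => ih (by omega) b.mem b.state b.time
        (hb b hbl).2.2 (hb b hbl).2.1 (le_trans (by
          have := (hb b hbl).1
          rw [hsplit]
          exact_mod_cast (by omega)) hT)
      refine ⟨max f₁ f₂ + 1, fun f hf => ?_⟩
      obtain ⟨f', rfl⟩ : ∃ f', f = f' + 1 := ⟨f - 1, by omega⟩
      rw [run, if_pos he, hf₁ f' (by omega), foundWeight, if_pos h17, mul_zero, add_zero]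
      refine le_trans (hr.trans ?_) (hf₂ f' (by omega))
      rw [List.sum_map_add, List.sum_map_mul_left, List.sum_map_mul_left, hw]
      exact add_le_add le_rfl (mul_le_mul_of_nonneg_left hF (hρ d))
    · exact hfound (d + 1) mem ψ t h hm h17 hT

/-- The number of values of the counter. -/
def totalExp (Q M : ℕ) : AExp :=
  .mul (.mul (.mul (.mul (.mul (.add (.mul (.lit Q) (.input (.lit 1))) (.lit 1)) numVars) expRange)
    expRange) expRange) (.lit M)

def total (n m Q M : ℕ) : ℕ := (Q * m + 1) * n * (n + 6) * (n + 6) * (n + 6) * M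

/-- Run attempts until something is found. -/
def mainProg (k Q M : ℕ) : Prog :=
  .seq (prelude k Q)
    (.loop (.mul (.sub (.lit 1) (reg 17)) (.sub (totalExp Q M) (reg 16))) (attemptBody k Q M))

/-- The counter values divided by the number of repetitions. -/
def index (n v b i₁ i₂ i₃ : ℕ) : ℕ :=
  (((v * n + b) * (n + 6) + i₁) * (n + 6) + i₂) * (n + 6) + i₃

theorem div_mod_of_eq {x y a b : ℕ} (hb : b < y) (h : x = a * y + b) : x / y = a ∧ x % y = b := by
  subst h
  rw [add_comm, Nat.add_mul_div_right _ _ (by omega), Nat.add_mul_mod_self_right, Nat.mod_eq_of_lt hb,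
    Nat.div_eq_of_lt hb, zero_add]
  exact ⟨rfl, rfl⟩

theorem params_of_index {n z v b i₁ i₂ i₃ : ℕ} (hb : b < n) (h₁ : i₁ < n + 6) (h₂ : i₂ < n + 6)
    (h₃ : i₃ < n + 6) (hz : z / M = index n v b i₁ i₂ i₃) : Params n M z v b i₁ i₂ i₃ := by
  obtain ⟨a₁, a₂⟩ := div_mod_of_eq h₃ hz
  obtain ⟨b₁, b₂⟩ := div_mod_of_eq h₂ a₁
  obtain ⟨c₁, c₂⟩ := div_mod_of_eq h₁ b₁
  obtain ⟨d₁, d₂⟩ := div_mod_of_eq hb c₁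
  exact ⟨d₁, d₂, c₂, b₂, a₂⟩

theorem index_lt {n m v b i₁ i₂ i₃ : ℕ} (hv : v ≤ Q * m) (hb : b < n) (h₁ : i₁ < n + 6)
    (h₂ : i₂ < n + 6) (h₃ : i₃ < n + 6) : (index n v b i₁ i₂ i₃ + 1) * M ≤ total n m Q M := by
  have key : ∀ x y a b : ℕ, x + 1 ≤ a → y < b → x * b + y + 1 ≤ a * b := fun x y a b hx hy => by
    have := Nat.mul_le_mul_right b hx
    rw [add_mul] at this
    omega
  exact Nat.mul_le_mul_right _ (key _ _ _ _ (key _ _ _ _ (key _ _ _ _ (key _ _ _ _ (by omega) hb) h₁)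
    h₂) h₃)

/-- A smaller target means a wider window and a smaller budget. Hence all attempts made before the
optimal target is reached fit into the time allowed for it. -/
theorem width_anti {v v' : ℕ} (h : v ≤ v') : width inp Q v' ≤ width inp Q v :=
  Nat.div_le_div_right (Nat.mul_le_mul (Nat.sub_le_sub_left h _) (Nat.sub_le_sub_left h _))

end QMachine

namespace QMachine

open Function Finsupp

variable {inp : ℕ → ℕ} {V : ℕ} {mem : ℕ → ℕ} {k Q M : ℕ}

/-! ## Success probability and running time -/

/-- A bound for the steps of the preparation. -/
def preludeSteps (inp : ℕ → ℕ) (k Q : ℕ) : ℕ :=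
  inp 1 * (k * (layerLen inp k Q * 10 + 8) + layerLen inp k Q * 9 + 16) + inp 0 * 20 + 11

/-- A bound for the steps of the main program. -/
def mainSteps (inp : ℕ → ℕ) (k Q M B Z : ℕ) : ℕ :=
  preludeSteps inp k Q +
    (total (inp 0) (inp 1) Q M * (attemptSteps (inp 0) B Z + (inp 0 * 10 + 6) + 1) + 1)

/-- Only the rounds up to the last repetition of the right tuple are counted: `D` of them, of which
`d` are left at counter `D - d`. The last `M` rounds use the right tuple and reduce the failure
bound by the factor 3/4 each; earlier rounds leave it unchanged. This is the sequence `(3 / 4) ^ min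
M d`. -/
theorem WF.mainProg (h : WF inp k (inp 0) (inp 1)) {v b i₁ i₂ i₃ B Z : ℕ} (hV : ∀ i, inp i ≤ V)
    (hfit : Fits V k Q (inp 0) (inp 1)) (hR : Room inp V B k Q) (hM : 0 < M)
    (htot : total (inp 0) (inp 1) Q M ≤ V) (hs : ∀ v, width inp Q v ≤ inp 0)
    (hv : v ≤ Q * inp 1) (hb : b < inp 0) (h₁ : i₁ < inp 0 + 6) (h₂ : i₂ < inp 0 + 6)
    (h₃ : i₃ < inp 0 + 6) (hall : Allowed inp Q v i₁ i₂ i₃)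
    (hw : 1 / 4 ≤ weight ((attemptOp inp k Q v b i₁ i₂ i₃ (ket ∅)).filter fun s =>
      cost inp Q (inp 1) s ≤ v))
    (hZ : ∀ x, x ^ 2 ≤ 256 * 2 ^ (inp 0 - width inp Q v) → x ≤ Z) {good : (ℕ → ℕ) → Prop}
    (hgood : ∀ mem : ℕ → ℕ, (∃ s, cost inp Q (inp 1) s ≤ v ∧ ∀ q < inp 0, (mem q ≠ 0 ↔ q ∈ s)) → good mem)
    {T : ℝ} (hT : ((mainSteps inp k Q M B Z * (mainProg k Q M).tick V : ℕ) : ℝ) ≤ T) :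
    Eventually inp (QMachine.mainProg k Q M) good T init (1 - (3 / 4) ^ M) := by
  have hBV := hR.le
  have hcir := hR.circuit
  have hrefl := hR.refl
  have hpre := h.prelude hfit (Q := Q) (by omega) (ψ := single ∅ 1)
  obtain ⟨l, ⟨f₁, hf₁⟩, hbr, hwt⟩ := hpre hV (fun _ => Nat.zero_le _) 0
  set D := (index (inp 0) v b i₁ i₂ i₃ + 1) * M with hD
  have hDt : D ≤ total (inp 0) (inp 1) Q M := index_lt hv hb h₁ h₂ h₃
  have hMD : M ≤ D := Nat.le_mul_of_pos_left _ (Nat.succ_pos _)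
  set e : AExp := .mul (.sub (.lit 1) (reg 17)) (.sub (totalExp Q M) (reg 16)) with he
  have heval : ∀ mem, e.eval inp mem = (1 - mem (inp 0 + 17)) *
      (total (inp 0) (inp 1) Q M - mem (inp 0 + 16)) := fun mem => rfl
  set N := attemptSteps (inp 0) B Z + (inp 0 * 10 + 6) with hN
  have hρ0 : ∀ d, (0 : ℝ) ≤ (3 / 4 : ℝ) ^ min M d := fun d => by positivity
  have hloop := eventually_loop (V := V) (e := e) (P := QMachine.attemptBody k Q M) (N := N) (D := D)
    (good := good) (T := T) (Inv := fun d mem ψ => d ≤ D ∧ MainInv inp k Q (D - d) v mem ψ)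
    (ρ := fun d => (3 / 4 : ℝ) ^ min M d) hV hρ0 (by simp) ?_ ?_ D le_rfl
  · have htick : (Prog.loop e (QMachine.attemptBody k Q M)).tick V ≤ (QMachine.mainProg k Q M).tick V :=
      Prog.tick_le (le_max_right _ _)
    have htick' : (QMachine.prelude k Q).tick V ≤ (QMachine.mainProg k Q M).tick V :=
      Prog.tick_le (le_max_left _ _)
    have hone : (l.map fun b => (1 - (3 / 4 : ℝ) ^ M) * weight b.state).sum = 1 - (3 / 4) ^ M := by
      rw [List.sum_map_mul_left, hwt, weight_single]; simp
    obtain ⟨f₂, hf₂⟩ := Eventually.bind (inp := inp) (good := good) (T := T)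
      (P := .loop e (QMachine.attemptBody k Q M)) (g := fun b => (1 - (3 / 4 : ℝ) ^ M) * weight b.state)
      (l := l) fun br hbrl => by
        obtain ⟨ht, hm, hψ, h16, h17, hB⟩ := hbr br hbrl
        have := hloop br.mem br.state br.time ⟨le_rfl, hB, by rw [h16, Nat.sub_self],
          fun _ => ⟨1, hψ⟩, fun h => absurd h17 h⟩ hm (le_trans ?_ hT)
        · rw [foundWeight, if_pos h17, mul_zero, add_zero, min_eq_left hMD] at this
          exact this
        · have a1 := Nat.mul_le_mul_left (preludeSteps inp k Q) htick'
          have a2 : (D * (N + 1) + 1) * (Prog.loop e (QMachine.attemptBody k Q M)).tick V ≤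
              (total (inp 0) (inp 1) Q M * (N + 1) + 1) * (QMachine.mainProg k Q M).tick V := by
            gcongr
          have a3 : br.time ≤ 0 + preludeSteps inp k Q * (QMachine.prelude k Q).tick V := ht
          have a4 : mainSteps inp k Q M B Z * (QMachine.mainProg k Q M).tick V =
              preludeSteps inp k Q * (QMachine.mainProg k Q M).tick V +
                (total (inp 0) (inp 1) Q M * (N + 1) + 1) * (QMachine.mainProg k Q M).tick V := by
            rw [mainSteps, ← hN, add_mul]
          exact_mod_cast (by omega)
    refine ⟨max f₁ f₂ + 1, fun f hf => ?_⟩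
    obtain ⟨f', rfl⟩ : ∃ f', f = f' + 1 := ⟨f - 1, by omega⟩
    rw [QMachine.mainProg, run, init, hf₁ f' (by omega), ← hone]
    exact hf₂ f' (by omega)
  · rintro d hd mem ψ ⟨-, hI⟩ h17
    obtain ⟨a, rfl⟩ := hI.state h17
    have hz : D - (d + 1) < total (inp 0) (inp 1) Q M := by omega
    refine ⟨?_, ?_⟩
    · rw [heval, h17, hI.counter]; omega
    set z := D - (d + 1) with hzd
    have hz1 : D - d = z + 1 := by omega
    have hzM : z / M ≤ index (inp 0) v b i₁ i₂ i₃ := by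
      rw [← Nat.lt_succ_iff, Nat.div_lt_iff_lt_mul hM]
      change z < D
      omega
    have hn : 0 < inp 0 := by omega
    have hvz := params_of_index (M := 1) (z := index (inp 0) v b i₁ i₂ i₃) hb h₁ h₂ h₃ (Nat.div_one _)
    set v' := z / M / (inp 0 + 6) / (inp 0 + 6) / (inp 0 + 6) / inp 0 with hv'
    have hvv : v' ≤ v := by
      rw [← hvz.v_eq, Nat.div_one, hv']
      gcongr
    have hZ' : ∀ x, x ^ 2 ≤ 256 * 2 ^ (inp 0 - width inp Q v') → x ≤ Z := fun x hx =>
      hZ x (hx.trans (Nat.mul_le_mul_left _ (Nat.pow_le_pow_right (by norm_num)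
        (Nat.sub_le_sub_left (width_anti hvv) _))))
    rw [hz1]
    simp only [weight_single]
    by_cases hdM : d + 1 ≤ M
    · have hzM' : z / M = index (inp 0) v b i₁ i₂ i₃ := by
        refine le_antisymm hzM ?_
        rw [Nat.le_div_iff_mul_le hM]
        have : D = index (inp 0) v b i₁ i₂ i₃ * M + M := by rw [hD, add_mul, one_mul]
        omega
      refine ⟨‖a‖ ^ 2 * (1 / 4), (h.attemptBody hI hR (by omega)
        (params_of_index hb h₁ h₂ h₃ hzM') (hs v) hn hv le_rfl hZ (fun ha => by simp [ha])
        (.inr ⟨hall, by gcongr⟩)).post fun _ _ h' => ⟨by omega, h'⟩, ?_⟩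
      -- With ρ' = 3ρ/4 one has 1 - ρ' = (1 - ρ) + ρ/4: success probability 1/4 is just enough.
      rw [min_eq_right hdM, min_eq_right (by omega), pow_succ]
      apply le_of_eq
      ring
    · refine ⟨0, (h.attemptBody hI hR (by omega) (v := v') ⟨rfl, rfl, rfl, rfl, rfl⟩ (hs v') hn
        (hvv.trans hv) hvv hZ' (fun _ => le_rfl) (.inl le_rfl)).post fun _ _ h' => ⟨by omega, h'⟩, ?_⟩
      rw [min_eq_left (by omega), min_eq_left (by omega), mul_zero, add_zero]
  · rintro d mem ψ ⟨-, hI⟩ h17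
    refine ⟨?_, fun hψ => hgood mem (hI.found h17 hψ)⟩
    rw [heval, Nat.sub_eq_zero_of_le (by omega), zero_mul]

end QMachine

/-! ## Asymptotics -/

-- A polynomial with natural coefficients is at most `C (n + 1) ^ d`, whose logarithm is `log C + d
-- log (n + 1)`. The added one keeps the logarithm nonnegative.
open Filter Asymptotics in
theorem isLittleO_logb_polynomial (q : Polynomial ℕ) :
    (fun n : ℕ => Real.logb 2 ((q.eval n : ℕ) + 1 : ℝ)) =o[atTop] (fun n : ℕ => (n : ℝ)) := by
  set d := q.natDegree
  set C := q.eval 1 + 1 with hC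
  -- The value at 1 is the sum of the coefficients, and every power of `n` that occurs is at most
  -- `(n + 1) ^ d`.
  have hq : ∀ n : ℕ, q.eval n + 1 ≤ C * (n + 1) ^ d := by
    intro n
    rw [hC, add_mul, one_mul, Polynomial.eval_eq_sum_range, Polynomial.eval_eq_sum_range,
      Finset.sum_mul]
    refine add_le_add (Finset.sum_le_sum fun i hi => ?_) (Nat.one_le_pow _ _ (Nat.succ_pos n))
    rw [one_pow, mul_one]
    refine Nat.mul_le_mul_left _ ?_
    rw [Finset.mem_range] at hi
    exact (Nat.pow_le_pow_left (Nat.le_succ n) i).trans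
      (Nat.pow_le_pow_right (Nat.succ_pos n) (by omega))
  have h1 : (fun n : ℕ => Real.log C + d * Real.log ((n : ℝ) + 1)) =o[atTop] fun n : ℕ => (n : ℝ) := by
    refine IsLittleO.add ?_ (IsLittleO.const_mul_left ?_ _)
    · exact (isLittleO_const_id_atTop (Real.log C)).comp_tendsto tendsto_natCast_atTop_atTop
    · have h2 : Tendsto (fun n : ℕ => (n : ℝ) + 1) atTop atTop :=
        tendsto_atTop_add_const_right _ _ tendsto_natCast_atTop_atTop
      refine (Real.isLittleO_log_id_atTop.comp_tendsto h2).trans_isBigO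
        (IsBigO.of_bound 2 (eventually_atTop.2 ⟨1, fun n hn => ?_⟩))
      have hn' : (1 : ℝ) ≤ n := by exact_mod_cast hn
      simp only [Function.comp_apply, id, Real.norm_eq_abs]
      rw [abs_of_nonneg (by positivity), abs_of_nonneg (by positivity)]
      linarith
  refine IsLittleO.of_isBigOWith fun c hc => ?_
  have h3 := (h1.const_mul_left (Real.log 2)⁻¹).bound hc
  refine IsBigOWith.of_bound ?_
  filter_upwards [h3] with n hn
  refine le_trans ?_ hn
  have hpos : (1 : ℝ) ≤ (q.eval n : ℕ) + 1 := by
    have : (0 : ℝ) ≤ (q.eval n : ℕ) := Nat.cast_nonneg (q.eval n)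
    linarith
  have hl2 : 0 < Real.log 2 := Real.log_pos (by norm_num)
  have hle : Real.log ((q.eval n : ℕ) + 1 : ℝ) ≤ Real.log C + d * Real.log ((n : ℝ) + 1) := by
    have hC0 : (C : ℝ) ≠ 0 := by rw [hC]; exact_mod_cast Nat.succ_ne_zero (q.eval 1)
    rw [← Real.log_pow, ← Real.log_mul hC0 (by positivity)]
    refine Real.log_le_log (by linarith) ?_
    exact_mod_cast hq n
  have h0 := Real.log_nonneg hpos
  rw [Real.norm_of_nonneg (Real.logb_nonneg (by norm_num) hpos), Real.norm_of_nonneg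
    (mul_nonneg (by positivity) (h0.trans hle)), Real.logb, div_eq_inv_mul]
  exact mul_le_mul_of_nonneg_left hle (by positivity)

/-! ### Explicit polynomial bounds for time and numbers -/

namespace QMachine

section
variable (k Q M n m : ℕ)

/-- A bound for the number of token places of a layer. -/
def layerBound : ℕ := (Q * 2 ^ k * m + 1) * 2 ^ k

/-- Steps of an oracle call. -/
def callBound : ℕ := (Q * m + 1) * 6 + m * (3 * layerBound k Q m) * 6 + 8 + (n * 24 + 20)

/-- A polynomial bound for all numbers but the powers. -/
def valueBound : ℕ :=
  callBound k Q n m + total n m Q M + (2 * n + 2 + (m + 1) * (4 * layerBound k Q m)) +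
    Q * 2 ^ k + n * (m * k) ^ 2 + (m * k + 1) + (2 + m * (1 + k + 2 ^ k)) + (n + m + k + 1)

/-- The polynomial factor of the running time. -/
def timeFactor : ℕ :=
  (m * (k * (layerBound k Q m * 10 + 8) + layerBound k Q m * 9 + 16) + n * 20 + 11 +
    (total n m Q M * (callBound k Q n m * 7 + n * 32 + 133) + 1)) *
      ((mainProg k Q M).unit * (valueBound k Q M n m + 2 * n + 14) ^ 2)

end

/-- For fixed `k`, `Q` and `M` the bound is a semiring expression in `n` and `p.eval n`; the witness
is the same expression in polynomials. -/
theorem exists_timeFactor_polynomial (k Q M : ℕ) (p : Polynomial ℕ) :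
    ∃ q : Polynomial ℕ, ∀ n, q.eval n = 34 * timeFactor k Q M n (p.eval n) := by
  refine ⟨34 * ((p * (Polynomial.C k * (((Polynomial.C (Q * 2 ^ k) * p + 1) * 2 ^ k) * 10 + 8) +
    ((Polynomial.C (Q * 2 ^ k) * p + 1) * 2 ^ k) * 9 + 16) + Polynomial.X * 20 + 11 +
    (((Polynomial.C Q * p + 1) * Polynomial.X * (Polynomial.X + 6) * (Polynomial.X + 6) *
      (Polynomial.X + 6) * Polynomial.C M) * (((Polynomial.C Q * p + 1) * 6 +
      p * (3 * ((Polynomial.C (Q * 2 ^ k) * p + 1) * 2 ^ k)) * 6 + 8 + (Polynomial.X * 24 + 20)) * 7 +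
      Polynomial.X * 32 + 133) + 1)) *
    (Polynomial.C (mainProg k Q M).unit * ((((Polynomial.C Q * p + 1) * 6 +
      p * (3 * ((Polynomial.C (Q * 2 ^ k) * p + 1) * 2 ^ k)) * 6 + 8 + (Polynomial.X * 24 + 20)) +
      ((Polynomial.C Q * p + 1) * Polynomial.X * (Polynomial.X + 6) * (Polynomial.X + 6) *
      (Polynomial.X + 6) * Polynomial.C M) + (2 * Polynomial.X + 2 + (p + 1) * (4 *
      ((Polynomial.C (Q * 2 ^ k) * p + 1) * 2 ^ k))) + Polynomial.C (Q * 2 ^ k) +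
      Polynomial.X * (p * Polynomial.C k) ^ 2 + (p * Polynomial.C k + 1) +
      (2 + p * Polynomial.C (1 + k + 2 ^ k)) + (Polynomial.X + p + Polynomial.C k + 1)) +
      2 * Polynomial.X + 14) ^ 2)), fun n => ?_⟩
  simp only [timeFactor, valueBound, callBound, layerBound, total, Polynomial.eval_mul,
    Polynomial.eval_add, Polynomial.eval_pow, Polynomial.eval_C, Polynomial.eval_X, Polynomial.eval_one,
    Polynomial.eval_ofNat]

theorem timeFactor_mono {k Q M n m m' : ℕ} (h : m ≤ m') :
    timeFactor k Q M n m ≤ timeFactor k Q M n m' := by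
  unfold timeFactor valueBound callBound layerBound total
  gcongr

theorem size_three_pow_le (n : ℕ) : (3 ^ (n + 6)).size ≤ 2 * n + 12 := by
  rw [Nat.size_le, show 2 * n + 12 = 2 * (n + 6) by ring, pow_mul]
  exact Nat.pow_lt_pow_left (by norm_num) (by omega)

/-- The root is at most 16 · 2^((n-s)/2), and adding one makes the factor 17. The rounding of `s`
costs a factor √2 ≤ 2 in the exponential, so the constant is 34. -/
theorem sqrt_add_one_le {c : ℝ} {n s : ℕ} (hs : s ≤ n) (hc : c * n - 1 ≤ s) :
    (Nat.sqrt (256 * 2 ^ (n - s)) : ℝ) + 1 ≤ 34 * (2 : ℝ) ^ ((1 - c) * n / 2) := by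
  have h1 : (Nat.sqrt (256 * 2 ^ (n - s)) : ℝ) ≤ 16 * (2 : ℝ) ^ (((n - s : ℕ) : ℝ) / 2) := by
    refine abs_le_of_sq_le_sq' ?_ (by positivity) |>.2
    have h3 : (Nat.sqrt (256 * 2 ^ (n - s)) : ℝ) ^ 2 ≤ 256 * 2 ^ (n - s) := by
      exact_mod_cast Nat.sqrt_le' (256 * 2 ^ (n - s))
    rw [mul_pow, ← Real.rpow_natCast (_ ^ _) 2, ← Real.rpow_mul (by norm_num)]
    have e : ((n - s : ℕ) : ℝ) / 2 * (2 : ℕ) = (n - s : ℕ) := by push_cast; ring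
    rw [e, Real.rpow_natCast]
    linarith
  have h2 : (1 : ℝ) ≤ (2 : ℝ) ^ (((n - s : ℕ) : ℝ) / 2) :=
    Real.one_le_rpow (by norm_num) (by positivity)
  have h3 : (2 : ℝ) ^ (((n - s : ℕ) : ℝ) / 2) ≤ 2 * (2 : ℝ) ^ ((1 - c) * n / 2) := by
    have e : (2 : ℝ) * (2 : ℝ) ^ ((1 - c) * n / 2) = (2 : ℝ) ^ (1 + (1 - c) * n / 2) := by
      rw [Real.rpow_add (by norm_num), Real.rpow_one]
    rw [e]
    refine Real.rpow_le_rpow_of_exponent_le (by norm_num) ?_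
    rw [Nat.cast_sub hs]
    linarith
  linarith

end QMachine

open QMachine

/-! ### Assembly of the time bound and the success probability -/

namespace MaxCSP

variable {k n m : ℕ} (I : MaxCSP k n m)

theorem fits {V Q M : ℕ} (h : valueBound k Q M n m ≤ V) : Fits V k Q n m := by
  unfold valueBound at h
  refine ⟨?_, ?_, ?_, ?_, ?_⟩
  · change 2 * n + 2 + (m + 1) * (4 * layerBound k Q m) ≤ V
    omega
  all_goals omega

theorem room {V Q : ℕ} (h : callBound k Q n m ≤ V) (h' : 3 ^ (n + 6) ≤ V) :
    Room I.tape V (callBound k Q n m) k Q := by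
  have hC : (costCircuit I.tape k Q).length ≤ m * (3 * layerBound k Q m) :=
    I.wf.length_costGates_le _ _ le_rfl
  refine ⟨h, ?_, ?_, h'⟩
  · change n * 24 + 20 ≤ _
    unfold callBound
    omega
  · change (Q * m + 1) * 6 + (costCircuit I.tape k Q).length * 6 + 8 ≤ _
    unfold callBound
    omega

theorem mainSteps_le (Q M Z : ℕ) : mainSteps I.tape k Q M (callBound k Q n m) Z ≤
    (m * (k * (layerBound k Q m * 10 + 8) + layerBound k Q m * 9 + 16) + n * 20 + 11 +
      (total n m Q M * (callBound k Q n m * 7 + n * 32 + 133) + 1)) * (Z + 1) := by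
  change m * (k * (layerBound k Q m * 10 + 8) + layerBound k Q m * 9 + 16) + n * 20 + 11 +
    (total n m Q M * ((Z * (6 * callBound k Q n m + 6) + callBound k Q n m + (n * 22 + 120)) +
      (n * 10 + 6) + 1) + 1) ≤ _
  generalize m * (k * (layerBound k Q m * 10 + 8) + layerBound k Q m * 9 + 16) + n * 20 + 11 = x
  generalize callBound k Q n m = B
  generalize total n m Q M = y
  have h : (Z * (6 * B + 6) + B + (n * 22 + 120)) + (n * 10 + 6) + 1 ≤
      (B * 7 + n * 32 + 133) * (Z + 1) := by
    have e : (B * 7 + n * 32 + 133) * (Z + 1) =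
      (Z * (6 * B + 6) + B + (n * 22 + 120)) + (n * 10 + 6) + 1 +
        (Z * B + n * 32 * Z + 127 * Z + 6 * B + 6) := by ring
    rw [e]
    exact Nat.le_add_right _ _
  calc _ ≤ x + (y * ((B * 7 + n * 32 + 133) * (Z + 1)) + 1) := by gcongr
    _ ≤ x + (y * ((B * 7 + n * 32 + 133) * (Z + 1)) + 1) + (x + 1) * Z := Nat.le_add_right _ _
    _ = _ := by ring

/-- The bound on the numbers contains an exponential power of three, but only its bit length enters,
which is linear in `n`. For the polynomial part the crude estimate of the length by the number
itself suffices. -/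
theorem tick_mainProg_le {Q M : ℕ} : (mainProg k Q M).tick (valueBound k Q M n m + 3 ^ (n + 6)) ≤
    (mainProg k Q M).unit * (valueBound k Q M n m + 2 * n + 14) ^ 2 := by
  have h1 := size_add_le (valueBound k Q M n m) (3 ^ (n + 6))
  have h2 := size_three_pow_le n
  have h3 : (valueBound k Q M n m).size ≤ valueBound k Q M n m := Nat.size_le.2 Nat.lt_two_pow_self
  generalize valueBound k Q M n m = A at *
  generalize 3 ^ (n + 6) = y at *
  refine Nat.mul_le_mul_left _ (Nat.pow_le_pow_left ?_ 2)
  omega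

theorem mainProg_eventually (hm : 0 < m) {M : ℕ} (hM : 0 < M) :
    Eventually I.tape (mainProg k (2 ^ k).factorial M) (fun mem => I.IsOptimal (output n mem))
      ((34 * timeFactor k (2 ^ k).factorial M n m : ℕ) * (2 : ℝ) ^ ((1 - I.cClassical) * n / 2)) init
      (1 - (3 / 4) ^ M) := by
  obtain ⟨v, b, i₁, i₂, i₃, hv, hb, h₁, h₂, h₃, hopt, hwid, ha₁, ha₂, hw⟩ := I.exists_attempt hm
  have hsn := I.width_le hm v
  have hwl := I.width_le hm
  generalize (2 ^ k).factorial = Q at *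
  have hgood : ∀ mem : ℕ → ℕ, (∃ t, cost I.tape Q m t ≤ v ∧ ∀ q < n, (mem q ≠ 0 ↔ q ∈ t)) →
      I.IsOptimal (output n mem) := by
    rintro mem ⟨t, ht, hbits⟩
    have : output n mem = assignment n t := by
      ext i
      simp only [output, assignment, decide_eq_decide]
      exact hbits i i.2
    rw [this]
    exact hopt t ht
  have hB : callBound k Q n m ≤ valueBound k Q M n m := by unfold valueBound; omega
  have htot : total n m Q M ≤ valueBound k Q M n m := by unfold valueBound; omega
  have hnm : n + m + k + 1 ≤ valueBound k Q M n m := Nat.le_add_left _ _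
  have hV : valueBound k Q M n m ≤ valueBound k Q M n m + 3 ^ (n + 6) := Nat.le_add_right _ _
  refine I.wf.mainProg (fun i => ((I.tape_le i).trans hnm).trans hV) (fits hV)
    (I.room (hB.trans hV) (Nat.le_add_left _ _)) hM (htot.trans hV) hwl hv hb h₁ h₂ h₃ ⟨ha₁, ha₂⟩ hw
    (fun x hx => Nat.le_sqrt'.2 hx) hgood ?_
  have h1 := Nat.mul_le_mul (I.mainSteps_le Q M (Nat.sqrt (256 * 2 ^ (n - width I.tape Q v))))
    (tick_mainProg_le (k := k) (n := n) (m := m) (Q := Q) (M := M))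
  -- The exponent is a minimum with γ as one entry, so the width bound for γ implies the one for it.
  have h2 := sqrt_add_one_le hsn (le_trans (sub_le_sub_right (mul_le_mul_of_nonneg_right
    (min_le_left (I.gammaExp (1 / 2)) (Real.binEntropy (I.theta (1 / 2)) / Real.log 2 / 2))
    (Nat.cast_nonneg n)) 1) hwid)
  rw [mul_right_comm] at h1
  refine le_trans (Nat.cast_le.2 h1) ?_
  rw [Nat.cast_mul, Nat.cast_mul 34, mul_comm ((34 : ℕ) : ℝ), mul_assoc]
  refine mul_le_mul_of_nonneg_left ?_ (Nat.cast_nonneg _)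
  push_cast
  exact h2

end MaxCSP

theorem mainTheorem4 (k : ℕ) :
    (∀ δ : ℝ, 0 < δ →
      ∃ P : QMachine.Prog, ∀ p : Polynomial ℕ,
        ∃ g : ℕ → ℝ, g =o[Filter.atTop] (fun n : ℕ => (n : ℝ)) ∧
          ∀ (n m : ℕ) (I : MaxCSP k n m), 0 < m → m ≤ p.eval n →
            QMachine.SucceedsWithin P I.encode (fun mem => I.IsOptimal (MaxCSP.output n mem))
              ((2 : ℝ) ^ ((1 - I.cClassical) * n / 2 + g n)) (1 - δ)) ∧
    (∀ (n m : ℕ) (I : MaxCSP k n m), 0 < m →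
      0.7213 * (I.optScale ^ 2 / (2 ^ (2 * k) * (k : ℝ) ^ 2 * I.irregularity)) ≤ I.cClassical) ∧
    (∀ (n m : ℕ) (I : MaxCSP k n m), 0 < m → 0 < I.optScale →
      I.cShortPath < I.cClassical) := by
  refine ⟨fun δ hδ => ?_, fun n m I hm => I.cClassical_lower_bound hm,
    fun n m I hm hΔ => I.cShortPath_lt hm hΔ⟩
  obtain ⟨M, hM⟩ := exists_pow_lt_of_lt_one hδ (show (3 / 4 : ℝ) < 1 by norm_num)
  -- The number of repetitions has to be positive, and `M` may be zero when δ > 1.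
  refine ⟨QMachine.mainProg k (2 ^ k).factorial (M + 1), fun p => ?_⟩
  obtain ⟨q, hq⟩ := QMachine.exists_timeFactor_polynomial k (2 ^ k).factorial (M + 1) p
  -- The overhead is `g n = log₂ (q n + 1)`, so that `2 ^ g n` is exactly a polynomial exceeding the
  -- time factor.
  refine ⟨_, isLittleO_logb_polynomial q, fun n m I hm hmp => ?_⟩
  obtain ⟨f, hf⟩ := I.mainProg_eventually hm (Nat.succ_pos M)
  have hδ' : 1 - δ ≤ 1 - (3 / 4 : ℝ) ^ (M + 1) := by
    have : (3 / 4 : ℝ) ^ (M + 1) ≤ (3 / 4) ^ M :=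
      pow_le_pow_of_le_one (by norm_num) (by norm_num) (Nat.le_succ M)
    linarith
  have hT : ((34 * QMachine.timeFactor k (2 ^ k).factorial (M + 1) n m : ℕ) : ℝ) *
      (2 : ℝ) ^ ((1 - I.cClassical) * n / 2) ≤
      (2 : ℝ) ^ ((1 - I.cClassical) * n / 2 + Real.logb 2 ((q.eval n : ℕ) + 1 : ℝ)) := by
    have h1 : 34 * QMachine.timeFactor k (2 ^ k).factorial (M + 1) n m ≤ q.eval n + 1 := by
      rw [hq]
      exact (Nat.mul_le_mul_left _ (QMachine.timeFactor_mono hmp)).trans (Nat.le_succ _)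
    have h2 : ((34 * QMachine.timeFactor k (2 ^ k).factorial (M + 1) n m : ℕ) : ℝ) ≤ (q.eval n : ℕ) + 1 := by
      exact_mod_cast h1
    rw [Real.rpow_add (by norm_num), Real.rpow_logb (by norm_num) (by norm_num) (by positivity),
      mul_comm]
    gcongr
  exact ⟨f, (hδ'.trans (hf f le_rfl)).trans (QMachine.probWithin_mono hT _)⟩
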